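/- Let $M$ be a smooth $n$-dimensional manifold (Hausdorff, second countable, without boundary) and $g_0$ a fixed smooth Riemannian metric on $M$ with Levi-Civita connection $\nabla$. For a sequence $\varepsilon=(\varepsilon_k)_{k\ge 0}$ of positive numbers let $C^\infty_\varepsilon$ be the space of smooth symmetric bilinear forms $h$ on $TM$ (equivalently, of smooth $g_0$-symmetric endomorphisms of $TM$) with $$\|h\|_\varepsilon=\sum_{k\ge 0}\varepsilon_k\,\sup_M|\nabla^k h|_{g_0}<\infty,$$ and let $\mathcal G=\mathcal G_\varepsilon$ be the set of Riemannian metrics $g=g_0+h$, $h\in C^\infty_\varepsilon$, with $g\ge c\,g_0$ on $M$ for some constant $c>0$, regarded as a subset of $C^\infty_\varepsilon$ via $g\mapsto h$. For $x\in M$ let $H^{1,2}_x=H^{1,2}_x([0,\infty),M)$ be the Hilbert manifold of continuous curves $\gamma\colon[0,\infty)\to M$ such that $\varphi\circ\gamma-\varphi(x)\in H^{1,2}([0,\infty),\mathbb R)$ for every $\varphi\in C^\infty(M,\mathbb R)$, with the topology and smooth structure induced by the maps $\gamma\mapsto\varphi\circ\gamma-\varphi(x)$. For a Morse function $f$ on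 $M$ and a critical point $x$ of $f$ with Morse index $\mu(x)$, the universal stable manifold is $$W^s_{\rm univ}(x)=\{(\gamma,g)\in C^\infty([0,\infty),M)\times\mathcal G \mid \dot\gamma+\nabla_g f\circ\gamma=0,\ \gamma(+\infty)=x\},$$ where $\nabla_g f$ is the $g$-gradient of $f$ and $\gamma(+\infty)=\lim_{t\to\infty}\gamma(t)$. Lemma. For all sufficiently rapidly decreasing $\varepsilon$ (i.e. there is a positive sequence $\varepsilon^0$, depending only on $M$ and $g_0$, such that for every positive sequence $\varepsilon$ with $\varepsilon_k\le\varepsilon^0_k$ for all $k$), $C^\infty_\varepsilon$ is a Banach space, $\mathcal G_\varepsilon$ is open in it and is dense in the space of all smooth Riemannian metrics on $M$ with respect to uniform convergence on compact sets (hence also in $L^2$ over compact sets), and the following holds for every Morse function $f$ on $M$ and every critical point $x$ of $f$. The set $W^s_{\rm univ}(x)$ is contained in $H^{1,2}_x\times\mathcal G$ and is a smooth Banach submanifold of it, modelled on $\mathbb R^{n-\mu(x)}\times C^\infty_\varepsilon$. The evaluation map $$E\colon W^s_{\rm univ}(x)\to M,\qquad E(\gamma,g)=\gamma(0),$$ is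 smooth, and it is a submersion at every $(\gamma,g)$ for which $\gamma$ is not the constant curve $\gamma\equiv x$. If $\mu(x)=0$, then $E$ is a submersion everywhere. -/

import Mathlib

open Bundle Filter MeasureTheory Set
open scoped Manifold ContDiff Topology NNReal ENNReal

set_option maxSynthPendingDepth 3

noncomputable section

namespace MorseUniv

/-- The model space `ℝⁿ` of an `n`-dimensional manifold. -/
abbrev Eu (n : ℕ) : Type := EuclideanSpace ℝ (Fin n)

/-! ### Covariant derivatives of covariant tensors in a coordinate chart -/

/-- The Christoffel symbols `Γ_y(u, v)` of a metric `G` given in coordinates: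
`G(Γ(u, v), w) = (∂_u G(v, w) + ∂_v G(u, w) - ∂_w G(u, v)) / 2`. -/
def christoffel {n : ℕ} (G : Eu n → Eu n →L[ℝ] Eu n →L[ℝ] ℝ) (y u v : Eu n) : Eu n :=
  (G y).inverse ((1 / 2 : ℝ) •
    (fderiv ℝ G y u v + fderiv ℝ G y v u - ((fderiv ℝ G y).flip u).flip v))

/-- The Levi-Civita covariant derivative of an `m`-tensor `T` given in coordinates:
`(∇T)(v₀, v₁, …, v_m) = ∂_{v₀} (T(v₁, …, v_m)) - ∑ᵢ T(v₁, …, Γ(v₀, vᵢ), …, v_m)`. -/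
def covDeriv {n m : ℕ} (G : Eu n → Eu n →L[ℝ] Eu n →L[ℝ] ℝ) (T : Eu n → (Fin m → Eu n) → ℝ) :
    Eu n → (Fin (m + 1) → Eu n) → ℝ := fun y v =>
  fderiv ℝ (fun z => T z (Fin.tail v)) y (v 0) -
    ∑ i : Fin m, T y (Function.update (Fin.tail v) i (christoffel G y (v 0) (v i.succ)))

/-- The `k`-th covariant derivative `∇ᵏ B` of a bilinear form `B` given in coordinates. -/
def iterCovDeriv {n : ℕ} (G B : Eu n → Eu n →L[ℝ] Eu n →L[ℝ] ℝ) :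
    (k : ℕ) → Eu n → (Fin (2 + k) → Eu n) → ℝ
  | 0 => fun y v => B y (v 0) (v 1)
  | k + 1 => covDeriv G (iterCovDeriv G B k)

/-! #### Smoothness and linearity of the iterated covariant derivatives -/

/-- Joint smoothness of a coordinate tensor over a set. -/
def JointSmooth {n m : ℕ} (U : Set (Eu n)) (T : Eu n → (Fin m → Eu n) → ℝ) : Prop :=
  ContDiffOn ℝ ∞ (fun z : Eu n × (Fin m → Eu n) => T z.1 z.2) (U ×ˢ univ)

theorem contDiffOn_christoffel {n : ℕ} {G : Eu n → Eu n →L[ℝ] Eu n →L[ℝ] ℝ} {U : Set (Eu n)}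
    (hU : IsOpen U) (hG : ContDiffOn ℝ ∞ G U) (hinv : ∀ y ∈ U, (G y).IsInvertible) :
    ContDiffOn ℝ ∞ (fun z : Eu n × Eu n × Eu n => christoffel G z.1 z.2.1 z.2.2)
      (U ×ˢ univ) := by
  have hD : ContDiffOn ℝ ∞ (fderiv ℝ G) U := hG.fderiv_of_isOpen hU (by simp)
  have hfst : ContDiffOn ℝ ∞ (fun z : Eu n × Eu n × Eu n => z.1) (U ×ˢ univ) :=
    contDiff_fst.contDiffOn
  have hm : MapsTo (fun z : Eu n × Eu n × Eu n => z.1) (U ×ˢ univ) U := fun z hz => hz.1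
  have hD' := hD.comp hfst hm
  have hI : ContDiffOn ℝ ∞ (fun z : Eu n × Eu n × Eu n => (G z.1).inverse) (U ×ˢ univ) := by
    intro z hz
    exact (ContinuousLinearMap.IsInvertible.contDiffAt_map_inverse (hinv z.1 hz.1)).comp_contDiffWithinAt z
      ((hG.comp hfst hm) z hz)
  have hu : ContDiffOn ℝ ∞ (fun z : Eu n × Eu n × Eu n => z.2.1) (U ×ˢ univ) :=
    (contDiff_fst.comp contDiff_snd).contDiffOn
  have hv : ContDiffOn ℝ ∞ (fun z : Eu n × Eu n × Eu n => z.2.2) (U ×ˢ univ) :=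
    (contDiff_snd.comp contDiff_snd).contDiffOn
  have hflip : ContDiffOn ℝ ∞ (fun z : Eu n × Eu n × Eu n => (fderiv ℝ G z.1).flip) (U ×ˢ univ) :=
    (ContinuousLinearMap.flipₗᵢ ℝ (Eu n) (Eu n) (Eu n →L[ℝ] ℝ)).toContinuousLinearEquiv.contDiff.comp_contDiffOn hD'
  have h3 : ContDiffOn ℝ ∞ (fun z : Eu n × Eu n × Eu n => ((fderiv ℝ G z.1).flip z.2.1).flip z.2.2)
      (U ×ˢ univ) :=
    ((ContinuousLinearMap.flipₗᵢ ℝ (Eu n) (Eu n) ℝ).toContinuousLinearEquiv.contDiff.comp_contDiffOn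
      (hflip.clm_apply hu)).clm_apply hv
  unfold christoffel
  exact hI.clm_apply (((((hD'.clm_apply hu).clm_apply hv).add
    ((hD'.clm_apply hv).clm_apply hu)).sub h3).const_smul (1 / 2 : ℝ))

theorem JointSmooth.fderiv_eq {n m : ℕ} {U : Set (Eu n)} (hU : IsOpen U)
    {T : Eu n → (Fin m → Eu n) → ℝ} (hT : JointSmooth U T) {y : Eu n} (hy : y ∈ U)
    (v : Fin m → Eu n) :
    HasFDerivAt (fun z => T z v)
      ((fderiv ℝ (fun z : Eu n × (Fin m → Eu n) => T z.1 z.2) (y, v)).comp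
        (ContinuousLinearMap.inl ℝ (Eu n) (Fin m → Eu n))) y := by
  have h1 : DifferentiableAt ℝ (fun z : Eu n × (Fin m → Eu n) => T z.1 z.2) (y, v) :=
    (hT.contDiffAt ((hU.prod isOpen_univ).mem_nhds ⟨hy, mem_univ _⟩)).differentiableAt (by simp)
  have h2 : HasFDerivAt (fun z : Eu n => (z, v))
      (ContinuousLinearMap.inl ℝ (Eu n) (Fin m → Eu n)) y := hasFDerivAt_prodMk_left y v
  exact HasFDerivAt.comp (g := fun z : Eu n × (Fin m → Eu n) => T z.1 z.2) y h1.hasFDerivAt h2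

theorem JointSmooth.covDeriv {n m : ℕ} {U : Set (Eu n)} (hU : IsOpen U)
    {G : Eu n → Eu n →L[ℝ] Eu n →L[ℝ] ℝ} (hG : ContDiffOn ℝ ∞ G U)
    (hinv : ∀ y ∈ U, (G y).IsInvertible)
    {T : Eu n → (Fin m → Eu n) → ℝ} (hT : JointSmooth U T) :
    JointSmooth U (covDeriv G T) := by
  have hD := hT.fderiv_of_isOpen (m := ∞) (hU.prod isOpen_univ) (by simp)
  have htail : ContDiff ℝ ∞ (fun z : Eu n × (Fin (m + 1) → Eu n) => (Fin.tail z.2 : Fin m → Eu n)) :=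
    contDiff_pi.2 fun j => (contDiff_apply ℝ (Eu n) j.succ).comp contDiff_snd
  have happ : ∀ j : Fin (m + 1), ContDiff ℝ ∞ (fun z : Eu n × (Fin (m + 1) → Eu n) => z.2 j) :=
    fun j => (contDiff_apply ℝ (Eu n) j).comp contDiff_snd
  have h1 : ContDiffOn ℝ ∞ (fun z : Eu n × (Fin (m + 1) → Eu n) =>
      fderiv ℝ (fun z : Eu n × (Fin m → Eu n) => T z.1 z.2) (z.1, Fin.tail z.2) (z.2 0, 0))
      (U ×ˢ univ) :=
    (hD.comp (contDiff_fst.prodMk htail).contDiffOn fun z hz => ⟨hz.1, mem_univ _⟩).clm_apply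
      ((happ 0).prodMk contDiff_const).contDiffOn
  have hchr : ∀ i : Fin m, ContDiffOn ℝ ∞ (fun z : Eu n × (Fin (m + 1) → Eu n) =>
      christoffel G z.1 (z.2 0) (z.2 i.succ)) (U ×ˢ univ) := fun i =>
    (contDiffOn_christoffel hU hG hinv).comp
      (contDiff_fst.prodMk ((happ 0).prodMk (happ i.succ))).contDiffOn fun z hz => ⟨hz.1, mem_univ _⟩
  have h2 : ∀ i : Fin m, ContDiffOn ℝ ∞ (fun z : Eu n × (Fin (m + 1) → Eu n) =>
      T z.1 (Function.update (Fin.tail z.2) i (christoffel G z.1 (z.2 0) (z.2 i.succ))))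
      (U ×ˢ univ) := by
    intro i
    refine ContDiffOn.comp (g := fun z : Eu n × (Fin m → Eu n) => T z.1 z.2) hT
      (contDiff_fst.contDiffOn.prodMk ?_) fun z hz => ⟨hz.1, mem_univ _⟩
    refine contDiffOn_pi.2 fun j => ?_
    by_cases hj : j = i
    · subst hj
      exact (hchr j).congr fun z _ => Function.update_self ..
    · exact (happ j.succ).contDiffOn.congr fun z _ => Function.update_of_ne hj ..
  refine (h1.sub (ContDiffOn.sum fun i (_ : i ∈ Finset.univ) => h2 i)).congr fun z hz => ?_
  simp only [MorseUniv.covDeriv]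
  rw [(hT.fderiv_eq hU hz.1 _).fderiv]
  simp

theorem jointSmooth_iterCovDeriv {n : ℕ} {U : Set (Eu n)} (hU : IsOpen U)
    {G B : Eu n → Eu n →L[ℝ] Eu n →L[ℝ] ℝ} (hG : ContDiffOn ℝ ∞ G U)
    (hinv : ∀ y ∈ U, (G y).IsInvertible) (hB : ContDiffOn ℝ ∞ B U) (k : ℕ) :
    JointSmooth U (iterCovDeriv G B k) := by
  induction k with
  | zero =>
    have happ : ∀ j : Fin 2, ContDiff ℝ ∞ (fun z : Eu n × (Fin 2 → Eu n) => z.2 j) :=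
      fun j => (contDiff_apply ℝ (Eu n) j).comp contDiff_snd
    exact ((hB.comp contDiff_fst.contDiffOn fun z hz => hz.1).clm_apply
      (happ 0).contDiffOn).clm_apply (happ 1).contDiffOn
  | succ k ih => exact ih.covDeriv hU hG hinv

theorem iterCovDeriv_add {n : ℕ} {U : Set (Eu n)} (hU : IsOpen U)
    {G B C : Eu n → Eu n →L[ℝ] Eu n →L[ℝ] ℝ} (hG : ContDiffOn ℝ ∞ G U)
    (hinv : ∀ y ∈ U, (G y).IsInvertible) (hB : ContDiffOn ℝ ∞ B U) (hC : ContDiffOn ℝ ∞ C U)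
    (k : ℕ) : ∀ y ∈ U, ∀ v, iterCovDeriv G (fun y => B y + C y) k y v =
      iterCovDeriv G B k y v + iterCovDeriv G C k y v := by
  induction k with
  | zero => intro y _ v; simp [iterCovDeriv]
  | succ k ih =>
    intro y hy v
    simp only [iterCovDeriv, covDeriv]
    have he : (fun z => iterCovDeriv G (fun y => B y + C y) k z (Fin.tail v)) =ᶠ[𝓝 y]
        fun z => iterCovDeriv G B k z (Fin.tail v) + iterCovDeriv G C k z (Fin.tail v) := by
      filter_upwards [hU.mem_nhds hy] with z hz using ih z hz _
    have d1 := (jointSmooth_iterCovDeriv hU hG hinv hB k).fderiv_eq hU hy (Fin.tail v)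
    have d2 := (jointSmooth_iterCovDeriv hU hG hinv hC k).fderiv_eq hU hy (Fin.tail v)
    rw [he.fderiv_eq, fderiv_fun_add d1.differentiableAt d2.differentiableAt]
    simp only [ih y hy, Finset.sum_add_distrib, add_apply]
    ring

theorem iterCovDeriv_smul {n : ℕ} {U : Set (Eu n)} (hU : IsOpen U)
    {G B : Eu n → Eu n →L[ℝ] Eu n →L[ℝ] ℝ} (hG : ContDiffOn ℝ ∞ G U)
    (hinv : ∀ y ∈ U, (G y).IsInvertible) (hB : ContDiffOn ℝ ∞ B U) (c : ℝ)
    (k : ℕ) : ∀ y ∈ U, ∀ v, iterCovDeriv G (fun y => c • B y) k y v =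
      c * iterCovDeriv G B k y v := by
  induction k with
  | zero => intro y _ v; simp [iterCovDeriv]
  | succ k ih =>
    intro y hy v
    simp only [iterCovDeriv, covDeriv]
    have he : (fun z => iterCovDeriv G (fun y => c • B y) k z (Fin.tail v)) =ᶠ[𝓝 y]
        fun z => c * iterCovDeriv G B k z (Fin.tail v) := by
      filter_upwards [hU.mem_nhds hy] with z hz using ih z hz _
    have d1 := (jointSmooth_iterCovDeriv hU hG hinv hB k).fderiv_eq hU hy (Fin.tail v)
    rw [he.fderiv_eq, fderiv_const_mul d1.differentiableAt]
    simp only [ih y hy, ← Finset.mul_sum, smul_apply, smul_eq_mul]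
    ring

/-! ### Smooth bilinear forms on a manifold -/

section Manifold

variable {n : ℕ} {M : Type*} [TopologicalSpace M] [ChartedSpace (Eu n) M] [IsManifold (𝓡 n) ∞ M]

variable (n M) in
/-- Smooth Riemannian metrics on `M`. -/
abbrev Metric : Type _ :=
  ContMDiffRiemannianMetric (𝓡 n) ∞ (Eu n) (fun p : M => TangentSpace (𝓡 n) p)

variable (n M) in
/-- Smooth bilinear forms on the tangent bundle of `M`. -/
def BilinForm : Type _ :=
  ContMDiffSection (𝓡 n) (Eu n →L[ℝ] Eu n →L[ℝ] ℝ) ∞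
    (fun p : M => TangentSpace (𝓡 n) p →L[ℝ] TangentSpace (𝓡 n) p →L[ℝ] ℝ)

instance : AddCommGroup (BilinForm n M) := ContMDiffSection.instAddCommGroup

instance : Module ℝ (BilinForm n M) := ContMDiffSection.instModule

instance : CoeFun (BilinForm n M)
    (fun _ => ∀ p : M, TangentSpace (𝓡 n) p →L[ℝ] TangentSpace (𝓡 n) p →L[ℝ] ℝ) :=
  ⟨ContMDiffSection.toFun⟩

/-- A Riemannian metric as a smooth bilinear form. -/
def Metric.toBilin (g : Metric n M) : BilinForm n M :=
  ContMDiffSection.mk g.inner g.contMDiff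

/-- The expression of the bilinear form `h` in the coordinates given by the chart at `p`. -/
def coordForm (h : BilinForm n M) (p : M) (y : Eu n) : Eu n →L[ℝ] Eu n →L[ℝ] ℝ :=
  (trivializationAt (Eu n →L[ℝ] Eu n →L[ℝ] ℝ)
    (fun q : M => TangentSpace (𝓡 n) q →L[ℝ] TangentSpace (𝓡 n) q →L[ℝ] ℝ) p).continuousLinearMapAt
      ℝ ((chartAt (Eu n) p).symm y) (h ((chartAt (Eu n) p).symm y))

/-- The value at `p` of `∇ᵏ h`, in the coordinates given by the chart at `p`, where `∇` is the
Levi-Civita connection of `g₀`. -/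
def nablaAt (g₀ : Metric n M) (k : ℕ) (h : BilinForm n M) (p : M) (v : Fin (2 + k) → Eu n) : ℝ :=
  iterCovDeriv (coordForm g₀.toBilin p) (coordForm h p) k (chartAt (Eu n) p p) v

/-- `sup_M |∇ᵏ h|`, with the pointwise norm
`|T|_p = sup {|T(v₁, …, v_m)| : |v₁|, …, |v_m| ≤ 1}` and lengths measured by `g₀`. -/
def nablaSup (g₀ : Metric n M) (k : ℕ) (h : BilinForm n M) : ℝ≥0∞ :=
  ⨆ (p : M) (v : Fin (2 + k) → Eu n)
    (_ : ∀ i, coordForm g₀.toBilin p (chartAt (Eu n) p p) (v i) (v i) ≤ 1),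
    ‖nablaAt g₀ k h p v‖ₑ

/-- `∑ₖ εₖ sup_M |∇ᵏ h|`. -/
def epsNorm (g₀ : Metric n M) (ε : ℕ → Ioi (0 : ℝ)) (h : BilinForm n M) : ℝ≥0∞ :=
  ∑' k, ENNReal.ofReal (ε k) * nablaSup g₀ k h

/-! #### The Banach space of bilinear forms with finite norm -/

theorem contDiffOn_coordForm (h : BilinForm n M) (p : M) :
    ContDiffOn ℝ ∞ (coordForm h p) (chartAt (Eu n) p).target := by
  set e := trivializationAt (Eu n →L[ℝ] Eu n →L[ℝ] ℝ)
    (fun q : M => TangentSpace (𝓡 n) q →L[ℝ] TangentSpace (𝓡 n) q →L[ℝ] ℝ) p with he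
  have hb : e.baseSet = (chartAt (Eu n) p).source := by
    simp [he, hom_trivializationAt_baseSet]
  have h1 := (e.contMDiffOn_section_baseSet_iff (IB := 𝓡 n) (n := ∞)).1 (ContMDiffSection.contMDiff_toFun h).contMDiffOn
  rw [← contMDiffOn_iff_contDiffOn]
  have h2 := h1.comp (contMDiffOn_chart_symm (I := 𝓡 n) (n := ∞) (x := p)) (by
    intro y hy
    rw [mem_preimage, hb]
    exact (chartAt (Eu n) p).map_target hy)
  refine h2.congr fun y hy => ?_
  have hy' : (chartAt (Eu n) p).symm y ∈ e.baseSet := by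
    rw [hb]; exact (chartAt (Eu n) p).map_target hy
  exact Trivialization.continuousLinearMapAt_apply_of_mem ℝ e hy' _

theorem coordForm_apply (h : BilinForm n M) (p : M) {y : Eu n}
    (hy : y ∈ (chartAt (Eu n) p).target) (u v : Eu n) :
    coordForm h p y u v = h ((chartAt (Eu n) p).symm y)
      ((trivializationAt (Eu n) (TangentSpace (𝓡 n)) p).symm ((chartAt (Eu n) p).symm y) u)
      ((trivializationAt (Eu n) (TangentSpace (𝓡 n)) p).symm ((chartAt (Eu n) p).symm y) v) := by
  have hs : (chartAt (Eu n) p).symm y ∈ (chartAt (Eu n) p).source :=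
    (chartAt (Eu n) p).map_target hy
  have hb : (chartAt (Eu n) p).symm y ∈
      (trivializationAt (Eu n) (TangentSpace (𝓡 n)) p).baseSet := by simpa using hs
  have hb' : (chartAt (Eu n) p).symm y ∈ (trivializationAt (Eu n →L[ℝ] Eu n →L[ℝ] ℝ)
    (fun q : M => TangentSpace (𝓡 n) q →L[ℝ] TangentSpace (𝓡 n) q →L[ℝ] ℝ) p).baseSet := by
    simpa [hom_trivializationAt_baseSet] using hs
  have := inCoordinates_apply_eq₂ (F₃ := ℝ) (E₃ := Trivial M ℝ) (𝕜 := ℝ)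
    (ϕ := h ((chartAt (Eu n) p).symm y)) (v := u) (w := v) hb hb (mem_univ _)
  unfold coordForm
  rw [Trivialization.continuousLinearMapAt_apply_of_mem ℝ _ hb', hom_trivializationAt_apply]
  refine this.trans ?_
  simp

theorem Metric.coordForm_pos (g : Metric n M) (p : M) {y : Eu n}
    (hy : y ∈ (chartAt (Eu n) p).target) {u : Eu n} (hu : u ≠ 0) :
    0 < coordForm g.toBilin p y u u := by
  have hb : (chartAt (Eu n) p).symm y ∈
      (trivializationAt (Eu n) (TangentSpace (𝓡 n)) p).baseSet := by
    simpa using (chartAt (Eu n) p).map_target hy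
  rw [coordForm_apply _ _ hy]
  refine g.pos _ _ fun h0 => hu ?_
  have := (trivializationAt (Eu n) (TangentSpace (𝓡 n)) p).continuousLinearMapAt_symmL (R := ℝ) hb u
  rw [Trivialization.symmL_apply _ hb, h0, map_zero] at this
  exact this.symm

theorem Metric.coordForm_isInvertible (g : Metric n M) (p : M) {y : Eu n}
    (hy : y ∈ (chartAt (Eu n) p).target) : (coordForm g.toBilin p y).IsInvertible := by
  have hinj : Function.Injective (coordForm g.toBilin p y) := by
    refine (injective_iff_map_eq_zero _).2 fun u hu => ?_
    by_contra hne
    have := g.coordForm_pos p hy hne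
    rw [hu] at this
    simp at this
  have hdim : Module.finrank ℝ (Eu n) = Module.finrank ℝ (Eu n →L[ℝ] ℝ) := by
    rw [← (LinearMap.toContinuousLinearMap (𝕜 := ℝ) (E := Eu n) (F' := ℝ)).finrank_eq]
    exact (Subspace.dual_finrank_eq).symm
  refine ⟨(LinearEquiv.ofInjectiveOfFinrankEq
    (coordForm g.toBilin p y : Eu n →ₗ[ℝ] Eu n →L[ℝ] ℝ) hinj hdim).toContinuousLinearEquiv, ?_⟩
  ext u v
  rfl

theorem coordForm_add (h k : BilinForm n M) (p : M) :
    coordForm (h + k) p = fun y => coordForm h p y + coordForm k p y := by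
  funext y; exact map_add _ _ _

theorem coordForm_smul (c : ℝ) (h : BilinForm n M) (p : M) :
    coordForm (c • h) p = fun y => c • coordForm h p y := by
  funext y; exact ContinuousLinearMap.map_smul _ _ _

theorem nablaAt_add (g₀ : Metric n M) (k : ℕ) (h h' : BilinForm n M) (p : M)
    (v : Fin (2 + k) → Eu n) :
    nablaAt g₀ k (h + h') p v = nablaAt g₀ k h p v + nablaAt g₀ k h' p v := by
  unfold nablaAt
  rw [coordForm_add]
  exact iterCovDeriv_add (chartAt (Eu n) p).open_target (contDiffOn_coordForm _ p)
    (fun y hy => g₀.coordForm_isInvertible p hy) (contDiffOn_coordForm _ p)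
    (contDiffOn_coordForm _ p) k _ (mem_chart_target _ p) v

theorem nablaAt_smul (g₀ : Metric n M) (k : ℕ) (c : ℝ) (h : BilinForm n M) (p : M)
    (v : Fin (2 + k) → Eu n) : nablaAt g₀ k (c • h) p v = c * nablaAt g₀ k h p v := by
  unfold nablaAt
  rw [coordForm_smul]
  exact iterCovDeriv_smul (chartAt (Eu n) p).open_target (contDiffOn_coordForm _ p)
    (fun y hy => g₀.coordForm_isInvertible p hy) (contDiffOn_coordForm _ p) c k _
    (mem_chart_target _ p) v

theorem nablaSup_add_le (g₀ : Metric n M) (k : ℕ) (h h' : BilinForm n M) :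
    nablaSup g₀ k (h + h') ≤ nablaSup g₀ k h + nablaSup g₀ k h' := by
  refine iSup_le fun p => iSup₂_le fun v hv => ?_
  rw [nablaAt_add]
  refine (enorm_add_le _ _).trans (add_le_add ?_ ?_)
  · exact (le_iSup₂ (f := fun v (_ : ∀ i, coordForm g₀.toBilin p (chartAt (Eu n) p p) (v i) (v i) ≤ 1)
      => ‖nablaAt g₀ k h p v‖ₑ) v hv).trans (le_iSup (fun p => ⨆ (v : Fin (2 + k) → Eu n)
      (_ : ∀ i, coordForm g₀.toBilin p (chartAt (Eu n) p p) (v i) (v i) ≤ 1),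
      ‖nablaAt g₀ k h p v‖ₑ) p)
  · exact (le_iSup₂ (f := fun v (_ : ∀ i, coordForm g₀.toBilin p (chartAt (Eu n) p p) (v i) (v i) ≤ 1)
      => ‖nablaAt g₀ k h' p v‖ₑ) v hv).trans (le_iSup (fun p => ⨆ (v : Fin (2 + k) → Eu n)
      (_ : ∀ i, coordForm g₀.toBilin p (chartAt (Eu n) p p) (v i) (v i) ≤ 1),
      ‖nablaAt g₀ k h' p v‖ₑ) p)

theorem nablaSup_smul (g₀ : Metric n M) (k : ℕ) (c : ℝ) (h : BilinForm n M) :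
    nablaSup g₀ k (c • h) = ‖c‖ₑ * nablaSup g₀ k h := by
  simp only [nablaSup, nablaAt_smul, enorm_mul, ENNReal.mul_iSup]

theorem epsNorm_add_le (g₀ : Metric n M) (ε : ℕ → Ioi (0 : ℝ)) (h h' : BilinForm n M) :
    epsNorm g₀ ε (h + h') ≤ epsNorm g₀ ε h + epsNorm g₀ ε h' := by
  unfold epsNorm
  rw [← ENNReal.tsum_add]
  refine ENNReal.tsum_le_tsum fun k => ?_
  rw [← mul_add]
  exact mul_le_mul_right (nablaSup_add_le g₀ k h h') _

theorem epsNorm_smul (g₀ : Metric n M) (ε : ℕ → Ioi (0 : ℝ)) (c : ℝ) (h : BilinForm n M) :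
    epsNorm g₀ ε (c • h) = ‖c‖ₑ * epsNorm g₀ ε h := by
  unfold epsNorm
  rw [← ENNReal.tsum_mul_left]
  refine tsum_congr fun k => ?_
  rw [nablaSup_smul]
  ring

theorem epsNorm_zero (g₀ : Metric n M) (ε : ℕ → Ioi (0 : ℝ)) :
    epsNorm g₀ ε (0 : BilinForm n M) = 0 := by
  have := epsNorm_smul g₀ ε 0 (0 : BilinForm n M)
  rwa [zero_smul, enorm_zero, zero_mul] at this

theorem eq_zero_of_epsNorm_eq_zero (g₀ : Metric n M) (ε : ℕ → Ioi (0 : ℝ)) {h : BilinForm n M}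
    (h0 : epsNorm g₀ ε h = 0) : h = 0 := by
  have h1 : nablaSup g₀ 0 h = 0 := by
    have := ENNReal.tsum_eq_zero.1 h0 0
    rcases mul_eq_zero.1 this with h2 | h2
    · exact absurd (ENNReal.ofReal_eq_zero.1 h2) (not_le.2 (ε 0).2)
    · exact h2
  have h2 : ∀ p (u v : Eu n), coordForm h p (chartAt (Eu n) p p) u v = 0 := by
    intro p
    set y := chartAt (Eu n) p p
    have hy : y ∈ (chartAt (Eu n) p).target := mem_chart_target _ p
    have key : ∀ u v : Eu n, coordForm g₀.toBilin p y u u ≤ 1 → coordForm g₀.toBilin p y v v ≤ 1 →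
        coordForm h p y u v = 0 := by
      intro u v hu hv
      have h3 := ENNReal.iSup_eq_zero.1 h1 p
      have h4 := ENNReal.iSup_eq_zero.1 (ENNReal.iSup_eq_zero.1 h3 ![u, v])
        (by intro i; fin_cases i <;> assumption)
      simpa [nablaAt, iterCovDeriv] using h4
    have scale : ∀ u : Eu n, ∃ c : ℝ, c ≠ 0 ∧ coordForm g₀.toBilin p y (c • u) (c • u) ≤ 1 := by
      intro u
      rcases eq_or_ne u 0 with rfl | hu
      · exact ⟨1, one_ne_zero, by simp⟩
      · have hp := g₀.coordForm_pos p hy hu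
        refine ⟨(Real.sqrt (coordForm g₀.toBilin p y u u))⁻¹, by positivity, ?_⟩
        simp only [map_smul, smul_apply, smul_eq_mul]
        have := Real.mul_self_sqrt hp.le
        have h5 := (Real.sqrt_pos.2 hp).ne'
        generalize Real.sqrt (coordForm g₀.toBilin p y u u) = s at *
        rw [← this]
        field_simp
        exact le_rfl
    intro u v
    obtain ⟨a, ha, hu⟩ := scale u
    obtain ⟨b, hb, hv⟩ := scale v
    have := key _ _ hu hv
    simpa [ha, hb] using this
  refine ContMDiffSection.ext fun p => ?_
  have hy : chartAt (Eu n) p p ∈ (chartAt (Eu n) p).target := mem_chart_target _ p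
  have h3 : coordForm h p (chartAt (Eu n) p p) = 0 := by
    ext u v : 2
    simpa using h2 p u v
  unfold coordForm at h3
  rw [(chartAt (Eu n) p).left_inv (mem_chart_source _ p)] at h3
  have hb : p ∈ (trivializationAt (Eu n →L[ℝ] Eu n →L[ℝ] ℝ)
    (fun q : M => TangentSpace (𝓡 n) q →L[ℝ] TangentSpace (𝓡 n) q →L[ℝ] ℝ) p).baseSet :=
    mem_baseSet_trivializationAt _ _ p
  have h4 := Trivialization.symmL_continuousLinearMapAt (R := ℝ) _ hb (h p)
  rw [h3] at h4
  exact h4.symm.trans (ContinuousLinearMap.map_zero _)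

/-- The space `C^∞_ε` of smooth symmetric bilinear forms `h` on `TM` with
`∑ₖ εₖ sup_M |∇ᵏ h| < ⊤`; equivalently, writing `h = g₀(A ·, ·)`, of smooth `g₀`-symmetric
endomorphisms `A` of `TM`. -/
def CEps (g₀ : Metric n M) (ε : ℕ → Ioi (0 : ℝ)) : Submodule ℝ (BilinForm n M) where
  carrier := {h | (∀ p u v, h p u v = h p v u) ∧ epsNorm g₀ ε h < ⊤}
  add_mem' {h k} hh hk := ⟨fun p u v => congrArg₂ (· + ·) (hh.1 p u v) (hk.1 p u v),
    (epsNorm_add_le g₀ ε h k).trans_lt (ENNReal.add_lt_top.2 ⟨hh.2, hk.2⟩)⟩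
  zero_mem' := ⟨fun p u v => rfl, by
    rw [epsNorm_zero]; exact ENNReal.zero_lt_top⟩
  smul_mem' c h hh := ⟨fun p u v => congrArg (c * ·) (hh.1 p u v), by
    rw [epsNorm_smul]
    exact ENNReal.mul_lt_top (by simp) hh.2⟩

theorem CEps.epsNorm_ne_top {g₀ : Metric n M} {ε : ℕ → Ioi (0 : ℝ)} (h : CEps g₀ ε) :
    epsNorm g₀ ε h.1 ≠ ⊤ := (And.right h.2).ne

instance (g₀ : Metric n M) (ε : ℕ → Ioi (0 : ℝ)) : Norm (CEps g₀ ε) :=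
  ⟨fun h => (epsNorm g₀ ε h.1).toReal⟩

theorem CEps.core (g₀ : Metric n M) (ε : ℕ → Ioi (0 : ℝ)) : NormedSpace.Core ℝ (CEps g₀ ε) where
  norm_nonneg _ := ENNReal.toReal_nonneg
  norm_smul c h := by
    change (epsNorm g₀ ε (c • h.1)).toReal = _
    rw [epsNorm_smul, ENNReal.toReal_mul, toReal_enorm]
    rfl
  norm_triangle h k := by
    change (epsNorm g₀ ε (h.1 + k.1)).toReal ≤ (epsNorm g₀ ε h.1).toReal + (epsNorm g₀ ε k.1).toReal
    rw [← ENNReal.toReal_add (CEps.epsNorm_ne_top h) (CEps.epsNorm_ne_top k)]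
    exact ENNReal.toReal_mono (ENNReal.add_ne_top.2 ⟨(CEps.epsNorm_ne_top h), (CEps.epsNorm_ne_top k)⟩) (epsNorm_add_le g₀ ε _ _)
  norm_eq_zero_iff h := by
    constructor
    · intro h0
      rcases (ENNReal.toReal_eq_zero_iff _).1 h0 with h1 | h1
      · exact Subtype.ext (eq_zero_of_epsNorm_eq_zero g₀ ε h1)
      · exact absurd h1 (CEps.epsNorm_ne_top h)
    · rintro rfl
      change (epsNorm g₀ ε 0).toReal = 0
      rw [epsNorm_zero]; rfl

instance (g₀ : Metric n M) (ε : ℕ → Ioi (0 : ℝ)) : NormedAddCommGroup (CEps g₀ ε) :=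
  NormedAddCommGroup.ofCore (CEps.core g₀ ε)

instance (g₀ : Metric n M) (ε : ℕ → Ioi (0 : ℝ)) : NormedSpace ℝ (CEps g₀ ε) :=
  NormedSpace.ofCore (CEps.core g₀ ε)


/-- The smooth Riemannian metrics `g₀ + h` with `h ∈ C^∞_ε` that are uniformly positive with
respect to `g₀`, as a subset of `C^∞_ε`. -/
def metricSet (g₀ : Metric n M) (ε : ℕ → Ioi (0 : ℝ)) : Set (CEps g₀ ε) :=
  {h | ∃ c > 0, ∀ (p : M) (v : TangentSpace (𝓡 n) p),
    c * g₀.inner p v v ≤ g₀.inner p v v + h.1 p v v}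

/-- Every smooth metric is a limit of metrics `g₀ + h`, `h ∈ metricSet g₀ ε`, uniformly on every
compact set (hence also in `L²` on every compact set). -/
def MetricsDense (g₀ : Metric n M) (ε : ℕ → Ioi (0 : ℝ)) : Prop :=
  ∀ (g : Metric n M) (K : Set M), IsCompact K → ∀ δ > 0, ∃ h ∈ metricSet g₀ ε,
    ∀ p ∈ K, ∀ v : TangentSpace (𝓡 n) p,
      |g₀.inner p v v + h.1 p v v - g.inner p v v| ≤ δ * g₀.inner p v v

/-! ### Morse functions -/

/-- Critical points. -/
def IsCrit (f : M → ℝ) (x : M) : Prop := mfderiv (𝓡 n) 𝓘(ℝ, ℝ) f x = 0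

/-- The Hessian of `f` at a (critical) point `x`, in the coordinates given by the chart at `x`. -/
def hessian (f : M → ℝ) (x : M) : Eu n →L[ℝ] Eu n →L[ℝ] ℝ :=
  fderiv ℝ (fderiv ℝ (f ∘ (chartAt (Eu n) x).symm)) (chartAt (Eu n) x x)

/-- A Morse function: smooth, with a nondegenerate Hessian at every critical point. -/
def IsMorse (f : M → ℝ) : Prop :=
  ContMDiff (𝓡 n) 𝓘(ℝ, ℝ) ∞ f ∧
    ∀ x, IsCrit (n := n) f x → ∀ u, (∀ v, hessian (n := n) f x u v = 0) → u = 0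

/-- The Morse index `μ(x)`: the largest dimension of a subspace on which the Hessian is negative
definite. -/
def morseIndex (f : M → ℝ) (x : M) : ℕ :=
  sSup {k | ∃ V : Submodule ℝ (Eu n), Module.finrank ℝ V = k ∧
    ∀ v ∈ V, v ≠ 0 → hessian (n := n) f x v v < 0}

/-- The gradient at `p` of `f` with respect to the metric `b` on `T_p M`: the vector `w` with
`b(w, ·) = df_p`. -/
def gradient (p : M) (b : TangentSpace (𝓡 n) p →L[ℝ] TangentSpace (𝓡 n) p →L[ℝ] ℝ) (f : M → ℝ) :
    TangentSpace (𝓡 n) p :=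
  b.inverse (mfderiv (𝓡 n) 𝓘(ℝ, ℝ) f p)

/-! ### The Sobolev space `H^{1,2}` on the half line and the path space `H^{1,2}_x` -/

/-- Lebesgue measure on `[0, ∞)`. -/
def halfLine : Measure ℝ := volume.restrict (Ici 0)

theorem intervalIntegrable_Lp (w : Lp ℝ 2 halfLine) {t : ℝ} (ht : 0 ≤ t) :
    IntervalIntegrable w volume 0 t := by
  rw [intervalIntegrable_iff_integrableOn_Ioc_of_le ht]
  have h1 : MemLp w 2 (halfLine.restrict (Ioc 0 t)) := (Lp.memLp w).restrict _
  have h2 : halfLine.restrict (Ioc 0 t) = volume.restrict (Ioc 0 t) := by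
    rw [halfLine, Measure.restrict_restrict measurableSet_Ioc,
      inter_eq_left.2 fun s hs => hs.1.le]
  rw [h2] at h1
  exact h1.integrable (by norm_num)

theorem integral_congr_halfLine {v w : ℝ → ℝ} (h : v =ᵐ[halfLine] w) {t : ℝ} (ht : 0 ≤ t) :
    ∫ s in (0 : ℝ)..t, v s = ∫ s in (0 : ℝ)..t, w s := by
  have h' : ∀ᵐ s ∂volume, s ∈ Ici (0 : ℝ) → v s = w s := (ae_restrict_iff' measurableSet_Ici).1 h
  refine intervalIntegral.integral_congr_ae ?_
  filter_upwards [h'] with s hs hmem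
  rw [uIoc_of_le ht] at hmem
  exact hs hmem.1.le

/-- `H^{1,2}([0,∞), ℝ)`: the pairs `(u, u')` of functions in `L²([0,∞))` such that `u` is absolutely
continuous with derivative `u'`, with the Hilbert space norm `(‖u‖² + ‖u'‖²)^{1/2}`. -/
def H1 : Submodule ℝ (WithLp 2 (Lp ℝ 2 halfLine × Lp ℝ 2 halfLine)) where
  carrier := {u | ∃ c : ℝ, ∀ᵐ t ∂halfLine, u.fst t = c + ∫ s in (0 : ℝ)..t, u.snd s}
  add_mem' {u v} hu hv := by
    obtain ⟨c, hc⟩ := hu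
    obtain ⟨d, hd⟩ := hv
    refine ⟨c + d, ?_⟩
    have hpos : ∀ᵐ t ∂halfLine, t ∈ Ici (0 : ℝ) := ae_restrict_mem measurableSet_Ici
    filter_upwards [hc, hd, hpos, Lp.coeFn_add u.fst v.fst] with t h1 h2 h3 h4
    rw [WithLp.add_fst, WithLp.add_snd, h4, Pi.add_apply, h1, h2,
      integral_congr_halfLine (Lp.coeFn_add u.snd v.snd) h3]
    simp only [Pi.add_apply]
    rw [intervalIntegral.integral_add (intervalIntegrable_Lp _ h3) (intervalIntegrable_Lp _ h3)]
    ring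
  zero_mem' := by
    refine ⟨0, ?_⟩
    have hpos : ∀ᵐ t ∂halfLine, t ∈ Ici (0 : ℝ) := ae_restrict_mem measurableSet_Ici
    filter_upwards [hpos, Lp.coeFn_zero ℝ 2 halfLine] with t h3 h4
    rw [WithLp.zero_fst, WithLp.zero_snd, h4, integral_congr_halfLine (Lp.coeFn_zero ℝ 2 halfLine) h3]
    simp
  smul_mem' a u hu := by
    obtain ⟨c, hc⟩ := hu
    refine ⟨a * c, ?_⟩
    have hpos : ∀ᵐ t ∂halfLine, t ∈ Ici (0 : ℝ) := ae_restrict_mem measurableSet_Ici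
    filter_upwards [hc, hpos, Lp.coeFn_smul a u.fst] with t h1 h3 h4
    rw [WithLp.smul_fst, WithLp.smul_snd, h4, Pi.smul_apply, h1,
      integral_congr_halfLine (Lp.coeFn_smul a u.snd) h3]
    simp only [Pi.smul_apply, smul_eq_mul]
    rw [intervalIntegral.integral_const_mul]
    ring

/-- The curve `γ : [0,∞) → M`, extended to the real line by the constant `γ(0)`. -/
def extend (γ : ℝ≥0 → M) (t : ℝ) : M := γ t.toNNReal

variable (n) in
/-- The path space `H^{1,2}_x([0,∞), M)`: continuous curves `γ` such that `φ ∘ γ - φ(x)` is of class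
`H^{1,2}` for every smooth function `φ` on `M`. -/
def H12 (x : M) : Type _ :=
  {γ : C(ℝ≥0, M) // ∀ φ : C^∞⟮𝓡 n, M; 𝓘(ℝ, ℝ), ℝ⟯, ∃ U : H1,
    U.1.fst =ᵐ[halfLine] fun t => φ (extend γ t) - φ x}

/-- The element `φ ∘ γ - φ(x)` of `H^{1,2}([0,∞), ℝ)`. -/
def H12.pull {x : M} (φ : C^∞⟮𝓡 n, M; 𝓘(ℝ, ℝ), ℝ⟯) (γ : H12 n x) : H1 :=
  Classical.choose (γ.2 φ)

/-- The topology of `H^{1,2}_x`: the coarsest one for which all maps `γ ↦ φ ∘ γ - φ(x)` into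
`H^{1,2}([0,∞), ℝ)` are continuous. -/
instance (x : M) : TopologicalSpace (H12 n x) :=
  ⨅ φ : C^∞⟮𝓡 n, M; 𝓘(ℝ, ℝ), ℝ⟯, TopologicalSpace.induced (H12.pull φ) inferInstance

/-! ### The universal stable manifold -/

/-- `γ` is a smooth curve on `[0,∞)` with `γ' + ∇_g f ∘ γ = 0`, `g = g₀ + h`, and `γ(+∞) = x`. -/
def IsStableCurve (g₀ : Metric n M) {ε : ℕ → Ioi (0 : ℝ)} (f : M → ℝ) (x : M)
    (h : CEps g₀ ε) (γ : ℝ≥0 → M) : Prop :=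
  ContMDiffOn 𝓘(ℝ, ℝ) (𝓡 n) ∞ (extend γ) (Ici 0) ∧
  (∀ t ∈ Ici (0 : ℝ), (mfderivWithin 𝓘(ℝ, ℝ) (𝓡 n) (extend γ) (Ici 0) t (1 : ℝ) :
      TangentSpace (𝓡 n) (extend γ t)) +
    gradient (extend γ t) (g₀.inner (extend γ t) + h.1 (extend γ t)) f = 0) ∧
  Tendsto γ atTop (𝓝 x)

/-- The universal stable manifold `W^s_univ(x)`, with the subspace topology from
`H^{1,2}_x × C^∞_ε`. -/
def WUniv (g₀ : Metric n M) (ε : ℕ → Ioi (0 : ℝ)) (f : M → ℝ) (x : M) : Type _ :=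
  {w : H12 n x × CEps g₀ ε // w.2 ∈ metricSet g₀ ε ∧ IsStableCurve g₀ f x w.2 w.1.1}

instance (g₀ : Metric n M) (ε : ℕ → Ioi (0 : ℝ)) (f : M → ℝ) (x : M) :
    TopologicalSpace (WUniv g₀ ε f x) := instTopologicalSpaceSubtype

/-- The evaluation map `E(γ, g) = γ(0)`. -/
def evalZero {g₀ : Metric n M} {ε : ℕ → Ioi (0 : ℝ)} {f : M → ℝ} {x : M} (w : WUniv g₀ ε f x) : M :=
  w.1.1.1 0

/-- The map `(γ, g₀ + h) ↦ ((φᵢ ∘ γ - φᵢ(x))ᵢ, h)` defined by finitely many smooth functions `φᵢ`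
on `M`. -/
def inclusionMap {g₀ : Metric n M} {ε : ℕ → Ioi (0 : ℝ)} {f : M → ℝ} {x : M} {N : ℕ}
    (φ : Fin N → C^∞⟮𝓡 n, M; 𝓘(ℝ, ℝ), ℝ⟯) (w : WUniv g₀ ε f x) : (Fin N → H1) × CEps g₀ ε :=
  (fun i => H12.pull (φ i) w.1.1, w.1.2)

/-- The model Banach space of the universal stable manifold. -/
abbrev WModel (g₀ : Metric n M) (ε : ℕ → Ioi (0 : ℝ)) (f : M → ℝ) (x : M) : Type _ :=
  Eu (n - morseIndex (n := n) f x) × CEps g₀ ε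

/-- `W^s_univ(x)`, with the given atlas, is a smooth Banach submanifold of `H^{1,2}_x × 𝒢`. The
smooth structure of `H^{1,2}_x` is the one induced by the maps `γ ↦ φ ∘ γ - φ(x)`: near a given
path, finitely many of these form a split embedding into a Hilbert space. Since the topology is the
subspace topology, the two conditions on the inclusion determine the smooth structure. -/
structure IsSubmanifoldAtlas (g₀ : Metric n M) (ε : ℕ → Ioi (0 : ℝ)) (f : M → ℝ) (x : M)
    [ChartedSpace (WModel g₀ ε f x) (WUniv g₀ ε f x)] : Prop where
  isManifold : IsManifold 𝓘(ℝ, WModel g₀ ε f x) ∞ (WUniv g₀ ε f x)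
  smooth_inclusion : ∀ (N : ℕ) (φ : Fin N → C^∞⟮𝓡 n, M; 𝓘(ℝ, ℝ), ℝ⟯),
    ContMDiff 𝓘(ℝ, WModel g₀ ε f x) 𝓘(ℝ, (Fin N → H1) × CEps g₀ ε) ∞
      (inclusionMap φ : WUniv g₀ ε f x → _)
  immersion_inclusion : ∀ w : WUniv g₀ ε f x, ∃ (N : ℕ) (φ : Fin N → C^∞⟮𝓡 n, M; 𝓘(ℝ, ℝ), ℝ⟯),
    Manifold.IsImmersionAt 𝓘(ℝ, WModel g₀ ε f x) 𝓘(ℝ, (Fin N → H1) × CEps g₀ ε) ∞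
      (inclusionMap φ : WUniv g₀ ε f x → _) w

end Manifold

end MorseUniv

end

open Bundle Filter MeasureTheory Set
open scoped Manifold ContDiff Topology NNReal ENNReal

set_option maxSynthPendingDepth 3
set_option linter.unusedSectionVars false

noncomputable section

namespace MorseUniv

/-! ### Composition operators on spaces of bounded continuous functions -/

open scoped BoundedContinuousFunction

section Nemytskii

/-! The charts of $W^s_{\rm univ}(x)$ are explicit families of stable curves, parametrized by
$\mathbb R^{n-\mu(x)}\times C^\infty_\varepsilon$. No Fredholm theory on the path space is involved.

Local family. In coordinates that diagonalize the linearized gradient flow at $x$ for a fixed metric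
$h_0$, the curves that stay near $x$ solve a Lyapunov–Perron equation. It is posed for profiles $w$
with $\gamma(t)=e^{-\eta t}w(t)$, $w$ bounded and continuous. Composition operators are smooth on
such profiles, so the inverse function theorem gives a smooth family indexed by the stable
coordinates and the metric (`exists_stable_family`, `exists_local_stable_family`). A contraction
estimate shows that it contains every solution staying near $x$ with those stable coordinates. A
given stable curve enters this regime at some time $T$. Flow boxes, joined by an infimum argument,
continue the family back to time $0$ (`FlowFamily.exists_backward_to`). The outcome is `StableData`.

Charts. Along the family, $\frac{d}{dt}\varphi(\gamma)=e^{-\eta t}B(t)$ with $B$ bounded and smooth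
in the parameter, for every smooth $\varphi$. A bounded linear map `expH1` turns $B$ into
$\varphi\circ\gamma-\varphi(x)\in H^{1,2}$. Thus the curves lie in $H^{1,2}_x$ and depend smoothly
on the parameter. Conversely, the parameter is recovered from the values of finitely many functions
at time $T$, which are bounded functionals `evalH1` on $H^{1,2}$. The transition maps are therefore
smooth, and the inclusion has a bounded linear left inverse in each chart, hence is an immersion.

Submersion. If $\gamma$ is not constant, $f$ decreases strictly along it. A change of the metric
supported near $\gamma(0)$ and inside $\{f>f(\gamma(b))\}$, with $b>0$ small, leaves $\gamma$ on
$[b,\infty)$ untouched and moves $\gamma(0)$ through a linear differential equation. For each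
$\zeta\ne0$ the change can be chosen so that the displacement is not orthogonal to $\zeta$
(`StableData.exists_inner_ne_zero`). At the constant curve with $\mu(x)=0$ one takes $T=0$: the
parameters are then $n$ functions of $\gamma(0)$ itself.

The space $C^\infty_\varepsilon$. Naturality of $\nabla^k$ under changes of charts makes the norm
control all coordinate derivatives of $h$, so $(y,h)\mapsto h_y$ is smooth (`contDiffOn_evIter`).
Completeness follows by taking limits in the bidual and applying Fatou's lemma to the norm. For
density, $\varepsilon^0$ is chosen so small that countably many forms, dense among those supported
in small sets, have finite norm (`exists_locallyDense`). A partition of unity does the rest. -/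

theorem exists_uniform_ball {X Y : Type*} [PseudoMetricSpace X] [PseudoMetricSpace Y]
    {D K : Set X} (hD : IsOpen D) (hK : IsCompact K) (hKD : K ⊆ D) {f : X → Y}
    (hf : ContinuousOn f D) {r : ℝ} (hr : 0 < r) :
    ∃ δ > 0, ∀ c ∈ K, ∀ y, dist y c < δ → y ∈ D ∧ dist (f y) (f c) < r := by
  obtain ⟨δ₁, hδ₁, h1⟩ := hK.exists_thickening_subset_open hD hKD
  have h2 := hK.uniformContinuousAt_of_continuousAt f
    (fun a ha => hf.continuousAt (hD.mem_nhds (hKD ha))) (Metric.dist_mem_uniformity hr)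
  obtain ⟨δ₂, hδ₂, h3⟩ := Metric.mem_uniformity_dist.1 h2
  refine ⟨min δ₁ δ₂, lt_min hδ₁ hδ₂, fun c hc y hy => ⟨h1 ?_, ?_⟩⟩
  · exact Metric.mem_thickening_iff.2 ⟨c, hc, hy.trans_le (min_le_left _ _)⟩
  · rw [dist_comm]
    exact h3 (by rw [dist_comm]; exact hy.trans_le (min_le_right _ _)) hc

/-- Multiplication of a bounded family of operators with a bounded family of vectors. -/
def bcfApply (T : Type*) [TopologicalSpace T] {E F : Type*} [NormedAddCommGroup E]
    [NormedSpace ℝ E] [NormedAddCommGroup F] [NormedSpace ℝ F] :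
    (T →ᵇ (E →L[ℝ] F)) →L[ℝ] (T →ᵇ E) →L[ℝ] (T →ᵇ F) :=
  LinearMap.mkContinuous₂
    (LinearMap.mk₂ ℝ
      (fun (A : T →ᵇ (E →L[ℝ] F)) (v : T →ᵇ E) => BoundedContinuousFunction.ofNormedAddCommGroup
        (fun t => A t (v t)) (A.continuous.clm_apply v.continuous) (‖A‖ * ‖v‖) fun t =>
          ((A t).le_opNorm _).trans (mul_le_mul (A.norm_coe_le_norm t) (v.norm_coe_le_norm t)
            (norm_nonneg _) (norm_nonneg _)))
      (fun A B v => by ext t; simp) (fun c A v => by ext t; simp)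
      (fun A v w => by ext t; simp) (fun c A v => by ext t; simp)) 1 fun A v => by
    rw [one_mul]
    refine (BoundedContinuousFunction.norm_le (by positivity)).2 fun t => ?_
    exact ((A t).le_opNorm _).trans (mul_le_mul (A.norm_coe_le_norm t) (v.norm_coe_le_norm t)
            (norm_nonneg _) (norm_nonneg _))

@[simp] theorem bcfApply_apply {T : Type*} [TopologicalSpace T] {E F : Type*}
    [NormedAddCommGroup E] [NormedSpace ℝ E] [NormedAddCommGroup F] [NormedSpace ℝ F]
    (A : T →ᵇ (E →L[ℝ] F)) (v : T →ᵇ E) (t : T) : bcfApply T A v t = A t (v t) := rfl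

/-- The inclusion of constant functions. -/
def bcfConst (T : Type*) [TopologicalSpace T] (E : Type*) [NormedAddCommGroup E]
    [NormedSpace ℝ E] : E →L[ℝ] (T →ᵇ E) :=
  LinearMap.mkContinuous
    { toFun := fun e => BoundedContinuousFunction.const T e
      map_add' := fun _ _ => rfl
      map_smul' := fun _ _ => rfl } 1 fun e => by
    rw [one_mul]
    exact BoundedContinuousFunction.norm_const_le e

@[simp] theorem bcfConst_apply {T : Type*} [TopologicalSpace T] {E : Type*}
    [NormedAddCommGroup E] [NormedSpace ℝ E] (e : E) (t : T) : bcfConst T E e t = e := rfl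

variable {T : Type*} [TopologicalSpace T]

section

variable {E P F : Type*} [NormedAddCommGroup E] [NormedSpace ℝ E]
  [NormedAddCommGroup P] [NormedSpace ℝ P] [NormedAddCommGroup F] [NormedSpace ℝ F]

/-- Pairing of a bounded function with a constant. -/
def bcfPair (T : Type*) [TopologicalSpace T] (E P : Type*) [NormedAddCommGroup E] [NormedSpace ℝ E]
    [NormedAddCommGroup P] [NormedSpace ℝ P] : ((T →ᵇ E) × P) →L[ℝ] (T →ᵇ (E × P)) :=
  ((ContinuousLinearMap.inl ℝ E P).compLeftContinuousBounded T).comp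
      (ContinuousLinearMap.fst ℝ (T →ᵇ E) P) +
    ((ContinuousLinearMap.inr ℝ E P).compLeftContinuousBounded T).comp
      ((bcfConst T P).comp (ContinuousLinearMap.snd ℝ (T →ᵇ E) P))

@[simp] theorem bcfPair_apply (q : (T →ᵇ E) × P) (t : T) : bcfPair T E P q t = (q.1 t, q.2) := by
  simp [bcfPair]

open Classical in
/-- The composition operator `(w, h) ↦ Ψ(w(·), h)`. -/
def nem (T : Type*) [TopologicalSpace T] (Ψ : E × P → F) (q : (T →ᵇ E) × P) : T →ᵇ F :=
  if hq : Continuous (fun t => Ψ (q.1 t, q.2)) ∧ ∃ C, ∀ t, ‖Ψ (q.1 t, q.2)‖ ≤ C then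
    BoundedContinuousFunction.ofNormedAddCommGroup (fun t => Ψ (q.1 t, q.2)) hq.1 hq.2.choose
      hq.2.choose_spec
  else 0

/-- The pairs `(w, h)` such that `w × {h}` stays in a compact subset of `D`. -/
def nemDom (T : Type*) [TopologicalSpace T] (D : Set (E × P)) : Set ((T →ᵇ E) × P) :=
  {q | ∃ C : Set E, IsCompact C ∧ (∀ t, q.1 t ∈ C) ∧ ∀ c ∈ C, (c, q.2) ∈ D}

theorem nem_apply {D : Set (E × P)} {Ψ : E × P → F} (hΨ : ContinuousOn Ψ D)
    {q : (T →ᵇ E) × P} (hq : q ∈ nemDom T D) (t : T) : nem T Ψ q t = Ψ (q.1 t, q.2) := by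
  obtain ⟨C, hC, hqC, hCD⟩ := hq
  have h1 : ContinuousOn (fun c => Ψ (c, q.2)) C :=
    hΨ.comp (Continuous.prodMk_left q.2).continuousOn hCD
  have h2 : Continuous (fun t => Ψ (q.1 t, q.2)) := h1.comp_continuous q.1.continuous hqC
  obtain ⟨B, hB⟩ := hC.exists_bound_of_continuousOn h1
  have h3 : Continuous (fun t => Ψ (q.1 t, q.2)) ∧ ∃ C, ∀ t, ‖Ψ (q.1 t, q.2)‖ ≤ C :=
    ⟨h2, B, fun t => hB _ (hqC t)⟩
  rw [nem, dif_pos h3]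
  rfl

/-- Curves near $w$ stay in a closed thickening of the compact set that contains $w$. This
thickening is compact because `E` is proper. -/
theorem isOpen_nemDom [ProperSpace E] {D : Set (E × P)} (hD : IsOpen D) :
    IsOpen (nemDom T D) := by
  rw [Metric.isOpen_iff]
  rintro ⟨w, h⟩ ⟨C, hC, hwC, hCD⟩
  have hK : IsCompact (C ×ˢ ({h} : Set P)) := hC.prod isCompact_singleton
  obtain ⟨δ, hδ, hball⟩ := hK.exists_thickening_subset_open hD (by
    rintro ⟨c, k⟩ ⟨hc, rfl⟩; exact hCD c hc)
  refine ⟨δ / 2, by positivity, ?_⟩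
  rintro ⟨w', h'⟩ hq
  rw [Metric.mem_ball, Prod.dist_eq, max_lt_iff] at hq
  refine ⟨Metric.cthickening (δ / 2) C, hC.cthickening, fun t => ?_, fun c hc => hball ?_⟩
  · exact Metric.mem_cthickening_of_dist_le _ (w t) _ _ (hwC t)
      ((BoundedContinuousFunction.dist_coe_le_dist t).trans hq.1.le)
  · rw [hC.cthickening_eq_biUnion_closedBall (by positivity)] at hc
    simp only [mem_iUnion, exists_prop] at hc
    obtain ⟨c', hc', hcc'⟩ := hc
    refine Metric.mem_thickening_iff.2 ⟨(c', h), ⟨hc', rfl⟩, ?_⟩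
    rw [Prod.dist_eq]
    exact max_lt ((Metric.mem_closedBall.1 hcc').trans_lt (by linarith)) (hq.2.trans (by linarith))

/-- No compactness of `T` is needed: the values of $w$ lie in a compact set, near which $\Psi$ is
uniformly continuous. -/
theorem nem_continuousOn [ProperSpace E] {D : Set (E × P)} (hD : IsOpen D) {Ψ : E × P → F}
    (hΨ : ContinuousOn Ψ D) : ContinuousOn (nem T Ψ) (nemDom T D) := by
  intro q hq
  refine ContinuousAt.continuousWithinAt (Metric.continuousAt_iff.2 fun r hr => ?_)
  obtain ⟨C, hC, hwC, hCD⟩ := id hq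
  have hK : IsCompact (C ×ˢ ({q.2} : Set P)) := hC.prod isCompact_singleton
  obtain ⟨δ, hδ, hu⟩ := exists_uniform_ball hD hK (by
    rintro ⟨c, k⟩ ⟨hc, rfl⟩; exact hCD c hc) hΨ (half_pos hr)
  obtain ⟨δ', hδ', hball⟩ := Metric.isOpen_iff.1 (isOpen_nemDom (T := T) hD) q hq
  refine ⟨min δ δ', lt_min hδ hδ', fun {q'} hq' => ?_⟩
  have hq'D := hball (hq'.trans_le (min_le_right _ _))
  refine lt_of_le_of_lt ((BoundedContinuousFunction.dist_le (half_pos hr).le).2 fun t => ?_)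
    (half_lt_self hr)
  rw [nem_apply hΨ hq'D, nem_apply hΨ hq]
  refine (hu (q.1 t, q.2) ⟨hwC t, rfl⟩ _ ?_).2.le
  refine lt_of_le_of_lt ?_ (hq'.trans_le (min_le_left _ _))
  rw [Prod.dist_eq, Prod.dist_eq]
  exact max_le_max (BoundedContinuousFunction.dist_coe_le_dist t) le_rfl

/-- The mean value inequality is applied on a ball around each $(w(t),h)$. Uniform continuity of
$D\Psi$ near the compact set of values makes radius and error independent of $t$. -/
theorem nem_hasFDerivAt [ProperSpace E] {D : Set (E × P)} (hD : IsOpen D) {Ψ : E × P → F}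
    (hΨ : ContDiffOn ℝ 1 Ψ D) {q : (T →ᵇ E) × P} (hq : q ∈ nemDom T D) :
    HasFDerivAt (nem T Ψ) ((bcfApply T (nem T (fderiv ℝ Ψ) q)).comp (bcfPair T E P)) q := by
  have hΨ' : ContinuousOn (fderiv ℝ Ψ) D := hΨ.continuousOn_fderiv_of_isOpen hD le_rfl
  rw [hasFDerivAt_iff_isLittleO, Asymptotics.isLittleO_iff]
  intro r hr
  obtain ⟨C, hC, hwC, hCD⟩ := id hq
  have hK : IsCompact (C ×ˢ ({q.2} : Set P)) := hC.prod isCompact_singleton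
  obtain ⟨δ, hδ, hu⟩ := exists_uniform_ball hD hK (by
    rintro ⟨c, k⟩ ⟨hc, rfl⟩; exact hCD c hc) hΨ' hr
  filter_upwards [Metric.ball_mem_nhds q hδ, (isOpen_nemDom (T := T) hD).mem_nhds hq] with q' h1 h2
  refine (BoundedContinuousFunction.norm_le (by positivity)).2 fun t => ?_
  have hdist : dist (q'.1 t, q'.2) (q.1 t, q.2) ≤ dist q' q := by
    rw [Prod.dist_eq, Prod.dist_eq]
    exact max_le_max (BoundedContinuousFunction.dist_coe_le_dist t) le_rfl
  have key := Convex.norm_image_sub_le_of_norm_fderiv_le' (𝕜 := ℝ) (f := Ψ)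
    (φ := fderiv ℝ Ψ (q.1 t, q.2)) (C := r) (s := Metric.ball (q.1 t, q.2) δ)
    (x := (q.1 t, q.2)) (y := (q'.1 t, q'.2))
    (fun y hy => (hΨ.contDiffAt (hD.mem_nhds
      (hu (q.1 t, q.2) ⟨hwC t, rfl⟩ y hy).1)).differentiableAt (by simp))
    (fun y hy => by
      rw [← dist_eq_norm]; exact (hu (q.1 t, q.2) ⟨hwC t, rfl⟩ y hy).2.le)
    (convex_ball _ _) (Metric.mem_ball_self hδ) (hdist.trans_lt h1)
  simp only [BoundedContinuousFunction.coe_sub, Pi.sub_apply, nem_apply hΨ.continuousOn h2,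
    nem_apply hΨ.continuousOn hq, ContinuousLinearMap.comp_apply, bcfApply_apply, nem_apply hΨ' hq,
    bcfPair_apply, Prod.fst_sub, Prod.snd_sub]
  refine key.trans (mul_le_mul_of_nonneg_left ?_ hr.le)
  rw [← dist_eq_norm, ← dist_eq_norm]
  exact hdist

end

section Smooth

universe u

/-- The derivative of the operator of $\Psi$ is a bounded linear expression in the operator of
$D\Psi$, so induction on the order works. The target changes from `F` to `E × P →L[ℝ] F` at each
step; placing `E` in `Type` and `F` in the universe of `P` keeps it in one universe. -/
theorem nem_contDiffOn_aux {E : Type} {P : Type u} [NormedAddCommGroup E] [NormedSpace ℝ E]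
    [ProperSpace E] [NormedAddCommGroup P] [NormedSpace ℝ P] {D : Set (E × P)} (hD : IsOpen D)
    (n : ℕ) : ∀ {F : Type u} [NormedAddCommGroup F] [NormedSpace ℝ F] {Ψ : E × P → F},
    ContDiffOn ℝ ∞ Ψ D → ContDiffOn ℝ n (nem T Ψ) (nemDom T D) := by
  induction n with
  | zero =>
    intro F _ _ Ψ hΨ
    exact contDiffOn_zero.2 (nem_continuousOn hD hΨ.continuousOn)
  | succ n ih =>
    intro F _ _ Ψ hΨ
    have hd : ∀ q ∈ nemDom T D, _ := fun q hq =>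
      nem_hasFDerivAt hD (hΨ.of_le (by simp)) hq
    rw [Nat.cast_add, Nat.cast_one, contDiffOn_succ_iff_fderiv_of_isOpen (isOpen_nemDom hD)]
    refine ⟨fun q hq => (hd q hq).differentiableAt.differentiableWithinAt, by simp, ?_⟩
    have h1 := ih (F := E × P →L[ℝ] F) (hΨ.fderiv_of_isOpen (m := ∞) hD (by simp))
    have h2 : ContDiffOn ℝ n (fun q => (bcfApply T (nem T (fderiv ℝ Ψ) q)).comp (bcfPair T E P))
        (nemDom T D) :=
      ((bcfApply T (E := E × P) (F := F)).contDiff.comp_contDiffOn h1).clm_comp contDiffOn_const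
    exact h2.congr fun q hq => (hd q hq).fderiv

/-- Composition with a smooth map is smooth. -/
theorem nem_contDiffOn {E F : Type} {P : Type u} [NormedAddCommGroup E] [NormedSpace ℝ E]
    [ProperSpace E] [NormedAddCommGroup P] [NormedSpace ℝ P] {D : Set (E × P)} (hD : IsOpen D)
    [NormedAddCommGroup F] [NormedSpace ℝ F] {Ψ : E × P → F}
    (hΨ : ContDiffOn ℝ ∞ Ψ D) : ContDiffOn ℝ ∞ (nem T Ψ) (nemDom T D) := by
  rw [contDiffOn_infty]
  intro n
  -- The target is lifted to the universe of `P` to meet the form of the inductive statement, and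
  -- lowered again at the end.
  let e : ULift.{u} F ≃L[ℝ] F := ContinuousLinearEquiv.ulift
  have h1 : ContDiffOn ℝ ∞ (fun q => e.symm (Ψ q)) D := e.symm.contDiff.comp_contDiffOn hΨ
  have h2 := nem_contDiffOn_aux (T := T) hD n h1
  have h3 := ((e : ULift.{u} F →L[ℝ] F).compLeftContinuousBounded T).contDiff.comp_contDiffOn h2
  refine h3.congr fun q hq => ?_
  ext t
  rw [nem_apply hΨ.continuousOn hq]
  simp [nem_apply h1.continuousOn hq]

end Smooth

end Nemytskii

/-! ### The inverse function theorem and the Hadamard factorization -/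

/-- The inverse function theorem yields smoothness of the inverse at a single point. Restricting to
the open set where the derivative is invertible gives smoothness on the whole target. -/
theorem exists_smooth_inverse {E F : Type*} [NormedAddCommGroup E] [NormedSpace ℝ E]
    [CompleteSpace E] [NormedAddCommGroup F] [NormedSpace ℝ F] {D : Set E} (hD : IsOpen D)
    {Φ : E → F} (hΦ : ContDiffOn ℝ ∞ Φ D) {a : E} (ha : a ∈ D) {A : E ≃L[ℝ] F}
    (hA : HasFDerivAt Φ (A : E →L[ℝ] F) a) :
    ∃ e : OpenPartialHomeomorph E F, (∀ y, e y = Φ y) ∧ a ∈ e.source ∧ e.source ⊆ D ∧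
      ContDiffOn ℝ ∞ e.symm e.target := by
  have hat : ContDiffAt ℝ ∞ Φ a := hΦ.contDiffAt (hD.mem_nhds ha)
  let e₀ := hat.toOpenPartialHomeomorph Φ hA (by simp)
  have hcont : ContinuousOn (fderiv ℝ Φ) D := hΦ.continuousOn_fderiv_of_isOpen hD (by simp)
  have hopen : IsOpen (D ∩ fderiv ℝ Φ ⁻¹' range ((↑) : (E ≃L[ℝ] F) → E →L[ℝ] F)) :=
    hcont.isOpen_inter_preimage hD ContinuousLinearEquiv.isOpen
  have ha' : a ∈ D ∩ fderiv ℝ Φ ⁻¹' range ((↑) : (E ≃L[ℝ] F) → E →L[ℝ] F) :=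
    ⟨ha, A, hA.fderiv.symm⟩
  let e := e₀.restr (D ∩ fderiv ℝ Φ ⁻¹' range ((↑) : (E ≃L[ℝ] F) → E →L[ℝ] F))
  have hes : e.source = e₀.source ∩ (D ∩ fderiv ℝ Φ ⁻¹' range ((↑) : (E ≃L[ℝ] F) → E →L[ℝ] F)) := by
    rw [OpenPartialHomeomorph.restr_source, hopen.interior_eq]
  refine ⟨e, fun y => rfl, ?_, ?_, ?_⟩
  · rw [hes]; exact ⟨hat.mem_toOpenPartialHomeomorph_source hA (by simp), ha'⟩
  · rw [hes]; exact fun y hy => hy.2.1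
  · intro y hy
    have hs := e.map_target hy
    rw [hes] at hs
    obtain ⟨B, hB⟩ := hs.2.2
    refine (e.contDiffAt_symm hy (f₀' := B) ?_ ?_).contDiffWithinAt
    · rw [hB]
      exact ((hΦ.contDiffAt (hD.mem_nhds hs.2.1)).differentiableAt (by simp)).hasFDerivAt
    · exact hΦ.contDiffAt (hD.mem_nhds hs.2.1)

/-- Truncation of the real line to `[-1, 1]`. -/
def clip : C(ℝ, ℝ) := ⟨fun s => max (-1) (min s 1), by fun_prop⟩

theorem clip_of_mem {s : ℝ} (hs : s ∈ Icc (-1 : ℝ) 1) : clip s = s := by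
  simp [clip, hs.1, hs.2]

theorem clip_mem (s : ℝ) : clip s ∈ Icc (-1 : ℝ) 1 := by
  constructor <;> simp [clip]

theorem abs_clip_le (s : ℝ) : |clip s| ≤ 1 := abs_le.2 (clip_mem s)

/-- The linear paths `s ↦ s • e`, truncated. -/
def bcfRay (E : Type*) [NormedAddCommGroup E] [NormedSpace ℝ E] : E →L[ℝ] (ℝ →ᵇ E) :=
  LinearMap.mkContinuous
    { toFun := fun e => BoundedContinuousFunction.ofNormedAddCommGroup (fun s => clip s • e)
        (by fun_prop) ‖e‖ fun s => by
          rw [norm_smul]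
          exact mul_le_of_le_one_left (norm_nonneg _) (abs_clip_le s)
      map_add' := fun _ _ => by ext; simp
      map_smul' := fun c e => by ext s; simp [smul_comm c (clip s) e] } 1 fun e => by
    rw [one_mul]
    refine (BoundedContinuousFunction.norm_le (norm_nonneg _)).2 fun s => ?_
    change ‖clip s • e‖ ≤ _
    rw [norm_smul]
    exact mul_le_of_le_one_left (norm_nonneg _) (abs_clip_le s)

@[simp] theorem bcfRay_apply {E : Type*} [NormedAddCommGroup E] [NormedSpace ℝ E] (e : E) (s : ℝ) :
    bcfRay E e s = clip s • e := rfl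

/-- The truncated primitive `s ↦ ∫₀^{clip s} v`. -/
def bcfPrim (F : Type*) [NormedAddCommGroup F] [NormedSpace ℝ F] [CompleteSpace F] :
    (ℝ →ᵇ F) →L[ℝ] (ℝ →ᵇ F) :=
  have hb : ∀ (v : ℝ →ᵇ F) (s : ℝ), ‖∫ r in (0 : ℝ)..clip s, v r‖ ≤ ‖v‖ := fun v s => by
    refine (intervalIntegral.norm_integral_le_of_norm_le_const
      (fun r _ => v.norm_coe_le_norm r)).trans ?_
    rw [sub_zero]
    exact mul_le_of_le_one_right (norm_nonneg _) (abs_clip_le s)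
  LinearMap.mkContinuous
    { toFun := fun v => BoundedContinuousFunction.ofNormedAddCommGroup
        (fun s => ∫ r in (0 : ℝ)..clip s, v r)
        ((intervalIntegral.continuous_primitive
          (fun a b => v.continuous.intervalIntegrable a b) 0).comp clip.continuous) ‖v‖ (hb v)
      map_add' := fun v w => by
        ext s
        exact intervalIntegral.integral_add (v.continuous.intervalIntegrable _ _)
          (w.continuous.intervalIntegrable _ _)
      map_smul' := fun c v => by
        ext s
        exact intervalIntegral.integral_smul c _ } 1 fun v => by
    rw [one_mul]
    exact (BoundedContinuousFunction.norm_le (norm_nonneg _)).2 (hb v)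

@[simp] theorem bcfPrim_apply {F : Type*} [NormedAddCommGroup F] [NormedSpace ℝ F]
    [CompleteSpace F] (v : ℝ →ᵇ F) (s : ℝ) : bcfPrim F v s = ∫ r in (0 : ℝ)..clip s, v r := rfl

section Hadamard

universe u

variable {E F : Type} {P : Type u} [NormedAddCommGroup E] [NormedSpace ℝ E]
    [ProperSpace E] [NormedAddCommGroup P] [NormedSpace ℝ P]
    [NormedAddCommGroup F] [NormedSpace ℝ F] [CompleteSpace F]

theorem mem_nemDom_of_norm_le {T : Type*} [TopologicalSpace T] {r : ℝ} {P' : Set P}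
    {q : (T →ᵇ E) × P} {s : ℝ} (hs : s < r) (hq : ∀ t, ‖q.1 t‖ ≤ s) (hP : q.2 ∈ P') :
    q ∈ nemDom T (Metric.ball (0 : E) r ×ˢ P') :=
  ⟨Metric.closedBall 0 s, isCompact_closedBall _ _, fun t => by simpa using hq t,
    fun c hc => ⟨Metric.closedBall_subset_ball hs hc, hP⟩⟩

/-- A smooth function that vanishes along `{0} × P` is a smooth linear combination of the
coordinates. -/
theorem exists_hadamard_factor {r : ℝ} {P' : Set P} (hP : IsOpen P') {Z : E × P → F}
    (hZ : ContDiffOn ℝ ∞ Z (Metric.ball 0 r ×ˢ P')) (hZ0 : ∀ h ∈ P', Z (0, h) = 0) :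
    ∃ L : E × P → E →L[ℝ] F, ContDiffOn ℝ ∞ L (Metric.ball 0 r ×ˢ P') ∧
      (∀ q ∈ Metric.ball (0 : E) r ×ˢ P', Z q = L q q.1) ∧
      ∀ h ∈ P', 0 < r → L (0, h) = (fderiv ℝ Z (0, h)).comp (ContinuousLinearMap.inl ℝ E P) := by
  have hD : IsOpen (Metric.ball (0 : E) r ×ˢ P') := Metric.isOpen_ball.prod hP
  let A : E × P → E →L[ℝ] F := fun q => (fderiv ℝ Z q).comp (ContinuousLinearMap.inl ℝ E P)
  have hA : ContDiffOn ℝ ∞ A (Metric.ball 0 r ×ˢ P') :=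
    (hZ.fderiv_of_isOpen hD (by simp)).clm_comp contDiffOn_const
  let R : E × P →L[ℝ] (ℝ →ᵇ E) × P := (bcfRay E).prodMap (ContinuousLinearMap.id ℝ P)
  have hR : ∀ q ∈ Metric.ball (0 : E) r ×ˢ P', R q ∈ nemDom ℝ (Metric.ball (0 : E) r ×ˢ P') := by
    rintro ⟨y, h⟩ ⟨hy, hh⟩
    refine mem_nemDom_of_norm_le (s := ‖y‖) (by simpa using hy) (fun t => ?_) hh
    change ‖clip t • y‖ ≤ _
    rw [norm_smul]
    exact mul_le_of_le_one_left (norm_nonneg _) (abs_clip_le t)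
  -- $L(y,h)=\int_0^1\partial_yZ(sy,h)\,ds$, written with `nem` and `bcfPrim` so that smoothness in
  -- $(y,h)$ is that of a composition operator along rays.
  let L : E × P → E →L[ℝ] F := fun q => bcfPrim (E →L[ℝ] F) (nem ℝ A (R q)) 1
  have hL : ∀ q ∈ Metric.ball (0 : E) r ×ˢ P', L q = ∫ s in (0 : ℝ)..1, A (s • q.1, q.2) := by
    intro q hq
    change bcfPrim _ _ _ = _
    rw [bcfPrim_apply, clip_of_mem (by simp)]
    refine intervalIntegral.integral_congr fun s hs => ?_
    rw [uIcc_of_le zero_le_one] at hs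
    rw [nem_apply hA.continuousOn (hR q hq)]
    change A (clip s • q.1, q.2) = _
    rw [clip_of_mem ⟨by linarith [hs.1], hs.2⟩]
  refine ⟨L, ?_, ?_, ?_⟩
  · exact ((BoundedContinuousFunction.evalCLM ℝ (1 : ℝ)).comp (bcfPrim (E →L[ℝ] F))).contDiff.comp_contDiffOn
      ((nem_contDiffOn hD hA).comp R.contDiff.contDiffOn hR)
  · rintro ⟨y, h⟩ hq
    have hmem : ∀ s ∈ uIcc (0 : ℝ) 1, (s • y, h) ∈ Metric.ball (0 : E) r ×ˢ P' := by
      intro s hs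
      rw [uIcc_of_le zero_le_one] at hs
      refine ⟨?_, hq.2⟩
      have := hq.1
      simp only [Metric.mem_ball, dist_zero_right] at this ⊢
      rw [norm_smul, Real.norm_of_nonneg hs.1]
      exact (mul_le_of_le_one_left (norm_nonneg _) hs.2).trans_lt this
    have hcA : ContinuousOn (fun s : ℝ => A (s • y, h)) (uIcc 0 1) :=
      hA.continuousOn.comp (by fun_prop) hmem
    have h1 : ∀ s ∈ uIcc (0 : ℝ) 1, HasDerivAt (fun s : ℝ => Z (s • y, h)) (A (s • y, h) y) s := by
      intro s hs
      have h2 : HasFDerivAt Z (fderiv ℝ Z (s • y, h)) (s • y, h) :=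
        ((hZ.contDiffAt (hD.mem_nhds (hmem s hs))).differentiableAt (by simp)).hasFDerivAt
      have h3 : HasDerivAt (fun s : ℝ => (s • y, h)) (y, (0 : P)) s := by
        have := (hasDerivAt_id s).smul_const y
        simp only [id, one_smul] at this
        exact this.prodMk (hasDerivAt_const s h)
      exact h2.comp_hasDerivAt s h3
    have h4 := intervalIntegral.integral_eq_sub_of_hasDerivAt h1
      ((hcA.clm_apply continuousOn_const).intervalIntegrable)
    rw [one_smul, zero_smul, hZ0 h hq.2, sub_zero] at h4
    rw [hL _ hq, ← h4]
    exact (ContinuousLinearMap.intervalIntegral_apply hcA.intervalIntegrable y).symm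
  · intro h hh hr
    rw [hL _ ⟨by simpa using hr, hh⟩]
    simp only [smul_zero]
    rw [intervalIntegral.integral_const]
    simp [A]

end Hadamard

/-! ### Exponential weights -/

/-- The weight `t ↦ exp(-ηt)` on `[0, ∞)`. -/
def expWeight {η : ℝ} (hη : 0 ≤ η) : ℝ≥0 →ᵇ ℝ :=
  BoundedContinuousFunction.ofNormedAddCommGroup (fun t : ℝ≥0 => Real.exp (-(η * t)))
    (by fun_prop) 1 fun t => by
      rw [Real.norm_of_nonneg (Real.exp_pos _).le]
      exact Real.exp_le_one_iff.2 (by have := t.2; simp only [Left.neg_nonpos_iff]; positivity)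

/-- Multiplication by a bounded scalar function. -/
def bcfMul {T : Type*} [TopologicalSpace T] (E : Type*) [NormedAddCommGroup E] [NormedSpace ℝ E]
    (k : T →ᵇ ℝ) : (T →ᵇ E) →L[ℝ] (T →ᵇ E) :=
  bcfApply T ((ContinuousLinearMap.lsmul ℝ ℝ : ℝ →L[ℝ] E →L[ℝ] E).compLeftContinuousBounded T k)

@[simp] theorem bcfMul_apply {T : Type*} [TopologicalSpace T] {E : Type*} [NormedAddCommGroup E]
    [NormedSpace ℝ E] (k : T →ᵇ ℝ) (v : T →ᵇ E) (t : T) : bcfMul E k v t = k t • v t := rfl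

@[simp] theorem expWeight_apply {η : ℝ} (hη : 0 ≤ η) (t : ℝ≥0) :
    expWeight hη t = Real.exp (-(η * t)) := rfl

theorem norm_expWeight_smul_le {η : ℝ} (hη : 0 ≤ η) {E : Type*} [NormedAddCommGroup E]
    [NormedSpace ℝ E] (e : E) (t : ℝ≥0) : ‖Real.exp (-(η * t)) • e‖ ≤ ‖e‖ := by
  rw [norm_smul, Real.norm_of_nonneg (Real.exp_pos _).le]
  refine mul_le_of_le_one_left (norm_nonneg _) (Real.exp_le_one_iff.2 ?_)
  have := t.2
  simp only [Left.neg_nonpos_iff]; positivity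

/-- The composition operator of a function vanishing at `0` acts smoothly on exponentially decaying
curves. -/
theorem exists_weighted_nem {E F : Type} {P : Type*} [NormedAddCommGroup E] [NormedSpace ℝ E]
    [ProperSpace E] [NormedAddCommGroup P] [NormedSpace ℝ P]
    [NormedAddCommGroup F] [NormedSpace ℝ F] [CompleteSpace F]
    {η : ℝ} (hη : 0 ≤ η) {r : ℝ} {P' : Set P} (hP : IsOpen P') {Z : E × P → F}
    (hZ : ContDiffOn ℝ ∞ Z (Metric.ball 0 r ×ˢ P')) (hZ0 : ∀ h ∈ P', Z (0, h) = 0) :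
    ∃ W : (ℝ≥0 →ᵇ E) × P → (ℝ≥0 →ᵇ F), ContDiffOn ℝ ∞ W (Metric.ball 0 r ×ˢ P') ∧
      (∀ q ∈ Metric.ball (0 : ℝ≥0 →ᵇ E) r ×ˢ P', ∀ t : ℝ≥0,
        Real.exp (-(η * t)) • W q t = Z (Real.exp (-(η * t)) • q.1 t, q.2)) ∧
      ∀ h ∈ P', 0 < r → (fderiv ℝ Z (0, h)).comp (ContinuousLinearMap.inl ℝ E P) = 0 →
        HasFDerivAt W (0 : (ℝ≥0 →ᵇ E) × P →L[ℝ] (ℝ≥0 →ᵇ F)) (0, h) := by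
  obtain ⟨L, hL, hLZ, hL0⟩ := exists_hadamard_factor hP hZ hZ0
  let m : (ℝ≥0 →ᵇ E) × P →L[ℝ] (ℝ≥0 →ᵇ E) × P :=
    (bcfMul E (expWeight hη)).prodMap (ContinuousLinearMap.id ℝ P)
  have hm : ∀ q ∈ Metric.ball (0 : ℝ≥0 →ᵇ E) r ×ˢ P',
      m q ∈ nemDom ℝ≥0 (Metric.ball (0 : E) r ×ˢ P') := by
    rintro ⟨w, h⟩ ⟨hw, hh⟩
    refine mem_nemDom_of_norm_le (s := ‖w‖) (by simpa using hw) (fun t => ?_) hh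
    exact (norm_expWeight_smul_le hη _ t).trans (w.norm_coe_le_norm t)
  have hD : IsOpen (Metric.ball (0 : E) r ×ˢ P') := Metric.isOpen_ball.prod hP
  have hn : ContDiffOn ℝ ∞ (fun q => nem ℝ≥0 L (m q)) (Metric.ball 0 r ×ˢ P') :=
    (nem_contDiffOn hD hL).comp m.contDiff.contDiffOn hm
  have hc : ContDiffOn ℝ ∞ (fun q => bcfApply ℝ≥0 (nem ℝ≥0 L (m q)))
      (Metric.ball 0 r ×ˢ P') := (bcfApply ℝ≥0 (E := E) (F := F)).contDiff.comp_contDiffOn hn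
  -- $W(w,h)(t)=L(e^{-\eta t}w(t),h)\,w(t)$: the factor linear in the curve releases exactly one
  -- weight $e^{-\eta t}$.
  refine ⟨fun q => bcfApply ℝ≥0 (nem ℝ≥0 L (m q)) q.1, ?_, ?_, ?_⟩
  · exact hc.clm_apply contDiff_fst.contDiffOn
  · rintro q hq t
    rw [bcfApply_apply, nem_apply hL.continuousOn (hm q hq)]
    have hmem : (Real.exp (-(η * t)) • q.1 t, q.2) ∈ Metric.ball (0 : E) r ×ˢ P' := by
      refine ⟨?_, hq.2⟩
      have := hq.1
      simp only [Metric.mem_ball, dist_zero_right] at this ⊢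
      exact ((norm_expWeight_smul_le hη _ t).trans (q.1.norm_coe_le_norm t)).trans_lt this
    rw [hLZ _ hmem]
    simp only [map_smul]
    rfl
  · intro h hh hr h0
    have hmem : ((0 : ℝ≥0 →ᵇ E), h) ∈ Metric.ball (0 : ℝ≥0 →ᵇ E) r ×ˢ P' := ⟨by simpa using hr, hh⟩
    have hdiff : HasFDerivAt (fun q => bcfApply ℝ≥0 (nem ℝ≥0 L (m q))) _ ((0 : ℝ≥0 →ᵇ E), h) :=
      ((hc.contDiffAt ((Metric.isOpen_ball.prod hP).mem_nhds hmem)).differentiableAt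
        (by simp)).hasFDerivAt
    -- In the product rule at $w=0$ one term contains the factor $w=0$ and the other the factor
    -- $L(0,h)=\partial_yZ(0,h)=0$.
    have h1 := hdiff.clm_apply (hasFDerivAt_fst (𝕜 := ℝ) (p := ((0 : ℝ≥0 →ᵇ E), h)))
    refine h1.congr_fderiv ?_
    have hz : nem ℝ≥0 L (m (0, h)) = 0 := by
      ext t
      rw [nem_apply hL.continuousOn (hm _ hmem)]
      have : L ((m (0, h)).1 t, (m (0, h)).2) = L (0, h) := by simp [m]
      rw [this, hL0 h hh hr, h0]
      rfl
    rw [hz]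
    refine ContinuousLinearMap.ext fun q => ?_
    simp

/-! ### Bounded solutions of scalar linear equations -/

open scoped BoundedContinuousFunction

theorem continuous_comp_toNNReal {F : Type*} [NormedAddCommGroup F] (g : ℝ≥0 →ᵇ F) :
    Continuous (fun s : ℝ => g s.toNNReal) := g.continuous.comp continuous_real_toNNReal

/-- The constant of integration that selects the bounded solution of `w' = -μ w + g`. -/
def kernConst (μ : ℝ) (g : ℝ≥0 →ᵇ ℝ) : ℝ :=
  if 0 < μ then 0 else -∫ s in Ioi (0 : ℝ), Real.exp (μ * s) * g s.toNNReal

/-- The bounded solution of `w' = -μ w + g` (with `w(0) = 0` if `μ > 0`). -/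
def kernFun (μ : ℝ) (g : ℝ≥0 →ᵇ ℝ) (t : ℝ) : ℝ :=
  Real.exp (-(μ * t)) *
    (kernConst μ g + ∫ s in (0 : ℝ)..t, Real.exp (μ * s) * g s.toNNReal)

theorem continuous_kern_integrand (μ : ℝ) (g : ℝ≥0 →ᵇ ℝ) :
    Continuous (fun s : ℝ => Real.exp (μ * s) * g s.toNNReal) :=
  (by fun_prop : Continuous fun s : ℝ => Real.exp (μ * s)).mul (continuous_comp_toNNReal g)

theorem integrableOn_kern_integrand {μ : ℝ} (hμ : μ < 0) (g : ℝ≥0 →ᵇ ℝ) (t : ℝ) :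
    IntegrableOn (fun s : ℝ => Real.exp (μ * s) * g s.toNNReal) (Ioi t) := by
  refine ((integrableOn_exp_mul_Ioi hμ t).mul_const ‖g‖).mono'
    (continuous_kern_integrand μ g).aestronglyMeasurable (ae_of_all _ fun s => ?_)
  rw [norm_mul, Real.norm_of_nonneg (Real.exp_pos _).le]
  exact mul_le_mul_of_nonneg_left (g.norm_coe_le_norm _) (Real.exp_pos _).le

theorem hasDerivAt_kernFun (μ : ℝ) (g : ℝ≥0 →ᵇ ℝ) (t : ℝ) :
    HasDerivAt (kernFun μ g) (-(μ * kernFun μ g t) + g t.toNNReal) t := by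
  have h1 : HasDerivAt (fun t : ℝ => ∫ s in (0 : ℝ)..t, Real.exp (μ * s) * g s.toNNReal)
      (Real.exp (μ * t) * g t.toNNReal) t :=
    intervalIntegral.integral_hasDerivAt_right
      ((continuous_kern_integrand μ g).intervalIntegrable _ _)
      ((continuous_kern_integrand μ g).stronglyMeasurableAtFilter _ _)
      (continuous_kern_integrand μ g).continuousAt
  have h2 : HasDerivAt (fun t : ℝ => Real.exp (-(μ * t))) (Real.exp (-(μ * t)) * -μ) t := by
    have := ((hasDerivAt_id t).const_mul μ).neg.exp
    simpa using this
  refine (h2.mul (h1.const_add (kernConst μ g))).congr_deriv ?_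
  have h3 : Real.exp (-(μ * t)) * Real.exp (μ * t) = 1 := by
    rw [← Real.exp_add]; simp
  simp only [kernFun]
  linear_combination g t.toNNReal * h3

/-- For $\mu<0$ the constant of integration turns $\int_0^t$ into $-\int_t^\infty$, whose integrand
decays. For $\mu>0$ the integral from $0$ is already damped by $e^{-\mu t}$. -/
theorem norm_kernFun_le {μ : ℝ} (hμ : μ ≠ 0) (g : ℝ≥0 →ᵇ ℝ) {t : ℝ} (ht : 0 ≤ t) :
    ‖kernFun μ g t‖ ≤ |μ|⁻¹ * ‖g‖ := by
  have hb : ∀ s : ℝ, ‖Real.exp (μ * s) * g s.toNNReal‖ ≤ Real.exp (μ * s) * ‖g‖ := fun s => by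
    rw [norm_mul, Real.norm_of_nonneg (Real.exp_pos _).le]
    exact mul_le_mul_of_nonneg_left (g.norm_coe_le_norm _) (Real.exp_pos _).le
  have h3 : Real.exp (-(μ * t)) * Real.exp (μ * t) = 1 := by
    rw [← Real.exp_add]; simp
  have key : ‖kernConst μ g + ∫ s in (0 : ℝ)..t, Real.exp (μ * s) * g s.toNNReal‖ ≤
      Real.exp (μ * t) * |μ|⁻¹ * ‖g‖ := by
    rcases lt_or_gt_of_ne hμ with hneg | hpos
    · have h1 := intervalIntegral.integral_Ioi_sub_Ioi (f := fun s : ℝ => Real.exp (μ * s) * g s.toNNReal)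
        (integrableOn_kern_integrand hneg g 0) ht
      rw [kernConst, if_neg hneg.not_gt, ← h1, neg_add_eq_sub, sub_sub_cancel_left, norm_neg]
      refine (norm_integral_le_integral_norm _).trans ?_
      have h2 : ∫ s in Ioi t, Real.exp (μ * s) * ‖g‖ = Real.exp (μ * t) * |μ|⁻¹ * ‖g‖ := by
        rw [integral_mul_const, integral_exp_mul_Ioi hneg, abs_of_neg hneg]
        field_simp
      rw [← h2]
      exact integral_mono_of_nonneg (ae_of_all _ fun s => norm_nonneg _)
        ((integrableOn_exp_mul_Ioi hneg t).mul_const _) (ae_of_all _ hb)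
    · rw [kernConst, if_pos hpos, zero_add]
      refine (intervalIntegral.norm_integral_le_of_norm_le ht (ae_of_all _ fun s _ => hb s)
        ((by fun_prop : Continuous fun s : ℝ => Real.exp (μ * s) * ‖g‖).intervalIntegrable _ _)).trans ?_
      have h4 : ∫ s in (0 : ℝ)..t, Real.exp (μ * s) * ‖g‖ = (Real.exp (μ * t) - 1) * μ⁻¹ * ‖g‖ := by
        rw [intervalIntegral.integral_mul_const, intervalIntegral.integral_comp_mul_left
          (fun x => Real.exp x) hμ, integral_exp]
        rw [smul_eq_mul, mul_zero, Real.exp_zero]; ring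
      rw [h4, abs_of_pos hpos]
      have : 0 ≤ μ⁻¹ * ‖g‖ := by positivity
      nlinarith
  rw [kernFun, norm_mul, Real.norm_of_nonneg (Real.exp_pos _).le]
  refine (mul_le_mul_of_nonneg_left key (Real.exp_pos _).le).trans (le_of_eq ?_)
  linear_combination |μ|⁻¹ * ‖g‖ * h3

/-- The solution operator of `w' = -μ w + g` on bounded functions. -/
def kern {μ : ℝ} (hμ : μ ≠ 0) : (ℝ≥0 →ᵇ ℝ) →L[ℝ] (ℝ≥0 →ᵇ ℝ) :=
  LinearMap.mkContinuous
    { toFun := fun g => BoundedContinuousFunction.ofNormedAddCommGroup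
        (fun t : ℝ≥0 => kernFun μ g t)
        ((continuous_iff_continuousAt.2 fun t => (hasDerivAt_kernFun μ g t).continuousAt).comp
          NNReal.continuous_coe) (|μ|⁻¹ * ‖g‖) (fun t => norm_kernFun_le hμ g t.2)
      map_add' := fun g g' => by
        ext t
        have h1 : kernConst μ (g + g') = kernConst μ g + kernConst μ g' := by
          unfold kernConst
          split_ifs with h
          · simp
          · have hneg : μ < 0 := lt_of_le_of_ne (not_lt.1 h) hμ
            rw [← neg_add, ← integral_add (integrableOn_kern_integrand hneg g 0)
              (integrableOn_kern_integrand hneg g' 0)]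
            simp [mul_add]
        have h2 : ∫ s in (0 : ℝ)..t, Real.exp (μ * s) * (g + g') s.toNNReal =
            (∫ s in (0 : ℝ)..t, Real.exp (μ * s) * g s.toNNReal) +
            ∫ s in (0 : ℝ)..t, Real.exp (μ * s) * g' s.toNNReal := by
          rw [← intervalIntegral.integral_add
            ((continuous_kern_integrand μ g).intervalIntegrable _ _)
            ((continuous_kern_integrand μ g').intervalIntegrable _ _)]
          simp [mul_add]
        change kernFun μ (g + g') t = kernFun μ g t + kernFun μ g' t
        simp only [kernFun, h1, h2]
        ring
      map_smul' := fun c g => by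
        ext t
        have h1 : kernConst μ (c • g) = c * kernConst μ g := by
          unfold kernConst
          split_ifs with h
          · simp
          · rw [mul_neg, ← integral_const_mul]
            simp [mul_left_comm]
        have h2 : ∫ s in (0 : ℝ)..t, Real.exp (μ * s) * (c • g) s.toNNReal =
            c * ∫ s in (0 : ℝ)..t, Real.exp (μ * s) * g s.toNNReal := by
          rw [← intervalIntegral.integral_const_mul]
          simp [mul_left_comm]
        change kernFun μ (c • g) t = c * kernFun μ g t
        simp only [kernFun, h1, h2]
        ring } |μ|⁻¹ fun g =>
    (BoundedContinuousFunction.norm_le (by positivity)).2 fun t => norm_kernFun_le hμ g t.2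

theorem kern_apply {μ : ℝ} (hμ : μ ≠ 0) (g : ℝ≥0 →ᵇ ℝ) (t : ℝ≥0) :
    kern hμ g t = kernFun μ g t := rfl

theorem kern_zero {μ : ℝ} (hμ : 0 < μ) (g : ℝ≥0 →ᵇ ℝ) : kern hμ.ne' g 0 = 0 := by
  simp [kern_apply, kernFun, kernConst, hμ]

theorem hasDerivWithinAt_kern {μ : ℝ} (hμ : μ ≠ 0) (g : ℝ≥0 →ᵇ ℝ) {t : ℝ} (ht : 0 ≤ t) :
    HasDerivWithinAt (fun s : ℝ => kern hμ g s.toNNReal)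
      (-(μ * kern hμ g t.toNNReal) + g t.toNNReal) (Ici 0) t := by
  have h1 := (hasDerivAt_kernFun μ g t).hasDerivWithinAt (s := Ici 0)
  rw [kern_apply, Real.coe_toNNReal t ht]
  refine h1.congr (fun s hs => ?_) ?_
  · rw [kern_apply, Real.coe_toNNReal s hs]
  · rw [kern_apply, Real.coe_toNNReal t ht]

/-- $e^{\mu t}d(t)$ is constant. If $\mu<0$ it tends to $0$ by boundedness; if $\mu>0$ the initial
condition makes it $0$. -/
theorem eq_zero_of_bounded_solution {μ : ℝ} (hμ : μ ≠ 0) {d : ℝ → ℝ} {C : ℝ}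
    (hd : ∀ t ≥ 0, HasDerivWithinAt d (-(μ * d t)) (Ici 0) t) (hC : ∀ t ≥ 0, |d t| ≤ C)
    (h0 : 0 < μ → d 0 = 0) : ∀ t ≥ 0, d t = 0 := by
  have hconst : ∀ t ≥ 0, Real.exp (μ * t) * d t = d 0 := by
    intro t ht
    have hder : ∀ s ≥ 0, HasDerivWithinAt (fun s => Real.exp (μ * s) * d s) 0 (Ici 0) s := by
      intro s hs
      have h1 : HasDerivAt (fun t : ℝ => Real.exp (μ * t)) (Real.exp (μ * s) * μ) s := by
        simpa using ((hasDerivAt_id s).const_mul μ).exp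
      refine (h1.hasDerivWithinAt.mul (hd s hs)).congr_deriv ?_
      ring
    have := constant_of_has_deriv_right_zero (f := fun s => Real.exp (μ * s) * d s) (a := 0) (b := t)
      (fun s hs => ((hder s hs.1).continuousWithinAt.mono Icc_subset_Ici_self))
      (fun s hs => (hder s hs.1).mono (Ici_subset_Ici.2 hs.1)) t ⟨ht, le_rfl⟩
    simpa using this
  have hd0 : d 0 = 0 := by
    rcases lt_or_gt_of_ne hμ with hneg | hpos
    · have hlim : Tendsto (fun t : ℝ => Real.exp (μ * t) * C) atTop (𝓝 0) := by
        have : Tendsto (fun t : ℝ => Real.exp (μ * t)) atTop (𝓝 0) :=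
          Real.tendsto_exp_atBot.comp (tendsto_id.const_mul_atTop_of_neg hneg)
        simpa using this.mul_const C
      have : |d 0| ≤ 0 := by
        refine ge_of_tendsto hlim ?_
        filter_upwards [eventually_ge_atTop 0] with t ht
        rw [← hconst t ht, abs_mul, abs_of_pos (Real.exp_pos _)]
        exact mul_le_mul_of_nonneg_left (hC t ht) (Real.exp_pos _).le
      exact abs_nonpos_iff.1 this
    · exact h0 hpos
  intro t ht
  have := hconst t ht
  rw [hd0] at this
  exact (mul_eq_zero.1 this).resolve_left (Real.exp_pos _).ne'

/-- The solution operator of the diagonal system `wᵢ' = -μᵢ wᵢ + gᵢ`. -/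
def diagKern {n : ℕ} {μ : Fin n → ℝ} (hμ : ∀ i, μ i ≠ 0) : (ℝ≥0 →ᵇ Eu n) →L[ℝ] (ℝ≥0 →ᵇ Eu n) :=
  ∑ i, ((ContinuousLinearMap.toSpanSingleton ℝ
      (EuclideanSpace.single i (1 : ℝ))).compLeftContinuousBounded ℝ≥0).comp
    ((kern (hμ i)).comp ((EuclideanSpace.proj (𝕜 := ℝ) i).compLeftContinuousBounded ℝ≥0))

theorem diagKern_apply {n : ℕ} {μ : Fin n → ℝ} (hμ : ∀ i, μ i ≠ 0) (g : ℝ≥0 →ᵇ Eu n) (t : ℝ≥0)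
    (i : Fin n) : diagKern hμ g t i =
      kern (hμ i) ((EuclideanSpace.proj (𝕜 := ℝ) i).compLeftContinuousBounded ℝ≥0 g) t := by
  unfold diagKern
  rw [sum_apply]
  simp [BoundedContinuousFunction.coe_sum, Finset.sum_apply, Pi.single_apply]

theorem proj_bcf_apply {n : ℕ} (i : Fin n) (g : ℝ≥0 →ᵇ Eu n) (t : ℝ≥0) :
    (EuclideanSpace.proj (𝕜 := ℝ) i).compLeftContinuousBounded ℝ≥0 g t = g t i := rfl

theorem hasDerivWithinAt_eu {n : ℕ} {u : ℝ → Eu n} {u' : Eu n} {s : Set ℝ} {t : ℝ} :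
    HasDerivWithinAt u u' s t ↔ ∀ i, HasDerivWithinAt (fun r => u r i) (u' i) s t := by
  rw [hasDerivWithinAt_iff_hasFDerivWithinAt, hasFDerivWithinAt_euclidean]
  refine forall_congr' fun i => ?_
  rw [hasDerivWithinAt_iff_hasFDerivWithinAt]
  refine iff_of_eq (congrArg (fun L => HasFDerivWithinAt (fun r => u r i) L s t) ?_)
  ext
  simp

/-! ### The local stable manifold of a family of vector fields -/

/-- The shear `(x, y) ↦ (x - B y, y)`. -/
def shear {X Y : Type*} [NormedAddCommGroup X] [NormedSpace ℝ X] [NormedAddCommGroup Y]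
    [NormedSpace ℝ Y] (B : Y →L[ℝ] X) : (X × Y) ≃L[ℝ] (X × Y) :=
  ContinuousLinearEquiv.equivOfInverse
    ((ContinuousLinearMap.fst ℝ X Y - B.comp (ContinuousLinearMap.snd ℝ X Y)).prod
      (ContinuousLinearMap.snd ℝ X Y))
    ((ContinuousLinearMap.fst ℝ X Y + B.comp (ContinuousLinearMap.snd ℝ X Y)).prod
      (ContinuousLinearMap.snd ℝ X Y))
    (fun p => by simp) (fun p => by simp)

@[simp] theorem shear_apply {X Y : Type*} [NormedAddCommGroup X] [NormedSpace ℝ X]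
    [NormedAddCommGroup Y] [NormedSpace ℝ Y] (B : Y →L[ℝ] X) (p : X × Y) :
    shear B p = (p.1 - B p.2, p.2) := rfl

section Stable

variable {n k : ℕ} {P : Type*} [NormedAddCommGroup P] [NormedSpace ℝ P]

/-- The decaying solutions of the diagonal system with prescribed stable coordinates at `0`. -/
def stableExp {μ : Fin n → ℝ} (e : Fin k → Fin n) (he : ∀ j, 0 < μ (e j)) :
    Eu k →L[ℝ] (ℝ≥0 →ᵇ Eu n) :=
  ∑ j, (bcfMul (Eu n) (expWeight (he j).le)).comp ((bcfConst ℝ≥0 (Eu n)).comp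
    ((ContinuousLinearMap.toSpanSingleton ℝ (EuclideanSpace.single (e j) (1 : ℝ))).comp
      (EuclideanSpace.proj (𝕜 := ℝ) j)))

theorem stableExp_apply {μ : Fin n → ℝ} (e : Fin k → Fin n) (he : ∀ j, 0 < μ (e j)) (ξ : Eu k)
    (t : ℝ≥0) (i : Fin n) : stableExp e he ξ t i =
      ∑ j, Real.exp (-(μ i * t)) * (ξ j * (if i = e j then 1 else 0)) := by
  unfold stableExp
  rw [sum_apply]
  simp only [BoundedContinuousFunction.coe_sum, Finset.sum_apply, WithLp.ofLp_sum]
  refine Finset.sum_congr rfl fun j _ => ?_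
  by_cases h : i = e j <;> simp [h, mul_comm]

theorem stableExp_zero {μ : Fin n → ℝ} {e : Fin k → Fin n} (hinj : Function.Injective e)
    (he : ∀ j, 0 < μ (e j)) (ξ : Eu k) (j : Fin k) : stableExp e he ξ 0 (e j) = ξ j := by
  rw [stableExp_apply]
  simp [hinj.eq_iff]

theorem hasDerivAt_stableExp {μ : Fin n → ℝ} (e : Fin k → Fin n) (he : ∀ j, 0 < μ (e j)) (ξ : Eu k)
    {t : ℝ} (ht : 0 ≤ t) (i : Fin n) :
    HasDerivWithinAt (fun s : ℝ => stableExp e he ξ s.toNNReal i)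
      (-(μ i * stableExp e he ξ t.toNNReal i)) (Ici 0) t := by
  have h1 : HasDerivAt (fun s : ℝ => ∑ j, Real.exp (-(μ i * s)) * (ξ j * (if i = e j then 1 else 0)))
      (∑ j, Real.exp (-(μ i * t)) * -μ i * (ξ j * (if i = e j then 1 else 0))) t := by
    refine HasDerivAt.fun_sum fun j _ => HasDerivAt.mul_const ?_ _
    simpa using ((hasDerivAt_id t).const_mul (μ i)).neg.exp
  refine (h1.hasDerivWithinAt.congr (fun s hs => ?_) ?_).congr_deriv ?_
  · rw [stableExp_apply, Real.coe_toNNReal s hs]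
  · rw [stableExp_apply, Real.coe_toNNReal t ht]
  · rw [stableExp_apply, Real.coe_toNNReal t ht, Finset.mul_sum, ← Finset.sum_neg_distrib]
    exact Finset.sum_congr rfl fun j _ => by ring

/-- A family of vector fields with a common hyperbolic zero `0`: the solutions that stay in a small
ball for all positive times are parametrized smoothly by their stable coordinates and the
parameter, as elements of a space of exponentially decaying curves. -/
theorem exists_stable_family [CompleteSpace P] {μ : Fin n → ℝ} (hμ : ∀ i, μ i ≠ 0)
    {e : Fin k → Fin n} (hinj : Function.Injective e) (he : ∀ j, 0 < μ (e j))
    (hsurj : ∀ i, 0 < μ i → ∃ j, e j = i) {r : ℝ} (hr : 0 < r) {P' : Set P} (hP : IsOpen P') {h₀ : P}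
    (hh₀ : h₀ ∈ P') {Y : Eu n × P → Eu n} (hY : ContDiffOn ℝ ∞ Y (Metric.ball 0 r ×ˢ P'))
    (hY0 : ∀ h ∈ P', Y (0, h) = 0) (hYd : ∀ z i, fderiv ℝ Y (0, h₀) (z, 0) i = -(μ i * z i)) :
    ∃ η > 0, ∃ ρ > 0, ρ ≤ r ∧ ∃ O : Set (Eu k × P), IsOpen O ∧ (0, h₀) ∈ O ∧ (∀ q ∈ O, q.2 ∈ P') ∧
      ∃ w : Eu k × P → (ℝ≥0 →ᵇ Eu n), ContDiffOn ℝ ∞ w O ∧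
      (∀ q ∈ O, ‖w q‖ < ρ ∧ (∀ j, w q 0 (e j) = q.1 j) ∧
        ∀ t ≥ 0, HasDerivWithinAt (fun s : ℝ => Real.exp (-(η * s)) • w q s.toNNReal)
          (Y (Real.exp (-(η * t)) • w q t.toNNReal, q.2)) (Ici 0) t) ∧
      ∀ q ∈ O, ∀ u : ℝ → Eu n, (∀ t ≥ 0, ‖u t‖ < ρ) →
        (∀ t ≥ 0, HasDerivWithinAt u (Y (u t, q.2)) (Ici 0) t) → (∀ j, u 0 (e j) = q.1 j) →
        ∀ t ≥ 0, u t = Real.exp (-(η * t)) • w q t.toNNReal := by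
  -- the spectral gap
  obtain ⟨η, hη, hημ⟩ : ∃ η > 0, ∀ i, 0 < μ i → 0 < μ i - η := by
    obtain ⟨m, hm, hmm⟩ : ∃ m > 0, ∀ i, m ≤ |μ i| := by
      rcases isEmpty_or_nonempty (Fin n) with hn | hn
      · exact ⟨1, one_pos, fun i => (hn.false i).elim⟩
      · obtain ⟨i₀, hi₀⟩ := Finite.exists_min (fun i => |μ i|)
        exact ⟨|μ i₀|, abs_pos.2 (hμ i₀), hi₀⟩
    refine ⟨m / 2, by positivity, fun i hi => ?_⟩
    have := hmm i
    rw [abs_of_pos hi] at this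
    linarith
  -- Writing $u=e^{-\eta t}w$ replaces the rates $\mu_i$ by $\mu_i-\eta$. The choice of $\eta$ keeps
  -- every sign, hence the numbers of stable and unstable directions.
  have hνne : ∀ i, μ i - η ≠ 0 := fun i => by
    rcases lt_or_gt_of_ne (hμ i) with h | h
    · exact (by linarith : μ i - η < 0).ne
    · exact (hημ i h).ne'
  have heν : ∀ j, 0 < (fun i => μ i - η) (e j) := fun j => hημ _ (he j)
  -- the nonlinearity
  let Λ : Eu n →L[ℝ] Eu n :=
    ∑ i, (ContinuousLinearMap.toSpanSingleton ℝ (EuclideanSpace.single i (μ i))).comp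
      (EuclideanSpace.proj (𝕜 := ℝ) i)
  have hΛ : ∀ z i, Λ z i = μ i * z i := fun z i => by
    simp [Λ, sum_apply, WithLp.ofLp_sum, Finset.sum_apply, Pi.single_apply, mul_comm]
  -- The linear part is split off at $h_0$ only. For other $h$ the derivative of $N$ at $0$ need not
  -- vanish; near $h_0$ it is small, which suffices.
  let N : Eu n × P → Eu n := fun q => Y q + Λ q.1
  have hD : IsOpen (Metric.ball (0 : Eu n) r ×ˢ P') := Metric.isOpen_ball.prod hP
  have hN : ContDiffOn ℝ ∞ N (Metric.ball 0 r ×ˢ P') :=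
    hY.add (Λ.contDiff.comp contDiff_fst).contDiffOn
  have hN0 : ∀ h ∈ P', N (0, h) = 0 := fun h hh => by simp [N, hY0 h hh]
  have hmem0 : ((0 : Eu n), h₀) ∈ Metric.ball (0 : Eu n) r ×ˢ P' := ⟨by simpa using hr, hh₀⟩
  have hNd : (fderiv ℝ N (0, h₀)).comp (ContinuousLinearMap.inl ℝ (Eu n) P) = 0 := by
    have h1 : HasFDerivAt N (fderiv ℝ Y (0, h₀) + Λ.comp (ContinuousLinearMap.fst ℝ (Eu n) P))
        (0, h₀) :=
      ((hY.contDiffAt (hD.mem_nhds hmem0)).differentiableAt (by simp)).hasFDerivAt.add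
        (Λ.hasFDerivAt.comp (0, h₀) hasFDerivAt_fst)
    rw [h1.fderiv]
    ext z i
    simp [hYd, hΛ]
  obtain ⟨W, hW, hWN, hWd⟩ := exists_weighted_nem hη.le hP hN hN0
  have hWd0 := hWd h₀ hh₀ hr hNd
  -- the Lyapunov–Perron equation
  let S := stableExp (n := n) (μ := fun i => μ i - η) e heν
  let K := diagKern hνne
  -- The first component vanishes exactly on the solutions of $w=S\xi+K\,W(w,h)$. Carrying $(\xi,h)$
  -- along lets the inverse function theorem act as the implicit function theorem.
  let Φ : (ℝ≥0 →ᵇ Eu n) × (Eu k × P) → (ℝ≥0 →ᵇ Eu n) × (Eu k × P) :=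
    fun p => (p.1 - S p.2.1 - K (W (p.1, p.2.2)), p.2)
  let D : Set ((ℝ≥0 →ᵇ Eu n) × (Eu k × P)) := {p | p.1 ∈ Metric.ball 0 r ∧ p.2.2 ∈ P'}
  have hDo : IsOpen D := (Metric.isOpen_ball.preimage continuous_fst).inter
    (hP.preimage (continuous_snd.comp continuous_snd))
  have hres : ContDiff ℝ ∞ (fun p : (ℝ≥0 →ᵇ Eu n) × (Eu k × P) => (p.1, p.2.2)) := by fun_prop
  have hΦ : ContDiffOn ℝ ∞ Φ D := by
    refine ContDiffOn.prodMk ((contDiff_fst.contDiffOn.sub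
      (S.contDiff.comp (contDiff_fst.comp contDiff_snd)).contDiffOn).sub
      (K.contDiff.comp_contDiffOn (hW.comp hres.contDiffOn fun p hp => ⟨hp.1, hp.2⟩)))
      contDiff_snd.contDiffOn
  -- Since $W$ has zero derivative at $(0,h_0)$, the derivative of $\Phi$ there is a shear, hence
  -- invertible.
  let A : ((ℝ≥0 →ᵇ Eu n) × (Eu k × P)) ≃L[ℝ] ((ℝ≥0 →ᵇ Eu n) × (Eu k × P)) :=
    shear (S.comp (ContinuousLinearMap.fst ℝ (Eu k) P))
  have hA : HasFDerivAt Φ (A : _ →L[ℝ] (ℝ≥0 →ᵇ Eu n) × (Eu k × P)) (0, (0, h₀)) := by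
    have h1 : HasFDerivAt (fun p : (ℝ≥0 →ᵇ Eu n) × (Eu k × P) => W (p.1, p.2.2)) _ (0, (0, h₀)) :=
      HasFDerivAt.comp (g := W) ((0 : ℝ≥0 →ᵇ Eu n), ((0 : Eu k), h₀)) hWd0
        (hasFDerivAt_fst.prodMk (hasFDerivAt_snd.comp _ hasFDerivAt_snd))
    have h2 := ((hasFDerivAt_fst (𝕜 := ℝ) (p := ((0 : ℝ≥0 →ᵇ Eu n), ((0 : Eu k), h₀)))).sub
      (S.hasFDerivAt.comp ((0 : ℝ≥0 →ᵇ Eu n), ((0 : Eu k), h₀))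
        (hasFDerivAt_fst.comp _ hasFDerivAt_snd))).sub
      (K.hasFDerivAt.comp ((0 : ℝ≥0 →ᵇ Eu n), ((0 : Eu k), h₀)) h1)
    refine (h2.prodMk hasFDerivAt_snd).congr_fderiv ?_
    refine ContinuousLinearMap.ext fun p => ?_
    simp [A]
  obtain ⟨Ψ, hΨ, hΨa, hΨD, hΨs⟩ := exists_smooth_inverse hDo hΦ
    (a := (0, (0, h₀))) ⟨by simpa using hr, hh₀⟩ hA
  have hΦ0 : Φ (0, (0, h₀)) = (0, (0, h₀)) := by
    have : W (0, h₀) = 0 := by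
      ext t : 1
      have h1 := hWN (0, h₀) ⟨by simpa using hr, hh₀⟩ t
      simp only [BoundedContinuousFunction.coe_zero, Pi.zero_apply, smul_zero] at h1 ⊢
      rw [hN0 h₀ hh₀] at h1
      exact (smul_eq_zero.1 h1).resolve_left (Real.exp_pos _).ne'
    simp [Φ, this]
  -- the size of the neighbourhoods
  let K₀ := diagKern hμ
  -- The Lipschitz constant of $N$ is made small against the unweighted operator `K₀`: a competing
  -- solution in the uniqueness statement is only known to be bounded, without decay, so the
  -- weighted operator cannot be applied to it.
  obtain ⟨ρ, P'', hρ, hρr, hP'', hh₀'', hP''P, hlip⟩ : ∃ ρ : ℝ, ∃ P'' : Set P, 0 < ρ ∧ ρ ≤ r ∧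
      IsOpen P'' ∧ h₀ ∈ P'' ∧ P'' ⊆ P' ∧ ∀ h ∈ P'', ∀ y ∈ Metric.ball (0 : Eu n) ρ,
        ∀ z ∈ Metric.ball (0 : Eu n) ρ,
        ‖N (y, h) - N (z, h)‖ ≤ (2 * (‖K₀‖ + 1))⁻¹ * ‖y - z‖ := by
    let B : Eu n × P → Eu n →L[ℝ] Eu n :=
      fun q => (fderiv ℝ N q).comp (ContinuousLinearMap.inl ℝ (Eu n) P)
    have hB : ContinuousOn B (Metric.ball 0 r ×ˢ P') :=
      (hN.continuousOn_fderiv_of_isOpen hD (by simp)).clm_comp continuousOn_const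
    have hBat := hB.continuousAt (hD.mem_nhds hmem0)
    have hB0 : B (0, h₀) = 0 := hNd
    have hpos : 0 < (2 * (‖K₀‖ + 1))⁻¹ := by positivity
    obtain ⟨δ, hδ, hball⟩ := Metric.mem_nhds_iff.1
      (inter_mem (hBat (Metric.ball_mem_nhds _ hpos)) (hD.mem_nhds hmem0))
    refine ⟨min δ r, Metric.ball h₀ δ ∩ P', lt_min hδ hr, min_le_right _ _,
      Metric.isOpen_ball.inter hP, ⟨Metric.mem_ball_self hδ, hh₀⟩, inter_subset_right, ?_⟩
    intro h hh y hy z hz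
    have hin : ∀ x ∈ Metric.ball (0 : Eu n) (min δ r), (x, h) ∈ Metric.ball ((0 : Eu n), h₀) δ := by
      intro x hx
      rw [Metric.mem_ball, Prod.dist_eq]
      exact max_lt ((Metric.mem_ball.1 hx).trans_le (min_le_left _ _)) hh.1
    have := Convex.norm_image_sub_le_of_norm_hasFDerivWithin_le (𝕜 := ℝ) (f := fun x => N (x, h))
      (f' := fun x => B (x, h)) (C := (2 * (‖K₀‖ + 1))⁻¹) (s := Metric.ball (0 : Eu n) (min δ r))
      (x := z) (y := y) (fun x hx => ?_) (fun x hx => ?_) (convex_ball _ _) hz hy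
    · exact this
    · have hxD : (x, h) ∈ Metric.ball (0 : Eu n) r ×ˢ P' := (hball (hin x hx)).2
      exact (HasFDerivAt.comp (g := N) x
        ((hN.contDiffAt (hD.mem_nhds hxD)).differentiableAt (by simp)).hasFDerivAt
        (hasFDerivAt_prodMk_left x h)).hasFDerivWithinAt
    · have h3 := (hball (hin x hx)).1
      rw [mem_preimage, hB0, mem_ball_zero_iff] at h3
      exact h3.le
  let j : Eu k × P → (ℝ≥0 →ᵇ Eu n) × (Eu k × P) := fun q => (0, q)
  have hj : ContDiff ℝ ∞ j := contDiff_const.prodMk contDiff_id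
  let w : Eu k × P → (ℝ≥0 →ᵇ Eu n) := fun q => (Ψ.symm (j q)).1
  have hO1 : IsOpen (j ⁻¹' Ψ.target) := Ψ.open_target.preimage hj.continuous
  have hw1 : ContDiffOn ℝ ∞ w (j ⁻¹' Ψ.target) :=
    contDiff_fst.comp_contDiffOn (hΨs.comp hj.contDiffOn fun q hq => hq)
  have ht0 : j (0, h₀) ∈ Ψ.target := by
    have := Ψ.map_source hΨa
    rwa [hΨ, hΦ0] at this
  have hw0 : w (0, h₀) = 0 := by
    have h1 := Ψ.left_inv hΨa
    rw [hΨ, hΦ0] at h1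
    exact congrArg Prod.fst h1
  let O : Set (Eu k × P) := (j ⁻¹' Ψ.target ∩ w ⁻¹' Metric.ball 0 ρ) ∩ Prod.snd ⁻¹' P''
  have hO : IsOpen O := (hw1.continuousOn.isOpen_inter_preimage hO1 Metric.isOpen_ball).inter
    (hP''.preimage continuous_snd)
  have hOw : ∀ q ∈ O, w q = S q.1 + K (W (w q, q.2)) := by
    intro q hq
    have h1 := Ψ.right_inv hq.1.1
    rw [hΨ] at h1
    have h2 : (Ψ.symm (j q)).2 = q := congrArg Prod.snd h1
    have h3 : (Φ (Ψ.symm (j q))).1 = 0 := congrArg Prod.fst h1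
    simp only [Φ, h2] at h3
    rw [sub_sub, sub_eq_zero] at h3
    exact h3
  have hOρ : ∀ q ∈ O, ‖w q‖ < ρ := fun q hq => by simpa using hq.1.2
  have hsol : ∀ q ∈ O, ∀ t ≥ 0, HasDerivWithinAt (fun s : ℝ => Real.exp (-(η * s)) • w q s.toNNReal)
      (Y (Real.exp (-(η * t)) • w q t.toNNReal, q.2)) (Ici 0) t := by
    intro q hq t ht
    have hqW := hWN (w q, q.2) ⟨by simpa using (hOρ q hq).trans_le hρr, hP''P hq.2⟩ t.toNNReal
    rw [Real.coe_toNNReal t ht] at hqW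
    rw [hasDerivWithinAt_eu]
    intro i
    have hwi : ∀ s : ℝ, w q s.toNNReal i = S q.1 s.toNNReal i +
        kern (hνne i) ((EuclideanSpace.proj (𝕜 := ℝ) i).compLeftContinuousBounded ℝ≥0
          (W (w q, q.2))) s.toNNReal := by
      intro s
      rw [← diagKern_apply]
      conv_lhs => rw [hOw q hq]
      simp [K]
    have h1 := (hasDerivAt_stableExp (μ := fun i => μ i - η) e heν q.1 ht i).add (hasDerivWithinAt_kern (hνne i)
      ((EuclideanSpace.proj (𝕜 := ℝ) i).compLeftContinuousBounded ℝ≥0 (W (w q, q.2))) ht)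
    have h2 : HasDerivWithinAt (fun s : ℝ => Real.exp (-(η * s))) (Real.exp (-(η * t)) * -η)
        (Ici 0) t := by
      have := ((hasDerivAt_id t).const_mul η).neg.exp
      simpa using this.hasDerivWithinAt
    have h3 := h2.mul h1
    refine (h3.congr (fun s _ => ?_) ?_).congr_deriv ?_
    · simp [hwi s, S]
    · simp [hwi t, S]
    · have h4 : Y (Real.exp (-(η * t)) • w q t.toNNReal, q.2) i =
          Real.exp (-(η * t)) * W (w q, q.2) t.toNNReal i -
            μ i * (Real.exp (-(η * t)) * w q t.toNNReal i) := by
        have := congrArg (fun z : Eu n => z i) hqW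
        simp only [N, PiLp.smul_apply, PiLp.add_apply, smul_eq_mul, hΛ] at this
        linarith
      have h5 := hwi t
      rw [h4]
      simp only [Pi.add_apply, proj_bcf_apply] at h5 ⊢
      rw [h5]
      simp only [S]
      ring
  have hinit : ∀ q ∈ O, ∀ j, w q 0 (e j) = q.1 j := by
    intro q hq j
    rw [hOw q hq]
    have h1 : K (W (w q, q.2)) 0 (e j) = 0 := by
      rw [diagKern_apply]
      exact kern_zero (heν j) _
    have h2 := stableExp_zero (μ := fun i => μ i - η) hinj heν q.1 j
    simp [h1, S, h2]
  refine ⟨η, hη, ρ, hρ, hρr, O, hO, ⟨⟨ht0, ?_⟩, hh₀''⟩, fun q hq => hP''P hq.2, w,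
    hw1.mono fun q hq => hq.1.1, fun q hq => ⟨hOρ q hq, hinit q hq, hsol q hq⟩, ?_⟩
  · rw [mem_preimage, hw0]; exact Metric.mem_ball_self hρ
  · intro q hq u hu hud hu0
    let v : ℝ → Eu n := fun s => Real.exp (-(η * s)) • w q s.toNNReal
    have hv : ∀ t ≥ 0, ‖v t‖ < ρ := by
      intro t ht
      have h1 := norm_expWeight_smul_le hη.le (w q t.toNNReal) t.toNNReal
      rw [Real.coe_toNNReal t ht] at h1
      exact (h1.trans ((w q).norm_coe_le_norm _)).trans_lt (hOρ q hq)
    have hvd := hsol q hq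
    have hcu : ContinuousOn u (Ici 0) := fun t ht => (hud t ht).continuousWithinAt
    have hcv : ContinuousOn v (Ici 0) := fun t ht => (hvd t ht).continuousWithinAt
    have hcd : Continuous fun t : ℝ≥0 => u t - v t :=
      (hcu.comp_continuous NNReal.continuous_coe fun t => t.2).sub
        (hcv.comp_continuous NNReal.continuous_coe fun t => t.2)
    let d : ℝ≥0 →ᵇ Eu n := BoundedContinuousFunction.ofNormedAddCommGroup
      (fun t : ℝ≥0 => u t - v t) hcd (ρ + ρ) fun t =>
        (norm_sub_le _ _).trans (add_le_add (hu t t.2).le (hv t t.2).le)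
    have hmemD : ∀ y : Eu n, ‖y‖ < ρ → (y, q.2) ∈ Metric.ball (0 : Eu n) r ×ˢ P' := fun y hy =>
      ⟨by simpa using hy.trans_le hρr, hP''P hq.2⟩
    have hcg : Continuous fun t : ℝ≥0 => N (u t, q.2) - N (v t, q.2) :=
      (hN.continuousOn.comp_continuous ((hcu.comp_continuous NNReal.continuous_coe
        fun t => t.2).prodMk continuous_const) fun t => hmemD _ (hu t t.2)).sub
      (hN.continuousOn.comp_continuous ((hcv.comp_continuous NNReal.continuous_coe
        fun t => t.2).prodMk continuous_const) fun t => hmemD _ (hv t t.2))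
    have hgd : ∀ t : ℝ≥0, ‖N (u t, q.2) - N (v t, q.2)‖ ≤ (2 * (‖K₀‖ + 1))⁻¹ * ‖d‖ := fun t =>
      (hlip q.2 hq.2 _ (by simpa using hu t t.2) _ (by simpa using hv t t.2)).trans
        (mul_le_mul_of_nonneg_left (d.norm_coe_le_norm t) (by positivity))
    let g : ℝ≥0 →ᵇ Eu n := BoundedContinuousFunction.ofNormedAddCommGroup
      (fun t : ℝ≥0 => N (u t, q.2) - N (v t, q.2)) hcg _ hgd
    -- Both curves solve the same equation, so $d=u-v$ satisfies $d_i'=-\mu_id_i+g_i$ with $g$ the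
    -- difference of the nonlinear terms. It is bounded and has no stable component at $0$, which
    -- forces $d=K_0g$.
    have hdK : ∀ i, ∀ t ≥ 0, u t i - v t i - kern (hμ i)
        ((EuclideanSpace.proj (𝕜 := ℝ) i).compLeftContinuousBounded ℝ≥0 g) t.toNNReal = 0 := by
      intro i
      refine eq_zero_of_bounded_solution (hμ i) (C := ρ + ρ + ‖kern (hμ i)
        ((EuclideanSpace.proj (𝕜 := ℝ) i).compLeftContinuousBounded ℝ≥0 g)‖)
        (fun t ht => ?_) (fun t ht => ?_) fun hi => ?_
      · refine (((hasDerivWithinAt_eu.1 (hud t ht) i).sub (hasDerivWithinAt_eu.1 (hvd t ht) i)).sub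
          (hasDerivWithinAt_kern (hμ i)
          ((EuclideanSpace.proj (𝕜 := ℝ) i).compLeftContinuousBounded ℝ≥0 g) ht)).congr_deriv ?_
        have h1 : g t.toNNReal i = (Y (u t, q.2) i + μ i * u t i) - (Y (v t, q.2) i + μ i * v t i) := by
          change (N (u (t.toNNReal : ℝ), q.2) - N (v (t.toNNReal : ℝ), q.2)) i = _
          rw [Real.coe_toNNReal t ht]
          simp [N, hΛ]
        simp only [proj_bcf_apply, h1]
        change Y (u t, q.2) i - Y (v t, q.2) i - _ = _
        ring
      · refine (abs_sub _ _).trans (add_le_add ((abs_sub _ _).trans (add_le_add ?_ ?_)) ?_)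
        · exact (PiLp.norm_apply_le (u t) i).trans (hu t ht).le
        · exact (PiLp.norm_apply_le (v t) i).trans (hv t ht).le
        · exact BoundedContinuousFunction.norm_coe_le_norm (kern (hμ i) ((EuclideanSpace.proj (𝕜 := ℝ) i).compLeftContinuousBounded ℝ≥0 g)) t.toNNReal
      · obtain ⟨j, rfl⟩ := hsurj i hi
        have h1 : v 0 (e j) = q.1 j := by simpa [v] using hinit q hq j
        rw [hu0 j, h1, Real.toNNReal_zero, kern_zero hi]
        simp
    have hdg : d = K₀ g := by
      ext t i
      have h1 := hdK i t t.2
      rw [Real.toNNReal_coe] at h1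
      rw [diagKern_apply]
      change u t i - v t i = _
      linarith
    -- Now $\|d\|\le\|K_0\|\,\|g\|\le\frac12\|d\|$.
    have hd0 : ‖d‖ = 0 := by
      have h1 : ‖g‖ ≤ (2 * (‖K₀‖ + 1))⁻¹ * ‖d‖ :=
        (BoundedContinuousFunction.norm_le (by positivity)).2 hgd
      have h2 : ‖d‖ ≤ ‖K₀‖ * ((2 * (‖K₀‖ + 1))⁻¹ * ‖d‖) := by
        conv_lhs => rw [hdg]
        exact (K₀.le_opNorm g).trans (mul_le_mul_of_nonneg_left h1 (norm_nonneg _))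
      have h3 : ‖K₀‖ * (2 * (‖K₀‖ + 1))⁻¹ ≤ 1 / 2 := by
        rw [mul_inv_le_iff₀ (by positivity)]
        linarith
      have h4 := norm_nonneg d
      nlinarith
    intro t ht
    have h1 : d t.toNNReal = 0 := by rw [norm_eq_zero.1 hd0]; rfl
    have h2 : u (t.toNNReal : ℝ) - v (t.toNNReal : ℝ) = 0 := h1
    rw [Real.coe_toNNReal t ht] at h2
    exact sub_eq_zero.1 h2

end Stable

/-! ### Flow boxes -/

/-- The local flow of a smooth family of vector fields, as a smooth map into a space of curves. -/
theorem exists_flow_box {E : Type} {P : Type*} [NormedAddCommGroup E] [NormedSpace ℝ E]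
    [ProperSpace E] [NormedAddCommGroup P] [NormedSpace ℝ P] [CompleteSpace P]
    {D : Set (E × P)} (hD : IsOpen D) {X : E × P → E} (hX : ContDiffOn ℝ ∞ X D) {q₀ : E × P}
    (hq₀ : q₀ ∈ D) :
    ∃ δ > 0, ∃ O : Set (E × P), IsOpen O ∧ q₀ ∈ O ∧ ∃ u : E × P → (ℝ →ᵇ E), ContDiffOn ℝ ∞ u O ∧
      ∀ q ∈ O, u q 0 = q.1 ∧ (u q, q.2) ∈ nemDom ℝ D ∧ ∀ t ∈ Icc (-δ) δ,
        HasDerivWithinAt (u q) (X (u q t, q.2)) (Icc (-δ) δ) t := by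
  let G : (ℝ →ᵇ E) × P → (ℝ →ᵇ E) := fun p => bcfPrim E (nem ℝ X p)
  have hG : ContDiffOn ℝ ∞ G (nemDom ℝ D) :=
    (bcfPrim E).contDiff.comp_contDiffOn (nem_contDiffOn hD hX)
  let res : (ℝ →ᵇ E) × (ℝ × E × P) →L[ℝ] (ℝ →ᵇ E) × P :=
    (ContinuousLinearMap.id ℝ _).prodMap ((ContinuousLinearMap.snd ℝ E P).comp
      (ContinuousLinearMap.snd ℝ ℝ (E × P)))
  let dl : (ℝ →ᵇ E) × (ℝ × E × P) →L[ℝ] ℝ :=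
    (ContinuousLinearMap.fst ℝ ℝ (E × P)).comp (ContinuousLinearMap.snd ℝ _ _)
  let cn : (ℝ →ᵇ E) × (ℝ × E × P) →L[ℝ] (ℝ →ᵇ E) := (bcfConst ℝ E).comp
    ((ContinuousLinearMap.fst ℝ E P).comp ((ContinuousLinearMap.snd ℝ ℝ (E × P)).comp
      (ContinuousLinearMap.snd ℝ _ _)))
  -- Time is rescaled: $v(s)=u(\delta s)$ solves $v=y+\delta\int_0^sX(v,h)$ on $[-1,1]$. With
  -- $\delta$ as a further variable, the constant curve solves the equation at $\delta=0$, and the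
  -- inverse function theorem supplies a positive $\delta$.
  let Φ : (ℝ →ᵇ E) × (ℝ × E × P) → (ℝ →ᵇ E) × (ℝ × E × P) :=
    fun p => (p.1 - cn p - dl p • G (res p), p.2)
  have hDo : IsOpen (res ⁻¹' nemDom ℝ D) := (isOpen_nemDom hD).preimage res.continuous
  have hGr : ContDiffOn ℝ ∞ (fun p => G (res p)) (res ⁻¹' nemDom ℝ D) :=
    hG.comp res.contDiff.contDiffOn fun p hp => hp
  have hΦ : ContDiffOn ℝ ∞ Φ (res ⁻¹' nemDom ℝ D) :=
    ((contDiff_fst.contDiffOn.sub cn.contDiff.contDiffOn).sub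
      (dl.contDiff.contDiffOn.smul hGr)).prodMk contDiff_snd.contDiffOn
  let p₀ : (ℝ →ᵇ E) × (ℝ × E × P) := (bcfConst ℝ E q₀.1, (0, q₀))
  have hp₀ : p₀ ∈ res ⁻¹' nemDom ℝ D :=
    ⟨{q₀.1}, isCompact_singleton, fun t => rfl, fun c hc => by
      rw [mem_singleton_iff.1 hc]; exact hq₀⟩
  let B : (ℝ × E × P) →L[ℝ] (ℝ →ᵇ E) := (bcfConst ℝ E).comp
    ((ContinuousLinearMap.fst ℝ E P).comp (ContinuousLinearMap.snd ℝ ℝ (E × P))) +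
    (ContinuousLinearMap.toSpanSingleton ℝ (G (res p₀))).comp (ContinuousLinearMap.fst ℝ ℝ (E × P))
  -- At $\delta=0$ the derivative of the integral term in $v$ is multiplied by $\delta$ and
  -- disappears; a shear remains.
  let A : ((ℝ →ᵇ E) × (ℝ × E × P)) ≃L[ℝ] ((ℝ →ᵇ E) × (ℝ × E × P)) :=
    shear B
  have hA : HasFDerivAt Φ (A : _ →L[ℝ] (ℝ →ᵇ E) × (ℝ × E × P)) p₀ := by
    have h1 : HasFDerivAt (fun p => G (res p)) _ p₀ :=
      ((hGr.contDiffAt (hDo.mem_nhds hp₀)).differentiableAt (by simp)).hasFDerivAt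
    have h2 := (((hasFDerivAt_fst (𝕜 := ℝ) (p := p₀)).sub cn.hasFDerivAt).sub
      (dl.hasFDerivAt.smul h1)).prodMk (hasFDerivAt_snd (𝕜 := ℝ) (p := p₀))
    refine h2.congr_fderiv ?_
    have h3 : dl p₀ = 0 := rfl
    refine ContinuousLinearMap.ext fun p => ?_
    simp [A, B, h3, cn, dl, sub_sub]
  obtain ⟨Ψ, hΨ, hΨa, hΨD, hΨs⟩ := exists_smooth_inverse hDo hΦ hp₀ hA
  have hΦ0 : Φ p₀ = (0, (0, q₀)) := by
    simp [Φ, p₀, cn, dl]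
  have ht0 : ((0 : ℝ →ᵇ E), ((0 : ℝ), q₀)) ∈ Ψ.target := by
    have := Ψ.map_source hΨa
    rwa [hΨ, hΦ0] at this
  obtain ⟨δ, hδ, hδt⟩ : ∃ δ > 0, ((0 : ℝ →ᵇ E), ((δ : ℝ), q₀)) ∈ Ψ.target := by
    have hc : ContinuousAt (fun δ : ℝ => ((0 : ℝ →ᵇ E), (δ, q₀))) 0 := by fun_prop
    obtain ⟨δ, hδ, hb⟩ := Metric.mem_nhds_iff.1 (hc (Ψ.open_target.mem_nhds ht0))
    exact ⟨δ / 2, by positivity, hb (by simp [abs_of_pos hδ]; linarith)⟩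
  let j : E × P → (ℝ →ᵇ E) × (ℝ × E × P) := fun q => (0, (δ, q))
  have hj : ContDiff ℝ ∞ j := contDiff_const.prodMk (contDiff_const.prodMk contDiff_id)
  let v : E × P → (ℝ →ᵇ E) := fun q => (Ψ.symm (j q)).1
  have hv : ContDiffOn ℝ ∞ v (j ⁻¹' Ψ.target) :=
    contDiff_fst.comp_contDiffOn (hΨs.comp hj.contDiffOn fun q hq => hq)
  let sc : C(ℝ, ℝ) := ⟨fun t => δ⁻¹ * t, by fun_prop⟩
  refine ⟨δ, hδ, j ⁻¹' Ψ.target, Ψ.open_target.preimage hj.continuous, hδt,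
    fun q => BoundedContinuousFunction.compContinuousCLM E ℝ sc (v q),
    (BoundedContinuousFunction.compContinuousCLM E ℝ sc).contDiff.comp_contDiffOn hv, ?_⟩
  intro q hq
  have h1 := Ψ.right_inv hq
  rw [hΨ] at h1
  have h2 : (Ψ.symm (j q)).2 = (δ, q) := congrArg Prod.snd h1
  have h3 : (Φ (Ψ.symm (j q))).1 = 0 := congrArg Prod.fst h1
  have h5 : res (Ψ.symm (j q)) = (v q, q.2) := by
    simp [res, v, Prod.ext_iff, h2]
  have hdom : (v q, q.2) ∈ nemDom ℝ D := by
    have h4 : res (Ψ.symm (j q)) ∈ nemDom ℝ D := hΨD (Ψ.map_target hq)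
    rwa [h5] at h4
  have hveq : v q = bcfConst ℝ E q.1 + δ • G (v q, q.2) := by
    simp only [Φ] at h3
    rw [h5, sub_sub, sub_eq_zero] at h3
    refine h3.trans ?_
    simp [h2, cn, dl]
  have hvt : ∀ t, v q t = q.1 + δ • ∫ s in (0 : ℝ)..clip t, X (v q s, q.2) := by
    intro t
    conv_lhs => rw [hveq]
    simp only [BoundedContinuousFunction.coe_add, Pi.add_apply, bcfConst_apply,
      BoundedContinuousFunction.coe_smul, G, bcfPrim_apply]
    simp only [nem_apply hX.continuousOn hdom]
  refine ⟨?_, ?_, ?_⟩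
  · change v q (δ⁻¹ * 0) = q.1
    rw [mul_zero, hvt, clip_of_mem (by simp)]
    simp
  · obtain ⟨C, hC, h4, h5⟩ := hdom
    exact ⟨C, hC, fun t => h4 _, h5⟩
  · intro t ht
    have hcX : Continuous fun s => X (v q s, q.2) := by
      have : (fun s => X (v q s, q.2)) = nem ℝ X (v q, q.2) := by
        funext s; rw [nem_apply hX.continuousOn hdom]
      rw [this]; exact BoundedContinuousFunction.continuous _
    have h4 : HasDerivAt (fun t : ℝ => ∫ s in (0 : ℝ)..t, X (v q s, q.2)) (X (v q (δ⁻¹ * t), q.2))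
        (δ⁻¹ * t) :=
      intervalIntegral.integral_hasDerivAt_right (hcX.intervalIntegrable _ _)
        (hcX.stronglyMeasurableAtFilter _ _) hcX.continuousAt
    have h5 : HasDerivAt (fun t : ℝ => δ⁻¹ * t) δ⁻¹ t := by
      simpa using (hasDerivAt_id t).const_mul δ⁻¹
    have h6 := ((h4.scomp t h5).const_smul δ).const_add q.1
    have hmem : ∀ s ∈ Icc (-δ) δ, clip (δ⁻¹ * s) = δ⁻¹ * s := fun s hs => by
      refine clip_of_mem ⟨?_, ?_⟩
      · rw [← div_eq_inv_mul, le_div_iff₀ hδ]; linarith [hs.1]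
      · rw [← div_eq_inv_mul, div_le_iff₀ hδ]; linarith [hs.2]
    refine (h6.hasDerivWithinAt.congr (fun s hs => ?_) ?_).congr_deriv ?_
    · change v q (δ⁻¹ * s) = _
      rw [hvt, hmem s hs]; rfl
    · change v q (δ⁻¹ * t) = _
      rw [hvt, hmem t ht]; rfl
    · change δ • δ⁻¹ • X (v q (δ⁻¹ * t), q.2) = _
      rw [smul_inv_smul₀ hδ.ne']
      rfl

/-! ### The Sobolev space on the half line -/

open scoped BoundedContinuousFunction

section Sobolev

theorem ae_halfLine_nonneg : ∀ᵐ t ∂halfLine, 0 ≤ t := ae_restrict_mem measurableSet_Ici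

/-- The primitive of the difference of the weak derivatives is constant almost everywhere, hence
everywhere on $[0,\infty)$ by continuity, and Lebesgue differentiation gives $0$. This is what makes
the chosen element `H12.pull` depend only on the curve. -/
theorem H1.fst_injective {U V : H1} (h : U.1.fst =ᵐ[halfLine] V.1.fst) : U = V := by
  have h1 : U.1.fst - V.1.fst = 0 := by
    rw [sub_eq_zero]; exact Lp.ext h
  obtain ⟨c, hc⟩ := (U - V).2
  have hfst : (U - V).1.fst = 0 := h1
  set w : Lp ℝ 2 halfLine := (U - V).1.snd with hw
  have hF0 : ∀ᵐ t ∂halfLine, ∫ s in (0 : ℝ)..t, w s = -c := by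
    filter_upwards [hc, Lp.coeFn_zero ℝ 2 halfLine] with t h2 h3
    rw [hfst, h3] at h2
    simp only [Pi.zero_apply] at h2
    linarith
  let w' : ℝ → ℝ := (Ici 0).indicator w
  have hmem : MemLp w' 2 volume := (memLp_indicator_iff_restrict measurableSet_Ici).2 (Lp.memLp w)
  have hloc : LocallyIntegrable w' volume := hmem.locallyIntegrable (by norm_num)
  have hint : ∀ t, 0 ≤ t → ∫ s in (0 : ℝ)..t, w' s = ∫ s in (0 : ℝ)..t, w s := fun t ht =>
    intervalIntegral.integral_congr fun s hs => by
      rw [uIcc_of_le ht] at hs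
      exact indicator_of_mem hs.1 _
  have hcont : Continuous fun t => ∫ s in (0 : ℝ)..t, w' s :=
    intervalIntegral.continuous_primitive (fun a b => intervalIntegrable_iff.2
      ((hloc.integrableOn_isCompact isCompact_uIcc).mono_set uIoc_subset_uIcc)) 0
  have hF1 : (fun t => ∫ s in (0 : ℝ)..t, w' s) =ᵐ[volume.restrict (Ici 0)] fun _ => -c := by
    filter_upwards [hF0, ae_halfLine_nonneg] with t h2 h3
    rw [hint t h3, h2]
  have hF2 : EqOn (fun t => ∫ s in (0 : ℝ)..t, w' s) (fun _ => -c) (Ici 0) :=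
    Measure.eqOn_of_ae_eq hF1 hcont.continuousOn continuousOn_const (by simp)
  have hsnd : w = 0 := by
    refine Lp.ext ?_
    have h2 := ae_restrict_of_ae (s := Ici (0 : ℝ)) (_root_.LocallyIntegrable.ae_hasDerivAt_integral hloc)
    have h3 : ∀ᵐ t ∂halfLine, t ≠ 0 := ae_restrict_of_ae (Measure.ae_ne volume 0)
    filter_upwards [h2, h3, ae_halfLine_nonneg, Lp.coeFn_zero ℝ 2 halfLine] with t h4 h5 h6 h7
    have hpos : 0 < t := lt_of_le_of_ne h6 (Ne.symm h5)
    have h8 : HasDerivAt (fun t => ∫ s in (0 : ℝ)..t, w' s) 0 t := by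
      refine (hasDerivAt_const t (-c)).congr_of_eventuallyEq ?_
      filter_upwards [Ioi_mem_nhds hpos] with s hs using hF2 (mem_Ici.2 (le_of_lt (mem_Ioi.1 hs)))
    have h9 := (h4 0).unique h8
    rw [h7]
    simpa [w', h6] using h9
  have hUV : U - V = 0 := by
    apply Subtype.ext
    apply (WithLp.equiv 2 _).injective
    exact Prod.ext hfst hsnd
  exact sub_eq_zero.1 hUV

theorem memLp_expWeight {η : ℝ} (hη : 0 < η) (v : ℝ≥0 →ᵇ ℝ) :
    MemLp (fun t : ℝ => Real.exp (-(η * t)) * v t.toNNReal) 2 halfLine := by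
  have hmeas : AEStronglyMeasurable (fun t : ℝ => Real.exp (-(η * t)) * v t.toNNReal) halfLine :=
    ((by fun_prop : Continuous fun t : ℝ => Real.exp (-(η * t))).mul
      (continuous_comp_toNNReal v)).aestronglyMeasurable
  rw [memLp_two_iff_integrable_sq hmeas]
  have h1 : IntegrableOn (fun t : ℝ => Real.exp (-(2 * η) * t)) (Ici 0) := by
    rw [integrableOn_Ici_iff_integrableOn_Ioi]
    exact integrableOn_exp_mul_Ioi (by linarith) 0
  refine Integrable.mono' (h1.mul_const (‖v‖ ^ 2)) (hmeas.pow 2) (ae_of_all _ fun t => ?_)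
  rw [mul_pow, norm_mul, norm_pow, norm_pow, Real.norm_of_nonneg (Real.exp_pos _).le, ← Real.exp_nat_mul]
  refine mul_le_mul (le_of_eq ?_) (pow_le_pow_left₀ (norm_nonneg _) (v.norm_coe_le_norm _) 2)
    (by positivity) (Real.exp_pos _).le
  push_cast
  ring_nf

/-- Multiplication by the weight `exp(-ηt)`, as an operator into `L²([0, ∞))`. -/
def expLp {η : ℝ} (hη : 0 < η) : (ℝ≥0 →ᵇ ℝ) →L[ℝ] Lp ℝ 2 halfLine :=
  LinearMap.mkContinuous
    { toFun := fun v => (memLp_expWeight hη v).toLp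
      map_add' := fun v w => by
        rw [← MemLp.toLp_add]
        refine MemLp.toLp_congr _ _ (ae_of_all _ fun t => ?_)
        simp [mul_add]
      map_smul' := fun c v => by
        rw [RingHom.id_apply, ← MemLp.toLp_const_smul]
        refine MemLp.toLp_congr _ _ (ae_of_all _ fun t => ?_)
        simp [mul_left_comm] } ‖(memLp_expWeight hη 1).toLp‖ fun v => by
    rw [mul_comm]
    refine Lp.norm_le_mul_norm_of_ae_le_mul ?_
    filter_upwards [(memLp_expWeight hη v).coeFn_toLp, (memLp_expWeight hη 1).coeFn_toLp]
      with t h1 h2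
    change ‖(memLp_expWeight hη v).toLp _ t‖ ≤ _
    rw [h1, h2, norm_mul, norm_mul, mul_comm ‖v‖]
    simpa using mul_le_mul_of_nonneg_left (v.norm_coe_le_norm t.toNNReal)
      (Real.exp_pos (-(η * t))).le

theorem expLp_ae {η : ℝ} (hη : 0 < η) (v : ℝ≥0 →ᵇ ℝ) :
    expLp hη v =ᵐ[halfLine] fun t => Real.exp (-(η * t)) * v t.toNNReal :=
  (memLp_expWeight hη v).coeFn_toLp

/-- The primitive of `exp(-ηt) v(t)` that vanishes at infinity. -/
def expPrim {η : ℝ} (hη : 0 < η) (v : ℝ≥0 →ᵇ ℝ) (t : ℝ) : ℝ :=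
  Real.exp (-(η * t)) * kern (neg_ne_zero.2 hη.ne') v t.toNNReal

theorem hasDerivWithinAt_expPrim {η : ℝ} (hη : 0 < η) (v : ℝ≥0 →ᵇ ℝ) {t : ℝ} (ht : 0 ≤ t) :
    HasDerivWithinAt (expPrim hη v) (Real.exp (-(η * t)) * v t.toNNReal) (Ici 0) t := by
  have h2 : HasDerivWithinAt (fun s : ℝ => Real.exp (-(η * s))) (Real.exp (-(η * t)) * -η)
      (Ici 0) t := by
    have := ((hasDerivAt_id t).const_mul η).neg.exp
    simpa using this.hasDerivWithinAt
  refine (h2.mul (hasDerivWithinAt_kern (neg_ne_zero.2 hη.ne') v ht)).congr_deriv ?_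
  ring

theorem tendsto_expPrim {η : ℝ} (hη : 0 < η) (v : ℝ≥0 →ᵇ ℝ) :
    Tendsto (expPrim hη v) atTop (𝓝 0) := by
  have h1 : Tendsto (fun t : ℝ => Real.exp (-(η * t))) atTop (𝓝 0) :=
    Real.tendsto_exp_atBot.comp (tendsto_neg_atTop_atBot.comp (tendsto_id.const_mul_atTop hη))
  refine h1.zero_mul_isBoundedUnder_le ⟨‖kern (neg_ne_zero.2 hη.ne') v‖, ?_⟩
  rw [eventually_map]
  exact Eventually.of_forall fun t => BoundedContinuousFunction.norm_coe_le_norm _ _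

/-- The derivative determines a function up to a constant, and the limit at infinity fixes the
constant. In this way $\varphi\circ\gamma-\varphi(x)$ is recovered from its slope alone. -/
theorem eq_expPrim {η : ℝ} (hη : 0 < η) {v : ℝ≥0 →ᵇ ℝ} {y : ℝ → ℝ}
    (hy : ∀ t ≥ 0, HasDerivWithinAt y (Real.exp (-(η * t)) * v t.toNNReal) (Ici 0) t)
    (hlim : Tendsto y atTop (𝓝 0)) : ∀ t ≥ 0, y t = expPrim hη v t := by
  have hd : ∀ t ≥ 0, HasDerivWithinAt (fun t => y t - expPrim hη v t) 0 (Ici 0) t := fun t ht =>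
    ((hy t ht).sub (hasDerivWithinAt_expPrim hη v ht)).congr_deriv (sub_self _)
  have hconst : ∀ t ≥ 0, y t - expPrim hη v t = y 0 - expPrim hη v 0 := fun t ht =>
    constant_of_has_deriv_right_zero (f := fun t => y t - expPrim hη v t) (a := 0) (b := t)
      (fun s hs => ((hd s hs.1).continuousWithinAt.mono Icc_subset_Ici_self))
      (fun s hs => (hd s hs.1).mono (Ici_subset_Ici.2 hs.1)) t ⟨ht, le_rfl⟩
  have h0 : y 0 - expPrim hη v 0 = 0 := by
    have h1 : Tendsto (fun t => y t - expPrim hη v t) atTop (𝓝 0) := by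
      simpa using hlim.sub (tendsto_expPrim hη v)
    refine tendsto_nhds_unique (tendsto_const_nhds.congr' ?_) h1
    filter_upwards [eventually_ge_atTop 0] with t ht using (hconst t ht).symm
  intro t ht
  have := hconst t ht
  rw [h0] at this
  linarith

theorem integral_expPrim {η : ℝ} (hη : 0 < η) (v : ℝ≥0 →ᵇ ℝ) {t : ℝ} (ht : 0 ≤ t) :
    ∫ s in (0 : ℝ)..t, Real.exp (-(η * s)) * v s.toNNReal = expPrim hη v t - expPrim hη v 0 := by
  refine intervalIntegral.integral_eq_sub_of_hasDeriv_right_of_le ht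
    (fun s hs => ((hasDerivWithinAt_expPrim hη v hs.1).continuousWithinAt.mono Icc_subset_Ici_self))
    (fun s hs => (hasDerivWithinAt_expPrim hη v hs.1.le).mono
      (Ioi_subset_Ici_self.trans (Ici_subset_Ici.2 hs.1.le))) ?_
  exact ((by fun_prop : Continuous fun t : ℝ => Real.exp (-(η * t))).mul
      (continuous_comp_toNNReal v)).intervalIntegrable _ _

/-- The element of `H^{1,2}([0, ∞))` with derivative `exp(-ηt) v(t)`. -/
def expH1 {η : ℝ} (hη : 0 < η) : (ℝ≥0 →ᵇ ℝ) →L[ℝ] H1 :=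
  (((WithLp.prodContinuousLinearEquiv 2 ℝ (Lp ℝ 2 halfLine) (Lp ℝ 2 halfLine)).symm :
      _ →L[ℝ] WithLp 2 (Lp ℝ 2 halfLine × Lp ℝ 2 halfLine)).comp
    (((expLp hη).comp (kern (neg_ne_zero.2 hη.ne'))).prod (expLp hη))).codRestrict H1 fun v => by
      refine ⟨expPrim hη v 0, ?_⟩
      filter_upwards [expLp_ae hη (kern (neg_ne_zero.2 hη.ne') v), ae_halfLine_nonneg] with t h1 h2
      change expLp hη (kern (neg_ne_zero.2 hη.ne') v) t = expPrim hη v 0 +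
        ∫ s in (0 : ℝ)..t, expLp hη v s
      rw [h1, integral_congr_halfLine (expLp_ae hη v) h2, integral_expPrim hη v h2]
      simp [expPrim]

theorem expH1_fst {η : ℝ} (hη : 0 < η) (v : ℝ≥0 →ᵇ ℝ) :
    (expH1 hη v).1.fst =ᵐ[halfLine] expPrim hη v :=
  expLp_ae hη (kern (neg_ne_zero.2 hη.ne') v)

theorem expH1_snd {η : ℝ} (hη : 0 < η) (v : ℝ≥0 →ᵇ ℝ) :
    (expH1 hη v).1.snd =ᵐ[halfLine] fun t => Real.exp (-(η * t)) * v t.toNNReal :=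
  expLp_ae hη v

theorem halfLine_Icc_ne_top (t : ℝ) : halfLine (Icc t (t + 1)) ≠ ⊤ :=
  ((Measure.restrict_apply_le _ _).trans_lt (by simp)).ne

theorem memLp_hat (t : ℝ) :
    MemLp ((Icc t (t + 1)).indicator fun s => t + 1 - s) 2 halfLine := by
  refine MemLp.of_le (memLp_indicator_const 2 (measurableSet_Icc (a := t) (b := t + 1)) (1 : ℝ)
    (Or.inr (halfLine_Icc_ne_top t)))
    (((by fun_prop : Continuous fun s : ℝ => t + 1 - s).measurable.indicator
      measurableSet_Icc).aestronglyMeasurable) (ae_of_all _ fun s => ?_)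
  by_cases hs : s ∈ Icc t (t + 1)
  · simp only [indicator_of_mem hs, norm_one]
    rw [Real.norm_of_nonneg (by linarith [hs.2])]
    linarith [hs.1]
  · simp [indicator_of_notMem hs]

/-- The evaluation functional at `t` on `H^{1,2}([0, ∞))`. -/
def evalH1 (t : ℝ) : H1 →L[ℝ] ℝ :=
  (((innerSL ℝ (indicatorConstLp 2 (measurableSet_Icc (a := t) (b := t + 1))
      (halfLine_Icc_ne_top t) (1 : ℝ))).comp (WithLp.fstL 2 ℝ (Lp ℝ 2 halfLine) (Lp ℝ 2 halfLine))) -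
    ((innerSL ℝ (memLp_hat t).toLp).comp (WithLp.sndL 2 ℝ (Lp ℝ 2 halfLine) (Lp ℝ 2 halfLine)))).comp
    H1.subtypeL

theorem evalH1_apply (t : ℝ) (U : H1) : evalH1 t U =
    inner ℝ (indicatorConstLp 2 (measurableSet_Icc (a := t) (b := t + 1))
      (halfLine_Icc_ne_top t) (1 : ℝ)) U.1.fst - inner ℝ (memLp_hat t).toLp U.1.snd := rfl

/-- Uniformity in $t$ is the point: conditions on a curve at all times $t\ge T$ become open in the
$H^{1,2}$ topology. -/
theorem norm_evalH1_le (t : ℝ) (U : H1) : ‖evalH1 t U‖ ≤ 2 * ‖U‖ := by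
  rw [evalH1_apply]
  have h1 : ‖indicatorConstLp 2 (measurableSet_Icc (a := t) (b := t + 1))
      (halfLine_Icc_ne_top t) (1 : ℝ)‖ ≤ 1 := by
    refine norm_indicatorConstLp_le.trans ?_
    rw [norm_one, one_mul]
    refine Real.rpow_le_one measureReal_nonneg ?_ (by positivity)
    have : halfLine (Icc t (t + 1)) ≤ 1 := (Measure.restrict_apply_le _ _).trans (by simp)
    exact ENNReal.toReal_le_of_le_ofReal zero_le_one (by simpa using this)
  have h2 : ‖(memLp_hat t).toLp‖ ≤ 1 := by
    refine (Lp.norm_le_norm_of_ae_le ?_).trans h1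
    filter_upwards [(memLp_hat t).coeFn_toLp, indicatorConstLp_coeFn (p := 2)
      (hs := measurableSet_Icc (a := t) (b := t + 1)) (hμs := halfLine_Icc_ne_top t) (c := (1 : ℝ))]
      with s h3 h4
    rw [h3, h4]
    by_cases hs : s ∈ Icc t (t + 1)
    · simp only [indicator_of_mem hs, norm_one]
      rw [Real.norm_of_nonneg (by linarith [hs.2])]
      linarith [hs.1]
    · simp [indicator_of_notMem hs]
  have h3 : ‖U.1.fst‖ ≤ ‖U‖ := WithLp.norm_fst_le _ U.1
  have h4 : ‖U.1.snd‖ ≤ ‖U‖ := WithLp.norm_snd_le _ U.1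
  refine (norm_sub_le _ _).trans ?_
  have h5 := (norm_inner_le_norm (𝕜 := ℝ) (indicatorConstLp 2 (measurableSet_Icc (a := t) (b := t + 1))
      (halfLine_Icc_ne_top t) (1 : ℝ)) U.1.fst).trans (mul_le_mul h1 h3 (norm_nonneg _) zero_le_one)
  have h6 := (norm_inner_le_norm (𝕜 := ℝ) (memLp_hat t).toLp U.1.snd).trans
    (mul_le_mul h2 h4 (norm_nonneg _) zero_le_one)
  linarith

/-- Integration by parts: $u(t)=\int_t^{t+1}u(s)\,ds-\int_t^{t+1}(t+1-s)\,u'(s)\,ds$, and both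
integrals are $L^2$ inner products. -/
theorem evalH1_expH1 {η : ℝ} (hη : 0 < η) (v : ℝ≥0 →ᵇ ℝ) {t : ℝ} (ht : 0 ≤ t) :
    evalH1 t (expH1 hη v) = expPrim hη v t := by
  have hsub : Icc t (t + 1) ⊆ Ici 0 := fun s hs => ht.trans hs.1
  have hrestr : ∀ f : ℝ → ℝ, ∫ s in Icc t (t + 1), f s ∂halfLine = ∫ s in t..t + 1, f s := by
    intro f
    rw [halfLine, Measure.restrict_restrict measurableSet_Icc, inter_eq_left.2 hsub,
      intervalIntegral.integral_of_le (by linarith), integral_Icc_eq_integral_Ioc]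
  have h1 : inner ℝ (indicatorConstLp 2 (measurableSet_Icc (a := t) (b := t + 1))
      (halfLine_Icc_ne_top t) (1 : ℝ)) (expH1 hη v).1.fst = ∫ s in t..t + 1, expPrim hη v s := by
    rw [L2.inner_indicatorConstLp_one, ← hrestr]
    exact integral_congr_ae (ae_restrict_of_ae (expH1_fst hη v))
  have h2 : inner ℝ (memLp_hat t).toLp (expH1 hη v).1.snd =
      ∫ s in t..t + 1, (t + 1 - s) * (Real.exp (-(η * s)) * v s.toNNReal) := by
    rw [L2.inner_def, ← hrestr, ← integral_indicator measurableSet_Icc]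
    refine integral_congr_ae ?_
    filter_upwards [(memLp_hat t).coeFn_toLp, expH1_snd hη v] with s h3 h4
    rw [h3, h4]
    by_cases hs : s ∈ Icc t (t + 1)
    · simp [indicator_of_mem hs, mul_comm]
    · simp [indicator_of_notMem hs]
  have hc : ContinuousOn (expPrim hη v) (Icc t (t + 1)) := fun s hs =>
    (hasDerivWithinAt_expPrim hη v (hsub hs)).continuousWithinAt.mono hsub
  have hc' : Continuous fun s : ℝ => (t + 1 - s) * (Real.exp (-(η * s)) * v s.toNNReal) :=
    (by fun_prop : Continuous fun s : ℝ => t + 1 - s).mul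
      ((by fun_prop : Continuous fun t : ℝ => Real.exp (-(η * t))).mul (continuous_comp_toNNReal v))
  have hi1 : IntervalIntegrable (expPrim hη v) volume t (t + 1) := by
    refine ContinuousOn.intervalIntegrable ?_
    rwa [uIcc_of_le (by linarith)]
  rw [evalH1_apply, h1, h2, ← intervalIntegral.integral_sub hi1 (hc'.intervalIntegrable _ _)]
  have key := intervalIntegral.integral_eq_sub_of_hasDeriv_right_of_le (a := t) (b := t + 1)
    (f := fun s => -((t + 1 - s) * expPrim hη v s))
    (f' := fun s => expPrim hη v s - (t + 1 - s) * (Real.exp (-(η * s)) * v s.toNNReal))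
    (by linarith) (((by fun_prop : Continuous fun s : ℝ => t + 1 - s).continuousOn.mul hc).neg)
    (fun s hs => ?_) (hi1.sub (hc'.intervalIntegrable _ _))
  · rw [key]; simp
  · have hs0 : 0 ≤ s := ht.trans hs.1.le
    have h3 : HasDerivAt (fun s : ℝ => t + 1 - s) (-1) s := by
      simpa using (hasDerivAt_id s).const_sub (t + 1)
    refine ((h3.hasDerivWithinAt.mul ((hasDerivWithinAt_expPrim hη v hs0).mono
      (Ioi_subset_Ici_self.trans (Ici_subset_Ici.2 hs0)))).neg).congr_deriv ?_
    ring

end Sobolev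

/-! ### Naturality of iterated covariant derivatives -/

section Tensor

variable {n m : ℕ}

/-- `T` is linear in each of its arguments. -/
def IsTensor (T : (Fin m → Eu n) → ℝ) : Prop :=
  ∃ A : ContinuousMultilinearMap ℝ (fun _ : Fin m => Eu n) ℝ, ∀ v, A v = T v

theorem IsTensor.update_add {T : (Fin m → Eu n) → ℝ} (hT : IsTensor T) (v : Fin m → Eu n)
    (i : Fin m) (a b : Eu n) :
    T (Function.update v i (a + b)) = T (Function.update v i a) + T (Function.update v i b) := by
  obtain ⟨A, hA⟩ := hT
  simp only [← hA, A.map_update_add]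

theorem IsTensor.update_smul {T : (Fin m → Eu n) → ℝ} (hT : IsTensor T) (v : Fin m → Eu n)
    (i : Fin m) (c : ℝ) (a : Eu n) :
    T (Function.update v i (c • a)) = c * T (Function.update v i a) := by
  obtain ⟨A, hA⟩ := hT
  simp only [← hA, A.map_update_smul, smul_eq_mul]

theorem IsTensor.smul {T : (Fin m → Eu n) → ℝ} (hT : IsTensor T) (v : Fin m → Eu n) (c : ℝ) :
    T (fun i => c • v i) = c ^ m * T v := by
  obtain ⟨A, hA⟩ := hT
  have := A.map_smul_univ (fun _ => c) v
  simpa [← hA] using this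

theorem christoffel_add_left (G : Eu n → Eu n →L[ℝ] Eu n →L[ℝ] ℝ) (y u u' v : Eu n) :
    christoffel G y (u + u') v = christoffel G y u v + christoffel G y u' v := by
  unfold christoffel
  rw [← map_add, ← smul_add]
  congr 2
  simp only [map_add, add_apply, ContinuousLinearMap.flip_add]
  abel

theorem christoffel_smul_left (G : Eu n → Eu n →L[ℝ] Eu n →L[ℝ] ℝ) (y u v : Eu n) (c : ℝ) :
    christoffel G y (c • u) v = c • christoffel G y u v := by
  unfold christoffel
  rw [← map_smul, smul_comm c]
  congr 2
  simp only [map_smul, smul_apply, ContinuousLinearMap.flip_smul, smul_sub, smul_add]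

theorem christoffel_add_right (G : Eu n → Eu n →L[ℝ] Eu n →L[ℝ] ℝ) (y u v v' : Eu n) :
    christoffel G y u (v + v') = christoffel G y u v + christoffel G y u v' := by
  unfold christoffel
  rw [← map_add, ← smul_add]
  congr 2
  simp only [map_add, add_apply]
  abel

theorem christoffel_smul_right (G : Eu n → Eu n →L[ℝ] Eu n →L[ℝ] ℝ) (y u v : Eu n) (c : ℝ) :
    christoffel G y u (c • v) = c • christoffel G y u v := by
  unfold christoffel
  rw [← map_smul, smul_comm c]
  congr 2
  simp only [map_smul, smul_apply, smul_sub, smul_add]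

theorem JointSmooth.differentiableAt {U : Set (Eu n)} (hU : IsOpen U)
    {T : Eu n → (Fin m → Eu n) → ℝ} (hT : JointSmooth U T) {y : Eu n} (hy : y ∈ U)
    (v : Fin m → Eu n) :
    DifferentiableAt ℝ (fun z : Eu n × (Fin m → Eu n) => T z.1 z.2) (y, v) :=
  (hT.contDiffAt ((hU.prod isOpen_univ).mem_nhds ⟨hy, mem_univ _⟩)).differentiableAt (by simp)

theorem JointSmooth.continuous {U : Set (Eu n)} {T : Eu n → (Fin m → Eu n) → ℝ}
    (hT : JointSmooth U T) {y : Eu n} (hy : y ∈ U) : Continuous (T y) :=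
  ContinuousOn.comp_continuous (g := fun z : Eu n × (Fin m → Eu n) => T z.1 z.2)
    hT.continuousOn (Continuous.prodMk_right y)
    fun _ => ⟨hy, mem_univ _⟩

theorem IsTensor.hasFDerivAt_apply {T : (Fin m → Eu n) → ℝ} (hT : IsTensor T)
    {v : Fin m → Eu n} {T' : (Fin m → Eu n) →L[ℝ] ℝ} (h : HasFDerivAt T T' v) (w : Fin m → Eu n) :
    T' w = ∑ i, T (Function.update v i (w i)) := by
  obtain ⟨B, hA⟩ := hT
  have hB : ⇑B = T := funext hA
  have h1 := B.hasFDerivAt v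
  rw [hB] at h1
  rw [h.unique h1, B.linearDeriv_apply]
  simp [hB]

/-- The total derivative of a tensor field in terms of the covariant derivative. -/
theorem fderiv_joint {U : Set (Eu n)} (hU : IsOpen U)
    (G : Eu n → Eu n →L[ℝ] Eu n →L[ℝ] ℝ) {T : Eu n → (Fin m → Eu n) → ℝ} (hT : JointSmooth U T)
    (hlin : ∀ y ∈ U, IsTensor (T y)) {y : Eu n} (hy : y ∈ U) (v w : Fin m → Eu n) (a : Eu n) :
    fderiv ℝ (fun z : Eu n × (Fin m → Eu n) => T z.1 z.2) (y, v) (a, w) =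
      covDeriv G T y (Fin.cons a v) +
        ∑ i, T y (Function.update v i (christoffel G y a (v i) + w i)) := by
  have hd := (hT.differentiableAt hU hy v).hasFDerivAt
  have h1 : HasFDerivAt (fun v => T y v) _ v :=
    HasFDerivAt.comp (g := fun z : Eu n × (Fin m → Eu n) => T z.1 z.2) v hd
      (hasFDerivAt_prodMk_right y v)
  have h2 := (hlin y hy).hasFDerivAt_apply h1 w
  have h3 := (hT.fderiv_eq hU hy v).fderiv
  have h4 : ((a, w) : Eu n × (Fin m → Eu n)) = (a, 0) + (0, w) := by simp
  rw [h4, map_add]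
  simp only [(hlin y hy).update_add, Finset.sum_add_distrib]
  rw [← h2]
  simp only [covDeriv, Fin.tail_cons, Fin.cons_zero, Fin.cons_succ, h3]
  simp only [ContinuousLinearMap.comp_apply, ContinuousLinearMap.inl_apply,
    ContinuousLinearMap.inr_apply]
  ring

/-- Differentiating a multilinear form could destroy nothing but the treatment of the Christoffel
terms: in slot $0$ and in the slot being corrected, linearity comes from that of $\Gamma$; in the
others from that of $T$. Tensoriality is needed for rescaling vectors and for `fderiv_joint`. -/
theorem IsTensor.covDeriv {U : Set (Eu n)} (hU : IsOpen U)
    {G : Eu n → Eu n →L[ℝ] Eu n →L[ℝ] ℝ} (hG : ContDiffOn ℝ ∞ G U)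
    (hinv : ∀ y ∈ U, (G y).IsInvertible) {T : Eu n → (Fin m → Eu n) → ℝ} (hT : JointSmooth U T)
    (hlin : ∀ y ∈ U, IsTensor (T y)) {y : Eu n} (hy : y ∈ U) :
    IsTensor (covDeriv G T y) := by
  have hadd : ∀ (v : Fin (m + 1) → Eu n) (i : Fin (m + 1)) (a b : Eu n),
      MorseUniv.covDeriv G T y (Function.update v i (a + b)) =
        MorseUniv.covDeriv G T y (Function.update v i a) +
        MorseUniv.covDeriv G T y (Function.update v i b) := by
    intro v i a b
    refine Fin.cases ?_ (fun j => ?_) i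
    · simp only [MorseUniv.covDeriv, Fin.tail_update_zero, Function.update_self,
        Function.update_of_ne (Fin.succ_ne_zero _), map_add, christoffel_add_left,
        (hlin y hy).update_add, Finset.sum_add_distrib]
      ring
    · simp only [MorseUniv.covDeriv, Fin.tail_update_succ,
        Function.update_of_ne (Fin.succ_ne_zero j).symm]
      have he : (fun z => T z (Function.update (Fin.tail v) j (a + b))) =ᶠ[𝓝 y] fun z =>
          T z (Function.update (Fin.tail v) j a) + T z (Function.update (Fin.tail v) j b) := by
        filter_upwards [hU.mem_nhds hy] with z hz using (hlin z hz).update_add _ _ _ _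
      rw [he.fderiv_eq, fderiv_fun_add (hT.fderiv_eq hU hy _).differentiableAt
        (hT.fderiv_eq hU hy _).differentiableAt, add_apply]
      have hs : ∀ l : Fin m, T y (Function.update (Function.update (Fin.tail v) j (a + b)) l
            (christoffel G y (v 0) (Function.update v j.succ (a + b) l.succ))) =
          T y (Function.update (Function.update (Fin.tail v) j a) l
            (christoffel G y (v 0) (Function.update v j.succ a l.succ))) +
          T y (Function.update (Function.update (Fin.tail v) j b) l
            (christoffel G y (v 0) (Function.update v j.succ b l.succ))) := by
        intro l
        rcases eq_or_ne l j with rfl | hl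
        · simp only [Function.update_self, Function.update_idem, christoffel_add_right,
            (hlin y hy).update_add]
        · simp only [Function.update_of_ne ((Fin.succ_injective m).ne hl)]
          simp only [Function.update_comm hl.symm, (hlin y hy).update_add]
      simp only [hs, Finset.sum_add_distrib]
      ring
  have hsmul : ∀ (v : Fin (m + 1) → Eu n) (i : Fin (m + 1)) (c : ℝ) (a : Eu n),
      MorseUniv.covDeriv G T y (Function.update v i (c • a)) =
        c * MorseUniv.covDeriv G T y (Function.update v i a) := by
    intro v i c a
    refine Fin.cases ?_ (fun j => ?_) i
    · simp only [MorseUniv.covDeriv, Fin.tail_update_zero, Function.update_self,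
        Function.update_of_ne (Fin.succ_ne_zero _), map_smul, christoffel_smul_left,
        (hlin y hy).update_smul, ← Finset.mul_sum, smul_eq_mul]
      ring
    · simp only [MorseUniv.covDeriv, Fin.tail_update_succ,
        Function.update_of_ne (Fin.succ_ne_zero j).symm]
      have he : (fun z => T z (Function.update (Fin.tail v) j (c • a))) =ᶠ[𝓝 y] fun z =>
          c * T z (Function.update (Fin.tail v) j a) := by
        filter_upwards [hU.mem_nhds hy] with z hz using (hlin z hz).update_smul _ _ _ _
      rw [he.fderiv_eq, fderiv_const_mul (hT.fderiv_eq hU hy _).differentiableAt, smul_apply]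
      have hs : ∀ l : Fin m, T y (Function.update (Function.update (Fin.tail v) j (c • a)) l
            (christoffel G y (v 0) (Function.update v j.succ (c • a) l.succ))) =
          c * T y (Function.update (Function.update (Fin.tail v) j a) l
            (christoffel G y (v 0) (Function.update v j.succ a l.succ))) := by
        intro l
        rcases eq_or_ne l j with rfl | hl
        · simp only [Function.update_self, Function.update_idem, christoffel_smul_right,
            (hlin y hy).update_smul]
        · simp only [Function.update_of_ne ((Fin.succ_injective m).ne hl)]
          simp only [Function.update_comm hl.symm, (hlin y hy).update_smul]
      simp only [hs, ← Finset.mul_sum, smul_eq_mul]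
      ring
  exact ⟨{ toFun := MorseUniv.covDeriv G T y
           map_update_add' := fun {_} v i a b => by convert hadd v i a b
           map_update_smul' := fun {_} v i c a => by
             rw [smul_eq_mul]; convert hsmul v i c a
           cont := (hT.covDeriv hU hG hinv).continuous hy },
    fun v => rfl⟩

theorem isTensor_iterCovDeriv {U : Set (Eu n)} (hU : IsOpen U)
    {G B : Eu n → Eu n →L[ℝ] Eu n →L[ℝ] ℝ} (hG : ContDiffOn ℝ ∞ G U)
    (hinv : ∀ y ∈ U, (G y).IsInvertible) (hB : ContDiffOn ℝ ∞ B U) (k : ℕ) :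
    ∀ y ∈ U, IsTensor (iterCovDeriv G B k y) := by
  induction k with
  | zero =>
    intro y _
    refine ⟨{ toFun := fun v => B y (v 0) (v 1)
              map_update_add' := fun {inst} v i a b => ?_
              map_update_smul' := fun {inst} v i c a => ?_
              cont := by fun_prop }, fun v => rfl⟩
    · obtain rfl : inst = instDecidableEqFin 2 := Subsingleton.elim _ _
      refine Fin.cases ?_ (fun j => ?_) i
      · simp
      · obtain rfl : j = 0 := Subsingleton.elim _ _
        simp
    · obtain rfl : inst = instDecidableEqFin 2 := Subsingleton.elim _ _
      refine Fin.cases ?_ (fun j => ?_) i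
      · simp
      · obtain rfl : j = 0 := Subsingleton.elim _ _
        simp
  | succ k ih =>
    intro y hy
    exact IsTensor.covDeriv hU hG hinv (jointSmooth_iterCovDeriv hU hG hinv hB k) ih hy

theorem christoffel_spec {G : Eu n → Eu n →L[ℝ] Eu n →L[ℝ] ℝ} {y : Eu n}
    (hinv : (G y).IsInvertible) (u v w : Eu n) :
    G y (christoffel G y u v) w =
      (1 / 2) * (fderiv ℝ G y u v w + fderiv ℝ G y v u w - fderiv ℝ G y w u v) := by
  unfold christoffel
  rw [hinv.self_apply_inverse]
  simp

/-! ### Behaviour under a local diffeomorphism. -/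

section Pullback

variable {U U' : Set (Eu n)} {ψ : Eu n → Eu n} {G G' B B' : Eu n → Eu n →L[ℝ] Eu n →L[ℝ] ℝ}

theorem fderiv_pullback (hU : IsOpen U) (hU' : IsOpen U')
    (hψ : ContDiffOn ℝ ∞ ψ U) (hm : MapsTo ψ U U') (hG : ContDiffOn ℝ ∞ G U)
    (hG' : ContDiffOn ℝ ∞ G' U')
    (hp : ∀ y ∈ U, ∀ u v, G y u v = G' (ψ y) (fderiv ℝ ψ y u) (fderiv ℝ ψ y v))
    {y : Eu n} (hy : y ∈ U) (a u v : Eu n) :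
    fderiv ℝ G y a u v =
      fderiv ℝ G' (ψ y) (fderiv ℝ ψ y a) (fderiv ℝ ψ y u) (fderiv ℝ ψ y v) +
      G' (ψ y) (fderiv ℝ (fderiv ℝ ψ) y a u) (fderiv ℝ ψ y v) +
      G' (ψ y) (fderiv ℝ ψ y u) (fderiv ℝ (fderiv ℝ ψ) y a v) := by
  have hdG : HasFDerivAt G (fderiv ℝ G y) y :=
    ((hG.contDiffAt (hU.mem_nhds hy)).differentiableAt (by simp)).hasFDerivAt
  have hdψ : HasFDerivAt ψ (fderiv ℝ ψ y) y :=
    ((hψ.contDiffAt (hU.mem_nhds hy)).differentiableAt (by simp)).hasFDerivAt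
  have hdψ2 : HasFDerivAt (fderiv ℝ ψ) (fderiv ℝ (fderiv ℝ ψ) y) y :=
    (((hψ.fderiv_of_isOpen hU (m := ∞) (by simp)).contDiffAt (hU.mem_nhds hy)).differentiableAt
      (by simp)).hasFDerivAt
  have hdG' : HasFDerivAt G' (fderiv ℝ G' (ψ y)) (ψ y) :=
    ((hG'.contDiffAt (hU'.mem_nhds (hm hy))).differentiableAt (by simp)).hasFDerivAt
  have h1 := (hdG.clm_apply (hasFDerivAt_const u y)).clm_apply (hasFDerivAt_const v y)
  have h2 := ((hdG'.comp y hdψ).clm_apply (hdψ2.clm_apply (hasFDerivAt_const u y))).clm_apply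
    (hdψ2.clm_apply (hasFDerivAt_const v y))
  have h3 := h1.unique (h2.congr_of_eventuallyEq (by
    filter_upwards [hU.mem_nhds hy] with z hz using hp z hz u v))
  have h4 := DFunLike.congr_fun h3 a
  simp at h4
  rw [h4]
  ring

/-- The classical transformation law. Testing against $G'$ reduces it to the Koszul formula; the
terms with second derivatives of $\psi$ combine by the symmetry of $D^2\psi$ and of $G'$. -/
theorem christoffel_pullback (hU : IsOpen U) (hU' : IsOpen U')
    (hψ : ContDiffOn ℝ ∞ ψ U) (hm : MapsTo ψ U U') (hG : ContDiffOn ℝ ∞ G U)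
    (hG' : ContDiffOn ℝ ∞ G' U') (hsymm : ∀ y ∈ U', ∀ u v, G' y u v = G' y v u)
    (hp : ∀ y ∈ U, ∀ u v, G y u v = G' (ψ y) (fderiv ℝ ψ y u) (fderiv ℝ ψ y v))
    (hinv : ∀ y ∈ U, (G y).IsInvertible) (hinv' : ∀ y ∈ U', (G' y).IsInvertible)
    {y : Eu n} (hy : y ∈ U) (hsurj : Function.Surjective (fderiv ℝ ψ y)) (u v : Eu n) :
    fderiv ℝ ψ y (christoffel G y u v) =
      christoffel G' (ψ y) (fderiv ℝ ψ y u) (fderiv ℝ ψ y v) + fderiv ℝ (fderiv ℝ ψ) y u v := by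
  apply (hinv' _ (hm hy)).injective
  ext w'
  obtain ⟨w, rfl⟩ := hsurj w'
  rw [← hp y hy, christoffel_spec (hinv y hy), map_add, add_apply,
    christoffel_spec (hinv' _ (hm hy))]
  simp only [fderiv_pullback hU hU' hψ hm hG hG' hp hy]
  have hs : ∀ a b, fderiv ℝ (fderiv ℝ ψ) y a b = fderiv ℝ (fderiv ℝ ψ) y b a :=
    (hψ.contDiffAt (hU.mem_nhds hy)).isSymmSndFDerivAt
      (by rw [minSmoothness_of_isRCLikeNormedField]; exact WithTop.coe_le_coe.2 le_top)
  rw [hs v u, hs w u, hs w v, hsymm _ (hm hy) (fderiv ℝ ψ y u) (fderiv ℝ (fderiv ℝ ψ) y v w),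
    hsymm _ (hm hy) (fderiv ℝ ψ y v) (fderiv ℝ (fderiv ℝ ψ) y u w)]
  ring

/-- The total derivative of the function $(y,v)\mapsto T_y(v)$ in a horizontal direction
$(a,-\Gamma(a,v_i))$ is the covariant derivative. By `christoffel_pullback` the map
$(y,v)\mapsto(\psi(y),D\psi\,v)$ sends horizontal directions to horizontal ones, so the chain rule
gives the inductive step. -/
theorem iterCovDeriv_pullback (hU : IsOpen U) (hU' : IsOpen U')
    (hψ : ContDiffOn ℝ ∞ ψ U) (hm : MapsTo ψ U U') (hG : ContDiffOn ℝ ∞ G U)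
    (hG' : ContDiffOn ℝ ∞ G' U') (hB : ContDiffOn ℝ ∞ B U) (hB' : ContDiffOn ℝ ∞ B' U')
    (hsymm : ∀ y ∈ U', ∀ u v, G' y u v = G' y v u)
    (hp : ∀ y ∈ U, ∀ u v, G y u v = G' (ψ y) (fderiv ℝ ψ y u) (fderiv ℝ ψ y v))
    (hpB : ∀ y ∈ U, ∀ u v, B y u v = B' (ψ y) (fderiv ℝ ψ y u) (fderiv ℝ ψ y v))
    (hinv : ∀ y ∈ U, (G y).IsInvertible) (hinv' : ∀ y ∈ U', (G' y).IsInvertible)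
    (hsurj : ∀ y ∈ U, Function.Surjective (fderiv ℝ ψ y)) (k : ℕ) :
    ∀ y ∈ U, ∀ v, iterCovDeriv G B k y v =
      iterCovDeriv G' B' k (ψ y) (fun i => fderiv ℝ ψ y (v i)) := by
  induction k with
  | zero => intro y hy v; exact hpB y hy _ _
  | succ k ih =>
    intro y hy v
    have hJ := jointSmooth_iterCovDeriv hU hG hinv hB k
    have hJ' := jointSmooth_iterCovDeriv hU' hG' hinv' hB' k
    have hL := isTensor_iterCovDeriv hU hG hinv hB k
    have hL' := isTensor_iterCovDeriv hU' hG' hinv' hB' k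
    -- In the horizontal direction all correction terms of `fderiv_joint` have a zero argument.
    have e1 := fderiv_joint hU G hJ hL hy (Fin.tail v)
      (fun i => -christoffel G y (v 0) (Fin.tail v i)) (v 0)
    have z1 : ∀ i, iterCovDeriv G B k y (Function.update (Fin.tail v) i 0) = 0 := fun i => by
      simpa using (hL y hy).update_smul (Fin.tail v) i 0 0
    have z2 : ∀ (w : Fin (2 + k) → Eu n) i, iterCovDeriv G' B' k (ψ y) (Function.update w i 0) = 0 :=
      fun w i => by simpa using (hL' _ (hm hy)).update_smul w i 0 0
    simp only [add_neg_cancel, z1, Finset.sum_const_zero, add_zero, Fin.cons_self_tail] at e1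
    have hdψ : HasFDerivAt ψ (fderiv ℝ ψ y) y :=
      ((hψ.contDiffAt (hU.mem_nhds hy)).differentiableAt (by simp)).hasFDerivAt
    have hdψ2 : HasFDerivAt (fderiv ℝ ψ) (fderiv ℝ (fderiv ℝ ψ) y) y :=
      (((hψ.fderiv_of_isOpen hU (m := ∞) (by simp)).contDiffAt (hU.mem_nhds hy)).differentiableAt
        (by simp)).hasFDerivAt
    have hf : HasFDerivAt (fun z : Eu n × (Fin (2 + k) → Eu n) => z.1)
      (ContinuousLinearMap.fst ℝ _ _) (y, Fin.tail v) := hasFDerivAt_fst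
    have hΨ : HasFDerivAt (fun z : Eu n × (Fin (2 + k) → Eu n) =>
        (ψ z.1, fun i => fderiv ℝ ψ z.1 (z.2 i))) _ (y, Fin.tail v) :=
      (HasFDerivAt.comp (y, Fin.tail v) (g := ψ) hdψ hf).prodMk (hasFDerivAt_pi.2 fun i =>
        (HasFDerivAt.comp (y, Fin.tail v) (g := fderiv ℝ ψ) hdψ2 hf).clm_apply
          (hasFDerivAt_pi'.1 (hasFDerivAt_snd (p := (y, Fin.tail v))) i))
    have hd' := (hJ'.differentiableAt hU' (hm hy)
      (fun i => fderiv ℝ ψ y (Fin.tail v i))).hasFDerivAt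
    have hc := HasFDerivAt.comp (y, Fin.tail v)
      (g := fun z : Eu n × (Fin (2 + k) → Eu n) => iterCovDeriv G' B' k z.1 z.2) hd' hΨ
    have hee : (fun z : Eu n × (Fin (2 + k) → Eu n) => iterCovDeriv G B k z.1 z.2)
        =ᶠ[𝓝 (y, Fin.tail v)] fun z => iterCovDeriv G' B' k (ψ z.1) (fun i => fderiv ℝ ψ z.1 (z.2 i)) := by
      filter_upwards [(hU.prod isOpen_univ).mem_nhds (show (y, Fin.tail v) ∈ U ×ˢ univ from
        ⟨hy, mem_univ _⟩)] with z hz using ih z.1 hz.1 z.2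
    have hc' := (hc.congr_of_eventuallyEq hee).fderiv
    rw [hc'] at e1
    have e2 := fderiv_joint hU' G' hJ' hL' (hm hy) (fun i => fderiv ℝ ψ y (Fin.tail v i))
      (fun i => -christoffel G' (ψ y) (fderiv ℝ ψ y (v 0)) (fderiv ℝ ψ y (Fin.tail v i)))
      (fderiv ℝ ψ y (v 0))
    simp only [add_neg_cancel, z2, Finset.sum_const_zero, add_zero] at e2
    have e3 : (Fin.cons (fderiv ℝ ψ y (v 0)) (fun i => fderiv ℝ ψ y (Fin.tail v i)) :
        Fin (2 + k + 1) → Eu n) = fun i => fderiv ℝ ψ y (v i) := by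
      funext i
      refine Fin.cases rfl (fun j => rfl) i
    rw [e3] at e2
    refine e1.symm.trans (Eq.trans ?_ e2)
    rw [ContinuousLinearMap.comp_apply]
    congr 1
    refine Prod.ext rfl (funext fun i => ?_)
    have := christoffel_pullback hU hU' hψ hm hG hG' hsymm hp hinv hinv' hy (hsurj y hy) (v 0)
      (Fin.tail v i)
    simp [this]

end Pullback

end Tensor

/-! ### Changes of coordinates on the manifold -/

section Coordinates

variable {n : ℕ} {M : Type*} [TopologicalSpace M] [ChartedSpace (Eu n) M] [IsManifold (𝓡 n) ∞ M]

/-- The components of a tangent vector at `m` in the chart at `p`. -/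
def toCoord (p m : M) : TangentSpace (𝓡 n) m →L[ℝ] Eu n :=
  (trivializationAt (Eu n) (TangentSpace (𝓡 n)) p).continuousLinearMapAt ℝ m

/-- The tangent vector at `m` with given components in the chart at `p`. -/
def ofCoord (p m : M) : Eu n →L[ℝ] TangentSpace (𝓡 n) m :=
  (trivializationAt (Eu n) (TangentSpace (𝓡 n)) p).symmL ℝ m

theorem ofCoord_toCoord {p m : M} (hm : m ∈ (chartAt (Eu n) p).source)
    (v : TangentSpace (𝓡 n) m) : ofCoord p m (toCoord p m v) = v :=
  (trivializationAt (Eu n) (TangentSpace (𝓡 n)) p).symmL_continuousLinearMapAt (R := ℝ)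
    (by simpa using hm) v

theorem toCoord_ofCoord {p m : M} (hm : m ∈ (chartAt (Eu n) p).source) (v : Eu n) :
    toCoord p m (ofCoord p m v) = v :=
  (trivializationAt (Eu n) (TangentSpace (𝓡 n)) p).continuousLinearMapAt_symmL (R := ℝ)
    (by simpa using hm) v

theorem coordForm_chart (h : BilinForm n M) {p m : M} (hm : m ∈ (chartAt (Eu n) p).source)
    (u v : Eu n) :
    coordForm h p (chartAt (Eu n) p m) u v = h m (ofCoord p m u) (ofCoord p m v) := by
  have hb : m ∈ (trivializationAt (Eu n) (TangentSpace (𝓡 n)) p).baseSet := by simpa using hm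
  rw [coordForm_apply h p ((chartAt (Eu n) p).map_source hm) u v,
    (chartAt (Eu n) p).left_inv hm]
  simp only [ofCoord, Trivialization.symmL_apply _ hb]

theorem apply_eq_coordForm (h : BilinForm n M) {p m : M} (hm : m ∈ (chartAt (Eu n) p).source)
    (u v : TangentSpace (𝓡 n) m) :
    h m u v = coordForm h p (chartAt (Eu n) p m) (toCoord p m u) (toCoord p m v) := by
  rw [coordForm_chart h hm, ofCoord_toCoord hm, ofCoord_toCoord hm]

/-- The change of coordinates from the chart at `p` to the chart at `q`. -/
def transition (p q : M) : OpenPartialHomeomorph (Eu n) (Eu n) :=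
  (chartAt (Eu n) p).symm ≫ₕ chartAt (Eu n) q

theorem mem_transition_source {p q : M} {y : Eu n} : y ∈ (transition p q).source ↔
    y ∈ (chartAt (Eu n) p).target ∧ (chartAt (Eu n) p).symm y ∈ (chartAt (Eu n) q).source := by
  simp [transition]

theorem transition_apply (p q : M) (y : Eu n) :
    transition p q y = chartAt (Eu n) q ((chartAt (Eu n) p).symm y) := rfl

theorem chart_mem_transition_source {p q m : M} (hp : m ∈ (chartAt (Eu n) p).source)
    (hq : m ∈ (chartAt (Eu n) q).source) : chartAt (Eu n) p m ∈ (transition p q).source :=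
  mem_transition_source.2 ⟨(chartAt (Eu n) p).map_source hp, by
    rwa [(chartAt (Eu n) p).left_inv hp]⟩

theorem contDiffOn_transition (p q : M) :
    ContDiffOn ℝ ∞ (transition p q : Eu n → Eu n) (transition p q).source := by
  rw [← contMDiffOn_iff_contDiffOn]
  exact (contMDiffOn_chart (I := 𝓡 n) (n := ∞) (x := q)).comp
    ((contMDiffOn_chart_symm (I := 𝓡 n) (n := ∞) (x := p)).mono
      fun y hy => (mem_transition_source.1 hy).1) fun y hy => (mem_transition_source.1 hy).2

theorem toCoord_ofCoord_of_mem {p q m : M} (hp : m ∈ (chartAt (Eu n) p).source)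
    (hq : m ∈ (chartAt (Eu n) q).source) (u : Eu n) :
    toCoord q m (ofCoord p m u) = fderiv ℝ (transition p q) (chartAt (Eu n) p m) u := by
  unfold toCoord ofCoord
  rw [TangentBundle.continuousLinearMapAt_trivializationAt_eq_core hq,
    TangentBundle.symmL_trivializationAt_eq_core hp]
  have h1 := tangentCoordChange_comp (I := 𝓡 n) (w := p) (x := m) (y := q) (z := m) (v := u)
    (by simp [hp, hq])
  refine Eq.trans h1 ?_
  rw [tangentCoordChange_def]
  simp only [extChartAt, mfld_simps, fderivWithin_univ]
  rfl

theorem fderiv_transition_surjective {p q : M} {y : Eu n} (hy : y ∈ (transition p q).source) :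
    Function.Surjective (fderiv ℝ (transition p q : Eu n → Eu n) y) := by
  obtain ⟨h1, h2⟩ := mem_transition_source.1 hy
  set m := (chartAt (Eu n) p).symm y
  have hm : m ∈ (chartAt (Eu n) p).source := (chartAt (Eu n) p).map_target h1
  have hy' : y = chartAt (Eu n) p m := ((chartAt (Eu n) p).right_inv h1).symm
  intro w
  refine ⟨toCoord p m (ofCoord q m w), ?_⟩
  rw [hy', ← toCoord_ofCoord_of_mem hm h2, ofCoord_toCoord hm, toCoord_ofCoord h2]

theorem coordForm_transition (h : BilinForm n M) {p q : M} {y : Eu n}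
    (hy : y ∈ (transition p q).source) (u v : Eu n) :
    coordForm h p y u v = coordForm h q (transition p q y)
      (fderiv ℝ (transition p q : Eu n → Eu n) y u)
      (fderiv ℝ (transition p q : Eu n → Eu n) y v) := by
  obtain ⟨h1, h2⟩ := mem_transition_source.1 hy
  set m := (chartAt (Eu n) p).symm y with hmdef
  have hm : m ∈ (chartAt (Eu n) p).source := (chartAt (Eu n) p).map_target h1
  have hy' : y = chartAt (Eu n) p m := ((chartAt (Eu n) p).right_inv h1).symm
  have hz : transition p q y = chartAt (Eu n) q m := rfl
  rw [hz, coordForm_chart h h2, hy', coordForm_chart h hm, ← toCoord_ofCoord_of_mem hm h2,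
    ← toCoord_ofCoord_of_mem hm h2, ofCoord_toCoord h2, ofCoord_toCoord h2]

theorem Metric.coordForm_symm (g : Metric n M) {p : M} {y : Eu n}
    (hy : y ∈ (chartAt (Eu n) p).target) (u v : Eu n) :
    coordForm g.toBilin p y u v = coordForm g.toBilin p y v u := by
  rw [coordForm_apply _ _ hy, coordForm_apply _ _ hy]
  exact g.symm _ _ _

/-- The `k`-th covariant derivative of `h` in the chart at `p`. -/
def chartIter (g₀ : Metric n M) (k : ℕ) (h : BilinForm n M) (p : M) :
    Eu n → (Fin (2 + k) → Eu n) → ℝ :=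
  iterCovDeriv (coordForm g₀.toBilin p) (coordForm h p) k

variable (g₀ : Metric n M)

theorem chartIter_transition (k : ℕ) (h : BilinForm n M) {p q : M} {y : Eu n}
    (hy : y ∈ (transition p q).source) (v : Fin (2 + k) → Eu n) :
    chartIter g₀ k h p y v = chartIter g₀ k h q (transition p q y)
      (fun i => fderiv ℝ (transition p q : Eu n → Eu n) y (v i)) := by
  have hsub : ∀ {y}, y ∈ (transition p q).source → y ∈ (chartAt (Eu n) p).target :=
    fun hy => (mem_transition_source.1 hy).1
  refine iterCovDeriv_pullback (transition p q).open_source (chartAt (Eu n) q).open_target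
    (contDiffOn_transition p q) (fun y hy => (chartAt (Eu n) q).map_source
      (mem_transition_source.1 hy).2) ((contDiffOn_coordForm _ p).mono fun _ => hsub)
    (contDiffOn_coordForm _ q) ((contDiffOn_coordForm _ p).mono fun _ => hsub)
    (contDiffOn_coordForm _ q) (fun y hy => g₀.coordForm_symm hy)
    (fun y hy => coordForm_transition _ hy) (fun y hy => coordForm_transition _ hy)
    (fun y hy => g₀.coordForm_isInvertible p (hsub hy))
    (fun y hy => g₀.coordForm_isInvertible q hy) (fun y hy => fderiv_transition_surjective hy) k y hy v

theorem jointSmooth_chartIter (k : ℕ) (h : BilinForm n M) (p : M) :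
    JointSmooth (chartAt (Eu n) p).target (chartIter g₀ k h p) :=
  jointSmooth_iterCovDeriv (chartAt (Eu n) p).open_target (contDiffOn_coordForm _ p)
    (fun _ hy => g₀.coordForm_isInvertible p hy) (contDiffOn_coordForm _ p) k

theorem isTensor_chartIter (k : ℕ) (h : BilinForm n M) (p : M) {y : Eu n}
    (hy : y ∈ (chartAt (Eu n) p).target) : IsTensor (chartIter g₀ k h p y) :=
  isTensor_iterCovDeriv (chartAt (Eu n) p).open_target (contDiffOn_coordForm _ p)
    (fun _ hy => g₀.coordForm_isInvertible p hy) (contDiffOn_coordForm _ p) k y hy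

theorem chartIter_add (k : ℕ) (h h' : BilinForm n M) (p : M) {y : Eu n}
    (hy : y ∈ (chartAt (Eu n) p).target) (v : Fin (2 + k) → Eu n) :
    chartIter g₀ k (h + h') p y v = chartIter g₀ k h p y v + chartIter g₀ k h' p y v := by
  unfold chartIter
  rw [coordForm_add]
  exact iterCovDeriv_add (chartAt (Eu n) p).open_target (contDiffOn_coordForm _ p)
    (fun _ hy => g₀.coordForm_isInvertible p hy) (contDiffOn_coordForm _ p)
    (contDiffOn_coordForm _ p) k y hy v

theorem chartIter_smul (k : ℕ) (c : ℝ) (h : BilinForm n M) (p : M) {y : Eu n}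
    (hy : y ∈ (chartAt (Eu n) p).target) (v : Fin (2 + k) → Eu n) :
    chartIter g₀ k (c • h) p y v = c * chartIter g₀ k h p y v := by
  unfold chartIter
  rw [coordForm_smul]
  exact iterCovDeriv_smul (chartAt (Eu n) p).open_target (contDiffOn_coordForm _ p)
    (fun _ hy => g₀.coordForm_isInvertible p hy) (contDiffOn_coordForm _ p) c k y hy v

/-- `nablaSup` looks at each point only in the chart preferred there. Naturality carries the bound
to every other chart. -/
theorem enorm_chartIter_le (k : ℕ) (h : BilinForm n M) {p : M} {y : Eu n}
    (hy : y ∈ (chartAt (Eu n) p).target) (v : Fin (2 + k) → Eu n)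
    (hv : ∀ i, coordForm g₀.toBilin p y (v i) (v i) ≤ 1) :
    ‖chartIter g₀ k h p y v‖ₑ ≤ nablaSup g₀ k h := by
  set q := (chartAt (Eu n) p).symm y with hq
  have hyt : y ∈ (transition p q).source := mem_transition_source.2 ⟨hy, mem_chart_source _ q⟩
  rw [chartIter_transition g₀ k h hyt]
  have h1 : ∀ i, coordForm g₀.toBilin q (chartAt (Eu n) q q)
      (fderiv ℝ (transition p q : Eu n → Eu n) y (v i))
      (fderiv ℝ (transition p q : Eu n → Eu n) y (v i)) ≤ 1 := by
    intro i
    have := hv i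
    rwa [coordForm_transition _ hyt] at this
  exact le_iSup_of_le q (le_iSup_of_le _ (le_iSup_of_le h1 le_rfl))

variable {g₀} {ε : ℕ → Ioi (0 : ℝ)}

theorem CEps.nablaSup_le (h : CEps g₀ ε) (k : ℕ) :
    nablaSup g₀ k h.1 ≤ ENNReal.ofReal (‖h‖ / ε k) := by
  have h1 : ENNReal.ofReal (ε k) * nablaSup g₀ k h.1 ≤ epsNorm g₀ ε h.1 :=
    ENNReal.le_tsum (f := fun k => ENNReal.ofReal (ε k) * nablaSup g₀ k h.1) k
  have hε : (0 : ℝ) < ε k := (ε k).2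
  have h2 : ENNReal.ofReal ‖h‖ = epsNorm g₀ ε h.1 := ENNReal.ofReal_toReal (CEps.epsNorm_ne_top h)
  rw [ENNReal.ofReal_div_of_pos hε, ENNReal.le_div_iff_mul_le (Or.inl (by simpa using hε))
    (Or.inl ENNReal.ofReal_ne_top), mul_comm, h2]
  exact h1

theorem CEps.abs_chartIter_le (h : CEps g₀ ε) (k : ℕ) {p : M} {y : Eu n}
    (hy : y ∈ (chartAt (Eu n) p).target) (v : Fin (2 + k) → Eu n)
    (hv : ∀ i, coordForm g₀.toBilin p y (v i) (v i) ≤ 1) :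
    |chartIter g₀ k h.1 p y v| ≤ ‖h‖ / ε k := by
  have h1 := (enorm_chartIter_le g₀ k h.1 hy v hv).trans (CEps.nablaSup_le h k)
  have hε : (0 : ℝ) < ε k := (ε k).2
  rw [← ofReal_norm, ENNReal.ofReal_le_ofReal_iff (by positivity)] at h1
  exact h1

/-- Vectors of Euclidean length at most $R$ become $g_0$-unit vectors after division by a constant
that works for all nearby points; homogeneity of the tensor restores the factor. -/
theorem CEps.exists_bound (k : ℕ) (p : M) {y₀ : Eu n} (hy₀ : y₀ ∈ (chartAt (Eu n) p).target)
    (R : ℝ) : ∃ N ∈ 𝓝 y₀, ∃ C, 0 ≤ C ∧ ∀ y ∈ N, y ∈ (chartAt (Eu n) p).target ∧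
      ∀ v : Fin (2 + k) → Eu n, (∀ i, ‖v i‖ ≤ R) →
        ∀ h : CEps g₀ ε, |chartIter g₀ k h.1 p y v| ≤ C * ‖h‖ := by
  set G := coordForm g₀.toBilin p
  have hcont : ContinuousAt (fun y => ‖G y‖) y₀ :=
    (((contDiffOn_coordForm g₀.toBilin p).continuousOn).continuousAt
      ((chartAt (Eu n) p).open_target.mem_nhds hy₀)).norm
  -- Near $y_0$ one has $G_y(v,v)\le(\|G_{y_0}\|+1)R^2\le K\le K^2$, the last because $K\ge1$.
  set K : ℝ := 1 + (‖G y₀‖ + 1) * R ^ 2 with hK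
  have hK1 : 1 ≤ K := by rw [hK]; nlinarith [norm_nonneg (G y₀), sq_nonneg R]
  have hε : (0 : ℝ) < ε k := (ε k).2
  refine ⟨_, Filter.inter_mem (hcont.eventually_lt continuousAt_const (lt_add_one _))
    ((chartAt (Eu n) p).open_target.mem_nhds hy₀), K ^ (2 + k) / ε k, by positivity,
    fun y hy => ⟨hy.2, fun v hv h => ?_⟩⟩
  have hscale : v = fun i => K • ((K⁻¹ : ℝ) • v i) := by
    funext i
    rw [smul_smul, mul_inv_cancel₀ (by positivity), one_smul]
  have hle : ∀ i, G y ((K⁻¹ : ℝ) • v i) ((K⁻¹ : ℝ) • v i) ≤ 1 := by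
    intro i
    simp only [map_smul, smul_apply, smul_eq_mul]
    have h1 : G y (v i) (v i) ≤ ‖G y‖ * ‖v i‖ * ‖v i‖ :=
      (Real.le_norm_self _).trans (ContinuousLinearMap.le_opNorm₂ _ _ _)
    have h2 : ‖G y‖ * ‖v i‖ * ‖v i‖ ≤ (‖G y₀‖ + 1) * R ^ 2 := by
      rw [mul_assoc, ← sq]
      have h3 : ‖G y‖ < ‖G y₀‖ + 1 := hy.1
      exact mul_le_mul h3.le (pow_le_pow_left₀ (norm_nonneg _) (hv i) 2) (by positivity)
        (by positivity)
    have h3 : G y (v i) (v i) ≤ K * K := by nlinarith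
    calc K⁻¹ * (K⁻¹ * G y (v i) (v i)) ≤ K⁻¹ * (K⁻¹ * (K * K)) := by gcongr
      _ = 1 := by field_simp
  have h1 := CEps.abs_chartIter_le h k hy.2 _ hle
  rw [hscale, (isTensor_chartIter g₀ k h.1 p hy.2).smul, abs_mul, abs_of_nonneg (by positivity)]
  calc K ^ (2 + k) * _ ≤ K ^ (2 + k) * (‖h‖ / ε k) := by gcongr
    _ = _ := by ring

/-- The functional `h ↦ (∇ᵏ h)(v)` at a point of the chart at `p`. -/
def evIter (g₀ : Metric n M) (ε : ℕ → Ioi (0 : ℝ)) (k : ℕ) (p : M)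
    (z : Eu n × (Fin (2 + k) → Eu n)) : CEps g₀ ε →L[ℝ] ℝ := by
  classical
  exact if hz : z.1 ∈ (chartAt (Eu n) p).target then
    LinearMap.mkContinuousOfExistsBound
      { toFun := fun h : CEps g₀ ε => chartIter g₀ k h.1 p z.1 z.2
        map_add' := fun h h' => chartIter_add g₀ k h.1 h'.1 p hz z.2
        map_smul' := fun c h => chartIter_smul g₀ k c h.1 p hz z.2 } (by
      obtain ⟨N, hN, C, -, h⟩ := CEps.exists_bound (g₀ := g₀) (ε := ε) k p hz ‖z.2‖
      exact ⟨C, (h _ (mem_of_mem_nhds hN)).2 z.2 fun i => norm_le_pi_norm _ i⟩)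
  else 0

theorem evIter_apply {k : ℕ} {p : M} {z : Eu n × (Fin (2 + k) → Eu n)}
    (hz : z.1 ∈ (chartAt (Eu n) p).target) (h : CEps g₀ ε) :
    evIter g₀ ε k p z h = chartIter g₀ k h.1 p z.1 z.2 := by
  unfold evIter
  rw [dif_pos hz]
  rfl

/-- A family of functionals that is pointwise differentiable, with norm continuous derivative, is
differentiable. -/
theorem hasFDerivAt_of_pointwise {Z V : Type*} [NormedAddCommGroup Z] [NormedSpace ℝ Z]
    [NormedAddCommGroup V] [NormedSpace ℝ V] {S : Set Z} (hS : IsOpen S) {F : Z → V →L[ℝ] ℝ}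
    {D : Z → Z →L[ℝ] V →L[ℝ] ℝ} (hD : ContinuousOn D S)
    (h : ∀ z ∈ S, ∀ v, HasFDerivAt (fun z => F z v) ((ContinuousLinearMap.apply ℝ ℝ v).comp (D z)) z)
    {z : Z} (hz : z ∈ S) : HasFDerivAt F (D z) z := by
  rw [hasFDerivAt_iff_isLittleO, Asymptotics.isLittleO_iff]
  intro c hc
  have h1 := (hD.continuousAt (hS.mem_nhds hz)).eventually (Metric.ball_mem_nhds (D z) hc)
  obtain ⟨r, hr, hball⟩ := Metric.mem_nhds_iff.1 (Filter.inter_mem h1 (hS.mem_nhds hz))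
  filter_upwards [Metric.ball_mem_nhds z hr] with z' hz'
  refine ContinuousLinearMap.opNorm_le_bound _ (by positivity) fun v => ?_
  have h2 := (convex_ball z r).norm_image_sub_le_of_norm_hasFDerivWithin_le'
    (f := fun z => F z v) (φ := (ContinuousLinearMap.apply ℝ ℝ v).comp (D z)) (C := c * ‖v‖)
    (fun x hx => (h x (hball hx).2 v).hasFDerivWithinAt) (fun x hx => ?_)
    (Metric.mem_ball_self hr) hz'
  · refine le_trans (le_of_eq ?_) (h2.trans (le_of_eq (by ring)))
    simp
  · refine ContinuousLinearMap.opNorm_le_bound _ (by positivity) fun w => ?_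
    have h3 : ‖D x - D z‖ ≤ c := by
      have := (hball hx).1
      rw [mem_ofPred_eq, dist_eq_norm] at this
      exact this.le
    calc ‖(D x - D z) w v‖ ≤ ‖D x - D z‖ * ‖w‖ * ‖v‖ := ContinuousLinearMap.le_opNorm₂ _ _ _
      _ ≤ c * ‖w‖ * ‖v‖ := by gcongr
      _ = c * ‖v‖ * ‖w‖ := by ring

end Coordinates

/-! ### The Banach space of bilinear forms -/

section Banach

variable {n : ℕ} {M : Type*} [TopologicalSpace M] [ChartedSpace (Eu n) M] [IsManifold (𝓡 n) ∞ M]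
  {g₀ : Metric n M} {ε : ℕ → Ioi (0 : ℝ)}

theorem hasFDerivAt_evIter_apply (k : ℕ) (p : M) {z : Eu n × (Fin (2 + k) → Eu n)}
    (hz : z.1 ∈ (chartAt (Eu n) p).target) (h : CEps g₀ ε) :
    HasFDerivAt (fun z => evIter g₀ ε k p z h)
      (fderiv ℝ (fun z : Eu n × (Fin (2 + k) → Eu n) => chartIter g₀ k h.1 p z.1 z.2) z) z := by
  have h1 := ((jointSmooth_chartIter g₀ k h.1 p).differentiableAt (chartAt (Eu n) p).open_target
    hz z.2).hasFDerivAt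
  refine h1.congr_of_eventuallyEq ?_
  filter_upwards [(chartAt (Eu n) p).open_target.preimage continuous_fst |>.mem_nhds hz] with z hz
    using evIter_apply hz h

/-- The derivative of `evIter` in a given direction. -/
def evIterDir (g₀ : Metric n M) (ε : ℕ → Ioi (0 : ℝ)) (k : ℕ) (p : M)
    (z d : Eu n × (Fin (2 + k) → Eu n)) : CEps g₀ ε →L[ℝ] ℝ :=
  evIter g₀ ε (k + 1) p (z.1, Fin.cons d.1 z.2) + ∑ i, evIter g₀ ε k p
    (z.1, Function.update z.2 i (christoffel (coordForm g₀.toBilin p) z.1 d.1 (z.2 i) + d.2 i))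

theorem evIterDir_apply (k : ℕ) (p : M) {z : Eu n × (Fin (2 + k) → Eu n)}
    (hz : z.1 ∈ (chartAt (Eu n) p).target) (d : Eu n × (Fin (2 + k) → Eu n)) (h : CEps g₀ ε) :
    evIterDir g₀ ε k p z d h =
      fderiv ℝ (fun z : Eu n × (Fin (2 + k) → Eu n) => chartIter g₀ k h.1 p z.1 z.2) z d := by
  have h1 := fderiv_joint (chartAt (Eu n) p).open_target (coordForm g₀.toBilin p)
    (jointSmooth_chartIter g₀ k h.1 p) (fun y hy => isTensor_chartIter g₀ k h.1 p hy) hz z.2 d.2 d.1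
  refine Eq.trans ?_ h1.symm
  simp only [evIterDir, add_apply, _root_.sum_apply]
  rw [evIter_apply (by exact hz)]
  congr 1
  exact Finset.sum_congr rfl fun i _ => evIter_apply (by exact hz) h

/-- The derivative of `evIter`. -/
def evIterDeriv (g₀ : Metric n M) (ε : ℕ → Ioi (0 : ℝ)) (k : ℕ) (p : M)
    (z : Eu n × (Fin (2 + k) → Eu n)) :
    Eu n × (Fin (2 + k) → Eu n) →L[ℝ] CEps g₀ ε →L[ℝ] ℝ := by
  classical
  exact if hz : z.1 ∈ (chartAt (Eu n) p).target then
    LinearMap.toContinuousLinearMap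
      { toFun := evIterDir g₀ ε k p z
        map_add' := fun d d' => by
          ext h; simp only [evIterDir_apply k p hz, map_add, add_apply]
        map_smul' := fun c d => by
          ext h; simp only [evIterDir_apply k p hz, map_smul, smul_apply, RingHom.id_apply] }
  else 0

theorem evIterDeriv_apply (k : ℕ) (p : M) {z : Eu n × (Fin (2 + k) → Eu n)}
    (hz : z.1 ∈ (chartAt (Eu n) p).target) (d : Eu n × (Fin (2 + k) → Eu n)) :
    evIterDeriv g₀ ε k p z d = evIterDir g₀ ε k p z d := by
  unfold evIterDeriv
  rw [dif_pos hz]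
  rfl

theorem isOpen_chartDomain (k : ℕ) (p : M) : IsOpen
    ((chartAt (Eu n) p).target ×ˢ (univ : Set (Fin (2 + k) → Eu n))) :=
  (chartAt (Eu n) p).open_target.prod isOpen_univ

/-- The derivative of $\nabla^kh$ in coordinates involves only $\nabla^{k+1}h$ and $\nabla^kh$, both
bounded by a multiple of $\|h\|$ locally uniformly. So the functional is locally Lipschitz in the
dual norm. -/
theorem continuousOn_evIter (k : ℕ) (p : M) : ContinuousOn (evIter g₀ ε k p)
    ((chartAt (Eu n) p).target ×ˢ univ) := by
  refine fun z₀ hz₀ => ContinuousAt.continuousWithinAt ?_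
  set G := coordForm g₀.toBilin p
  have hT := (chartAt (Eu n) p).open_target
  set R := ‖z₀.2‖ + 1 with hR
  obtain ⟨r, hr, hrT⟩ := Metric.nhds_basis_closedBall.mem_iff.1 (hT.mem_nhds hz₀.1)
  have hcpt : IsCompact (Metric.closedBall z₀.1 r ×ˢ (Metric.closedBall (0 : Eu n) 1 ×ˢ
      Metric.closedBall (0 : Eu n) R)) :=
    (isCompact_closedBall _ _).prod ((isCompact_closedBall _ _).prod (isCompact_closedBall _ _))
  have hΓ := (contDiffOn_christoffel hT (contDiffOn_coordForm g₀.toBilin p)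
    (fun y hy => g₀.coordForm_isInvertible p hy)).continuousOn.mono
    (show Metric.closedBall z₀.1 r ×ˢ (Metric.closedBall (0 : Eu n) 1 ×ˢ
      Metric.closedBall (0 : Eu n) R) ⊆ _ from fun z hz => ⟨hrT hz.1, mem_univ _⟩)
  obtain ⟨A, hA⟩ := hcpt.exists_bound_of_continuousOn hΓ
  -- Near $z_0$ and for unit directions, the vectors entering $\nabla^{k+1}h$ have length at most
  -- $R+1$, those entering $\nabla^kh$ at most $\max(R,A+1)$, where $A$ bounds the Christoffel
  -- symbols.
  obtain ⟨N₁, hN₁, C₁, hC₁, h1⟩ := CEps.exists_bound (g₀ := g₀) (ε := ε) (k + 1) p hz₀.1 (R + 1)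
  obtain ⟨N₂, hN₂, C₂, hC₂, h2⟩ := CEps.exists_bound (g₀ := g₀) (ε := ε) k p hz₀.1 (max R (A + 1))
  obtain ⟨s, hs, hsN⟩ := Metric.mem_nhds_iff.1 (Filter.inter_mem (Filter.inter_mem hN₁ hN₂)
    (Metric.closedBall_mem_nhds z₀.1 hr))
  set s' := min s 1
  have hs' : 0 < s' := lt_min hs one_pos
  set C := C₁ + (2 + k) * C₂
  have hbound : ∀ z ∈ Metric.ball z₀ s', z.1 ∈ (chartAt (Eu n) p).target ∧ ∀ h : CEps g₀ ε,
      ‖fderiv ℝ (fun z : Eu n × (Fin (2 + k) → Eu n) => chartIter g₀ k h.1 p z.1 z.2) z‖ ≤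
        C * ‖h‖ := by
    intro z hz
    have hz1 : z.1 ∈ Metric.ball z₀.1 s := by
      rw [Metric.mem_ball] at hz ⊢
      exact (le_max_left _ _).trans_lt (hz.trans_le (min_le_left _ _))
    have hz2 : ‖z.2‖ ≤ R := by
      have : dist z.2 z₀.2 < 1 := (le_max_right _ _).trans_lt
        ((Metric.mem_ball.1 hz).trans_le (min_le_right _ _))
      rw [dist_eq_norm] at this
      have := norm_le_norm_add_norm_sub' z.2 z₀.2
      linarith
    obtain ⟨⟨hm1, hm2⟩, hm3⟩ := hsN hz1
    refine ⟨(h1 _ hm1).1, fun h => ?_⟩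
    refine ContinuousLinearMap.opNorm_le_of_unit_norm (by positivity) fun d hd => ?_
    rw [← evIterDir_apply k p (h1 _ hm1).1 d h]
    have hd1 : ‖d.1‖ ≤ 1 := (norm_fst_le d).trans hd.le
    have hd2 : ‖d.2‖ ≤ 1 := (norm_snd_le d).trans hd.le
    simp only [evIterDir, add_apply, _root_.sum_apply]
    refine (norm_add_le _ _).trans ?_
    have e1 : ‖evIter g₀ ε (k + 1) p (z.1, Fin.cons d.1 z.2) h‖ ≤ C₁ * ‖h‖ := by
      rw [evIter_apply (by exact (h1 _ hm1).1)]
      refine (h1 _ hm1).2 _ (fun i => ?_) h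
      refine Fin.cases ?_ (fun j => ?_) i
      · simp only [Fin.cons_zero]; linarith [norm_nonneg z₀.2]
      · simp only [Fin.cons_succ]
        exact (norm_le_pi_norm z.2 j).trans (by linarith)
    have e2 : ∀ i, ‖evIter g₀ ε k p (z.1, Function.update z.2 i
        (christoffel G z.1 d.1 (z.2 i) + d.2 i)) h‖ ≤ C₂ * ‖h‖ := by
      intro i
      rw [evIter_apply (by exact (h1 _ hm1).1)]
      refine (h2 _ hm2).2 _ (fun j => ?_) h
      rcases eq_or_ne j i with rfl | hj
      · simp only [Function.update_self]
        refine le_max_of_le_right ((norm_add_le _ _).trans (add_le_add ?_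
          ((norm_le_pi_norm _ _).trans hd2)))
        exact hA (z.1, d.1, z.2 j) ⟨hm3, mem_closedBall_zero_iff.2 hd1,
          mem_closedBall_zero_iff.2 ((norm_le_pi_norm z.2 j).trans hz2)⟩
      · simp only [Function.update_of_ne hj]
        exact le_max_of_le_left ((norm_le_pi_norm _ _).trans hz2)
    have e3 := norm_sum_le_of_le Finset.univ fun i _ => e2 i
    refine (add_le_add e1 e3).trans (le_of_eq ?_)
    simp [C]
    ring
  have hlip : ∀ z ∈ Metric.ball z₀ s', ‖evIter g₀ ε k p z - evIter g₀ ε k p z₀‖ ≤ C * ‖z - z₀‖ := by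
    intro z hz
    refine ContinuousLinearMap.opNorm_le_bound _ (by positivity) fun h => ?_
    have := (convex_ball z₀ s').norm_image_sub_le_of_norm_hasFDerivWithin_le
      (f := fun z => evIter g₀ ε k p z h)
      (fun x hx => (hasFDerivAt_evIter_apply k p (hbound x hx).1 h).hasFDerivWithinAt)
      (fun x hx => (hbound x hx).2 h) (Metric.mem_ball_self hs') hz
    exact this.trans (le_of_eq (by ring))
  rw [ContinuousAt, tendsto_iff_norm_sub_tendsto_zero]
  refine squeeze_zero' (Eventually.of_forall fun _ => norm_nonneg _)
    (eventually_of_mem (Metric.ball_mem_nhds z₀ hs') hlip) ?_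
  have : Tendsto (fun z => C * ‖z - z₀‖) (𝓝 z₀) (𝓝 (C * ‖z₀ - z₀‖)) :=
    (by fun_prop : Continuous fun z => C * ‖z - z₀‖).tendsto z₀
  simpa using this

theorem contDiff_prodMk_cons {k : ℕ} {r : ℕ∞ω} (a : Eu n) : ContDiff ℝ r
    (fun z : Eu n × (Fin (2 + k) → Eu n) =>
      (z.1, (Fin.cons a z.2 : Fin (2 + (k + 1)) → Eu n))) := by
  refine contDiff_fst.prodMk (contDiff_pi.2 fun j => ?_)
  refine Fin.cases (motive := fun j : Fin (2 + k + 1) => ContDiff ℝ r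
    fun z : Eu n × (Fin (2 + k) → Eu n) => (Fin.cons a z.2 : Fin (2 + k + 1) → Eu n) j)
    contDiff_const (fun l => ?_) j
  exact (contDiff_apply ℝ (Eu n) l).comp contDiff_snd

theorem contDiffOn_evIter_cons {r : ℕ∞ω} (p : M) (k : ℕ)
    (hk : ContDiffOn ℝ r (evIter g₀ ε (k + 1) p) ((chartAt (Eu n) p).target ×ˢ univ)) (a : Eu n) :
    ContDiffOn ℝ r (fun z : Eu n × (Fin (2 + k) → Eu n) =>
      evIter g₀ ε (k + 1) p (z.1, Fin.cons a z.2)) ((chartAt (Eu n) p).target ×ˢ univ) := by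
  have h1 : ContDiffOn ℝ r (fun z : Eu n × (Fin (2 + k) → Eu n) =>
      (z.1, (Fin.cons a z.2 : Fin (2 + (k + 1)) → Eu n)))
      ((chartAt (Eu n) p).target ×ˢ univ) := (contDiff_prodMk_cons a).contDiffOn
  exact hk.comp h1 fun z hz => ⟨hz.1, mem_univ _⟩

theorem contDiffOn_evIterDir {m : ℕ∞ω} (hm : m ≤ (∞ : ℕ∞ω)) (p : M)
    (hk : ∀ k, ContDiffOn ℝ m (evIter g₀ ε k p) ((chartAt (Eu n) p).target ×ˢ univ)) (k : ℕ)
    (d : Eu n × (Fin (2 + k) → Eu n)) :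
    ContDiffOn ℝ m (fun z => evIterDir g₀ ε k p z d) ((chartAt (Eu n) p).target ×ˢ univ) := by
  have happ : ∀ j : Fin (2 + k), ContDiff ℝ m (fun z : Eu n × (Fin (2 + k) → Eu n) => z.2 j) :=
    fun j => (contDiff_apply ℝ (Eu n) j).comp contDiff_snd
  have h2 : ∀ i, ContDiffOn ℝ m (fun z : Eu n × (Fin (2 + k) → Eu n) => evIter g₀ ε k p
      (z.1, Function.update z.2 i (christoffel (coordForm g₀.toBilin p) z.1 d.1 (z.2 i) + d.2 i)))
      ((chartAt (Eu n) p).target ×ˢ univ) := by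
    intro i
    refine (hk k).comp (contDiff_fst.contDiffOn.prodMk (contDiffOn_pi.2 fun j => ?_))
      fun z hz => ⟨hz.1, mem_univ _⟩
    rcases eq_or_ne j i with rfl | hj
    · simp only [Function.update_self]
      have h3 := (contDiffOn_christoffel (chartAt (Eu n) p).open_target
        (contDiffOn_coordForm g₀.toBilin p)
        (fun y hy => g₀.coordForm_isInvertible p hy)).of_le hm
      have h4 : ContDiff ℝ m (fun z : Eu n × (Fin (2 + k) → Eu n) => (z.1, d.1, z.2 j)) :=
        contDiff_fst.prodMk (contDiff_const.prodMk (happ j))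
      have h5 := h3.comp h4.contDiffOn (s := (chartAt (Eu n) p).target ×ˢ univ)
        fun z hz => ⟨hz.1, mem_univ _⟩
      exact h5.add contDiffOn_const
    · simp only [Function.update_of_ne hj]
      exact (happ j).contDiffOn
  exact (contDiffOn_evIter_cons p k (hk (k + 1)) d.1).add (ContDiffOn.sum fun i _ => h2 i)

theorem contDiffOn_evIterDeriv {m : ℕ∞ω} (hm : m ≤ (∞ : ℕ∞ω)) (p : M)
    (hk : ∀ k, ContDiffOn ℝ m (evIter g₀ ε k p) ((chartAt (Eu n) p).target ×ˢ univ)) (k : ℕ) :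
    ContDiffOn ℝ m (evIterDeriv g₀ ε k p) ((chartAt (Eu n) p).target ×ˢ univ) :=
  contDiffOn_clm_apply.2 fun d => (contDiffOn_evIterDir hm p hk k d).congr
    fun _ hz => evIterDeriv_apply k p hz.1 d

theorem hasFDerivAt_evIter (k : ℕ) (p : M) {z : Eu n × (Fin (2 + k) → Eu n)}
    (hz : z.1 ∈ (chartAt (Eu n) p).target) :
    HasFDerivAt (evIter g₀ ε k p) (evIterDeriv g₀ ε k p z) z := by
  have hc := (contDiffOn_evIterDeriv (g₀ := g₀) (ε := ε) (m := 0) (by simp) p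
    (fun k => contDiffOn_zero.2 (continuousOn_evIter k p)) k).continuousOn
  refine hasFDerivAt_of_pointwise (isOpen_chartDomain k p) hc (fun z hz h => ?_) ⟨hz, mem_univ _⟩
  refine (hasFDerivAt_evIter_apply k p hz.1 h).congr_fderiv ?_
  refine ContinuousLinearMap.ext fun d => ?_
  rw [← evIterDir_apply k p hz.1, ← evIterDeriv_apply k p hz.1]
  rfl

/-- A bootstrap over all $k$ at once: the derivative of the functional of order $k$ is made of those
of orders $k+1$ and $k$, so $C^m$ for every $k$ gives $C^{m+1}$ for every $k$. -/
theorem contDiffOn_evIter (k : ℕ) (p : M) :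
    ContDiffOn ℝ ∞ (evIter g₀ ε k p) ((chartAt (Eu n) p).target ×ˢ univ) := by
  rw [contDiffOn_infty]
  intro m
  induction m generalizing k with
  | zero => exact contDiffOn_zero.2 (continuousOn_evIter k p)
  | succ m ih =>
    push_cast
    rw [contDiffOn_succ_iff_hasFDerivWithinAt_of_uniqueDiffOn (isOpen_chartDomain k p).uniqueDiffOn]
    exact ⟨by simp, evIterDeriv g₀ ε k p, contDiffOn_evIterDeriv
      (WithTop.coe_le_coe.2 (le_top (a := (m : ℕ∞)))) p ih k,
      fun z hz => (hasFDerivAt_evIter k p hz.1).hasFDerivWithinAt⟩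

/-- The coordinates of `h` depend smoothly on the point and on `h`. -/
theorem contDiffOn_coordForm_joint (p : M) :
    ContDiffOn ℝ ∞ (fun z : Eu n × CEps g₀ ε => coordForm z.2.1 p z.1)
      ((chartAt (Eu n) p).target ×ˢ univ) := by
  refine contDiffOn_clm_apply.2 fun u => contDiffOn_clm_apply.2 fun v => ?_
  have h1 : ContDiffOn ℝ ∞ (fun z : Eu n × CEps g₀ ε => evIter g₀ ε 0 p (z.1, ![u, v]) z.2)
      ((chartAt (Eu n) p).target ×ˢ univ) := by
    refine ContDiffOn.clm_apply ((contDiffOn_evIter 0 p).comp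
      (contDiff_fst.prodMk contDiff_const).contDiffOn fun z hz => ⟨hz.1, mem_univ _⟩)
      contDiff_snd.contDiffOn
  refine h1.congr fun z hz => ?_
  rw [evIter_apply hz.1]
  rfl

/-- The map `h ↦ coordForm h p y`. -/
def coordL (g₀ : Metric n M) (ε : ℕ → Ioi (0 : ℝ)) (p : M) {y : Eu n}
    (hy : y ∈ (chartAt (Eu n) p).target) : CEps g₀ ε →L[ℝ] Eu n →L[ℝ] Eu n →L[ℝ] ℝ :=
  ⟨{ toFun := fun h => coordForm h.1 p y
     map_add' := fun h k => congrFun (coordForm_add h.1 k.1 p) y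
     map_smul' := fun c h => congrFun (coordForm_smul c h.1 p) y },
    (ContinuousOn.comp_continuous
      (g := fun z : Eu n × CEps g₀ ε => coordForm z.2.1 p z.1) (contDiffOn_coordForm_joint p).continuousOn
      (Continuous.prodMk_right y) fun _ => ⟨hy, mem_univ _⟩)⟩

/-- The form with prescribed coordinates. -/
theorem exists_bilinForm (c : M → Eu n →L[ℝ] Eu n →L[ℝ] ℝ)
    (L : M → Eu n → Eu n →L[ℝ] Eu n →L[ℝ] ℝ)
    (hL : ∀ p, ContDiffOn ℝ ∞ (L p) (chartAt (Eu n) p).target)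
    (hc : ∀ p, ∀ m ∈ (chartAt (Eu n) p).source, ∀ u v,
      L p (chartAt (Eu n) p m) u v = c m (toCoord m m (ofCoord p m u)) (toCoord m m (ofCoord p m v))) :
    ∃ h : BilinForm n M, ∀ p, ∀ y ∈ (chartAt (Eu n) p).target, coordForm h p y = L p y := by
  let s : ∀ m : M, TangentSpace (𝓡 n) m →L[ℝ] TangentSpace (𝓡 n) m →L[ℝ] ℝ := fun m =>
    (ContinuousLinearMap.precomp ℝ (toCoord m m)).comp
      ((c m).comp (toCoord m m))
  have hs : ∀ m u v, s m u v = c m (toCoord m m u) (toCoord m m v) := fun m u v => rfl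
  have key : ∀ p, ∀ m ∈ (chartAt (Eu n) p).source,
      (trivializationAt (Eu n →L[ℝ] Eu n →L[ℝ] ℝ)
        (fun q : M => TangentSpace (𝓡 n) q →L[ℝ] TangentSpace (𝓡 n) q →L[ℝ] ℝ) p
        ⟨m, s m⟩).2 = L p (chartAt (Eu n) p m) := by
    intro p m hm
    have hb : m ∈ (trivializationAt (Eu n) (TangentSpace (𝓡 n)) p).baseSet := by simpa using hm
    ext u v
    rw [hom_trivializationAt_apply]
    have := inCoordinates_apply_eq₂ (F₃ := ℝ) (E₃ := Trivial M ℝ) (𝕜 := ℝ)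
      (ϕ := s m) (v := u) (w := v) hb hb (mem_univ _)
    refine this.trans ?_
    rw [hc p m hm]
    simp only [Trivial.fiberBundle_trivializationAt', Trivial.linearMapAt_trivialization,
      LinearMap.id_coe, id_eq]
    rw [← Trivialization.symmL_apply (R := ℝ) _ hb, ← Trivialization.symmL_apply (R := ℝ) _ hb]
    rfl
  have hsm : ContMDiff (𝓡 n) ((𝓡 n).prod 𝓘(ℝ, Eu n →L[ℝ] Eu n →L[ℝ] ℝ)) ∞
      (fun m => TotalSpace.mk' (Eu n →L[ℝ] Eu n →L[ℝ] ℝ) (E := fun q : M =>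
        TangentSpace (𝓡 n) q →L[ℝ] TangentSpace (𝓡 n) q →L[ℝ] ℝ) m (s m)) := by
    intro p
    set e := trivializationAt (Eu n →L[ℝ] Eu n →L[ℝ] ℝ)
      (fun q : M => TangentSpace (𝓡 n) q →L[ℝ] TangentSpace (𝓡 n) q →L[ℝ] ℝ) p with he
    have hb : e.baseSet = (chartAt (Eu n) p).source := by
      simp [he, hom_trivializationAt_baseSet]
    have h1 : ContMDiffOn (𝓡 n) ((𝓡 n).prod 𝓘(ℝ, Eu n →L[ℝ] Eu n →L[ℝ] ℝ)) ∞
      (fun m => TotalSpace.mk' (Eu n →L[ℝ] Eu n →L[ℝ] ℝ) (E := fun q : M =>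
        TangentSpace (𝓡 n) q →L[ℝ] TangentSpace (𝓡 n) q →L[ℝ] ℝ) m (s m)) e.baseSet := by
      refine (e.contMDiffOn_section_baseSet_iff (IB := 𝓡 n) (n := ∞)).2 ?_
      rw [hb]
      refine ContMDiffOn.congr (f := L p ∘ chartAt (Eu n) p) ?_ fun m hm => key p m hm
      exact (contMDiffOn_iff_contDiffOn.2 (hL p)).comp
        (contMDiffOn_chart (I := 𝓡 n) (n := ∞) (x := p)) fun m hm => (chartAt (Eu n) p).map_source hm
    refine h1.contMDiffAt (e.open_baseSet.mem_nhds ?_)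
    rw [hb]
    exact mem_chart_source _ p
  refine ⟨⟨s, hsm⟩, fun p y hy => ?_⟩
  have hm : (chartAt (Eu n) p).symm y ∈ (chartAt (Eu n) p).source := (chartAt (Eu n) p).map_target hy
  have hb' : (chartAt (Eu n) p).symm y ∈ (trivializationAt (Eu n →L[ℝ] Eu n →L[ℝ] ℝ)
    (fun q : M => TangentSpace (𝓡 n) q →L[ℝ] TangentSpace (𝓡 n) q →L[ℝ] ℝ) p).baseSet := by
    simpa [hom_trivializationAt_baseSet] using hm
  unfold coordForm
  rw [Trivialization.continuousLinearMapAt_apply_of_mem ℝ _ hb']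
  refine (key p _ hm).trans ?_
  rw [(chartAt (Eu n) p).right_inv hy]

end Banach

/-! ### Completeness, openness of the set of metrics, and metrics in coordinates. -/

section Complete

variable {n : ℕ} {M : Type*} [TopologicalSpace M] [ChartedSpace (Eu n) M] [IsManifold (𝓡 n) ∞ M]
  {g₀ : Metric n M} {ε : ℕ → Ioi (0 : ℝ)}

/-- Suprema are lower semicontinuous under pointwise limits, and Fatou's lemma for the counting
measure handles the sum over $k$. -/
theorem epsNorm_le_liminf {w : BilinForm n M} {W : ℕ → BilinForm n M}
    (h : ∀ k p v, Tendsto (fun l => nablaAt g₀ k (W l) p v) atTop (𝓝 (nablaAt g₀ k w p v))) :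
    epsNorm g₀ ε w ≤ liminf (fun l => epsNorm g₀ ε (W l)) atTop := by
  have h1 : ∀ k, nablaSup g₀ k w ≤ liminf (fun l => nablaSup g₀ k (W l)) atTop := by
    intro k
    refine iSup_le fun p => iSup_le fun v => iSup_le fun hv => ?_
    rw [((h k p v).enorm).liminf_eq.symm]
    refine liminf_le_liminf (Eventually.of_forall fun l => ?_)
    exact le_iSup_of_le p (le_iSup_of_le v (le_iSup_of_le hv le_rfl))
  unfold epsNorm
  simp only [← lintegral_count]
  refine le_trans (lintegral_mono fun k => ?_) (lintegral_liminf_le fun l => measurable_of_countable _)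
  rw [ENNReal.liminf_const_mul_of_ne_top ENNReal.ofReal_ne_top]
  gcongr
  exact h1 k

/-- `evIter` is differentiable with values in the dual space, so the bounded functional $\Lambda$
commutes with differentiation in the base point. -/
theorem chartIter_limit {Λ : StrongDual ℝ (StrongDual ℝ (CEps g₀ ε))}
    {w : BilinForm n M} (hw : ∀ p, ∀ y ∈ (chartAt (Eu n) p).target, ∀ a b,
      coordForm w p y a b = Λ (evIter g₀ ε 0 p (y, ![a, b]))) (k : ℕ) (p : M) :
    ∀ y ∈ (chartAt (Eu n) p).target, ∀ v, chartIter g₀ k w p y v = Λ (evIter g₀ ε k p (y, v)) := by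
  induction k with
  | zero =>
    intro y hy v
    have : v = ![v 0, v 1] := by
      funext i; fin_cases i <;> rfl
    rw [this]
    exact hw p y hy _ _
  | succ k ih =>
    intro y hy v
    change covDeriv (coordForm g₀.toBilin p) (chartIter g₀ k w p) y v = _
    unfold covDeriv
    have h1 : HasFDerivAt (fun z => Λ (evIter g₀ ε k p (z, Fin.tail v)))
        (Λ.comp ((evIterDeriv g₀ ε k p (y, Fin.tail v)).comp
          (ContinuousLinearMap.inl ℝ _ _))) y :=
      Λ.hasFDerivAt.comp y (HasFDerivAt.comp (g := evIter g₀ ε k p) y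
        (hasFDerivAt_evIter k p (z := (y, Fin.tail v)) hy)
        (hasFDerivAt_prodMk_left (𝕜 := ℝ) (E := Eu n) (F := Fin (2 + k) → Eu n) y (Fin.tail v)))
    have h2 : (fun z => chartIter g₀ k w p z (Fin.tail v)) =ᶠ[𝓝 y]
        fun z => Λ (evIter g₀ ε k p (z, Fin.tail v)) := by
      filter_upwards [(chartAt (Eu n) p).open_target.mem_nhds hy] with z hz using ih z hz _
    rw [h2.fderiv_eq, h1.fderiv]
    simp only [ContinuousLinearMap.comp_apply, ContinuousLinearMap.inl_apply]
    rw [evIterDeriv_apply k p (by exact hy), evIterDir, map_add, map_sum]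
    simp only [Pi.zero_apply, add_zero, ih y hy, Fin.cons_self_tail]
    exact add_sub_cancel_right _ _

theorem CEps.symm (h : CEps g₀ ε) (p : M) (u v : TangentSpace (𝓡 n) p) : h.1 p u v = h.1 p v u :=
  h.2.1 p u v

theorem CEps.coordForm_symm (h : CEps g₀ ε) {p : M} {y : Eu n}
    (hy : y ∈ (chartAt (Eu n) p).target) (u v : Eu n) :
    coordForm h.1 p y u v = coordForm h.1 p y v u := by
  rw [coordForm_apply _ _ hy, coordForm_apply _ _ hy]
  exact CEps.symm h _ _ _

theorem nablaAt_sub (k : ℕ) (h h' : BilinForm n M) (p : M) (v : Fin (2 + k) → Eu n) :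
    nablaAt g₀ k (h - h') p v = nablaAt g₀ k h p v - nablaAt g₀ k h' p v := by
  have := nablaAt_add g₀ k (h - h') h' p v
  rw [sub_add_cancel] at this
  linarith

/-- The limit form is found by evaluating a limit $\Lambda$ in the bidual on the functionals
`evIter`. Smoothness of `evIter` makes this form smooth and makes all its covariant derivatives the
pointwise limits. Fatou's lemma applied to $u_l-u_m$ as $l\to\infty$ then gives convergence in norm.
-/
theorem completeSpace_CEps : CompleteSpace (CEps g₀ ε) := by
  refine Metric.complete_of_cauchySeq_tendsto fun u hu => ?_
  -- A dual space is complete whether or not the space itself is, so the argument is not circular.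
  obtain ⟨Λ, hΛ⟩ := cauchySeq_tendsto_of_complete
    ((NormedSpace.inclusionInDoubleDual ℝ (CEps g₀ ε)).uniformContinuous.comp_cauchySeq hu)
  have hlim : ∀ ℓ : CEps g₀ ε →L[ℝ] ℝ, Tendsto (fun m => ℓ (u m)) atTop (𝓝 (Λ ℓ)) := fun ℓ =>
    ((ContinuousLinearMap.apply ℝ ℝ ℓ).continuous.tendsto Λ).comp hΛ
  have hL : ∀ p : M, ∀ y : Eu n, ∃ L : Eu n →L[ℝ] Eu n →L[ℝ] ℝ, y ∈ (chartAt (Eu n) p).target →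
      Tendsto (fun m => coordForm (u m).1 p y) atTop (𝓝 L) := by
    intro p y
    by_cases hy : y ∈ (chartAt (Eu n) p).target
    · obtain ⟨L, h⟩ := cauchySeq_tendsto_of_complete ((coordL g₀ ε p hy).uniformContinuous.comp_cauchySeq hu)
      exact ⟨L, fun _ => h⟩
    · exact ⟨0, fun h => absurd h hy⟩
  choose L hL using hL
  have hLa : ∀ p, ∀ y ∈ (chartAt (Eu n) p).target, ∀ a b,
      Tendsto (fun m => coordForm (u m).1 p y a b) atTop (𝓝 (L p y a b)) := fun p y hy a b =>
    ((ContinuousLinearMap.apply ℝ ℝ b).continuous.tendsto _).comp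
      (((ContinuousLinearMap.apply ℝ (Eu n →L[ℝ] ℝ) a).continuous.tendsto _).comp (hL p y hy))
  have hLΛ : ∀ p, ∀ y ∈ (chartAt (Eu n) p).target, ∀ a b,
      L p y a b = Λ (evIter g₀ ε 0 p (y, ![a, b])) := fun p y hy a b =>
    tendsto_nhds_unique (hLa p y hy a b)
      ((hlim (evIter g₀ ε 0 p (y, ![a, b]))).congr fun m => evIter_apply (by exact hy) (u m))
  obtain ⟨w, hw⟩ := exists_bilinForm (fun m : M => L m (chartAt (Eu n) m m)) L (fun p => by
      refine contDiffOn_clm_apply.2 fun a => contDiffOn_clm_apply.2 fun b => ?_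
      refine ContDiffOn.congr (f := fun y => Λ (evIter g₀ ε 0 p (y, ![a, b]))) ?_
        fun y hy => hLΛ p y hy a b
      exact Λ.contDiff.comp_contDiffOn ((contDiffOn_evIter 0 p).comp
        (contDiff_id.prodMk contDiff_const).contDiffOn fun y hy => ⟨hy, mem_univ _⟩))
    (fun p m hm a b => by
      refine tendsto_nhds_unique (hLa p _ ((chartAt (Eu n) p).map_source hm) a b)
        ((hLa m _ (mem_chart_target _ m) _ _).congr fun l => ?_)
      rw [coordForm_chart _ hm, apply_eq_coordForm _ (mem_chart_source (Eu n) m)])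
  have hiter := chartIter_limit (Λ := Λ) (w := w) (g₀ := g₀) fun p y hy a b => by
    rw [hw p y hy]; exact hLΛ p y hy a b
  have hnabla : ∀ k p v, Tendsto (fun l => nablaAt g₀ k (u l).1 p v) atTop
      (𝓝 (nablaAt g₀ k w p v)) := by
    intro k p v
    have h1 : nablaAt g₀ k w p v = _ := hiter k p _ (mem_chart_target _ p) v
    rw [h1]
    exact (hlim _).congr fun l => evIter_apply (mem_chart_target _ p) (u l)
  have hsymm : ∀ p a b, w p a b = w p b a := by
    intro p a b
    rw [apply_eq_coordForm w (mem_chart_source (Eu n) p),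
      apply_eq_coordForm w (mem_chart_source (Eu n) p), hw p _ (mem_chart_target _ p)]
    refine tendsto_nhds_unique (hLa p _ (mem_chart_target _ p) _ _)
      ((hLa p _ (mem_chart_target _ p) _ _).congr fun l => ?_)
    exact CEps.coordForm_symm (u l) (mem_chart_target _ p) _ _
  have hdist : ∀ δ > 0, ∃ N, ∀ m ≥ N, epsNorm g₀ ε (w - (u m).1) ≤ ENNReal.ofReal δ := by
    intro δ hδ
    obtain ⟨N, hN⟩ := Metric.cauchySeq_iff.1 hu δ hδ
    refine ⟨N, fun m hm => ?_⟩
    refine (epsNorm_le_liminf (g₀ := g₀) (ε := ε) (W := fun l => (u l).1 - (u m).1)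
      fun k p v => ?_).trans ?_
    · simp only [nablaAt_sub]
      exact (hnabla k p v).sub_const _
    · refine liminf_le_of_le (by isBoundedDefault) fun b hb => ?_
      obtain ⟨l, hl, hlN⟩ := (hb.and (eventually_ge_atTop N)).exists
      refine hl.trans ?_
      have h1 : ENNReal.ofReal ‖u l - u m‖ = epsNorm g₀ ε (u l - u m).1 :=
        ENNReal.ofReal_toReal (CEps.epsNorm_ne_top _)
      refine h1.symm.le.trans (ENNReal.ofReal_le_ofReal ?_)
      rw [← dist_eq_norm]
      exact (hN l hlN m hm).le
  obtain ⟨N, hN⟩ := hdist 1 one_pos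
  have hmem : w - (u N).1 ∈ CEps g₀ ε := ⟨fun p a b => by
    change w p a b - (u N).1 p a b = w p b a - (u N).1 p b a
    rw [hsymm, CEps.symm (u N)], (hN N le_rfl).trans_lt ENNReal.ofReal_lt_top⟩
  have hwmem : w ∈ CEps g₀ ε := by
    have := (CEps g₀ ε).add_mem hmem (u N).2
    rwa [sub_add_cancel] at this
  refine ⟨⟨w, hwmem⟩, Metric.tendsto_atTop.2 fun δ hδ => ?_⟩
  obtain ⟨N, hN⟩ := hdist (δ / 2) (by positivity)
  refine ⟨N, fun m hm => ?_⟩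
  rw [dist_comm, dist_eq_norm]
  have h1 : ‖(⟨w, hwmem⟩ : CEps g₀ ε) - u m‖ = (epsNorm g₀ ε (w - (u m).1)).toReal := rfl
  rw [h1]
  have := ENNReal.toReal_mono ENNReal.ofReal_ne_top (hN m hm)
  rw [ENNReal.toReal_ofReal (by positivity)] at this
  linarith

/-- The term $k=0$ of the norm, extended by homogeneity from $g_0$-unit vectors. It makes uniform
positivity an open condition. -/
theorem CEps.abs_apply_le (h : CEps g₀ ε) (p : M) (v : TangentSpace (𝓡 n) p) :
    |h.1 p v v| ≤ ‖h‖ / ε 0 * g₀.inner p v v := by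
  have hp := mem_chart_source (Eu n) p
  set u := toCoord p p v
  have h1 : g₀.inner p v v = coordForm g₀.toBilin p (chartAt (Eu n) p p) u u :=
    apply_eq_coordForm g₀.toBilin hp v v
  rw [apply_eq_coordForm h.1 hp, h1]
  change |coordForm h.1 p (chartAt (Eu n) p p) u u| ≤ _
  rcases eq_or_ne u 0 with hu | hu
  · simp [hu]
  · have hs := g₀.coordForm_pos p (mem_chart_target _ p) hu
    set s := coordForm g₀.toBilin p (chartAt (Eu n) p p) u u
    have h2 := CEps.abs_chartIter_le h 0 (mem_chart_target _ p)
      (fun _ => (Real.sqrt s)⁻¹ • u) (fun i => by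
        simp only [map_smul, smul_apply, smul_eq_mul]
        rw [← mul_assoc, ← mul_inv, Real.mul_self_sqrt hs.le]
        exact (inv_mul_cancel₀ hs.ne').le)
    have h3 : chartIter g₀ 0 h.1 p (chartAt (Eu n) p p) (fun _ => (Real.sqrt s)⁻¹ • u) =
        s⁻¹ * coordForm h.1 p (chartAt (Eu n) p p) u u := by
      change coordForm h.1 p (chartAt (Eu n) p p) ((Real.sqrt s)⁻¹ • u) ((Real.sqrt s)⁻¹ • u) = _
      simp only [map_smul, smul_apply, smul_eq_mul]
      rw [← mul_assoc, ← mul_inv, Real.mul_self_sqrt hs.le]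
    rw [h3, abs_mul, abs_of_pos (inv_pos.2 hs), inv_mul_le_iff₀ hs] at h2
    linarith

theorem metric_inner_nonneg (g : Metric n M) (p : M) (v : TangentSpace (𝓡 n) p) :
    0 ≤ g.inner p v v := by
  rcases eq_or_ne v 0 with rfl | hv
  · simp
  · exact (g.pos p v hv).le

theorem isOpen_metricSet : IsOpen (metricSet g₀ ε) := by
  rw [Metric.isOpen_iff]
  rintro h ⟨c, hc, hh⟩
  have hε : (0 : ℝ) < ε 0 := (ε 0).2
  refine ⟨c * ε 0 / 2, by positivity, fun k hk => ⟨c / 2, by positivity, fun p v => ?_⟩⟩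
  have h1 := CEps.abs_apply_le (k - h) p v
  have h2 : (k - h).1 p v v = k.1 p v v - h.1 p v v := rfl
  rw [h2] at h1
  have h3 : ‖k - h‖ / ε 0 ≤ c / 2 := by
    rw [div_le_iff₀ hε, ← dist_eq_norm]
    have := (Metric.mem_ball.1 hk).le
    linarith
  have h4 := mul_le_mul_of_nonneg_right h3 (metric_inner_nonneg g₀ p v)
  have h5 := hh p v
  have h6 := (abs_le.1 h1).1
  linarith

theorem isInvertible_of_pos {B : Eu n →L[ℝ] Eu n →L[ℝ] ℝ} (hB : ∀ u, u ≠ 0 → 0 < B u u) :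
    B.IsInvertible := by
  have hinj : Function.Injective B := by
    refine (injective_iff_map_eq_zero _).2 fun u hu => ?_
    by_contra hne
    have := hB u hne
    rw [hu] at this
    simp at this
  have hdim : Module.finrank ℝ (Eu n) = Module.finrank ℝ (Eu n →L[ℝ] ℝ) := by
    rw [← (LinearMap.toContinuousLinearMap (𝕜 := ℝ) (E := Eu n) (F' := ℝ)).finrank_eq]
    exact (Subspace.dual_finrank_eq).symm
  exact ⟨(LinearEquiv.ofInjectiveOfFinrankEq
    (B : Eu n →ₗ[ℝ] Eu n →L[ℝ] ℝ) hinj hdim).toContinuousLinearEquiv, by ext u v; rfl⟩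

/-- The metric `g₀ + h` in the chart at `p`. -/
def metricCoord (g₀ : Metric n M) {ε : ℕ → Ioi (0 : ℝ)} (p : M) (z : Eu n × CEps g₀ ε) :
    Eu n →L[ℝ] Eu n →L[ℝ] ℝ :=
  coordForm g₀.toBilin p z.1 + coordForm z.2.1 p z.1

theorem metricCoord_pos {p : M} {z : Eu n × CEps g₀ ε} (hy : z.1 ∈ (chartAt (Eu n) p).target)
    (hh : z.2 ∈ metricSet g₀ ε) {u : Eu n} (hu : u ≠ 0) : 0 < metricCoord g₀ p z u u := by
  obtain ⟨c, hc, h⟩ := hh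
  have h1 := g₀.coordForm_pos p hy hu
  have h2 := h ((chartAt (Eu n) p).symm z.1)
    ((trivializationAt (Eu n) (TangentSpace (𝓡 n)) p).symm ((chartAt (Eu n) p).symm z.1) u)
  have h3 := coordForm_apply g₀.toBilin p hy u u
  have h4 := coordForm_apply z.2.1 p hy u u
  have h5 : c * coordForm g₀.toBilin p z.1 u u ≤ metricCoord g₀ p z u u := by
    change _ ≤ coordForm g₀.toBilin p z.1 u u + coordForm z.2.1 p z.1 u u
    rw [h3, h4]
    exact h2
  exact (mul_pos hc h1).trans_le h5

theorem metricCoord_symm {p : M} {z : Eu n × CEps g₀ ε} (hy : z.1 ∈ (chartAt (Eu n) p).target)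
    (u v : Eu n) : metricCoord g₀ p z u v = metricCoord g₀ p z v u :=
  congrArg₂ (· + ·) (g₀.coordForm_symm hy u v) (CEps.coordForm_symm z.2 hy u v)

theorem metricCoord_isInvertible {p : M} {z : Eu n × CEps g₀ ε}
    (hy : z.1 ∈ (chartAt (Eu n) p).target) (hh : z.2 ∈ metricSet g₀ ε) :
    (metricCoord g₀ p z).IsInvertible :=
  isInvertible_of_pos fun _ hu => metricCoord_pos hy hh hu

theorem contDiffOn_metricCoord (p : M) :
    ContDiffOn ℝ ∞ (metricCoord g₀ (ε := ε) p) ((chartAt (Eu n) p).target ×ˢ univ) :=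
  ((contDiffOn_coordForm _ p).comp contDiff_fst.contDiffOn fun _ hz => hz.1).add
    (contDiffOn_coordForm_joint p)

end Complete

/-! ### Density -/

section Density

variable {n : ℕ} {M : Type*} [TopologicalSpace M] [ChartedSpace (Eu n) M] [IsManifold (𝓡 n) ∞ M]
  {g₀ : Metric n M}

theorem iterCovDeriv_eq_zero {U : Set (Eu n)} (hU : IsOpen U)
    {G B : Eu n → Eu n →L[ℝ] Eu n →L[ℝ] ℝ} (hB : ∀ y ∈ U, B y = 0) (k : ℕ) :
    ∀ y ∈ U, ∀ v, iterCovDeriv G B k y v = 0 := by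
  induction k with
  | zero => intro y hy v; simp [iterCovDeriv, hB y hy]
  | succ k ih =>
    intro y hy v
    have h1 : (fun z => iterCovDeriv G B k z (Fin.tail v)) =ᶠ[𝓝 y] fun _ => 0 := by
      filter_upwards [hU.mem_nhds hy] with z hz using ih z hz _
    simp only [iterCovDeriv, covDeriv, h1.fderiv_eq, ih y hy]
    simp

theorem exists_pos_lower_bound {C : Set (Eu n)} (hC : IsCompact C)
    {G : Eu n → Eu n →L[ℝ] Eu n →L[ℝ] ℝ} (hG : ContinuousOn G C)
    (hpos : ∀ y ∈ C, ∀ u, u ≠ 0 → 0 < G y u u) :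
    ∃ a > 0, ∀ y ∈ C, ∀ u, a * ‖u‖ ^ 2 ≤ G y u u := by
  -- The product is empty when $C$ is empty or $n=0$; then there is nothing to minimize.
  rcases (C ×ˢ Metric.sphere (0 : Eu n) 1).eq_empty_or_nonempty with he | hne
  · refine ⟨1, one_pos, fun y hy u => ?_⟩
    rcases eq_or_ne u 0 with rfl | hu
    · simp
    · exfalso
      have : (y, (‖u‖⁻¹ : ℝ) • u) ∈ C ×ˢ Metric.sphere (0 : Eu n) 1 :=
        ⟨hy, by simp [norm_smul, hu]⟩
      rw [he] at this
      exact this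
  · have hcont : ContinuousOn (fun z : Eu n × Eu n => G z.1 z.2 z.2)
        (C ×ˢ Metric.sphere (0 : Eu n) 1) :=
      ((hG.comp continuousOn_fst fun z hz => hz.1).clm_apply continuousOn_snd).clm_apply
        continuousOn_snd
    obtain ⟨z, hz, hmin⟩ := (hC.prod (isCompact_sphere (0 : Eu n) 1)).exists_isMinOn hne hcont
    have hz2 : z.2 ≠ 0 := by
      intro h0
      have := hz.2
      rw [h0] at this
      simp at this
    refine ⟨G z.1 z.2 z.2, hpos z.1 hz.1 z.2 hz2, fun y hy u => ?_⟩
    rcases eq_or_ne u 0 with rfl | hu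
    · simp
    · have h1 := hmin (show (y, (‖u‖⁻¹ : ℝ) • u) ∈ C ×ˢ Metric.sphere (0 : Eu n) 1 from
        ⟨hy, by simp [norm_smul, hu]⟩)
      rw [mem_ofPred_eq] at h1
      simp only [map_smul, smul_apply, smul_eq_mul] at h1
      have hu' : 0 < ‖u‖ := norm_pos_iff.2 hu
      calc G z.1 z.2 z.2 * ‖u‖ ^ 2 ≤ (‖u‖⁻¹ * (‖u‖⁻¹ * G y u u)) * ‖u‖ ^ 2 := by gcongr
        _ = G y u u := by field_simp

/-- A diagonal choice: $\varepsilon_k=2^{-k}/(1+\sum_{j\le k}a_{jk})$ dominates row $j$ from $k=j$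
on by a geometric series, and the finitely many earlier terms are finite. Any smaller sequence works
too. -/
theorem exists_summing_sequence (a : ℕ → ℕ → ℝ≥0∞) (ha : ∀ j k, a j k < ⊤) :
    ∃ ε₀ : ℕ → Ioi (0 : ℝ), ∀ ε ≤ ε₀, ∀ j, ∑' k, ENNReal.ofReal (ε k) * a j k < ⊤ := by
  let s : ℕ → ℝ := fun k => ∑ j ∈ Finset.range (k + 1), (a j k).toReal
  have hs : ∀ k, 0 ≤ s k := fun k => Finset.sum_nonneg fun j _ => ENNReal.toReal_nonneg
  refine ⟨fun k => ⟨(1 / 2) ^ k / (1 + s k), by have := hs k; exact mem_Ioi.2 (by positivity)⟩,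
    fun ε hε j => ?_⟩
  have hbound : ∀ k, ENNReal.ofReal (ε k) * a j k ≤
      (if k < j then ENNReal.ofReal (ε k) * a j k else 0) + ENNReal.ofReal ((1 / 2) ^ k) := by
    intro k
    split_ifs with hk
    · exact le_self_add
    · rw [zero_add, ← ENNReal.ofReal_toReal (ha j k).ne, ← ENNReal.ofReal_mul (ε k).2.le]
      refine ENNReal.ofReal_le_ofReal ?_
      have h1 : (a j k).toReal ≤ s k := Finset.single_le_sum (f := fun j => (a j k).toReal)
        (fun j _ => ENNReal.toReal_nonneg) (Finset.mem_range.2 (by omega))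
      have h2 : (ε k : ℝ) ≤ (1 / 2) ^ k / (1 + s k) := hε k
      have h3 := hs k
      calc (ε k : ℝ) * (a j k).toReal ≤ (1 / 2) ^ k / (1 + s k) * (1 + s k) := by
            gcongr; linarith
        _ = (1 / 2) ^ k := by field_simp
  refine (ENNReal.tsum_le_tsum hbound).trans_lt ?_
  rw [ENNReal.tsum_add]
  refine ENNReal.add_lt_top.2 ⟨?_, ?_⟩
  · rw [tsum_eq_sum (s := Finset.range j) fun k hk => if_neg (by simpa using hk)]
    refine ENNReal.sum_lt_top.2 fun k _ => ?_
    split_ifs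
    · exact ENNReal.mul_lt_top ENNReal.ofReal_lt_top (ha j k)
    · exact ENNReal.zero_lt_top
  · exact (summable_geometric_two.tsum_ofReal_lt_top)

/-- On the compact closure of $V$, inside one chart, $g_0$-unit vectors are bounded, so the
continuous function $\nabla^kS$ is bounded on them. Off the closure, $S$ vanishes on a neighbourhood
and so do all its derivatives. -/
theorem nablaSup_lt_top {V : Set M} {p : M} (hV : IsCompact (closure V))
    (hVp : closure V ⊆ (chartAt (Eu n) p).source) {S : BilinForm n M}
    (hS : ∀ m ∉ V, S m = 0) (k : ℕ) : nablaSup g₀ k S < ⊤ := by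
  set C := chartAt (Eu n) p '' closure V with hCdef
  have hC : IsCompact C := hV.image_of_continuousOn ((chartAt (Eu n) p).continuousOn.mono hVp)
  have hCt : C ⊆ (chartAt (Eu n) p).target := by
    rintro _ ⟨m, hm, rfl⟩
    exact (chartAt (Eu n) p).map_source (hVp hm)
  obtain ⟨a, ha, hlow⟩ := exists_pos_lower_bound hC
    ((contDiffOn_coordForm g₀.toBilin p).continuousOn.mono hCt)
    (fun y hy u hu => g₀.coordForm_pos p (hCt hy) hu)
  set R := Real.sqrt (1 / a)
  have hcpt : IsCompact (C ×ˢ (univ.pi fun _ : Fin (2 + k) => Metric.closedBall (0 : Eu n) R)) :=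
    hC.prod (isCompact_univ_pi fun _ => isCompact_closedBall _ _)
  obtain ⟨A, hA⟩ := hcpt.exists_bound_of_continuousOn
    ((jointSmooth_chartIter g₀ k S p).continuousOn.mono fun z hz => ⟨hCt hz.1, mem_univ _⟩)
  refine lt_of_le_of_lt (b := ENNReal.ofReal A) ?_ ENNReal.ofReal_lt_top
  refine iSup_le fun q => iSup_le fun v => iSup_le fun hv => ?_
  by_cases hq : q ∈ closure V
  · have hyt : chartAt (Eu n) q q ∈ (transition q p).source :=
      chart_mem_transition_source (mem_chart_source _ q) (hVp hq)
    have h1 : nablaAt g₀ k S q v = _ := chartIter_transition g₀ k S hyt v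
    have h2 : transition q p (chartAt (Eu n) q q) = chartAt (Eu n) p q := by
      rw [transition_apply, (chartAt (Eu n) q).left_inv (mem_chart_source _ q)]
    rw [h2] at h1
    have hqC : chartAt (Eu n) p q ∈ C := mem_image_of_mem _ hq
    rw [h1, ← ofReal_norm]
    refine ENNReal.ofReal_le_ofReal (hA (_, _) ⟨hqC, fun i _ => ?_⟩)
    rw [mem_closedBall_zero_iff]
    refine Real.le_sqrt_of_sq_le ?_
    rw [le_div_iff₀ ha, mul_comm]
    refine (hlow _ hqC _).trans ?_
    have := hv i
    rwa [coordForm_transition _ hyt, h2] at this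
  · set U := (chartAt (Eu n) q).target ∩ (chartAt (Eu n) q).symm ⁻¹' (closure V)ᶜ
    have hU : IsOpen U :=
      (chartAt (Eu n) q).isOpen_inter_preimage_symm isClosed_closure.isOpen_compl
    have hzero : ∀ y ∈ U, coordForm S q y = 0 := by
      intro y hy
      unfold coordForm
      rw [hS _ fun h => hy.2 (subset_closure h)]
      exact ContinuousLinearMap.map_zero _
    have h1 : nablaAt g₀ k S q v = 0 := iterCovDeriv_eq_zero hU hzero k _
      ⟨mem_chart_target _ q, by
        rw [mem_preimage, (chartAt (Eu n) q).left_inv (mem_chart_source _ q)]; exact hq⟩ v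
    rw [h1]
    simp

theorem exists_bilinForm_smul (f : M → ℝ) (hf : ContMDiff (𝓡 n) 𝓘(ℝ, ℝ) ∞ f) (S : BilinForm n M) :
    ∃ T : BilinForm n M, ∀ m u v, T m u v = f m * S m u v := by
  obtain ⟨T, hT⟩ := exists_bilinForm (fun m => f m • coordForm S m (chartAt (Eu n) m m))
    (fun p y => f ((chartAt (Eu n) p).symm y) • coordForm S p y) (fun p => by
      refine ContDiffOn.smul (f := fun y => f ((chartAt (Eu n) p).symm y)) ?_
        (contDiffOn_coordForm S p)
      rw [← contMDiffOn_iff_contDiffOn]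
      exact hf.comp_contMDiffOn (contMDiffOn_chart_symm (I := 𝓡 n) (n := ∞) (x := p)))
    (fun p m hm u v => by
      simp only [smul_apply, (chartAt (Eu n) p).left_inv hm]
      rw [coordForm_chart S hm, apply_eq_coordForm S (mem_chart_source (Eu n) m)])
  refine ⟨T, fun m u v => ?_⟩
  rw [apply_eq_coordForm T (mem_chart_source (Eu n) m), hT m _ (mem_chart_target _ m),
    apply_eq_coordForm S (mem_chart_source (Eu n) m)]
  simp only [smul_apply, smul_eq_mul, (chartAt (Eu n) m).left_inv (mem_chart_source _ m)]

/-- Symmetric forms vanishing outside `V`. -/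
def formsIn (V : Set M) : Set (BilinForm n M) :=
  {S | (∀ p u v, S p u v = S p v u) ∧ ∀ m ∉ V, S m = 0}

/-- The continuous maps from a compact subset of $\mathbb R^n$ to bilinear forms are a separable
metric space, and so is every subset. Hence a countable dense set can be taken among the coordinate
expressions of smooth forms supported in $V$. -/
theorem exists_countable_dense_formsIn (g₀ : Metric n M) {V : Set M} {p : M}
    (hV : IsCompact (closure V)) (hVp : closure V ⊆ (chartAt (Eu n) p).source) :
    ∃ D : Set (BilinForm n M), D.Countable ∧ D ⊆ formsIn V ∧ ∀ S ∈ formsIn V, ∀ δ > 0, ∃ T ∈ D,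
      ∀ m v, |T m v v - S m v v| ≤ δ * g₀.inner m v v := by
  set C := chartAt (Eu n) p '' closure V with hCdef
  have hC : IsCompact C := hV.image_of_continuousOn ((chartAt (Eu n) p).continuousOn.mono hVp)
  have hCt : C ⊆ (chartAt (Eu n) p).target := by
    rintro _ ⟨m, hm, rfl⟩
    exact (chartAt (Eu n) p).map_source (hVp hm)
  obtain ⟨a, ha, hlow⟩ := exists_pos_lower_bound hC
    ((contDiffOn_coordForm g₀.toBilin p).continuousOn.mono hCt)
    (fun y hy u hu => g₀.coordForm_pos p (hCt hy) hu)
  have : CompactSpace C := isCompact_iff_compactSpace.1 hC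
  let ι : formsIn (n := n) V → C(C, Eu n →L[ℝ] Eu n →L[ℝ] ℝ) := fun S =>
    ⟨fun y => coordForm S.1 p y,
      ((contDiffOn_coordForm S.1 p).continuousOn.mono hCt).domRestrict⟩
  have : SecondCountableTopology (range ι) := inferInstance
  obtain ⟨s, hs, hd⟩ := TopologicalSpace.exists_countable_dense (range ι)
  choose r hr using fun x : range ι => x.2
  refine ⟨(fun x => (r x).1) '' s, hs.image _, ?_, fun S hS δ hδ => ?_⟩
  · rintro _ ⟨x, -, rfl⟩
    exact (r x).2
  obtain ⟨x, hxs, hx⟩ := hd.exists_dist_lt (⟨ι ⟨S, hS⟩, mem_range_self _⟩ : range ι)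
    (mul_pos hδ ha)
  refine ⟨_, mem_image_of_mem _ hxs, fun m v => ?_⟩
  have hx' : dist (ι ⟨S, hS⟩) (ι (r x)) < δ * a := by rw [hr]; exact hx
  by_cases hm : m ∈ V
  · have hmp := hVp (subset_closure hm)
    have hyC : chartAt (Eu n) p m ∈ C := mem_image_of_mem _ (subset_closure hm)
    have h1 := ((ContinuousMap.dist_apply_le_dist (f := ι ⟨S, hS⟩) (g := ι (r x))
      ⟨_, hyC⟩).trans hx'.le)
    rw [dist_comm, dist_eq_norm] at h1
    change ‖coordForm (r x).1 p (chartAt (Eu n) p m) - coordForm S p (chartAt (Eu n) p m)‖ ≤ _ at h1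
    rw [apply_eq_coordForm _ hmp, apply_eq_coordForm S hmp]
    have h2 : g₀.inner m v v = coordForm g₀.toBilin p (chartAt (Eu n) p m) (toCoord p m v)
      (toCoord p m v) := apply_eq_coordForm g₀.toBilin hmp v v
    rw [h2]
    set u := toCoord p m v
    have h3 := ContinuousLinearMap.le_opNorm₂ (coordForm (r x).1 p (chartAt (Eu n) p m) -
      coordForm S p (chartAt (Eu n) p m)) u u
    refine h3.trans ?_
    calc _ ≤ δ * a * ‖u‖ * ‖u‖ := by gcongr
      _ = δ * (a * ‖u‖ ^ 2) := by ring
      _ ≤ _ := by gcongr; exact hlow _ hyC u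
  · rw [(r x).2.2 m hm, hS.2 m hm]
    simp only [_root_.zero_apply, sub_self, abs_zero]
    exact mul_nonneg hδ.le (metric_inner_nonneg g₀ m v)

variable [T2Space M] [SecondCountableTopology M]

theorem exists_basis_subset_chart {W : Set M} (hW : IsOpen W) {m : M} (hm : m ∈ W) :
    ∃ V ∈ TopologicalSpace.countableBasis M, m ∈ V ∧ closure V ⊆ W ∧ IsCompact (closure V) ∧
      closure V ⊆ (chartAt (Eu n) m).source := by
  have : LocallyCompactSpace M := ChartedSpace.locallyCompactSpace (Eu n) M
  obtain ⟨K, hK, hKs, hKc⟩ := local_compact_nhds (Filter.inter_mem (hW.mem_nhds hm)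
    ((chartAt (Eu n) m).open_source.mem_nhds (mem_chart_source _ m)))
  obtain ⟨V, hV, hmV, hVK⟩ := (TopologicalSpace.isBasis_countableBasis M).mem_nhds_iff.1 hK
  have hcl : closure V ⊆ K := closure_minimal hVK hKc.isClosed
  exact ⟨V, hV, hmV, fun x hx => (hKs (hcl hx)).1, hKc.of_isClosed_subset isClosed_closure hcl,
    fun x hx => (hKs (hcl hx)).2⟩

/-- `C^∞_ε` contains enough forms supported near every point. -/
def LocallyDense (g₀ : Metric n M) (ε : ℕ → Ioi (0 : ℝ)) : Prop :=
  ∀ W : Set M, IsOpen W → ∀ m ∈ W, ∃ V, IsOpen V ∧ m ∈ V ∧ closure V ⊆ W ∧ IsCompact (closure V) ∧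
    ∀ S ∈ formsIn (n := n) V, ∀ δ > 0, ∃ h : CEps g₀ ε, h.1 ∈ formsIn V ∧
      ∀ m v, |h.1 m v v - S m v v| ≤ δ * g₀.inner m v v

/-- Countably many relatively compact basis sets inside charts, each with a countable dense set of
forms, give one sequence of compactly supported forms. The diagonal choice of $\varepsilon^0$ gives
all of them finite norm. Only $M$ and $g_0$ enter. -/
theorem exists_locallyDense (g₀ : Metric n M) :
    ∃ ε₀ : ℕ → Ioi (0 : ℝ), ∀ ε ≤ ε₀, LocallyDense g₀ ε := by
  let 𝒱 : Set (Set M) := {V ∈ TopologicalSpace.countableBasis M | IsCompact (closure V) ∧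
    ∃ p : M, closure V ⊆ (chartAt (Eu n) p).source}
  have h𝒱 : 𝒱.Countable := (TopologicalSpace.countable_countableBasis M).mono fun V hV => hV.1
  choose! D hDc hDs hD using fun (V : Set M) (hV : V ∈ 𝒱) =>
    exists_countable_dense_formsIn g₀ hV.2.1 hV.2.2.choose_spec
  -- Zero is added to make the set nonempty, so that it can be enumerated by the natural numbers.
  have hcount : (insert 0 (⋃ V ∈ 𝒱, D V)).Countable := (h𝒱.biUnion hDc).insert 0
  obtain ⟨H, hH⟩ := hcount.exists_eq_range (insert_nonempty _ _)
  have hfin : ∀ j k, nablaSup g₀ k (H j) < ⊤ := by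
    intro j k
    have hj : H j ∈ insert 0 (⋃ V ∈ 𝒱, D V) := hH ▸ mem_range_self j
    rcases hj with hj | hj
    · rw [hj]
      have : nablaSup g₀ k (0 : BilinForm n M) = 0 := by
        refine ENNReal.iSup_eq_zero.2 fun p => ENNReal.iSup_eq_zero.2 fun v =>
          ENNReal.iSup_eq_zero.2 fun hv => ?_
        have := nablaAt_smul g₀ k 0 0 p v
        simp only [zero_smul, zero_mul] at this
        rw [this]
        simp
      rw [this]
      exact ENNReal.zero_lt_top
    · obtain ⟨V, hV, hjV⟩ := mem_iUnion₂.1 hj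
      exact nablaSup_lt_top hV.2.1 hV.2.2.choose_spec (hDs V hV hjV).2 k
  obtain ⟨ε₀, hε₀⟩ := exists_summing_sequence (fun j k => nablaSup g₀ k (H j)) hfin
  refine ⟨ε₀, fun ε hε W hW m hm => ?_⟩
  obtain ⟨V, hVb, hmV, hVW, hVc, hVs⟩ := exists_basis_subset_chart (n := n) hW hm
  have hV : V ∈ 𝒱 := ⟨hVb, hVc, m, hVs⟩
  refine ⟨V, TopologicalSpace.isOpen_of_mem_countableBasis hVb, hmV, hVW, hVc,
    fun S hS δ hδ => ?_⟩
  obtain ⟨T, hT, hTS⟩ := hD V hV S hS δ hδ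
  have hT' : T ∈ range H := hH ▸ mem_insert_of_mem _ (mem_biUnion hV hT)
  obtain ⟨j, rfl⟩ := hT'
  exact ⟨⟨H j, (hDs V hV hT).1, hε₀ ε hε j⟩, hDs V hV hT, hTS⟩

/-- With a partition of unity $f_i$ for a cover of $K$, each $f_i(g-g_0)$ is approximated by an
element of $C^\infty_\varepsilon$ with support in the same small set. With $\theta=\sum f_i$, the
sum is close to $g$ on $K$, where $\theta=1$, and elsewhere close to the convex combination
$(1-\theta)g_0+\theta g$, hence uniformly positive. -/
theorem LocallyDense.metricsDense {ε : ℕ → Ioi (0 : ℝ)} (hd : LocallyDense g₀ ε) :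
    MetricsDense g₀ ε := by
  classical
  intro g K hK δ hδ
  have : LocallyCompactSpace M := ChartedSpace.locallyCompactSpace (Eu n) M
  choose V hVo hmV _ hVc hV using fun m : M => hd univ isOpen_univ m (mem_univ m)
  obtain ⟨t, htK⟩ := hK.elim_nhds_subcover V fun m _ => (hVo m).mem_nhds (hmV m)
  obtain ⟨f, hf⟩ := SmoothPartitionOfUnity.exists_isSubordinate (𝓡 n) hK.isClosed
    (fun i : t => V i.1) (fun i => hVo i.1) (fun x hx => by
      obtain ⟨i, hi, hx⟩ := mem_iUnion₂.1 (htK.2 hx)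
      exact mem_iUnion.2 ⟨⟨i, hi⟩, hx⟩)
  have hcl : IsCompact (⋃ i : t, closure (V i.1)) := isCompact_iUnion fun i => hVc i.1
  obtain ⟨c, hc, hcg⟩ : ∃ c > 0, ∀ m ∈ ⋃ i : t, closure (V i.1), ∀ v,
      c * g₀.inner m v v ≤ g.inner m v v := by
    refine hcl.induction_on (p := fun A => ∃ c > 0, ∀ m ∈ A, ∀ v,
      c * g₀.inner m v v ≤ g.inner m v v) ⟨1, one_pos, by simp⟩ ?_ ?_ ?_
    · rintro A B hAB ⟨c, hc, h⟩
      exact ⟨c, hc, fun m hm => h m (hAB hm)⟩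
    · rintro A B ⟨c, hc, h⟩ ⟨c', hc', h'⟩
      refine ⟨min c c', lt_min hc hc', fun m hm v => ?_⟩
      have := metric_inner_nonneg g₀ m v
      rcases hm with hm | hm
      · exact (mul_le_mul_of_nonneg_right (min_le_left _ _) this).trans (h m hm v)
      · exact (mul_le_mul_of_nonneg_right (min_le_right _ _) this).trans (h' m hm v)
    · intro x _
      obtain ⟨V, hVb, hxV, -, hVc, hVs⟩ := exists_basis_subset_chart (n := n) isOpen_univ
        (mem_univ x)
      refine ⟨V, mem_nhdsWithin_of_mem_nhds
        ((TopologicalSpace.isOpen_of_mem_countableBasis hVb).mem_nhds hxV), ?_⟩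
      set C := chartAt (Eu n) x '' closure V
      have hC : IsCompact C :=
        hVc.image_of_continuousOn ((chartAt (Eu n) x).continuousOn.mono hVs)
      have hCt : C ⊆ (chartAt (Eu n) x).target := by
        rintro _ ⟨m, hm, rfl⟩
        exact (chartAt (Eu n) x).map_source (hVs hm)
      obtain ⟨a, ha, hlow⟩ := exists_pos_lower_bound hC
        ((contDiffOn_coordForm g.toBilin x).continuousOn.mono hCt)
        (fun y hy u hu => g.coordForm_pos x (hCt hy) hu)
      obtain ⟨A, hA⟩ := hC.exists_bound_of_continuousOn
        ((contDiffOn_coordForm g₀.toBilin x).continuousOn.mono hCt)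
      refine ⟨a / (|A| + 1), by positivity, fun m hm v => ?_⟩
      have hms := hVs (subset_closure hm)
      have hmC : chartAt (Eu n) x m ∈ C := mem_image_of_mem _ (subset_closure hm)
      have e1 : g₀.inner m v v = _ := apply_eq_coordForm g₀.toBilin hms v v
      have e2 : g.inner m v v = _ := apply_eq_coordForm g.toBilin hms v v
      rw [e1, e2]
      set u := toCoord x m v
      refine le_trans ?_ (hlow _ hmC u)
      have h3 := (Real.le_norm_self _).trans (ContinuousLinearMap.le_opNorm₂
        (coordForm g₀.toBilin x (chartAt (Eu n) x m)) u u)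
      have h4 : coordForm g₀.toBilin x (chartAt (Eu n) x m) u u ≤ (|A| + 1) * ‖u‖ ^ 2 := by
        refine h3.trans ?_
        rw [mul_assoc, ← sq]
        gcongr
        exact (hA _ hmC).trans (by linarith [le_abs_self A])
      calc a / (|A| + 1) * _ ≤ a / (|A| + 1) * ((|A| + 1) * ‖u‖ ^ 2) := by gcongr
        _ = a * ‖u‖ ^ 2 := by field_simp
  set N : ℝ := t.card + 1
  -- The total error is at most $\delta g_0$, as required on $K$, and at most half of the lower
  -- bound $\min(1,c)\,g_0$ of the convex combination. It is divided among the finitely many pieces.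
  set δ' := min δ (min 1 c / 2) / N with hδ'
  have hN : 0 < N := by positivity
  have hmin : 0 < min δ (min 1 c / 2) := lt_min hδ (half_pos (lt_min one_pos hc))
  have hδ'0 : 0 < δ' := div_pos hmin hN
  choose S hS using fun i : t => exists_bilinForm_smul (n := n) (f i) (f i).contMDiff
    (g.toBilin - g₀.toBilin)
  have hS' : ∀ i : t, ∀ m u v, S i m u v = f i m * (g.inner m u v - g₀.inner m u v) :=
    fun i m u v => hS i m u v
  have hSm : ∀ i : t, S i ∈ formsIn (V i.1) := fun i => ⟨fun p u v => by
      rw [hS', hS', g.symm, g₀.symm], fun m hm => by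
      have h0 : f i m = 0 := by
        by_contra hne
        exact hm (hf i (subset_tsupport _ hne))
      ext u v
      rw [hS', h0, zero_mul]
      rfl⟩
  choose h hh hhS using fun i : t => hV i.1 (S i) (hSm i) δ' hδ'0
  have hsum : ∀ m (v : TangentSpace (𝓡 n) m),
      (∑ i, h i : CEps g₀ ε).1 m v v = ∑ i, (h i).1 m v v := by
    intro m v
    have : ∀ s : Finset t, (∑ i ∈ s, h i : CEps g₀ ε).1 m v v = ∑ i ∈ s, (h i).1 m v v := by
      intro s
      induction s using Finset.induction_on with
      | empty => rfl
      | insert a s ha ih =>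
        rw [Finset.sum_insert ha, Finset.sum_insert ha, ← ih]
        rfl
    exact this Finset.univ
  have hcard : (Finset.univ : Finset t).card = t.card := by simp
  have hest : ∀ m (v : TangentSpace (𝓡 n) m),
      |(∑ i, h i : CEps g₀ ε).1 m v v - (∑ i, f i m) * (g.inner m v v - g₀.inner m v v)| ≤
        min δ (min 1 c / 2) * g₀.inner m v v := by
    intro m v
    rw [hsum, Finset.sum_mul, ← Finset.sum_sub_distrib]
    refine (Finset.abs_sum_le_sum_abs _ _).trans ?_
    refine (Finset.sum_le_sum (g := fun _ => δ' * g₀.inner m v v) fun i _ => by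
      have := hhS i m v; rwa [hS'] at this).trans ?_
    rw [Finset.sum_const, hcard, nsmul_eq_mul, ← mul_assoc]
    refine mul_le_mul_of_nonneg_right ?_ (metric_inner_nonneg g₀ m v)
    calc (t.card : ℝ) * δ' ≤ N * δ' := by gcongr; simp [N]
      _ = _ := by rw [hδ']; field_simp
  refine ⟨∑ i, h i, ⟨min 1 c / 2, half_pos (lt_min one_pos hc), fun m v => ?_⟩, fun m hm v => ?_⟩
  · have hg0 := metric_inner_nonneg g₀ m v
    by_cases hm : m ∈ ⋃ i : t, closure (V i.1)
    · have h1 := (abs_le.1 (hest m v)).1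
      have h2 := hcg m hm v
      have hθ1 : ∑ i, f i m ≤ 1 := by
        have := f.sum_le_one m
        rwa [finsum_eq_sum_of_fintype] at this
      have hθ0 : 0 ≤ ∑ i, f i m := Finset.sum_nonneg fun i _ => f.nonneg i m
      set θ := ∑ i, f i m
      have h3 : min δ (min 1 c / 2) * g₀.inner m v v ≤ min 1 c / 2 * g₀.inner m v v :=
        mul_le_mul_of_nonneg_right (min_le_right _ _) hg0
      have h4 : min 1 c * g₀.inner m v v ≤ g.inner m v v :=
        (mul_le_mul_of_nonneg_right (min_le_right _ _) hg0).trans h2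
      have h5 : min 1 c * g₀.inner m v v ≤ g₀.inner m v v :=
        (mul_le_mul_of_nonneg_right (min_le_left _ _) hg0).trans (one_mul _).le
      have h6 := mul_le_mul_of_nonneg_left h4 hθ0
      have h7 := mul_le_mul_of_nonneg_left h5 (sub_nonneg.2 hθ1)
      linarith
    · have h0 : (∑ i, h i : CEps g₀ ε).1 m v v = 0 := by
        rw [hsum]
        refine Finset.sum_eq_zero fun i _ => ?_
        rw [(hh i).2 m fun hmV => hm (mem_iUnion.2 ⟨i, subset_closure hmV⟩)]
        rfl
      rw [h0, add_zero]
      have : min 1 c / 2 ≤ 1 := by linarith [min_le_left 1 c]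
      nlinarith
  · have h1 := hest m v
    have h2 : ∑ i, f i m = 1 := by
      have := f.sum_eq_one hm
      rwa [finsum_eq_sum_of_fintype] at this
    rw [h2, one_mul] at h1
    have h3 : g₀.inner m v v + (∑ i, h i : CEps g₀ ε).1 m v v - g.inner m v v =
      (∑ i, h i : CEps g₀ ε).1 m v v - (g.inner m v v - g₀.inner m v v) := by ring
    rw [h3]
    exact h1.trans (mul_le_mul_of_nonneg_right (min_le_left _ _) (metric_inner_nonneg g₀ m v))

end Density

/-! ### The Hessian -/

section LinearAlgebra

theorem exists_eigenbasis {V : Type*} [AddCommGroup V] [Module ℝ V] [FiniteDimensional ℝ V] {n : ℕ}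
    (hn : Module.finrank ℝ V = n) (G : V →ₗ[ℝ] V →ₗ[ℝ] ℝ) (hGs : ∀ u v, G u v = G v u)
    (hGp : ∀ u, u ≠ 0 → 0 < G u u) (T : V →ₗ[ℝ] V) (hT : ∀ u v, G (T u) v = G u (T v)) :
    ∃ (b : Module.Basis (Fin n) ℝ V) (μ : Fin n → ℝ), (∀ i, T (b i) = μ i • b i) ∧
      ∀ i j, G (b i) (b j) = if i = j then 1 else 0 := by
  let core : InnerProductSpace.Core ℝ V :=
    { inner := fun u v => G u v
      conj_inner_symm := fun u v => by simp [hGs u v]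
      re_inner_nonneg := fun u => by
        rcases eq_or_ne u 0 with rfl | hu
        · simp
        · exact (hGp u hu).le
      add_left := fun u v w => by simp
      smul_left := fun u v r => by simp
      definite := fun u hu => by
        by_contra hne
        exact (hGp u hne).ne' hu }
  let _ : NormedAddCommGroup V := core.toNormedAddCommGroup
  let _ : InnerProductSpace ℝ V := InnerProductSpace.ofCore core.toCore
  have hsym : T.IsSymmetric := fun u v => hT u v
  refine ⟨(hsym.eigenvectorBasis hn).toBasis, hsym.eigenvalues hn, fun i => ?_, fun i j => ?_⟩
  · have := hsym.apply_eigenvectorBasis hn i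
    rw [OrthonormalBasis.coe_toBasis]
    exact this
  · have := orthonormal_iff_ite.1 (hsym.eigenvectorBasis hn).orthonormal i j
    rw [OrthonormalBasis.coe_toBasis]
    exact this

/-- $G^{-1}H$ is self-adjoint for the inner product $G$, so a $G$-orthonormal eigenbasis
diagonalizes it and $H$ simultaneously. By Sylvester's law of inertia the index is the number of
negative eigenvalues. -/
theorem exists_diagonalization {n : ℕ} {G H : Eu n →L[ℝ] Eu n →L[ℝ] ℝ}
    (hGs : ∀ u v, G u v = G v u) (hGp : ∀ u, u ≠ 0 → 0 < G u u) (hHs : ∀ u v, H u v = H v u)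
    (hnd : ∀ u, (∀ v, H u v = 0) → u = 0) :
    ∃ (Q : Eu n ≃L[ℝ] Eu n) (μ : Fin n → ℝ), (∀ i, μ i ≠ 0) ∧
      (∀ z i, Q.symm (G.inverse (H (Q z))) i = μ i * z i) ∧
      sSup {k | ∃ V : Submodule ℝ (Eu n), Module.finrank ℝ V = k ∧ ∀ v ∈ V, v ≠ 0 → H v v < 0} =
        (Finset.univ.filter fun i => μ i < 0).card := by
  classical
  have hinv := isInvertible_of_pos hGp
  let T : Eu n →ₗ[ℝ] Eu n := (G.inverse.comp H : Eu n →L[ℝ] Eu n)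
  have hTG : ∀ u v, G (T u) v = H u v := fun u v => by
    change G (G.inverse (H u)) v = _
    rw [hinv.self_apply_inverse]
  obtain ⟨b, μ, hb, hbG⟩ := exists_eigenbasis (V := Eu n) (n := n) (by simp)
    ((ContinuousLinearMap.coeLM ℝ).comp (G : Eu n →ₗ[ℝ] Eu n →L[ℝ] ℝ)) hGs hGp T
    (fun u v => by
      change G (T u) v = G u (T v)
      rw [hTG, hGs u, hTG, hHs])
  let Q : Eu n ≃L[ℝ] Eu n :=
    ((WithLp.linearEquiv 2 ℝ (Fin n → ℝ)).trans b.equivFun.symm).toContinuousLinearEquiv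
  have hQ : ∀ z, Q z = ∑ i, z i • b i := fun z => b.equivFun_symm_apply _
  have hTQ : ∀ z, T (Q z) = Q (WithLp.toLp 2 fun i => μ i * z i) := by
    intro z
    rw [hQ, hQ, map_sum]
    refine Finset.sum_congr rfl fun i _ => ?_
    rw [map_smul, hb, smul_smul, mul_comm]
  have hHQ : ∀ z w, H (Q z) (Q w) = ∑ i, μ i * z i * w i := by
    intro z w
    rw [← hTG, hTQ, hQ, hQ]
    simp only [map_sum, map_smul, _root_.sum_apply, smul_apply, smul_eq_mul]
    have hbG' : ∀ i j, G (b i) (b j) = if i = j then 1 else 0 := hbG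
    simp [hbG']
    refine Finset.sum_congr rfl fun i _ => by ring
  have hμ : ∀ i, μ i ≠ 0 := by
    intro i h0
    have : b i = 0 := hnd _ fun v => by
      rw [← hTG, hb, h0]; simp
    exact b.ne_zero i this
  refine ⟨Q, μ, hμ, fun z i => ?_, ?_⟩
  · change Q.symm (T (Q z)) i = _
    rw [hTQ, Q.symm_apply_apply]
  · refine IsGreatest.csSup_eq ⟨?_, ?_⟩
    -- The span of the eigenvectors with negative eigenvalue attains the number.
    · let ι : ({i // μ i < 0} → ℝ) →ₗ[ℝ] Eu n :=
        Q.toLinearMap.comp ((WithLp.linearEquiv 2 ℝ (Fin n → ℝ)).symm.toLinearMap.comp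
          (LinearMap.pi fun i => if h : μ i < 0 then LinearMap.proj ⟨i, h⟩ else 0))
      have hι : ∀ w, ι w = Q (WithLp.toLp 2 fun i => if h : μ i < 0 then w ⟨i, h⟩ else 0) := by
        intro w
        change Q _ = _
        congr 1
        ext i
        change (if h : μ i < 0 then LinearMap.proj ⟨i, h⟩ else (0 : ({i // μ i < 0} → ℝ) →ₗ[ℝ] ℝ)) w = _
        split_ifs with h
        · simp [h]
        · simp [h]
      have hinj : Function.Injective ι := by
        intro w w' h
        rw [hι, hι] at h
        have h1 := Q.injective h
        funext i
        have := congrArg (fun z : Eu n => z i.1) h1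
        simpa [i.2] using this
      refine ⟨LinearMap.range ι, ?_, ?_⟩
      · rw [LinearMap.finrank_range_of_inj hinj, Module.finrank_fintype_fun_eq_card,
          Fintype.card_subtype]
      · rintro _ ⟨w, rfl⟩ hw
        have hw0 : w ≠ 0 := by rintro rfl; simp at hw
        rw [hι, hHQ]
        obtain ⟨j, hj⟩ := Function.ne_iff.1 hw0
        have hle : ∀ i, μ i * (if h : μ i < 0 then w ⟨i, h⟩ else 0) *
            (if h : μ i < 0 then w ⟨i, h⟩ else 0) ≤ 0 := by
          intro i
          split_ifs with h
          · rw [mul_assoc]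
            exact mul_nonpos_of_nonpos_of_nonneg h.le (mul_self_nonneg _)
          · simp
        refine Finset.sum_neg' (fun i _ => hle i) ⟨j.1, Finset.mem_univ _, ?_⟩
        simp only [j.2, dif_pos]
        rw [mul_assoc]
        exact mul_neg_of_neg_of_pos j.2 (mul_self_pos.2 hj)
    · rintro _ ⟨V, rfl, hV⟩
      -- A negative definite subspace meets the nonnegative eigenspaces only in $0$, so it embeds
      -- into the negative coordinates.
      let pr : V →ₗ[ℝ] ({i // μ i < 0} → ℝ) :=
        LinearMap.pi fun i => (LinearMap.proj i.1).comp
          ((WithLp.linearEquiv 2 ℝ (Fin n → ℝ)).toLinearMap.comp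
            (Q.symm.toLinearMap.comp V.subtype))
      have hpr : ∀ v i, pr v i = Q.symm v i.1 := fun v i => rfl
      have hinj : Function.Injective pr := by
        refine (injective_iff_map_eq_zero pr).2 fun v hv => ?_
        by_contra hne
        have h1 := hV v v.2 (by simpa using hne)
        have h2 : (v : Eu n) = Q (Q.symm v) := (Q.apply_symm_apply _).symm
        rw [h2, hHQ] at h1
        refine absurd h1 (not_lt.2 (Finset.sum_nonneg fun i _ => ?_))
        rcases lt_or_ge (μ i) 0 with h | h
        · have : Q.symm (v : Eu n) i = 0 := by rw [← hpr v ⟨i, h⟩, hv]; rfl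
          simp [this]
        · rw [mul_assoc]
          exact mul_nonneg h (mul_self_nonneg _)
      have := LinearMap.finrank_le_finrank_of_injective hinj
      rwa [Module.finrank_fintype_fun_eq_card, Fintype.card_subtype] at this

theorem exists_positive_indices {n : ℕ} {μ : Fin n → ℝ} (hμ : ∀ i, μ i ≠ 0) {k : ℕ}
    (hk : k = n - (Finset.univ.filter fun i => μ i < 0).card) :
    ∃ e : Fin k → Fin n, Function.Injective e ∧ (∀ j, 0 < μ (e j)) ∧
      ∀ i, 0 < μ i → ∃ j, e j = i := by
  have hcard : (Finset.univ.filter fun i => 0 < μ i).card = k := by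
    have h1 := Finset.card_filter_add_card_filter_not (s := (Finset.univ : Finset (Fin n)))
      (fun i => μ i < 0)
    have h2 : (Finset.univ.filter fun i => ¬ μ i < 0) = Finset.univ.filter fun i => 0 < μ i :=
      Finset.filter_congr fun i _ => by
        rw [not_lt]; exact ⟨fun h => lt_of_le_of_ne h (hμ i).symm, le_of_lt⟩
    rw [h2, Finset.card_univ, Fintype.card_fin] at h1
    omega
  refine ⟨(Finset.univ.filter fun i => 0 < μ i).orderEmbOfFin hcard, ((Finset.univ.filter fun i => 0 < μ i).orderEmbOfFin hcard).injective,
    fun j => ?_, fun i hi => ?_⟩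
  · exact (Finset.mem_filter.1 (Finset.orderEmbOfFin_mem _ hcard j)).2
  · have : i ∈ Set.range ((Finset.univ.filter fun i => 0 < μ i).orderEmbOfFin hcard) := by
      rw [Finset.range_orderEmbOfFin]; simpa using hi
    exact this

end LinearAlgebra

/-! ### The gradient flow in coordinates -/

section Flow

variable {n : ℕ} {M : Type*} [TopologicalSpace M] [ChartedSpace (Eu n) M] [IsManifold (𝓡 n) ∞ M]
  {g₀ : Metric n M} {ε : ℕ → Ioi (0 : ℝ)} {f : M → ℝ}

/-- The negative gradient of `f` for the metric `g₀ + h`, in the chart at `p`. -/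
def field (g₀ : Metric n M) {ε : ℕ → Ioi (0 : ℝ)} (f : M → ℝ) (p : M) (z : Eu n × CEps g₀ ε) : Eu n :=
  -((metricCoord g₀ p z).inverse (fderiv ℝ (f ∘ (chartAt (Eu n) p).symm) z.1))

theorem contDiffOn_comp_chart_symm {F : Type*} [NormedAddCommGroup F] [NormedSpace ℝ F] {f : M → F}
    (hf : ContMDiff (𝓡 n) 𝓘(ℝ, F) ∞ f) (p : M) :
    ContDiffOn ℝ ∞ (f ∘ (chartAt (Eu n) p).symm) (chartAt (Eu n) p).target := by
  rw [← contMDiffOn_iff_contDiffOn]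
  exact hf.comp_contMDiffOn (contMDiffOn_chart_symm (I := 𝓡 n) (n := ∞) (x := p))

theorem contDiffOn_field (hf : ContMDiff (𝓡 n) 𝓘(ℝ, ℝ) ∞ f) (p : M) :
    ContDiffOn ℝ ∞ (field g₀ (ε := ε) f p) ((chartAt (Eu n) p).target ×ˢ metricSet g₀ ε) := by
  have h1 : ContDiffOn ℝ ∞ (fun z : Eu n × CEps g₀ ε => (metricCoord g₀ p z).inverse)
      ((chartAt (Eu n) p).target ×ˢ metricSet g₀ ε) := fun z hz =>
    (ContinuousLinearMap.IsInvertible.contDiffAt_map_inverse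
      (metricCoord_isInvertible hz.1 hz.2)).comp_contDiffWithinAt z
      (((contDiffOn_metricCoord p).mono fun z hz => ⟨hz.1, mem_univ _⟩) z hz)
  have h2 : ContDiffOn ℝ ∞ (fun z : Eu n × CEps g₀ ε =>
      fderiv ℝ (f ∘ (chartAt (Eu n) p).symm) z.1)
      ((chartAt (Eu n) p).target ×ˢ metricSet g₀ ε) :=
    ((contDiffOn_comp_chart_symm hf p).fderiv_of_isOpen (m := ∞) (chartAt (Eu n) p).open_target
      (by simp)).comp contDiff_fst.contDiffOn fun z hz => hz.1
  exact (h1.clm_apply h2).neg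

theorem metricCoord_field {p : M} {z : Eu n × CEps g₀ ε} (hy : z.1 ∈ (chartAt (Eu n) p).target)
    (hh : z.2 ∈ metricSet g₀ ε) (u : Eu n) :
    metricCoord g₀ p z (field g₀ f p z) u = -fderiv ℝ (f ∘ (chartAt (Eu n) p).symm) z.1 u := by
  unfold field
  rw [map_neg, (metricCoord_isInvertible hy hh).self_apply_inverse]
  rfl

theorem metricCoord_transition {p q : M} {z : Eu n × CEps g₀ ε}
    (hy : z.1 ∈ (transition p q).source) (u v : Eu n) :
    metricCoord g₀ p z u v = metricCoord g₀ q (transition p q z.1, z.2)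
      (fderiv ℝ (transition p q : Eu n → Eu n) z.1 u)
      (fderiv ℝ (transition p q : Eu n → Eu n) z.1 v) :=
  congrArg₂ (· + ·) (coordForm_transition _ hy u v) (coordForm_transition _ hy u v)

theorem differentiableAt_transition {p q : M} {y : Eu n} (hy : y ∈ (transition p q).source) :
    DifferentiableAt ℝ (transition p q : Eu n → Eu n) y :=
  ((contDiffOn_transition p q).contDiffAt
    ((transition p q).open_source.mem_nhds hy)).differentiableAt (by simp)

theorem fderiv_comp_transition {F : Type*} [NormedAddCommGroup F] [NormedSpace ℝ F] {f : M → F}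
    (hf : ContMDiff (𝓡 n) 𝓘(ℝ, F) ∞ f) {p q : M} {y : Eu n}
    (hy : y ∈ (transition p q).source) (u : Eu n) :
    fderiv ℝ (f ∘ (chartAt (Eu n) p).symm) y u =
      fderiv ℝ (f ∘ (chartAt (Eu n) q).symm) (transition p q y)
        (fderiv ℝ (transition p q : Eu n → Eu n) y u) := by
  have h1 : f ∘ (chartAt (Eu n) p).symm =ᶠ[𝓝 y]
      (f ∘ (chartAt (Eu n) q).symm) ∘ transition p q := by
    filter_upwards [(transition p q).open_source.mem_nhds hy] with z hz
    have := (mem_transition_source.1 hz).2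
    simp only [Function.comp_apply, transition_apply, (chartAt (Eu n) q).left_inv this]
  have h2 : DifferentiableAt ℝ (f ∘ (chartAt (Eu n) q).symm) (transition p q y) :=
    ((contDiffOn_comp_chart_symm hf q).contDiffAt ((chartAt (Eu n) q).open_target.mem_nhds
      ((chartAt (Eu n) q).map_source (mem_transition_source.1 hy).2))).differentiableAt (by simp)
  rw [h1.fderiv_eq, fderiv_comp y h2 (differentiableAt_transition hy)]
  rfl

theorem field_transition (hf : ContMDiff (𝓡 n) 𝓘(ℝ, ℝ) ∞ f) {p q : M} {z : Eu n × CEps g₀ ε}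
    (hy : z.1 ∈ (transition p q).source) (hh : z.2 ∈ metricSet g₀ ε) :
    fderiv ℝ (transition p q : Eu n → Eu n) z.1 (field g₀ f p z) =
      field g₀ f q (transition p q z.1, z.2) := by
  have hq : transition p q z.1 ∈ (chartAt (Eu n) q).target :=
    (chartAt (Eu n) q).map_source (mem_transition_source.1 hy).2
  apply (metricCoord_isInvertible (z := (transition p q z.1, z.2)) hq hh).injective
  ext w'
  obtain ⟨w, rfl⟩ := fderiv_transition_surjective hy w'
  rw [← metricCoord_transition hy, metricCoord_field (mem_transition_source.1 hy).1 hh,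
    metricCoord_field (z := (transition p q z.1, z.2)) hq hh, fderiv_comp_transition hf hy]

/-- `γ` is on `s` a continuous curve solving `γ' + ∇_g f ∘ γ = 0`, `g = g₀ + h`. -/
def IsFlow (f : M → ℝ) (h : CEps g₀ ε) (γ : ℝ → M) (s : Set ℝ) : Prop :=
  ContinuousOn γ s ∧ ∀ t ∈ s, ∀ p, γ t ∈ (chartAt (Eu n) p).source →
    HasDerivWithinAt (chartAt (Eu n) p ∘ γ) (field g₀ f p (chartAt (Eu n) p (γ t), h)) s t

/-- The field is intrinsic, so the equation need be checked in one chart around each point only. -/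
theorem hasDerivWithinAt_chart_change (hf : ContMDiff (𝓡 n) 𝓘(ℝ, ℝ) ∞ f) {h : CEps g₀ ε}
    (hh : h ∈ metricSet g₀ ε) {γ : ℝ → M} {s : Set ℝ} {t : ℝ}
    (hc : ContinuousWithinAt γ s t) (hts : t ∈ s) {p q : M}
    (hp : γ t ∈ (chartAt (Eu n) p).source) (hq : γ t ∈ (chartAt (Eu n) q).source)
    (hd : HasDerivWithinAt (chartAt (Eu n) p ∘ γ) (field g₀ f p (chartAt (Eu n) p (γ t), h)) s t) :
    HasDerivWithinAt (chartAt (Eu n) q ∘ γ) (field g₀ f q (chartAt (Eu n) q (γ t), h)) s t := by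
  have hsrc := chart_mem_transition_source hp hq
  have h1 := (differentiableAt_transition hsrc).hasFDerivAt.comp_hasDerivWithinAt t hd
  rw [field_transition hf (z := (chartAt (Eu n) p (γ t), h)) hsrc hh] at h1
  have h2 : transition p q (chartAt (Eu n) p (γ t)) = chartAt (Eu n) q (γ t) := by
    rw [transition_apply, (chartAt (Eu n) p).left_inv hp]
  simp only [h2] at h1
  refine h1.congr_of_eventuallyEq_of_mem ?_ hts
  filter_upwards [hc.preimage_mem_nhdsWithin ((chartAt (Eu n) p).open_source.mem_nhds hp)] with r hr
  simp only [Function.comp_apply, transition_apply, (chartAt (Eu n) p).left_inv hr]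

theorem IsFlow.mono {h : CEps g₀ ε} {γ : ℝ → M} {s s' : Set ℝ} (hγ : IsFlow f h γ s)
    (hs : s' ⊆ s) : IsFlow f h γ s' :=
  ⟨hγ.1.mono hs, fun t ht p hp => (hγ.2 t (hs ht) p hp).mono hs⟩

theorem IsFlow.congr {h : CEps g₀ ε} {γ γ' : ℝ → M} {s : Set ℝ} (hγ : IsFlow f h γ s)
    (hs : EqOn γ' γ s) : IsFlow f h γ' s := by
  refine ⟨hγ.1.congr hs, fun t ht p hp => ?_⟩
  rw [hs ht] at hp ⊢
  exact (hγ.2 t ht p hp).congr_of_mem (fun r hr => by simp [hs hr]) ht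

theorem isFlow_const {h : CEps g₀ ε} {x : M} (hx : field g₀ f x (chartAt (Eu n) x x, h) = 0)
    (hf : ContMDiff (𝓡 n) 𝓘(ℝ, ℝ) ∞ f) (hh : h ∈ metricSet g₀ ε) (s : Set ℝ) :
    IsFlow f h (fun _ => x) s := by
  refine ⟨continuousOn_const, fun t ht p hp => ?_⟩
  refine hasDerivWithinAt_chart_change hf hh (γ := fun _ => x) continuousWithinAt_const ht
    (mem_chart_source _ x) hp ?_
  rw [hx]
  exact hasDerivWithinAt_const ..

/-- At the junction the one-sided derivatives agree, because the equation prescribes both. -/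
theorem IsFlow.union {h : CEps g₀ ε} {γ : ℝ → M} {a b : ℝ} (hab : a ≤ b)
    (h1 : IsFlow f h γ (Icc a b)) (h2 : IsFlow f h γ (Ici b)) : IsFlow f h γ (Ici a) := by
  have hU : Icc a b ∪ Ici b = Ici a := Icc_union_Ici_eq_Ici hab
  refine ⟨?_, fun t ht p hp => ?_⟩
  · rw [← hU]
    exact h1.1.union_of_isClosed h2.1 isClosed_Icc isClosed_Ici
  · rcases lt_trichotomy t b with htb | rfl | htb
    · exact (h1.2 t ⟨ht, htb.le⟩ p hp).mono_of_mem_nhdsWithin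
        (mem_nhdsWithin.2 ⟨Iio b, isOpen_Iio, htb, fun r hr => ⟨hr.2, le_of_lt hr.1⟩⟩)
    · rw [← hU]
      exact (h1.2 t ⟨hab, le_rfl⟩ p hp).union (h2.2 t self_mem_Ici p hp)
    · exact (h2.2 t htb.le p hp).mono_of_mem_nhdsWithin
        (mem_nhdsWithin_of_mem_nhds (Ici_mem_nhds htb))

/-! #### Uniqueness -/

/-- Near $\gamma(t)$ the field is Lipschitz in a chart, and Grönwall's uniqueness theorem is applied
forward and backward from $t$. -/
theorem IsFlow.eventuallyEq (hf : ContMDiff (𝓡 n) 𝓘(ℝ, ℝ) ∞ f) {h : CEps g₀ ε}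
    (hh : h ∈ metricSet g₀ ε) {γ γ' : ℝ → M} {a t : ℝ} (hγ : IsFlow f h γ (Ici a))
    (hγ' : IsFlow f h γ' (Ici a)) (ht : a ≤ t) (he : γ t = γ' t) :
    ∀ᶠ s in 𝓝[Ici a] t, γ s = γ' s := by
  set p := γ t with hp
  have hps : γ t ∈ (chartAt (Eu n) p).source := mem_chart_source _ _
  set F : Eu n → Eu n := fun y => field g₀ f p (y, h)
  have hF : ContDiffAt ℝ 1 F (chartAt (Eu n) p (γ t)) := by
    have h1 : ContDiffOn ℝ ∞ F (chartAt (Eu n) p).target :=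
      (contDiffOn_field hf p).comp (contDiff_id.prodMk contDiff_const).contDiffOn
        fun y hy => ⟨hy, hh⟩
    exact (h1.contDiffAt ((chartAt (Eu n) p).open_target.mem_nhds
      ((chartAt (Eu n) p).map_source hps))).of_le (by simp)
  obtain ⟨K, B, hB, hlip⟩ := hF.exists_lipschitzOnWith
  have hnear : ∀ σ : ℝ → M, IsFlow f h σ (Ici a) → σ t = γ t → ∀ᶠ s in 𝓝[Ici a] t,
      σ s ∈ (chartAt (Eu n) p).source ∧ chartAt (Eu n) p (σ s) ∈ B := by
    intro σ hσ hσt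
    have h1 : ContinuousWithinAt σ (Ici a) t := hσ.1 t ht
    rw [← hσt] at hps hB
    exact (h1.eventually ((chartAt (Eu n) p).open_source.mem_nhds hps)).and
      (h1.eventually (((chartAt (Eu n) p).continuousAt hps) hB))
  have hev := (hnear γ hγ rfl).and (hnear γ' hγ' he.symm)
  obtain ⟨δ, hδ, hball⟩ := Metric.mem_nhdsWithin_iff.1 hev
  have hin : ∀ s ∈ Ici a, |s - t| < δ → (γ s ∈ (chartAt (Eu n) p).source ∧
      chartAt (Eu n) p (γ s) ∈ B) ∧ (γ' s ∈ (chartAt (Eu n) p).source ∧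
      chartAt (Eu n) p (γ' s) ∈ B) := fun s hs hst => hball ⟨by rwa [Metric.mem_ball, Real.dist_eq], hs⟩
  have hcont : ∀ σ : ℝ → M, IsFlow f h σ (Ici a) → ∀ s ∈ Ici a,
      σ s ∈ (chartAt (Eu n) p).source → ContinuousWithinAt (chartAt (Eu n) p ∘ σ) (Ici a) s :=
    fun σ hσ s hs hsrc => (hσ.2 s hs p hsrc).continuousWithinAt
  have heq : (chartAt (Eu n) p ∘ γ) t = (chartAt (Eu n) p ∘ γ') t := by
    simp only [Function.comp_apply, ← he]; rfl
  filter_upwards [inter_mem_nhdsWithin (Ici a) (Metric.ball_mem_nhds t (half_pos hδ))] with s hs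
  have hsδ : |s - t| < δ / 2 := by rw [← Real.dist_eq]; exact hs.2
  have hkey : (chartAt (Eu n) p ∘ γ) s = (chartAt (Eu n) p ∘ γ') s := by
    rcases le_total t s with hts | hts
    · have hr : ∀ r ∈ Icc t s, r ∈ Ici a ∧ |r - t| < δ := fun r hr => ⟨ht.trans hr.1, by
        rw [abs_lt] at hsδ ⊢; constructor <;> linarith [hr.1, hr.2]⟩
      refine ODE_solution_unique_of_mem_Icc_right (v := fun _ => F) (s := fun _ => B) (K := K)
        (fun _ _ => hlip) (f := chartAt (Eu n) p ∘ γ) (g := chartAt (Eu n) p ∘ γ') (a := t) (b := s)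
        ?_ ?_ ?_ ?_ ?_ ?_ heq ⟨hts, le_rfl⟩
      · exact fun r h => ((hcont γ hγ r (hr r h).1 (hin r (hr r h).1 (hr r h).2).1.1)).mono
          fun q hq => (hr q hq).1
      · intro r h'
        have h := Ico_subset_Icc_self h'
        exact (hγ.2 r (hr r h).1 p (hin r (hr r h).1 (hr r h).2).1.1).mono
          (Ici_subset_Ici.2 (hr r h).1)
      · intro r h'
        have h := Ico_subset_Icc_self h'
        exact (hin r (hr r h).1 (hr r h).2).1.2
      · exact fun r h => ((hcont γ' hγ' r (hr r h).1 (hin r (hr r h).1 (hr r h).2).2.1)).mono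
          fun q hq => (hr q hq).1
      · intro r h'
        have h := Ico_subset_Icc_self h'
        exact (hγ'.2 r (hr r h).1 p (hin r (hr r h).1 (hr r h).2).2.1).mono
          (Ici_subset_Ici.2 (hr r h).1)
      · intro r h'
        have h := Ico_subset_Icc_self h'
        exact (hin r (hr r h).1 (hr r h).2).2.2
    · have hr : ∀ r ∈ Icc s t, r ∈ Ici a ∧ |r - t| < δ := fun r hr => ⟨le_trans hs.1 hr.1, by
        rw [abs_lt] at hsδ ⊢; constructor <;> linarith [hr.1, hr.2]⟩
      refine ODE_solution_unique_of_mem_Icc_left (v := fun _ => F) (s := fun _ => B) (K := K)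
        (fun _ _ => hlip) (f := chartAt (Eu n) p ∘ γ) (g := chartAt (Eu n) p ∘ γ') (a := s) (b := t)
        ?_ ?_ ?_ ?_ ?_ ?_ heq ⟨le_rfl, hts⟩
      · exact fun r h => ((hcont γ hγ r (hr r h).1 (hin r (hr r h).1 (hr r h).2).1.1)).mono
          fun q hq => (hr q hq).1
      · intro r h'
        have h := Ioc_subset_Icc_self h'
        exact ((hγ.2 r (hr r h).1 p (hin r (hr r h).1 (hr r h).2).1.1).hasDerivAt
          (Ici_mem_nhds (lt_of_le_of_lt hs.1 h'.1))).hasDerivWithinAt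
      · intro r h'
        have h := Ioc_subset_Icc_self h'
        exact (hin r (hr r h).1 (hr r h).2).1.2
      · exact fun r h => ((hcont γ' hγ' r (hr r h).1 (hin r (hr r h).1 (hr r h).2).2.1)).mono
          fun q hq => (hr q hq).1
      · intro r h'
        have h := Ioc_subset_Icc_self h'
        exact ((hγ'.2 r (hr r h).1 p (hin r (hr r h).1 (hr r h).2).2.1).hasDerivAt
          (Ici_mem_nhds (lt_of_le_of_lt hs.1 h'.1))).hasDerivWithinAt
      · intro r h'
        have h := Ioc_subset_Icc_self h'
        exact (hin r (hr r h).1 (hr r h).2).2.2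
  have h3 := hin s hs.1 (by linarith)
  exact (chartAt (Eu n) p).injOn h3.1.1 h3.2.1 hkey

/-- The set of agreement is open by local uniqueness, closed because $M$ is Hausdorff, and
$[a,\infty)$ is connected. -/
theorem IsFlow.eqOn [T2Space M] (hf : ContMDiff (𝓡 n) 𝓘(ℝ, ℝ) ∞ f) {h : CEps g₀ ε}
    (hh : h ∈ metricSet g₀ ε) {γ γ' : ℝ → M} {a t : ℝ} (hγ : IsFlow f h γ (Ici a))
    (hγ' : IsFlow f h γ' (Ici a)) (ht : a ≤ t) (he : γ t = γ' t) : EqOn γ γ' (Ici a) := by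
  let A : Set (Ici a) := {s | γ s = γ' s}
  have hA : IsClopen A := by
    refine ⟨isClosed_eq hγ.1.domRestrict hγ'.1.domRestrict, isOpen_iff_mem_nhds.2 fun s hs => ?_⟩
    have := hγ.eventuallyEq hf hh hγ' s.2 hs
    rw [mem_nhds_subtype_iff_nhdsWithin]
    filter_upwards [this, self_mem_nhdsWithin] with r hr hra
    exact ⟨⟨r, hra⟩, hr, rfl⟩
  have : PreconnectedSpace (Ici a) := isPreconnected_iff_preconnectedSpace.1 isPreconnected_Ici
  have hU := hA.eq_univ ⟨⟨t, ht⟩, he⟩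
  intro s hs
  have : (⟨s, hs⟩ : Ici a) ∈ A := hU ▸ mem_univ _
  exact this

end Flow

/-! ### Intrinsic stable curves and flow lines in charts. -/

section StableCurve

variable {n : ℕ} {M : Type*} [TopologicalSpace M] [ChartedSpace (Eu n) M] [IsManifold (𝓡 n) ∞ M]
  {g₀ : Metric n M} {ε : ℕ → Ioi (0 : ℝ)} {f : M → ℝ}

theorem hasMFDerivAt_chart {p m : M} (hm : m ∈ (chartAt (Eu n) p).source) :
    HasMFDerivAt (𝓡 n) 𝓘(ℝ, Eu n) (chartAt (Eu n) p) m (toCoord p m) := by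
  have h1 := (mdifferentiableAt_extChartAt (I := 𝓡 n) hm).hasMFDerivAt
  rw [← TangentBundle.continuousLinearMapAt_trivializationAt hm] at h1
  exact h1

theorem mfderiv_eq_fderiv_chart (hf : ContMDiff (𝓡 n) 𝓘(ℝ, ℝ) ∞ f) {p m : M}
    (hm : m ∈ (chartAt (Eu n) p).source) (v : TangentSpace (𝓡 n) m) :
    mfderiv (𝓡 n) 𝓘(ℝ, ℝ) f m v =
      fderiv ℝ (f ∘ (chartAt (Eu n) p).symm) (chartAt (Eu n) p m) (toCoord p m v) := by
  have h2 : DifferentiableAt ℝ (f ∘ (chartAt (Eu n) p).symm) (chartAt (Eu n) p m) :=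
    ((contDiffOn_comp_chart_symm hf p).contDiffAt ((chartAt (Eu n) p).open_target.mem_nhds
      ((chartAt (Eu n) p).map_source hm))).differentiableAt (by simp)
  have h3 := (h2.hasFDerivAt.hasMFDerivAt).comp m (hasMFDerivAt_chart hm)
  have h4 : HasMFDerivAt (𝓡 n) 𝓘(ℝ, ℝ) f m _ := h3.congr_of_eventuallyEq (by
    filter_upwards [(chartAt (Eu n) p).open_source.mem_nhds hm] with r hr
    simp only [Function.comp_apply, (chartAt (Eu n) p).left_inv hr])
  rw [h4.mfderiv]
  rfl

theorem metric_add_isInvertible {h : CEps g₀ ε} (hh : h ∈ metricSet g₀ ε) (m : M) :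
    (g₀.inner m + h.1 m).IsInvertible := by
  obtain ⟨c, hc, H⟩ := hh
  exact isInvertible_of_pos (n := n) (B := g₀.inner m + h.1 m) fun u hu =>
    (mul_pos hc (g₀.pos m u hu)).trans_le (H m u)

/-- Both sides have the same product with every vector for the invertible form $g_0+h$. This is the
bridge between the intrinsic gradient and `field`. -/
theorem toCoord_gradient (hf : ContMDiff (𝓡 n) 𝓘(ℝ, ℝ) ∞ f) {h : CEps g₀ ε}
    (hh : h ∈ metricSet g₀ ε) {p m : M} (hm : m ∈ (chartAt (Eu n) p).source) :
    toCoord p m (gradient m (g₀.inner m + h.1 m) f) =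
      -field g₀ f p (chartAt (Eu n) p m, h) := by
  have ht := (chartAt (Eu n) p).map_source hm
  apply (metricCoord_isInvertible (z := (chartAt (Eu n) p m, h)) ht hh).injective
  ext u
  rw [map_neg, neg_apply, metricCoord_field (z := (chartAt (Eu n) p m, h)) ht hh, neg_neg]
  have h1 : metricCoord g₀ p (chartAt (Eu n) p m, h)
      (toCoord p m (gradient m (g₀.inner m + h.1 m) f)) u =
      (g₀.inner m + h.1 m) (gradient m (g₀.inner m + h.1 m) f) (ofCoord p m u) := by
    refine congrArg₂ (· + ·) ((coordForm_chart g₀.toBilin hm _ _).trans ?_)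
      ((coordForm_chart h.1 hm _ _).trans ?_)
    · rw [ofCoord_toCoord hm]; rfl
    · rw [ofCoord_toCoord hm]; rfl
  have h2 : (g₀.inner m + h.1 m) (gradient m (g₀.inner m + h.1 m) f) =
      mfderiv (𝓡 n) 𝓘(ℝ, ℝ) f m := (metric_add_isInvertible hh m).self_apply_inverse _
  refine h1.trans ((DFunLike.congr_fun h2 (ofCoord p m u)).trans ?_)
  refine (mfderiv_eq_fderiv_chart hf hm _).trans ?_
  rw [toCoord_ofCoord hm]

theorem hasDerivWithinAt_chart_comp {γ : ℝ → M} {s : Set ℝ} {t : ℝ} {p : M}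
    (hp : γ t ∈ (chartAt (Eu n) p).source)
    {L : TangentSpace 𝓘(ℝ, ℝ) t →L[ℝ] TangentSpace (𝓡 n) (γ t)}
    (hL : HasMFDerivWithinAt 𝓘(ℝ, ℝ) (𝓡 n) γ s t L) :
    HasDerivWithinAt (chartAt (Eu n) p ∘ γ) (toCoord p (γ t) (L (1 : ℝ))) s t := by
  have h2 := (hasMFDerivAt_chart hp).comp_hasMFDerivWithinAt t hL
  let A : ℝ →L[ℝ] Eu n := (toCoord p (γ t)).comp L
  have h3 : HasFDerivWithinAt (chartAt (Eu n) p ∘ γ) A s t := h2.hasFDerivWithinAt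
  exact h3.hasDerivWithinAt

theorem IsStableCurve.isFlow (hf : ContMDiff (𝓡 n) 𝓘(ℝ, ℝ) ∞ f) {h : CEps g₀ ε}
    (hh : h ∈ metricSet g₀ ε) {x : M} {γ : ℝ≥0 → M} (hγ : IsStableCurve g₀ f x h γ) :
    IsFlow f h (extend γ) (Ici 0) := by
  refine ⟨hγ.1.continuousOn, fun t ht p hp => ?_⟩
  have h1 := ((hγ.1 t ht).mdifferentiableWithinAt (by simp)).hasMFDerivWithinAt
  refine (hasDerivWithinAt_chart_comp hp h1).congr_deriv ?_
  have h4 := eq_neg_of_add_eq_zero_left (hγ.2.1 t ht)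
  change toCoord p (extend γ t) (mfderivWithin 𝓘(ℝ, ℝ) (𝓡 n) (extend γ) (Ici 0) t (1 : ℝ)) = _
  have h5 := congrArg (toCoord p (extend γ t)) h4
  refine h5.trans ?_
  rw [map_neg, toCoord_gradient hf hh hp, neg_neg]

/-- A bootstrap: $u'=F(u)$ is as smooth as $u$. Hence a flow line, defined as merely differentiable,
is a smooth curve. -/
theorem contDiffOn_of_hasDerivWithinAt {E : Type*} [NormedAddCommGroup E] [NormedSpace ℝ E]
    {F : E → E} {U : Set E} (hF : ContDiffOn ℝ ∞ F U) {u : ℝ → E} {S : Set ℝ}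
    (hS : UniqueDiffOn ℝ S) (hu : ∀ t ∈ S, HasDerivWithinAt u (F (u t)) S t) (hm : MapsTo u S U) :
    ContDiffOn ℝ ∞ u S := by
  rw [contDiffOn_infty]
  intro m
  induction m with
  | zero => exact contDiffOn_zero.2 fun t ht => (hu t ht).continuousWithinAt
  | succ m ih =>
    push_cast
    rw [contDiffOn_succ_iff_derivWithin hS]
    refine ⟨fun t ht => (hu t ht).differentiableWithinAt, by simp, ?_⟩
    refine ContDiffOn.congr (f := F ∘ u) ((hF.of_le (WithTop.coe_le_coe.2
      (le_top (a := (m : ℕ∞))))).comp ih hm) fun t ht => ?_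
    exact (hu t ht).derivWithin (hS t ht)

theorem IsFlow.contMDiffOn (hf : ContMDiff (𝓡 n) 𝓘(ℝ, ℝ) ∞ f) {h : CEps g₀ ε}
    (hh : h ∈ metricSet g₀ ε) {γ : ℝ → M} {a : ℝ} (hγ : IsFlow f h γ (Ici a)) :
    ContMDiffOn 𝓘(ℝ, ℝ) (𝓡 n) ∞ γ (Ici a) := by
  intro t ht
  set p := γ t
  have hps : γ t ∈ (chartAt (Eu n) p).source := mem_chart_source _ _
  obtain ⟨V, hV, htV, hVs⟩ := mem_nhdsWithin.1
    ((hγ.1 t ht).preimage_mem_nhdsWithin ((chartAt (Eu n) p).open_source.mem_nhds hps))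
  have hS : UniqueDiffOn ℝ (Ici a ∩ V) := (uniqueDiffOn_Ici a).inter hV
  have h1 : ContDiffOn ℝ ∞ (chartAt (Eu n) p ∘ γ) (Ici a ∩ V) := by
    have hF : ContDiffOn ℝ ∞ (fun y => field g₀ f p (y, h)) (chartAt (Eu n) p).target :=
      (contDiffOn_field hf p).comp (contDiff_id.prodMk contDiff_const).contDiffOn
        fun y hy => ⟨hy, hh⟩
    refine contDiffOn_of_hasDerivWithinAt hF hS (fun r hr => ?_) fun r hr =>
      (chartAt (Eu n) p).map_source (hVs ⟨hr.2, hr.1⟩)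
    exact (hγ.2 r hr.1 p (hVs ⟨hr.2, hr.1⟩)).mono inter_subset_left
  have h2 : ContMDiffOn 𝓘(ℝ, ℝ) (𝓡 n) ∞ ((chartAt (Eu n) p).symm ∘ (chartAt (Eu n) p ∘ γ))
      (Ici a ∩ V) :=
    (contMDiffOn_chart_symm (I := 𝓡 n) (n := ∞) (x := p)).comp (contMDiffOn_iff_contDiffOn.2 h1)
      fun r hr => (chartAt (Eu n) p).map_source (hVs ⟨hr.2, hr.1⟩)
  have h3 : ContMDiffOn 𝓘(ℝ, ℝ) (𝓡 n) ∞ γ (Ici a ∩ V) := h2.congr fun r hr => by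
    simp only [Function.comp_apply, (chartAt (Eu n) p).left_inv (hVs ⟨hr.2, hr.1⟩)]
  exact (h3 t ⟨ht, htV⟩).mono_of_mem_nhdsWithin
    (inter_mem_nhdsWithin _ (hV.mem_nhds htV))

theorem isStableCurve_of_isFlow (hf : ContMDiff (𝓡 n) 𝓘(ℝ, ℝ) ∞ f) {h : CEps g₀ ε}
    (hh : h ∈ metricSet g₀ ε) {x : M} {γ : ℝ≥0 → M} (hγ : IsFlow f h (extend γ) (Ici 0))
    (hx : Tendsto γ atTop (𝓝 x)) : IsStableCurve g₀ f x h γ := by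
  have hs := hγ.contMDiffOn hf hh
  refine ⟨hs, fun t ht => ?_, hx⟩
  set p := extend γ t
  have hp : extend γ t ∈ (chartAt (Eu n) p).source := mem_chart_source _ _
  have h1 := ((hs t ht).mdifferentiableWithinAt (by simp)).hasMFDerivWithinAt
  have h3 := (uniqueDiffOn_Ici (0 : ℝ) t ht).eq_deriv _ (hasDerivWithinAt_chart_comp hp h1)
    (hγ.2 t ht p hp)
  have h4 : toCoord p (extend γ t)
      (mfderivWithin 𝓘(ℝ, ℝ) (𝓡 n) (extend γ) (Ici 0) t (1 : ℝ)) =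
      -toCoord p (extend γ t) (gradient (extend γ t) (g₀.inner (extend γ t) + h.1 (extend γ t)) f) := by
    rw [toCoord_gradient hf hh hp, neg_neg]
    exact h3
  have h5 := congrArg (ofCoord p (extend γ t)) h4
  rw [map_neg, ofCoord_toCoord hp, ofCoord_toCoord hp] at h5
  rw [h5]
  exact neg_add_cancel _

theorem field_eq_zero_of_isCrit (hf : ContMDiff (𝓡 n) 𝓘(ℝ, ℝ) ∞ f) {x : M}
    (hx : IsCrit (n := n) f x) (h : CEps g₀ ε) {p : M} (hp : x ∈ (chartAt (Eu n) p).source) :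
    field g₀ f p (chartAt (Eu n) p x, h) = 0 := by
  have h1 : fderiv ℝ (f ∘ (chartAt (Eu n) p).symm) (chartAt (Eu n) p x) = 0 := by
    ext u
    have := mfderiv_eq_fderiv_chart hf hp (ofCoord p x u)
    rw [toCoord_ofCoord hp, hx] at this
    exact this.symm
  unfold field
  rw [h1, map_zero, neg_zero]

theorem isCrit_of_field_eq_zero (hf : ContMDiff (𝓡 n) 𝓘(ℝ, ℝ) ∞ f) {x p : M} {h : CEps g₀ ε}
    (hh : h ∈ metricSet g₀ ε) (hp : x ∈ (chartAt (Eu n) p).source)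
    (h0 : field g₀ f p (chartAt (Eu n) p x, h) = 0) : IsCrit (n := n) f x := by
  unfold IsCrit
  refine ContinuousLinearMap.ext fun v => ?_
  rw [mfderiv_eq_fderiv_chart hf hp]
  have := metricCoord_field (f := f) (z := (chartAt (Eu n) p x, h))
    ((chartAt (Eu n) p).map_source hp) hh (toCoord p x v)
  rw [h0, map_zero, zero_apply] at this
  have h2 := neg_eq_zero.1 this.symm
  exact h2

end StableCurve

/-! ### The local stable manifold of a critical point -/

section LocalStable

open scoped BoundedContinuousFunction

variable {n : ℕ} {M : Type*} [TopologicalSpace M] [ChartedSpace (Eu n) M] [IsManifold (𝓡 n) ∞ M]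
  {g₀ : Metric n M} {ε : ℕ → Ioi (0 : ℝ)} {f : M → ℝ}

/-- The inverse of the chart `chartCoord` centred at `x`. -/
def chartPoint (x : M) (Q : Eu n ≃L[ℝ] Eu n) (z : Eu n) : M :=
  (chartAt (Eu n) x).symm (chartAt (Eu n) x x + Q z)

/-- The chart at `x`, moved to the origin and composed with the linear map `Q⁻¹`. -/
def chartCoord (x : M) (Q : Eu n ≃L[ℝ] Eu n) (m : M) : Eu n :=
  Q.symm (chartAt (Eu n) x m - chartAt (Eu n) x x)

/-- The negative gradient of `f` in the coordinates `chartCoord x Q`. -/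
def linField (g₀ : Metric n M) {ε : ℕ → Ioi (0 : ℝ)} (f : M → ℝ) (x : M) (Q : Eu n ≃L[ℝ] Eu n)
    (z : Eu n × CEps g₀ ε) : Eu n :=
  Q.symm (field g₀ f x (chartAt (Eu n) x x + Q z.1, z.2))

theorem chart_chartPoint {x : M} {Q : Eu n ≃L[ℝ] Eu n} {z : Eu n}
    (hz : chartAt (Eu n) x x + Q z ∈ (chartAt (Eu n) x).target) :
    chartAt (Eu n) x (chartPoint x Q z) = chartAt (Eu n) x x + Q z :=
  (chartAt (Eu n) x).right_inv hz

theorem chartPoint_zero (x : M) (Q : Eu n ≃L[ℝ] Eu n) : chartPoint x Q 0 = x := by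
  simp [chartPoint]

theorem chartCoord_chartPoint {x : M} {Q : Eu n ≃L[ℝ] Eu n} {z : Eu n}
    (hz : chartAt (Eu n) x x + Q z ∈ (chartAt (Eu n) x).target) :
    chartCoord x Q (chartPoint x Q z) = z := by
  simp [chartCoord, chart_chartPoint hz]

theorem chartPoint_chartCoord {x m : M} (Q : Eu n ≃L[ℝ] Eu n)
    (hm : m ∈ (chartAt (Eu n) x).source) : chartPoint x Q (chartCoord x Q m) = m := by
  simp [chartCoord, chartPoint, (chartAt (Eu n) x).left_inv hm]

theorem contDiffOn_linField (hf : ContMDiff (𝓡 n) 𝓘(ℝ, ℝ) ∞ f) {x : M} {Q : Eu n ≃L[ℝ] Eu n}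
    {r : ℝ} (hr : ∀ z ∈ Metric.ball (0 : Eu n) r,
      chartAt (Eu n) x x + Q z ∈ (chartAt (Eu n) x).target) :
    ContDiffOn ℝ ∞ (linField g₀ (ε := ε) f x Q) (Metric.ball 0 r ×ˢ metricSet g₀ ε) := by
  refine Q.symm.contDiff.comp_contDiffOn ((contDiffOn_field hf x).comp
    (((contDiff_const.add (Q.contDiff.comp contDiff_fst)).prodMk contDiff_snd).contDiffOn) ?_)
  exact fun z hz => ⟨hr z.1 hz.1, hz.2⟩

/-- At a critical point $df=0$, so the derivative of $G^{-1}df$ has no term from $G^{-1}$; only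
$G^{-1}$ applied to the Hessian remains. -/
theorem fderiv_linField (hf : ContMDiff (𝓡 n) 𝓘(ℝ, ℝ) ∞ f) {x : M} (hx : IsCrit (n := n) f x)
    {h : CEps g₀ ε} (hh : h ∈ metricSet g₀ ε) (ho : IsOpen (metricSet g₀ ε)) (Q : Eu n ≃L[ℝ] Eu n)
    {r : ℝ} (hr0 : 0 < r) (hr : ∀ z ∈ Metric.ball (0 : Eu n) r,
      chartAt (Eu n) x x + Q z ∈ (chartAt (Eu n) x).target) (z : Eu n) :
    fderiv ℝ (linField g₀ f x Q) (0, h) (z, 0) =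
      -Q.symm ((metricCoord g₀ x (chartAt (Eu n) x x, h)).inverse (hessian f x (Q z))) := by
  set y₀ := chartAt (Eu n) x x with hy₀
  have hyt : y₀ ∈ (chartAt (Eu n) x).target := mem_chart_target _ x
  have h1 : DifferentiableAt ℝ (linField g₀ f x Q) ((0 : Eu n), h) :=
    ((contDiffOn_linField hf hr).contDiffAt ((Metric.isOpen_ball.prod ho).mem_nhds
      ⟨Metric.mem_ball_self hr0, hh⟩)).differentiableAt (by simp)
  have h2 : HasFDerivAt (fun z => linField g₀ f x Q (z, h))
      ((fderiv ℝ (linField g₀ f x Q) (0, h)).comp (ContinuousLinearMap.inl ℝ _ _)) 0 :=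
    HasFDerivAt.comp (g := linField g₀ f x Q) 0 h1.hasFDerivAt (hasFDerivAt_prodMk_left 0 h)
  set a : Eu n → Eu n →L[ℝ] ℝ := fderiv ℝ (f ∘ (chartAt (Eu n) x).symm) with ha
  have ha0 : a y₀ = 0 := by
    ext u
    have h3 := field_eq_zero_of_isCrit hf hx h (mem_chart_source (Eu n) x)
    have h4 := metricCoord_field (f := f) (z := (y₀, h)) hyt hh u
    rw [h3, map_zero, zero_apply] at h4
    exact neg_eq_zero.1 h4.symm
  have hnhds := (chartAt (Eu n) x).open_target.mem_nhds hyt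
  have ha' : HasFDerivAt a (hessian f x) y₀ :=
    ((((contDiffOn_comp_chart_symm hf x).fderiv_of_isOpen (m := ∞) (chartAt (Eu n) x).open_target
      (by simp)).contDiffAt hnhds).differentiableAt (by simp)).hasFDerivAt
  have hG : DifferentiableAt ℝ (fun y => (metricCoord g₀ x (y, h)).inverse) y₀ := by
    have h3 : ContDiffAt ℝ ∞ (fun y => metricCoord g₀ x (y, h)) y₀ :=
      ((contDiffOn_metricCoord x).comp (contDiff_id.prodMk contDiff_const).contDiffOn
        fun y hy => ⟨hy, mem_univ _⟩).contDiffAt hnhds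
    exact (ContDiffAt.comp y₀ (g := ContinuousLinearMap.inverse) (f := fun y => metricCoord g₀ x (y, h)) (ContinuousLinearMap.IsInvertible.contDiffAt_map_inverse
      (metricCoord_isInvertible (z := (y₀, h)) hyt hh)) h3).differentiableAt (by simp)
  have h5 : HasFDerivAt (fun y => field g₀ f x (y, h))
      (-((metricCoord g₀ x (y₀, h)).inverse.comp (hessian f x))) y₀ := by
    refine (hG.hasFDerivAt.clm_apply ha').neg.congr_fderiv ?_
    ext u i
    simp [ha0]
  have h6 : HasFDerivAt (fun z => linField g₀ f x Q (z, h))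
      ((Q.symm : Eu n →L[ℝ] Eu n).comp ((-((metricCoord g₀ x (y₀, h)).inverse.comp
        (hessian f x))).comp (Q : Eu n →L[ℝ] Eu n))) 0 := by
    refine (Q.symm : Eu n →L[ℝ] Eu n).hasFDerivAt.comp 0 ?_
    have h7 : HasFDerivAt (fun z => y₀ + Q z) (Q : Eu n →L[ℝ] Eu n) 0 :=
      Q.hasFDerivAt.const_add y₀
    refine HasFDerivAt.comp (g := fun y => field g₀ f x (y, h)) 0 ?_ h7
    simpa using h5
  have h8 := DFunLike.congr_fun (h2.unique h6) z
  simpa using h8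

theorem hasDerivWithinAt_linField_iff {x : M} (Q : Eu n ≃L[ℝ] Eu n) {u : ℝ → Eu n} {s : Set ℝ}
    {h : CEps g₀ ε} {t : ℝ} :
    HasDerivWithinAt u (linField g₀ f x Q (u t, h)) s t ↔
      HasDerivWithinAt (fun r => chartAt (Eu n) x x + Q (u r))
        (field g₀ f x (chartAt (Eu n) x x + Q (u t), h)) s t := by
  constructor
  · intro hu
    have := (Q.hasFDerivAt (x := u t)).comp_hasDerivWithinAt t hu
    simpa [linField] using this.const_add (chartAt (Eu n) x x)
  · intro hu
    have := (Q.symm.hasFDerivAt (x := Q (u t))).comp_hasDerivWithinAt (f := fun r => Q (u r)) t (by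
      simpa using hu.const_add (-chartAt (Eu n) x x))
    refine (this.congr_deriv rfl).congr_of_eventuallyEq ?_ ?_
    · exact Eventually.of_forall fun r => by simp
    · simp

theorem isFlow_chartPoint (hf : ContMDiff (𝓡 n) 𝓘(ℝ, ℝ) ∞ f) {h : CEps g₀ ε}
    (hh : h ∈ metricSet g₀ ε) {x : M} {Q : Eu n ≃L[ℝ] Eu n} {u : ℝ → Eu n} {s : Set ℝ}
    (hu : ∀ t ∈ s, HasDerivWithinAt u (linField g₀ f x Q (u t, h)) s t)
    (ht : ∀ t ∈ s, chartAt (Eu n) x x + Q (u t) ∈ (chartAt (Eu n) x).target) :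
    IsFlow f h (fun t => chartPoint x Q (u t)) s := by
  have hc : ContinuousOn (fun t => chartPoint x Q (u t)) s := by
    refine (chartAt (Eu n) x).continuousOn_symm.comp (fun t hts => ?_) ht
    exact ((hasDerivWithinAt_linField_iff Q).1 (hu t hts)).continuousWithinAt
  refine ⟨hc, fun t hts p hp => ?_⟩
  refine hasDerivWithinAt_chart_change hf hh (hc t hts) hts
    ((chartAt (Eu n) x).map_target (ht t hts)) hp ?_
  rw [chart_chartPoint (ht t hts)]
  refine ((hasDerivWithinAt_linField_iff Q).1 (hu t hts)).congr_of_mem (fun r hr => ?_) hts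
  exact chart_chartPoint (ht r hr)

theorem IsFlow.hasDerivWithinAt_chartCoord {h : CEps g₀ ε} {x : M} (Q : Eu n ≃L[ℝ] Eu n)
    {γ : ℝ → M} {s : Set ℝ} (hγ : IsFlow f h γ s) {t : ℝ} (hts : t ∈ s)
    (ht : γ t ∈ (chartAt (Eu n) x).source) :
    HasDerivWithinAt (fun r => chartCoord x Q (γ r)) (linField g₀ f x Q (chartCoord x Q (γ t), h))
      s t := by
  rw [hasDerivWithinAt_linField_iff (u := fun r => chartCoord x Q (γ r))]
  simpa [chartCoord, Function.comp_def] using hγ.2 t hts x ht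

/-- `Q` diagonalizes the linearized flow for the metric $h_0$ alone. The eigenvalues of $G^{-1}H$
that are positive number $n-\mu(x)$ and are the decay rates of the stable directions. Since $x$ is a
zero of the gradient for every metric, the family theorem applies. -/
theorem exists_local_stable_family [CompleteSpace (CEps g₀ ε)] (ho : IsOpen (metricSet g₀ ε))
    (hf : IsMorse (n := n) f) {x : M} (hx : IsCrit (n := n) f x) {k : ℕ}
    (hk : k = n - morseIndex (n := n) f x) {h₀ : CEps g₀ ε} (hh₀ : h₀ ∈ metricSet g₀ ε) :
    ∃ (Q : Eu n ≃L[ℝ] Eu n) (e : Fin k → Fin n), ∃ η > 0, ∃ ρ > 0, Function.Injective e ∧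
      (∀ z ∈ Metric.ball (0 : Eu n) ρ, chartAt (Eu n) x x + Q z ∈ (chartAt (Eu n) x).target) ∧
      ∃ O : Set (Eu k × CEps g₀ ε), IsOpen O ∧ (0, h₀) ∈ O ∧ (∀ q ∈ O, q.2 ∈ metricSet g₀ ε) ∧
      ∃ w : Eu k × CEps g₀ ε → (ℝ≥0 →ᵇ Eu n), ContDiffOn ℝ ∞ w O ∧
      (∀ q ∈ O, ‖w q‖ < ρ ∧ (∀ j, w q 0 (e j) = q.1 j) ∧
        ∀ t ≥ 0, HasDerivWithinAt (fun s : ℝ => Real.exp (-(η * s)) • w q s.toNNReal)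
          (linField g₀ f x Q (Real.exp (-(η * t)) • w q t.toNNReal, q.2)) (Ici 0) t) ∧
      ∀ q ∈ O, ∀ u : ℝ → Eu n, (∀ t ≥ 0, ‖u t‖ < ρ) →
        (∀ t ≥ 0, HasDerivWithinAt u (linField g₀ f x Q (u t, q.2)) (Ici 0) t) →
        (∀ j, u 0 (e j) = q.1 j) →
        ∀ t ≥ 0, u t = Real.exp (-(η * t)) • w q t.toNNReal := by
  have hyt : chartAt (Eu n) x x ∈ (chartAt (Eu n) x).target := mem_chart_target _ x
  have hHs : ∀ u v, hessian (n := n) f x u v = hessian (n := n) f x v u := by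
    have h1 := ((contDiffOn_comp_chart_symm hf.1 x).contDiffAt
      ((chartAt (Eu n) x).open_target.mem_nhds hyt)).isSymmSndFDerivAt (by
        simpa using WithTop.coe_le_coe.2 (le_top (a := (2 : ℕ∞))))
    exact fun u v => h1 u v
  obtain ⟨Q, μ, hμ, hQ, hcard⟩ := exists_diagonalization (G := metricCoord g₀ x (chartAt (Eu n) x x, h₀))
    (H := hessian f x) (fun u v => metricCoord_symm (z := (chartAt (Eu n) x x, h₀)) hyt u v)
    (fun u hu => metricCoord_pos (z := (chartAt (Eu n) x x, h₀)) hyt hh₀ hu) hHs (hf.2 x hx)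
  obtain ⟨e, hinj, he, hsurj⟩ := exists_positive_indices hμ (k := k) (by
    rw [hk, ← hcard]; rfl)
  obtain ⟨r, hr, hball⟩ : ∃ r > 0, ∀ z ∈ Metric.ball (0 : Eu n) r,
      chartAt (Eu n) x x + Q z ∈ (chartAt (Eu n) x).target := by
    have hc : Continuous fun z : Eu n => chartAt (Eu n) x x + Q z := by fun_prop
    have : (fun z : Eu n => chartAt (Eu n) x x + Q z) ⁻¹' (chartAt (Eu n) x).target ∈ 𝓝 (0 : Eu n) :=
      ((chartAt (Eu n) x).open_target.preimage hc).mem_nhds (by simp)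
    obtain ⟨r, hr, hb⟩ := Metric.mem_nhds_iff.1 this
    exact ⟨r, hr, fun z hz => hb hz⟩
  obtain ⟨η, hη, ρ, hρ, hρr, O, hO, h0O, hOP, w, hw, hw1, hw2⟩ := exists_stable_family hμ hinj he hsurj
    hr ho hh₀ (contDiffOn_linField hf.1 hball) (fun h _ => by
      unfold linField
      have := field_eq_zero_of_isCrit hf.1 hx h (mem_chart_source (Eu n) x)
      simp [this])
    (fun z i => by
      rw [fderiv_linField hf.1 hx hh₀ ho Q hr hball z, PiLp.neg_apply, hQ])
  exact ⟨Q, e, η, hη, ρ, hρ, hinj, fun z hz => hball z (Metric.ball_subset_ball hρr hz), O, hO, h0O, hOP, w, hw,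
    hw1, hw2⟩

end LocalStable

/-! ### Smooth families of flow lines -/

section FlowFamily

open scoped BoundedContinuousFunction

/-- Precomposition with a continuous map, on bounded continuous functions. -/
def bcfComp {S T : Type*} [TopologicalSpace S] [TopologicalSpace T] (E : Type*)
    [NormedAddCommGroup E] [NormedSpace ℝ E] (g : C(S, T)) : (T →ᵇ E) →L[ℝ] (S →ᵇ E) :=
  LinearMap.mkContinuous
    { toFun := fun v => v.compContinuous g
      map_add' := fun _ _ => rfl
      map_smul' := fun _ _ => rfl } 1 fun v => by
    rw [one_mul]
    exact (BoundedContinuousFunction.norm_le (norm_nonneg _)).2 fun s => v.norm_coe_le_norm _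

@[simp] theorem bcfComp_apply {S T : Type*} [TopologicalSpace S] [TopologicalSpace T] {E : Type*}
    [NormedAddCommGroup E] [NormedSpace ℝ E] (g : C(S, T)) (v : T →ᵇ E) (s : S) :
    bcfComp E g v s = v (g s) := rfl

variable {n k : ℕ} {M : Type*} [TopologicalSpace M] [ChartedSpace (Eu n) M]
  [IsManifold (𝓡 n) ∞ M] {g₀ : Metric n M} {ε : ℕ → Ioi (0 : ℝ)} {f : M → ℝ}

variable (f) in
/-- The derivative of `φ` along the negative gradient of `f` for the metric `g₀ + h`. -/
def slope (φ : M → ℝ) (h : CEps g₀ ε) (m : M) : ℝ :=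
  -(mfderiv (𝓡 n) 𝓘(ℝ, ℝ) φ m (gradient m (g₀.inner m + h.1 m) f) : ℝ)

theorem slope_eq (hf : ContMDiff (𝓡 n) 𝓘(ℝ, ℝ) ∞ f) {φ : M → ℝ}
    (hφ : ContMDiff (𝓡 n) 𝓘(ℝ, ℝ) ∞ φ) {h : CEps g₀ ε} (hh : h ∈ metricSet g₀ ε) {p m : M}
    (hm : m ∈ (chartAt (Eu n) p).source) :
    slope f φ h m = fderiv ℝ (φ ∘ (chartAt (Eu n) p).symm) (chartAt (Eu n) p m)
      (field g₀ f p (chartAt (Eu n) p m, h)) := by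
  unfold slope
  have h1 := mfderiv_eq_fderiv_chart hφ hm (gradient m (g₀.inner m + h.1 m) f)
  rw [toCoord_gradient hf hh hm, map_neg] at h1
  exact neg_eq_iff_eq_neg.2 h1

theorem IsFlow.hasDerivWithinAt_comp (hf : ContMDiff (𝓡 n) 𝓘(ℝ, ℝ) ∞ f) {φ : M → ℝ}
    (hφ : ContMDiff (𝓡 n) 𝓘(ℝ, ℝ) ∞ φ) {h : CEps g₀ ε} (hh : h ∈ metricSet g₀ ε) {γ : ℝ → M}
    {s : Set ℝ} (hγ : IsFlow f h γ s) {t : ℝ} (ht : t ∈ s) :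
    HasDerivWithinAt (φ ∘ γ) (slope f φ h (γ t)) s t := by
  have hm := mem_chart_source (Eu n) (γ t)
  rw [slope_eq hf hφ hh hm]
  have h1 : DifferentiableAt ℝ (φ ∘ (chartAt (Eu n) (γ t)).symm) (chartAt (Eu n) (γ t) (γ t)) :=
    ((contDiffOn_comp_chart_symm hφ (γ t)).contDiffAt ((chartAt (Eu n) (γ t)).open_target.mem_nhds
      ((chartAt (Eu n) (γ t)).map_source hm))).differentiableAt (by simp)
  refine (h1.hasFDerivAt.comp_hasDerivWithinAt t (hγ.2 t ht (γ t) hm)).congr_of_eventuallyEq_of_mem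
    ?_ ht
  filter_upwards [(hγ.1 t ht).preimage_mem_nhdsWithin
    ((chartAt (Eu n) (γ t)).open_source.mem_nhds hm)] with r hr
  simp only [Function.comp_apply, (chartAt (Eu n) (γ t)).left_inv hr]

theorem isFlow_chart_symm (hf : ContMDiff (𝓡 n) 𝓘(ℝ, ℝ) ∞ f) {h : CEps g₀ ε}
    (hh : h ∈ metricSet g₀ ε) {p : M} {y : ℝ → Eu n} {s : Set ℝ}
    (hy : ∀ t ∈ s, HasDerivWithinAt y (field g₀ f p (y t, h)) s t)
    (ht : ∀ t ∈ s, y t ∈ (chartAt (Eu n) p).target) :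
    IsFlow f h (fun t => (chartAt (Eu n) p).symm (y t)) s := by
  have hc : ContinuousOn (fun t => (chartAt (Eu n) p).symm (y t)) s :=
    (chartAt (Eu n) p).continuousOn_symm.comp (fun t hts => (hy t hts).continuousWithinAt) ht
  refine ⟨hc, fun t hts q hq => ?_⟩
  refine hasDerivWithinAt_chart_change hf hh (hc t hts) hts
    ((chartAt (Eu n) p).map_target (ht t hts)) hq ?_
  rw [(chartAt (Eu n) p).right_inv (ht t hts)]
  exact (hy t hts).congr_of_mem (fun r hr => (chartAt (Eu n) p).right_inv (ht r hr)) hts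

/-- A flow line is continued backward in a chart. -/
theorem IsFlow.glue (hf : ContMDiff (𝓡 n) 𝓘(ℝ, ℝ) ∞ f) {h : CEps g₀ ε} (hh : h ∈ metricSet g₀ ε)
    {a b δ : ℝ} (hab : a ≤ b) (hδ : b - δ ≤ a) {γ : ℝ → M} (hγ : IsFlow f h γ (Ici b)) {p : M}
    (hp : γ b ∈ (chartAt (Eu n) p).source) {y : ℝ → Eu n} (hy0 : y 0 = chartAt (Eu n) p (γ b))
    (hyt : ∀ s, y s ∈ (chartAt (Eu n) p).target)
    (hy : ∀ s ∈ Icc (-δ) δ, HasDerivWithinAt y (field g₀ f p (y s, h)) (Icc (-δ) δ) s) :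
    IsFlow f h (fun t => if t ≤ b then (chartAt (Eu n) p).symm (y (t - b)) else γ t) (Ici a) ∧
      EqOn (fun t => if t ≤ b then (chartAt (Eu n) p).symm (y (t - b)) else γ t) γ (Ici b) := by
  have heq : EqOn (fun t => if t ≤ b then (chartAt (Eu n) p).symm (y (t - b)) else γ t) γ
      (Ici b) := by
    intro t ht
    rcases eq_or_lt_of_le (mem_Ici.1 ht) with rfl | hlt
    · simp only [le_refl, if_true, sub_self, hy0]
      exact (chartAt (Eu n) p).left_inv hp
    · exact if_neg (not_le.2 hlt)
  refine ⟨IsFlow.union hab ?_ (hγ.congr heq), heq⟩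
  refine (isFlow_chart_symm hf hh (p := p) (y := fun t => y (t - b))
    (fun t ht => ?_) (fun t ht => hyt _)).congr fun t ht => if_pos ht.2
  have h1 := hy (t - b) ⟨by linarith [ht.1], by linarith [ht.1, ht.2]⟩
  have h2 : HasDerivWithinAt (fun t : ℝ => t - b) 1 (Icc a b) t :=
    ((hasDerivAt_id t).sub_const b).hasDerivWithinAt
  have hmap : MapsTo (fun t : ℝ => t - b) (Icc a b) (Icc (-δ) δ) := fun r hr =>
    ⟨by linarith [hr.1], by linarith [hr.1, hr.2]⟩
  have h3 := h1.scomp t h2 hmap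
  rw [one_smul] at h3
  exact h3

variable (f) in
/-- A family of flow lines on `[a, ∞)`, depending smoothly on a parameter whose last component is
the metric, in the topology of exponential convergence. -/
structure FlowFamily (η a : ℝ) (O : Set (Eu k × CEps g₀ ε)) (Γ : Eu k × CEps g₀ ε → ℝ → M) :
    Prop where
  isOpen : IsOpen O
  mem : ∀ q ∈ O, q.2 ∈ metricSet g₀ ε
  isFlow : ∀ q ∈ O, IsFlow f q.2 (Γ q) (Ici a)
  smooth : ContMDiffOn 𝓘(ℝ, Eu k × CEps g₀ ε) (𝓡 n) ∞ (fun q => Γ q a) O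
  rep : ∀ φ : M → ℝ, ContMDiff (𝓡 n) 𝓘(ℝ, ℝ) ∞ φ → ∃ B : Eu k × CEps g₀ ε → (ℝ →ᵇ ℝ),
    ContDiffOn ℝ ∞ B O ∧ ∀ q ∈ O, ∀ t ≥ a, slope f φ q.2 (Γ q t) = Real.exp (-(η * t)) * B q t

theorem contDiffOn_slope_coord (hf : ContMDiff (𝓡 n) 𝓘(ℝ, ℝ) ∞ f) {φ : M → ℝ}
    (hφ : ContMDiff (𝓡 n) 𝓘(ℝ, ℝ) ∞ φ) (p : M) :
    ContDiffOn ℝ ∞ (fun z : Eu n × CEps g₀ ε =>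
      fderiv ℝ (φ ∘ (chartAt (Eu n) p).symm) z.1 (field g₀ f p z))
      ((chartAt (Eu n) p).target ×ˢ metricSet g₀ ε) :=
  (((contDiffOn_comp_chart_symm hφ p).fderiv_of_isOpen (m := ∞) (chartAt (Eu n) p).open_target
      (by simp)).comp contDiff_fst.contDiffOn fun z hz => hz.1).clm_apply (contDiffOn_field hf p)

theorem isOpen_chart_preimage {p : M} {O : Set (Eu k × CEps g₀ ε)} (hO : IsOpen O)
    {G : Eu k × CEps g₀ ε → M} (hG : ContinuousOn G O) {O₁ : Set (Eu n × CEps g₀ ε)}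
    (hO₁ : IsOpen O₁) :
    IsOpen {q ∈ O | G q ∈ (chartAt (Eu n) p).source ∧ (chartAt (Eu n) p (G q), q.2) ∈ O₁} := by
  have h1 : IsOpen (O ∩ G ⁻¹' (chartAt (Eu n) p).source) :=
    hG.isOpen_inter_preimage hO (chartAt (Eu n) p).open_source
  have h2 : ContinuousOn (fun q : Eu k × CEps g₀ ε => (chartAt (Eu n) p (G q), q.2))
      (O ∩ G ⁻¹' (chartAt (Eu n) p).source) :=
    ((chartAt (Eu n) p).continuousOn.comp (hG.mono inter_subset_left) fun q hq => hq.2).prodMk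
      continuous_snd.continuousOn
  convert h2.isOpen_inter_preimage h1 hO₁ using 1
  ext q
  simp only [mem_ofPred_eq, mem_inter_iff, mem_preimage, and_assoc]

/-- The flow box is run backward from the point $\Gamma_q(b)$, which depends smoothly on $q$. The
work is to write the slopes on $[a,\infty)$ again as $e^{-\eta t}$ times one smooth bounded family.
-/
theorem FlowFamily.exists_backward (hf : ContMDiff (𝓡 n) 𝓘(ℝ, ℝ) ∞ f) (ho : IsOpen (metricSet g₀ ε))
    {η a b δ : ℝ} (hab : a ≤ b) (hδ : b - δ ≤ a) {O : Set (Eu k × CEps g₀ ε)}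
    {Γ : Eu k × CEps g₀ ε → ℝ → M} (hΓ : FlowFamily f η b O Γ) {p : M}
    {O₁ : Set (Eu n × CEps g₀ ε)} (hO₁ : IsOpen O₁) {u : Eu n × CEps g₀ ε → (ℝ →ᵇ Eu n)}
    (hu : ContDiffOn ℝ ∞ u O₁)
    (hu' : ∀ q ∈ O₁, u q 0 = q.1 ∧
      (u q, q.2) ∈ nemDom ℝ ((chartAt (Eu n) p).target ×ˢ metricSet g₀ ε) ∧
      ∀ t ∈ Icc (-δ) δ, HasDerivWithinAt (u q) (field g₀ f p (u q t, q.2)) (Icc (-δ) δ) t) :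
    ∃ Γ' : Eu k × CEps g₀ ε → ℝ → M, FlowFamily f η a {q ∈ O | Γ q b ∈ (chartAt (Eu n) p).source ∧
        (chartAt (Eu n) p (Γ q b), q.2) ∈ O₁} Γ' ∧
      ∀ q ∈ O, Γ q b ∈ (chartAt (Eu n) p).source → (chartAt (Eu n) p (Γ q b), q.2) ∈ O₁ →
        EqOn (Γ' q) (Γ q) (Ici b) ∧ ∀ t ≤ b, Γ' q t = (chartAt (Eu n) p).symm
          (u (chartAt (Eu n) p (Γ q b), q.2) (t - b)) := by
  set c := chartAt (Eu n) p with hc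
  set O' := {q ∈ O | Γ q b ∈ c.source ∧ (c (Γ q b), q.2) ∈ O₁} with hO'
  let v : Eu k × CEps g₀ ε → (ℝ →ᵇ Eu n) := fun q => u (c (Γ q b), q.2)
  let Γ' : Eu k × CEps g₀ ε → ℝ → M := fun q t => if t ≤ b then c.symm (v q (t - b)) else Γ q t
  have hD : IsOpen (c.target ×ˢ metricSet g₀ ε) := c.open_target.prod ho
  have hvt : ∀ q ∈ O', ∀ s, v q s ∈ c.target := fun q hq s => by
    obtain ⟨C, -, h1, h2⟩ := (hu' _ hq.2.2).2.1
    exact (h2 _ (h1 s)).1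
  have hΓ'b : ∀ q, ∀ t ≤ b, Γ' q t = c.symm (v q (t - b)) := fun q t ht => if_pos ht
  have hglue := fun q (hq : q ∈ O') => IsFlow.glue hf (hΓ.mem q hq.1) hab hδ
    ((hΓ.isFlow q hq.1)) hq.2.1 (hu' _ hq.2.2).1 (hvt q hq) (hu' _ hq.2.2).2.2
  have heq : ∀ q ∈ O', EqOn (Γ' q) (Γ q) (Ici b) := fun q hq => (hglue q hq).2
  have hOopen : IsOpen O' := isOpen_chart_preimage hΓ.isOpen hΓ.smooth.continuousOn hO₁
  have hkey : ContDiffOn ℝ ∞ (fun q : Eu k × CEps g₀ ε => (c (Γ q b), q.2)) O' := by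
    refine ContDiffOn.prodMk ?_ contDiff_snd.contDiffOn
    rw [← contMDiffOn_iff_contDiffOn]
    exact (contMDiffOn_chart (I := 𝓡 n) (n := ∞) (x := p)).comp (hΓ.smooth.mono (sep_subset _ _))
      fun q hq => hq.2.1
  have hv : ContDiffOn ℝ ∞ v O' := hu.comp hkey fun q hq => hq.2.2
  refine ⟨Γ', ⟨hOopen, fun q hq => hΓ.mem q hq.1, fun q hq => (hglue q hq).1, ?_, fun φ hφ => ?_⟩,
    fun q hq h1 h2 => ⟨heq q ⟨hq, h1, h2⟩, hΓ'b q⟩⟩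
  · have h1 : ContMDiffOn 𝓘(ℝ, Eu k × CEps g₀ ε) 𝓘(ℝ, Eu n) ∞ (fun q => v q (a - b)) O' := by
      rw [contMDiffOn_iff_contDiffOn]
      exact (BoundedContinuousFunction.evalCLM ℝ (a - b)).contDiff.comp_contDiffOn hv
    refine ((contMDiffOn_chart_symm (I := 𝓡 n) (n := ∞) (x := p)).comp h1
      fun q hq => hvt q hq _).congr fun q hq => hΓ'b q a hab
  · obtain ⟨B, hB, hBs⟩ := hΓ.rep φ hφ
    let Ξ : Eu n × CEps g₀ ε → ℝ := fun z => fderiv ℝ (φ ∘ c.symm) z.1 (field g₀ f p z)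
    have hΞ : ContDiffOn ℝ ∞ Ξ (c.target ×ˢ metricSet g₀ ε) := contDiffOn_slope_coord hf hφ p
    let cl : C(ℝ, ℝ) := ⟨fun t => max a (min t b), by fun_prop⟩
    have hcl : ∀ t, cl t ∈ Icc a b := fun t => ⟨le_max_left _ _, max_le hab (min_le_right _ _)⟩
    have hcl' : ∀ t ∈ Icc a b, cl t = t := fun t ht => by
      simp [cl, ht.1, ht.2]
    let clb : C(ℝ, ℝ) := ⟨fun t => cl t - b, by fun_prop⟩
    let mx : C(ℝ, ℝ) := ⟨fun t => max t b, by fun_prop⟩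
    let κ : ℝ →ᵇ ℝ := BoundedContinuousFunction.ofNormedAddCommGroup (fun t => Real.exp (η * cl t))
      (by fun_prop) (Real.exp (|η| * max |a| |b|)) fun t => by
        rw [Real.norm_of_nonneg (Real.exp_pos _).le]
        refine Real.exp_le_exp.2 ((le_abs_self _).trans ?_)
        rw [abs_mul]
        exact mul_le_mul_of_nonneg_left (abs_le_max_abs_abs (hcl t).1 (hcl t).2) (abs_nonneg _)
    let N : Eu k × CEps g₀ ε → (ℝ →ᵇ ℝ) := fun q => nem ℝ Ξ (v q, q.2)
    have hN : ContDiffOn ℝ ∞ N O' := (nem_contDiffOn hD hΞ).comp (hv.prodMk contDiff_snd.contDiffOn)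
      fun q hq => (hu' _ hq.2.2).2.1
    have hNv : ∀ q ∈ O', ∀ s, N q s = slope f φ q.2 (c.symm (v q s)) := fun q hq s => by
      rw [slope_eq hf hφ (hΓ.mem q hq.1) (c.map_target (hvt q hq s)), c.right_inv (hvt q hq s)]
      exact nem_apply hΞ.continuousOn (hu' _ hq.2.2).2.1 s
    -- The old factor is frozen at its value $B(b)$ before $b$, the factor from the flow box at its
    -- value, again $B(b)$, after $b$. Subtracting $B(b)$ once leaves the right factor on each side.
    refine ⟨fun q => bcfComp ℝ mx (B q) + bcfMul ℝ κ (bcfComp ℝ clb (N q)) - bcfConst ℝ ℝ (B q b),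
      ?_, fun q hq t ht => ?_⟩
    · have hB' := hB.mono (sep_subset O fun q => Γ q b ∈ c.source ∧ (c (Γ q b), q.2) ∈ O₁)
      refine (((bcfComp ℝ mx).contDiff.comp_contDiffOn hB').add
        (((bcfMul ℝ κ).comp (bcfComp ℝ clb)).contDiff.comp_contDiffOn hN)).sub
        (((bcfConst ℝ ℝ).comp (BoundedContinuousFunction.evalCLM ℝ b)).contDiff.comp_contDiffOn hB')
    · have hval : ∀ t, κ t * N q (clb t) = Real.exp (η * cl t) * slope f φ q.2 (Γ' q (cl t)) := by
        intro t
        rw [hNv q hq, hΓ'b q _ (hcl t).2]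
        rfl
      have hb : Real.exp (η * b) * slope f φ q.2 (Γ' q b) = B q b := by
        rw [heq q hq self_mem_Ici, hBs q hq.1 b le_rfl, ← mul_assoc, ← Real.exp_add]
        simp
      change _ = Real.exp (-(η * t)) * (B q (max t b) + κ t * N q (clb t) - B q b)
      rw [hval]
      rcases le_total t b with htb | htb
      · rw [max_eq_right htb, hcl' t ⟨ht, htb⟩, add_sub_cancel_left, ← mul_assoc, ← Real.exp_add]
        simp
      · have : cl t = b := by simp [cl, htb, hab]
        rw [max_eq_left htb, this, hb, add_sub_cancel_right, heq q hq htb, hBs q hq.1 t htb]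

/-- The starting times reachable after shrinking the parameter domain have an infimum $s$. A flow
box around $\gamma_0(s)$ extends a family that starts just after $s$ to times before $s$, unless
$s=0$ is reached. The single curve $\gamma_0$, defined down to time $0$, guides the continuation. -/
theorem FlowFamily.exists_backward_to [T2Space M] [CompleteSpace (CEps g₀ ε)]
    (hf : ContMDiff (𝓡 n) 𝓘(ℝ, ℝ) ∞ f) (ho : IsOpen (metricSet g₀ ε)) {η T : ℝ} (hT : 0 ≤ T)
    {O : Set (Eu k × CEps g₀ ε)} {Γ : Eu k × CEps g₀ ε → ℝ → M} (hΓ : FlowFamily f η T O Γ)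
    {q₀ : Eu k × CEps g₀ ε} (hq₀ : q₀ ∈ O) {γ₀ : ℝ → M} (hγ₀ : IsFlow f q₀.2 γ₀ (Ici 0))
    (he : γ₀ T = Γ q₀ T) :
    ∃ O' ⊆ O, q₀ ∈ O' ∧ ∃ Γ', FlowFamily f η 0 O' Γ' ∧ ∀ q ∈ O', EqOn (Γ' q) (Γ q) (Ici T) := by
  let S : Set ℝ := {a ∈ Icc 0 T | ∃ O' ⊆ O, q₀ ∈ O' ∧ ∃ Γ', FlowFamily f η a O' Γ' ∧
    ∀ q ∈ O', EqOn (Γ' q) (Γ q) (Ici T)}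
  have hTS : T ∈ S := ⟨⟨hT, le_rfl⟩, O, subset_rfl, hq₀, Γ, hΓ, fun q _ => eqOn_refl _ _⟩
  have hbdd : BddBelow S := ⟨0, fun a ha => ha.1.1⟩
  set s := sInf S with hs
  have hs0 : 0 ≤ s := le_csInf ⟨T, hTS⟩ fun a ha => ha.1.1
  have hh := hΓ.mem q₀ hq₀
  set p := γ₀ s
  have hps : γ₀ s ∈ (chartAt (Eu n) p).source := mem_chart_source _ _
  obtain ⟨δ, hδ, O₁, hO₁, hmem, u, hu, hu'⟩ := exists_flow_box
    ((chartAt (Eu n) p).open_target.prod ho) (contDiffOn_field (ε := ε) hf p)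
    (q₀ := (chartAt (Eu n) p (γ₀ s), q₀.2)) ⟨(chartAt (Eu n) p).map_source hps, hh⟩
  have hev : ∀ᶠ b in 𝓝[Ici 0] s, γ₀ b ∈ (chartAt (Eu n) p).source ∧
      (chartAt (Eu n) p (γ₀ b), q₀.2) ∈ O₁ := by
    have h1 := hγ₀.1 s hs0
    refine (h1.eventually ((chartAt (Eu n) p).open_source.mem_nhds hps)).and ?_
    exact (((hγ₀.2 s hs0 p hps).continuousWithinAt).prodMk continuousWithinAt_const).eventually
      (hO₁.mem_nhds hmem)
  obtain ⟨δ', hδ', hball⟩ := Metric.mem_nhdsWithin_iff.1 hev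
  -- $b$ is so close to $s$ that $\gamma_0(b)$ lies in the domain of the flow box, whose time span
  -- $\delta$ then reaches back to $s-\delta/2$.
  obtain ⟨b, hbS, hb⟩ := exists_lt_of_csInf_lt ⟨T, hTS⟩
    (show sInf S < s + min δ' (δ / 2) by rw [← hs]; linarith [lt_min hδ' (half_pos hδ)])
  have hsb : s ≤ b := csInf_le hbdd hbS
  obtain ⟨⟨hb0, hbT⟩, O', hO', hq₀', Γ', hΓ', heq⟩ := hbS
  -- The family member through $q_0$ is the reference curve itself, by uniqueness forward and
  -- backward from $T$.
  have hbγ : Γ' q₀ b = γ₀ b :=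
    ((hΓ'.isFlow q₀ hq₀').eqOn hf hh (hγ₀.mono (Ici_subset_Ici.2 hb0)) hbT
      ((heq q₀ hq₀' self_mem_Ici).trans he.symm)) self_mem_Ici
  have hbm := hball ⟨by
    rw [Metric.mem_ball, Real.dist_eq, abs_of_nonneg (by linarith)]
    linarith [min_le_left δ' (δ / 2)], hb0⟩
  have hab : max 0 (s - δ / 2) ≤ b := max_le hb0 (by linarith)
  obtain ⟨Γ'', hΓ'', heq'⟩ := hΓ'.exists_backward hf ho (a := max 0 (s - δ / 2)) (δ := δ) hab
    (le_max_of_le_right (by linarith [min_le_right δ' (δ / 2)])) hO₁ hu hu'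
  have hnew : max 0 (s - δ / 2) ∈ S := by
    refine ⟨⟨le_max_left _ _, hab.trans hbT⟩, _, ?_, ?_, Γ'', hΓ'', fun q hq t ht => ?_⟩
    · exact fun q hq => hO' hq.1
    · refine ⟨hq₀', ?_⟩
      rw [hbγ]
      exact hbm
    · rw [(heq' q hq.1 hq.2.1 hq.2.2).1 (hbT.trans ht), heq q hq.1 ht]
  have h1 := csInf_le hbdd hnew
  have h2 : max 0 (s - δ / 2) = 0 := by
    refine max_eq_left ?_
    by_contra hneg
    rw [max_eq_right (not_le.1 hneg).le, ← hs] at h1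
    linarith
  rw [h2] at hnew
  exact hnew.2

end FlowFamily

/-! ### Smooth families of stable curves -/

section StableData

open scoped BoundedContinuousFunction

variable {n k : ℕ} {M : Type*} [TopologicalSpace M] [ChartedSpace (Eu n) M]
  [IsManifold (𝓡 n) ∞ M] {g₀ : Metric n M} {ε : ℕ → Ioi (0 : ℝ)} {f : M → ℝ}

/-- The decaying curve with profile `v`, starting at the time `T`. -/
def decayCurve (η T : ℝ) (v : ℝ≥0 →ᵇ Eu n) (t : ℝ) : Eu n :=
  Real.exp (-(η * (t - T))) • v (t - T).toNNReal

theorem norm_decayCurve_le {η T : ℝ} (hη : 0 ≤ η) (v : ℝ≥0 →ᵇ Eu n) {t : ℝ} (ht : T ≤ t) :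
    ‖decayCurve η T v t‖ ≤ ‖v‖ := by
  have h1 := norm_expWeight_smul_le hη (v (t - T).toNNReal) (t - T).toNNReal
  rw [Real.coe_toNNReal _ (sub_nonneg.2 ht)] at h1
  exact h1.trans (v.norm_coe_le_norm _)

theorem tendsto_decayCurve {η T : ℝ} (hη : 0 < η) (v : ℝ≥0 →ᵇ Eu n) :
    Tendsto (decayCurve η T v) atTop (𝓝 0) := by
  have h1 : Tendsto (fun t : ℝ => Real.exp (-(η * (t - T)))) atTop (𝓝 0) :=
    Real.tendsto_exp_atBot.comp (tendsto_neg_atTop_atBot.comp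
      ((tendsto_atTop_add_const_right _ (-T) tendsto_id).const_mul_atTop hη))
  refine h1.zero_smul_isBoundedUnder_le ⟨‖v‖, ?_⟩
  rw [eventually_map]
  exact Eventually.of_forall fun t => BoundedContinuousFunction.norm_coe_le_norm _ _

theorem contMDiffOn_chartPoint (x : M) (Q : Eu n ≃L[ℝ] Eu n) {ρ : ℝ}
    (hρ : ∀ z ∈ Metric.ball (0 : Eu n) ρ, chartAt (Eu n) x x + Q z ∈ (chartAt (Eu n) x).target) :
    ContMDiffOn 𝓘(ℝ, Eu n) (𝓡 n) ∞ (chartPoint x Q) (Metric.ball 0 ρ) := by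
  have h1 : ContMDiffOn 𝓘(ℝ, Eu n) 𝓘(ℝ, Eu n) ∞ (fun z => chartAt (Eu n) x x + Q z)
      (Metric.ball 0 ρ) := by
    rw [contMDiffOn_iff_contDiffOn]
    exact (contDiff_const.add Q.contDiff).contDiffOn
  exact (contMDiffOn_chart_symm (I := 𝓡 n) (n := ∞) (x := x)).comp h1 hρ

/-- The slope of $\varphi$ vanishes at $x$ for every metric, so the weighted composition operator
extracts a factor $e^{-\eta(t-T)}$ from it along the decaying profiles. -/
theorem flowFamily_chartPoint (hf : ContMDiff (𝓡 n) 𝓘(ℝ, ℝ) ∞ f) (ho : IsOpen (metricSet g₀ ε))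
    {x : M} (hx : IsCrit (n := n) f x) {Q : Eu n ≃L[ℝ] Eu n} {ρ η : ℝ} (hη : 0 < η)
    (hρ : ∀ z ∈ Metric.ball (0 : Eu n) ρ, chartAt (Eu n) x x + Q z ∈ (chartAt (Eu n) x).target)
    {O : Set (Eu k × CEps g₀ ε)} (hO : IsOpen O) (hOm : ∀ q ∈ O, q.2 ∈ metricSet g₀ ε)
    {w : Eu k × CEps g₀ ε → (ℝ≥0 →ᵇ Eu n)} (hw : ContDiffOn ℝ ∞ w O)
    (hwρ : ∀ q ∈ O, ‖w q‖ < ρ)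
    (hd : ∀ q ∈ O, ∀ t ≥ 0, HasDerivWithinAt (fun s : ℝ => Real.exp (-(η * s)) • w q s.toNNReal)
      (linField g₀ f x Q (Real.exp (-(η * t)) • w q t.toNNReal, q.2)) (Ici 0) t) (T : ℝ) :
    FlowFamily f η T O fun q t => chartPoint x Q (decayCurve η T (w q) t) := by
  have hball : ∀ q ∈ O, ∀ t ≥ T, decayCurve η T (w q) t ∈ Metric.ball (0 : Eu n) ρ :=
    fun q hq t ht => mem_ball_zero_iff.2 ((norm_decayCurve_le hη.le _ ht).trans_lt (hwρ q hq))
  refine ⟨hO, hOm, fun q hq => ?_, ?_, fun φ hφ => ?_⟩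
  · refine isFlow_chartPoint hf (hOm q hq) (fun t ht => ?_) fun t ht => hρ _ (hball q hq t ht)
    have h2 : HasDerivWithinAt (fun t : ℝ => t - T) 1 (Ici T) t :=
      ((hasDerivAt_id t).sub_const T).hasDerivWithinAt
    have h3 := (hd q hq (t - T) (sub_nonneg.2 ht)).scomp t h2 fun r hr => sub_nonneg.2 (mem_Ici.1 hr)
    rw [one_smul] at h3
    exact h3
  · have h1 : ContMDiffOn 𝓘(ℝ, Eu k × CEps g₀ ε) 𝓘(ℝ, Eu n) ∞
        (fun q => decayCurve η T (w q) T) O := by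
      rw [contMDiffOn_iff_contDiffOn]
      refine ((BoundedContinuousFunction.evalCLM ℝ (0 : ℝ≥0)).contDiff.comp_contDiffOn hw).congr
        fun q hq => ?_
      simp [decayCurve]
    exact (contMDiffOn_chartPoint x Q hρ).comp h1 fun q hq => hball q hq T le_rfl
  · let Z : Eu n × CEps g₀ ε → ℝ := fun z => fderiv ℝ (φ ∘ (chartAt (Eu n) x).symm)
      (chartAt (Eu n) x x + Q z.1) (field g₀ f x (chartAt (Eu n) x x + Q z.1, z.2))
    have hZ : ContDiffOn ℝ ∞ Z (Metric.ball 0 ρ ×ˢ metricSet g₀ ε) :=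
      (contDiffOn_slope_coord hf hφ x).comp
        (((contDiff_const.add (Q.contDiff.comp contDiff_fst)).prodMk contDiff_snd).contDiffOn)
        fun z hz => ⟨hρ z.1 hz.1, hz.2⟩
    obtain ⟨W, hW, hWZ, -⟩ := exists_weighted_nem hη.le ho hZ fun h _ => by
      have := field_eq_zero_of_isCrit hf hx h (mem_chart_source (Eu n) x)
      simp [Z, this]
    have hwm : MapsTo (fun q : Eu k × CEps g₀ ε => (w q, q.2)) O
        (Metric.ball 0 ρ ×ˢ metricSet g₀ ε) := fun q hq =>
      ⟨mem_ball_zero_iff.2 (hwρ q hq), hOm q hq⟩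
    let sh : C(ℝ, ℝ≥0) := ⟨fun t => (t - T).toNNReal, by fun_prop⟩
    -- The factor $e^{\eta T}$ moves the origin of the weight from $T$ to $0$.
    refine ⟨fun q => Real.exp (η * T) • bcfComp ℝ sh (W (w q, q.2)), ?_, fun q hq t ht => ?_⟩
    · exact ((Real.exp (η * T) • bcfComp ℝ sh).contDiff.comp_contDiffOn
        (hW.comp (hw.prodMk contDiff_snd.contDiffOn) hwm))
    · have h1 := hWZ _ (hwm hq) (t - T).toNNReal
      rw [Real.coe_toNNReal _ (sub_nonneg.2 ht)] at h1
      have hz := hρ _ (hball q hq t ht)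
      have hz' : chartPoint x Q (decayCurve η T (w q) t) ∈ (chartAt (Eu n) x).source :=
        (chartAt (Eu n) x).map_target hz
      rw [slope_eq hf hφ (hOm q hq) hz', chart_chartPoint hz]
      refine h1.symm.trans ?_
      change Real.exp (-(η * (t - T))) * W (w q, q.2) (t - T).toNNReal =
        Real.exp (-(η * t)) * (Real.exp (η * T) * W (w q, q.2) (t - T).toNNReal)
      rw [← mul_assoc, ← Real.exp_add]
      ring_nf

variable (g₀ ε f) in
/-- A smooth family of stable curves of `x`, parametrized by the coordinates `coord` of the point at
the time `T` and by the metric, that contains all stable curves which stay in `{ψ < 1}` after the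
time `T`. -/
structure StableData (x : M) (k : ℕ) where
  T : ℝ
  T_nonneg : 0 ≤ T
  η : ℝ
  η_pos : 0 < η
  O : Set (Eu k × CEps g₀ ε)
  Γ : Eu k × CEps g₀ ε → ℝ → M
  coord : Fin k → C^∞⟮𝓡 n, M; 𝓘(ℝ, ℝ), ℝ⟯
  ψ : C^∞⟮𝓡 n, M; 𝓘(ℝ, ℝ), ℝ⟯
  family : FlowFamily f η 0 O Γ
  tendsto : ∀ q ∈ O, Tendsto (Γ q) atTop (𝓝 x)
  coord_zero : ∀ j, coord j x = 0
  coord_Γ : ∀ q ∈ O, ∀ j, coord j (Γ q T) = q.1 j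
  unique : ∀ h ∈ metricSet g₀ ε, ∀ (γ : ℝ → M) (b : ℝ), 0 ≤ b → b ≤ T → IsFlow f h γ (Ici b) →
    (∀ t ≥ T, ψ (γ t) < 1) → (WithLp.toLp 2 (fun j => coord j (γ T)), h) ∈ O →
    EqOn γ (Γ (WithLp.toLp 2 (fun j => coord j (γ T)), h)) (Ici b)

/-- The topology of $H^{1,2}_x$ sees curves only through globally defined functions, so the local
coordinates are cut off. With $\psi=1-\chi'$, the condition $\psi<1$ confines a point to the region
where the cut-off coordinates are the true ones. -/
theorem exists_cutoff_coord [T2Space M] (x : M) (Q : Eu n ≃L[ℝ] Eu n) {ρ : ℝ} (hρ : 0 < ρ) :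
    ∃ (z : Fin n → C^∞⟮𝓡 n, M; 𝓘(ℝ, ℝ), ℝ⟯) (ψ : C^∞⟮𝓡 n, M; 𝓘(ℝ, ℝ), ℝ⟯), ψ x = 0 ∧
      (∃ s > 0, ∀ v, ‖v‖ < s → ∀ i, z i (chartPoint x Q v) = v i) ∧
      ∀ m, ψ m < 1 → m ∈ (chartAt (Eu n) x).source ∧ ‖chartCoord x Q m‖ < ρ ∧
        ∀ i, z i m = chartCoord x Q m i := by
  have hs := mem_chart_source (Eu n) x
  have hc : ContinuousAt (chartCoord x Q) x :=
    Q.symm.continuous.continuousAt.comp (((chartAt (Eu n) x).continuousAt hs).sub continuousAt_const)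
  have hc0 : chartCoord x Q x = 0 := by simp [chartCoord]
  obtain ⟨χ, -, -⟩ := (SmoothBumpFunction.nhds_basis_support (I := 𝓡 n) (c := x)
    (univ_mem : univ ∈ 𝓝 x)).mem_iff.1 univ_mem
  have hG : {m | m ∈ (chartAt (Eu n) x).source ∧ ‖chartCoord x Q m‖ < ρ ∧ χ m = 1} ∈ 𝓝 x := by
    refine inter_mem ((chartAt (Eu n) x).open_source.mem_nhds hs) (inter_mem ?_ χ.eventuallyEq_one)
    refine hc.norm.eventually (gt_mem_nhds ?_)
    simpa [hc0] using hρ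
  obtain ⟨χ', hχ', -⟩ := (SmoothBumpFunction.nhds_basis_support (I := 𝓡 n) (c := x) hG).mem_iff.1 hG
  have hsm : ∀ i, ContMDiffOn (𝓡 n) 𝓘(ℝ, ℝ) ∞ (fun m => chartCoord x Q m i)
      (chartAt (Eu n) x).source := fun i => by
    have h1 : ContDiff ℝ ∞ fun y : Eu n => Q.symm (y - chartAt (Eu n) x x) i :=
      (EuclideanSpace.proj i : Eu n →L[ℝ] ℝ).contDiff.comp (Q.symm.contDiff.comp (contDiff_id.sub contDiff_const))
    exact h1.contMDiff.comp_contMDiffOn (contMDiffOn_chart (I := 𝓡 n) (n := ∞) (x := x))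
  refine ⟨fun i => ⟨fun m => χ m • chartCoord x Q m i, χ.contMDiff_smul (hsm i)⟩,
    ⟨fun m => 1 - χ' m, contMDiff_const.sub χ'.contMDiff⟩, ?_, ?_, fun m hm => ?_⟩
  · change 1 - χ' x = 0
    rw [χ'.eq_one, sub_self]
  · have hcp : ContinuousAt (chartPoint x Q) 0 := by
      have h1 : ContinuousAt (fun v : Eu n => chartAt (Eu n) x x + Q v) 0 := by fun_prop
      refine ContinuousAt.comp (g := (chartAt (Eu n) x).symm) ?_ h1
      exact (chartAt (Eu n) x).continuousAt_symm (by simp)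
    have h2 : ∀ᶠ v in 𝓝 (0 : Eu n), χ (chartPoint x Q v) = 1 ∧
        chartAt (Eu n) x x + Q v ∈ (chartAt (Eu n) x).target := by
      refine Filter.Eventually.and ?_ ?_
      · have := hcp.tendsto
        rw [chartPoint_zero] at this
        exact this.eventually χ.eventuallyEq_one
      · have h1 : ContinuousAt (fun v : Eu n => chartAt (Eu n) x x + Q v) 0 := by fun_prop
        exact h1.eventually ((chartAt (Eu n) x).open_target.mem_nhds (by simp))
    obtain ⟨s, hs0, hb⟩ := Metric.mem_nhds_iff.1 h2
    refine ⟨s, hs0, fun v hv i => ?_⟩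
    obtain ⟨h3, h4⟩ := hb (mem_ball_zero_iff.2 hv)
    change χ (chartPoint x Q v) • chartCoord x Q (chartPoint x Q v) i = v i
    rw [h3, one_smul, chartCoord_chartPoint h4]
  · have h1 : m ∈ Function.support χ' := by
      intro h0
      have h2 : 1 - χ' m < 1 := hm
      rw [h0] at h2
      linarith
    have h2 := hχ' (subset_tsupport _ h1)
    refine ⟨h2.1, h2.2.1, fun i => ?_⟩
    change χ m • chartCoord x Q m i = _
    rw [h2.2.2, one_smul]

/-- The neighbourhood $N$ is chosen before the time $T$. This leaves $T$ free: $T=0$ for the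
constant curve and $T>0$ for the others. -/
theorem exists_stableData [T2Space M] [CompleteSpace (CEps g₀ ε)] (ho : IsOpen (metricSet g₀ ε))
    (hf : IsMorse (n := n) f) {x : M} (hx : IsCrit (n := n) f x)
    (hk : k = n - morseIndex (n := n) f x) {h₀ : CEps g₀ ε} (hh₀ : h₀ ∈ metricSet g₀ ε) :
    ∃ N ∈ 𝓝 x, ∀ T ≥ 0, ∀ γ₀ : ℝ → M, IsFlow f h₀ γ₀ (Ici 0) → (∀ t ≥ T, γ₀ t ∈ N) →
      ∃ S : StableData g₀ ε f x k, S.T = T ∧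
        (WithLp.toLp 2 (fun j => S.coord j (γ₀ T)), h₀) ∈ S.O ∧ ∀ t ≥ T, S.ψ (γ₀ t) ≤ 1 / 2 := by
  obtain ⟨Q, e, η, hη, ρ, hρ, -, hρt, O, hO, h0O, hOm, w, hw, hw1, hw2⟩ :=
    exists_local_stable_family ho hf hx hk hh₀
  obtain ⟨z, ψ, hψx, ⟨s, hs, hz⟩, hψ⟩ := exists_cutoff_coord x Q hρ
  -- The constant curve at the origin is a solution with zero stable coordinates, so by uniqueness
  -- it is the member of the family at $(0,h_0)$.
  have hw0 : w (0, h₀) 0 = 0 := by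
    have h1 := hw2 (0, h₀) h0O (fun _ => 0) (fun t _ => by simpa using hρ) (fun t _ => by
      have := field_eq_zero_of_isCrit hf.1 hx h₀ (mem_chart_source (Eu n) x)
      simpa [linField, this] using hasDerivWithinAt_const t (Ici 0) (0 : Eu n)) (fun j => rfl) 0 le_rfl
    simpa using h1.symm
  -- For starting points of norm less than $s$ the cut-off coordinates return the stable
  -- coordinates, so that the parameter can be read off from the curve at time $T$.
  set O' : Set (Eu k × CEps g₀ ε) := {q ∈ O | ‖w q 0‖ < s} with hO'
  have hO'o : IsOpen O' := by
    have h1 : ContinuousOn (fun q => ‖w q 0‖) O :=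
      ((BoundedContinuousFunction.evalCLM ℝ (0 : ℝ≥0)).continuous.comp_continuousOn
        hw.continuousOn).norm
    exact h1.isOpen_inter_preimage hO isOpen_Iio
  have h0O' : (0, h₀) ∈ O' := ⟨h0O, by simpa [hw0] using hs⟩
  let coord : Fin k → C^∞⟮𝓡 n, M; 𝓘(ℝ, ℝ), ℝ⟯ := fun j => z (e j)
  have hcx : ∀ j, coord j x = 0 := fun j => by
    have := hz 0 (by simpa using hs) (e j)
    rwa [chartPoint_zero] at this
  let ζ : M → Eu k := fun m => WithLp.toLp 2 fun j => coord j m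
  have hζ : Continuous ζ := (PiLp.continuous_toLp 2 _).comp
    (continuous_pi fun j => (coord j).contMDiff.continuous)
  refine ⟨{m | ψ m < 1 / 2 ∧ (ζ m, h₀) ∈ O'}, inter_mem ?_ ?_, fun T hT γ₀ hγ₀ hN => ?_⟩
  · refine ψ.contMDiff.continuous.continuousAt.eventually (gt_mem_nhds ?_)
    rw [hψx]; norm_num
  · refine (hζ.prodMk continuous_const).continuousAt.eventually (hO'o.mem_nhds ?_)
    have : ζ x = 0 := by
      ext j; exact hcx j
    change (ζ x, h₀) ∈ O'
    rwa [this]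
  let Γ := fun (q : Eu k × CEps g₀ ε) t => chartPoint x Q (decayCurve η T (w q) t)
  have hΓ : FlowFamily f η T O' Γ := flowFamily_chartPoint hf.1 ho hx hη hρt hO'o
    (fun q hq => hOm q hq.1) (hw.mono (sep_subset _ _)) (fun q hq => (hw1 q hq.1).1)
    (fun q hq => (hw1 q hq.1).2.2) T
  -- After time $T$ the condition $\psi<1$ keeps the curve inside the ball of the local theorem,
  -- whose uniqueness statement is applied with time shifted by $T$.
  have huniq : ∀ h : CEps g₀ ε, ∀ γ : ℝ → M, IsFlow f h γ (Ici T) → (∀ t ≥ T, ψ (γ t) < 1) →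
      (ζ (γ T), h) ∈ O' → EqOn γ (Γ (ζ (γ T), h)) (Ici T) := by
    intro h γ hγ hψγ hq t ht
    have h1 := hw2 _ hq.1 (fun r => chartCoord x Q (γ (r + T)))
      (fun r hr => (hψ _ (hψγ _ (by linarith))).2.1) (fun r hr => by
        have h2 : HasDerivWithinAt (fun t : ℝ => t + T) 1 (Ici 0) r :=
          ((hasDerivAt_id r).add_const T).hasDerivWithinAt
        have hmap : MapsTo (fun t : ℝ => t + T) (Ici 0) (Ici T) := fun a ha => by
          have := mem_Ici.1 ha
          exact mem_Ici.2 (by linarith)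
        have h3 := (hγ.hasDerivWithinAt_chartCoord Q (hmap hr)
          (hψ _ (hψγ _ (hmap hr))).1).scomp r h2 hmap
        rw [one_smul] at h3
        exact h3) (fun j => by
        rw [zero_add]
        exact ((hψ _ (hψγ T le_rfl)).2.2 (e j)).symm) (t - T) (sub_nonneg.2 ht)
    rw [sub_add_cancel] at h1
    rw [← chartPoint_chartCoord Q (hψ _ (hψγ t ht)).1, h1]
    rfl
  have hψ₀ : ∀ t ≥ T, ψ (γ₀ t) < 1 := fun t ht => (hN t ht).1.trans (by norm_num)
  have hq₀ := (hN T le_rfl).2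
  have heq₀ := huniq h₀ γ₀ (hγ₀.mono (Ici_subset_Ici.2 hT)) hψ₀ hq₀
  obtain ⟨O'', hO'', hq₀', Γ', hΓ', heq⟩ := hΓ.exists_backward_to hf.1 ho hT hq₀ hγ₀
    (heq₀ self_mem_Ici)
  refine ⟨⟨T, hT, η, hη, O'', Γ', coord, ψ, hΓ', fun q hq => ?_, hcx, fun q hq j => ?_,
    fun h hh γ b hb0 hbT hγ hψγ hq => ?_⟩, rfl, hq₀', fun t ht => (hN t ht).1.le⟩
  · have h1 : Tendsto (chartPoint x Q) (𝓝 0) (𝓝 x) := by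
      have := ((contMDiffOn_chartPoint x Q hρt).continuousOn.continuousAt
        (Metric.ball_mem_nhds 0 hρ)).tendsto
      rwa [chartPoint_zero] at this
    refine (h1.comp (tendsto_decayCurve (T := T) hη (w q))).congr' ?_
    filter_upwards [eventually_ge_atTop T] with t ht
    exact (heq q hq ht).symm
  · rw [heq q hq self_mem_Ici]
    change z (e j) (chartPoint x Q (decayCurve η T (w q) T)) = q.1 j
    have h1 : decayCurve η T (w q) T = w q 0 := by simp [decayCurve]
    rw [h1, hz _ (hO'' hq).2, (hw1 q (hO'' hq).1).2.1]
  · have h1 := huniq h γ (hγ.mono (Ici_subset_Ici.2 hbT)) hψγ (hO'' hq)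
    exact hγ.eqOn hf.1 hh ((hΓ'.isFlow _ hq).mono (Ici_subset_Ici.2 hb0)) hbT
      ((h1 self_mem_Ici).trans (heq _ hq self_mem_Ici).symm)

end StableData

/-! ### The charts of the universal stable manifold -/

section Charts

open scoped BoundedContinuousFunction

variable {n k : ℕ} {M : Type*} [TopologicalSpace M] [ChartedSpace (Eu n) M]
  [IsManifold (𝓡 n) ∞ M] {g₀ : Metric n M} {ε : ℕ → Ioi (0 : ℝ)} {f : M → ℝ} {x : M}

theorem H12.pull_fst (φ : C^∞⟮𝓡 n, M; 𝓘(ℝ, ℝ), ℝ⟯) (γ : H12 n x) :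
    (γ.pull φ).1.fst =ᵐ[halfLine] fun t => φ (extend γ.1 t) - φ x :=
  Classical.choose_spec (γ.2 φ)

theorem H12.continuous_pull (φ : C^∞⟮𝓡 n, M; 𝓘(ℝ, ℝ), ℝ⟯) :
    Continuous (H12.pull (x := x) φ) :=
  continuous_iInf_dom (i := φ) continuous_induced_dom

theorem H12.continuousOn_of_pull {X : Type*} [TopologicalSpace X] {s : Set X} {τ : X → H12 n x}
    (h : ∀ φ : C^∞⟮𝓡 n, M; 𝓘(ℝ, ℝ), ℝ⟯, ContinuousOn (fun q => (τ q).pull φ) s) :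
    ContinuousOn τ s := by
  rw [continuousOn_iff_continuous_domRestrict]
  refine continuous_iInf_rng.2 fun φ => continuous_induced_rng.2 ?_
  exact continuousOn_iff_continuous_domRestrict.1 (h φ)

/-- The curve of a point of the universal stable manifold. -/
def WUniv.curve (w : WUniv g₀ ε f x) : C(ℝ≥0, M) := w.1.1.1

/-- The metric of a point of the universal stable manifold, as a perturbation of `g₀`. -/
def WUniv.form (w : WUniv g₀ ε f x) : CEps g₀ ε := w.1.2

/-- The element `φ ∘ γ - φ(x)` of `H^{1,2}([0,∞), ℝ)` for a point `(γ, g)`. -/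
def WUniv.pull (φ : C^∞⟮𝓡 n, M; 𝓘(ℝ, ℝ), ℝ⟯) (w : WUniv g₀ ε f x) : H1 := w.1.1.pull φ

theorem WUniv.pull_fst (φ : C^∞⟮𝓡 n, M; 𝓘(ℝ, ℝ), ℝ⟯) (w : WUniv g₀ ε f x) :
    (w.pull φ).1.fst =ᵐ[halfLine] fun t => φ (extend w.curve t) - φ x :=
  w.1.1.pull_fst φ

theorem WUniv.continuous_form : Continuous (WUniv.form : WUniv g₀ ε f x → _) :=
  continuous_snd.comp continuous_subtype_val

theorem WUniv.continuous_pull (φ : C^∞⟮𝓡 n, M; 𝓘(ℝ, ℝ), ℝ⟯) :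
    Continuous (WUniv.pull φ : WUniv g₀ ε f x → _) :=
  (H12.continuous_pull φ).comp (continuous_fst.comp continuous_subtype_val)

theorem WUniv.form_mem (w : WUniv g₀ ε f x) : w.form ∈ metricSet g₀ ε := w.2.1

theorem WUniv.isStableCurve (w : WUniv g₀ ε f x) : IsStableCurve g₀ f x w.form w.curve := w.2.2

theorem WUniv.ext {w w' : WUniv g₀ ε f x} (h1 : ∀ t, w.curve t = w'.curve t) (h2 : w.form = w'.form) :
    w = w' :=
  Subtype.ext (Prod.ext (Subtype.ext (ContinuousMap.ext h1)) h2)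

theorem extend_coe (γ : ℝ≥0 → M) (t : ℝ≥0) : extend γ t = γ t := by
  simp [extend]

theorem extend_eq {γ : ℝ≥0 → M} {Γ : ℝ → M} (h : ∀ t : ℝ≥0, γ t = Γ t) {t : ℝ} (ht : 0 ≤ t) :
    extend γ t = Γ t := by
  rw [extend, h, Real.coe_toNNReal t ht]

theorem WUniv.isFlow (hf : ContMDiff (𝓡 n) 𝓘(ℝ, ℝ) ∞ f) (w : WUniv g₀ ε f x) :
    IsFlow f w.form (extend w.curve) (Ici 0) :=
  w.isStableCurve.isFlow hf w.form_mem

namespace StableData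

variable (S : StableData g₀ ε f x k)

/-- The slope $e^{-\eta t}B_q(t)$ and the limit $x$ determine $\varphi\circ\Gamma_q-\varphi(x)$ as
the primitive that vanishes at infinity. It is the image of $B_q$ under a bounded linear map, hence
smooth in $q$. -/
theorem exists_pull (hf : ContMDiff (𝓡 n) 𝓘(ℝ, ℝ) ∞ f) (φ : C^∞⟮𝓡 n, M; 𝓘(ℝ, ℝ), ℝ⟯) :
    ∃ F : Eu k × CEps g₀ ε → H1, ContDiffOn ℝ ∞ F S.O ∧ ∀ q ∈ S.O,
      ((F q).1.fst =ᵐ[halfLine] fun t => φ (S.Γ q t) - φ x) ∧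
      ∀ t ≥ 0, evalH1 t (F q) = φ (S.Γ q t) - φ x := by
  obtain ⟨B, hB, hBs⟩ := S.family.rep φ φ.contMDiff
  let sh : C(ℝ≥0, ℝ) := ⟨fun t => t, NNReal.continuous_coe⟩
  have key : ∀ q ∈ S.O, ∀ t ≥ 0, φ (S.Γ q t) - φ x = expPrim S.η_pos (bcfComp ℝ sh (B q)) t := by
    intro q hq
    refine eq_expPrim S.η_pos (y := fun t => φ (S.Γ q t) - φ x) (fun t ht => ?_) ?_
    · have h1 := ((S.family.isFlow q hq).hasDerivWithinAt_comp hf φ.contMDiff (S.family.mem q hq)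
        ht).sub_const (φ x)
      rw [hBs q hq t ht] at h1
      refine h1.congr_deriv ?_
      simp only [bcfComp_apply, sh, ContinuousMap.coe_mk, Real.coe_toNNReal t ht]
    · have h1 := (φ.contMDiff.continuous.tendsto x).comp (S.tendsto q hq)
      simpa using h1.sub_const (φ x)
  refine ⟨fun q => expH1 S.η_pos (bcfComp ℝ sh (B q)),
    ((expH1 S.η_pos).comp (bcfComp ℝ sh)).contDiff.comp_contDiffOn hB, fun q hq => ⟨?_, fun t ht => ?_⟩⟩
  · filter_upwards [expH1_fst S.η_pos (bcfComp ℝ sh (B q)), ae_halfLine_nonneg] with t h1 h2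
    rw [h1, key q hq t h2]
  · rw [evalH1_expH1 S.η_pos _ ht, key q hq t ht]

theorem exists_point (hf : ContMDiff (𝓡 n) 𝓘(ℝ, ℝ) ∞ f) {q : Eu k × CEps g₀ ε} (hq : q ∈ S.O) :
    ∃ w : WUniv g₀ ε f x, w.form = q.2 ∧ ∀ t : ℝ≥0, w.curve t = S.Γ q t := by
  have hfl := S.family.isFlow q hq
  have hext : EqOn (extend fun t : ℝ≥0 => S.Γ q t) (S.Γ q) (Ici 0) := fun t ht => by
    simp [extend, Real.coe_toNNReal t ht]
  let γ : C(ℝ≥0, M) := ⟨fun t => S.Γ q t,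
    hfl.1.comp_continuous NNReal.continuous_coe fun t => t.2⟩
  have hs : IsStableCurve g₀ f x q.2 γ := isStableCurve_of_isFlow hf (S.family.mem q hq)
    (hfl.congr hext) ((S.tendsto q hq).comp (NNReal.tendsto_coe_atTop.2 tendsto_id))
  refine ⟨⟨(⟨γ, fun φ => ?_⟩, q.2), S.family.mem q hq, hs⟩, rfl, fun t => rfl⟩
  obtain ⟨F, -, hF⟩ := S.exists_pull hf φ
  refine ⟨F q, ?_⟩
  filter_upwards [(hF q hq).1, ae_halfLine_nonneg] with t h1 h2
  rw [h1, extend_eq (γ := γ) (fun t => rfl) h2]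

theorem pull_eq {φ : C^∞⟮𝓡 n, M; 𝓘(ℝ, ℝ), ℝ⟯}
    {q : Eu k × CEps g₀ ε} {w : WUniv g₀ ε f x} (hw : ∀ t : ℝ≥0, w.curve t = S.Γ q t) {U : H1}
    (hU : U.1.fst =ᵐ[halfLine] fun t => φ (S.Γ q t) - φ x) : w.pull φ = U := by
  refine H1.fst_injective ?_
  filter_upwards [hU, w.pull_fst φ, ae_halfLine_nonneg] with t h1 h2 h3
  rw [h1, h2, extend_eq hw h3]

/-- The coordinates on the universal stable manifold defined by `S`. -/
def proj : WUniv g₀ ε f x → Eu k × CEps g₀ ε := fun w =>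
  (WithLp.toLp 2 fun j => evalH1 S.T (w.pull (S.coord j)), w.form)

end StableData

/-- Every smooth curve that merely converges to $x$ belongs to one of the families. It therefore
decays exponentially and lies in $H^{1,2}_x$. -/
theorem WUniv.exists_stableData [T2Space M] [CompleteSpace (CEps g₀ ε)]
    (ho : IsOpen (metricSet g₀ ε)) (hf : IsMorse (n := n) f) (hx : IsCrit (n := n) f x)
    (hk : k = n - morseIndex (n := n) f x) {h : CEps g₀ ε} (hh : h ∈ metricSet g₀ ε) {γ : ℝ≥0 → M}
    (hγ : IsStableCurve g₀ f x h γ) :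
    ∃ S : StableData g₀ ε f x k, ((∀ t, γ t = x) → S.T = 0) ∧ ((∃ t, γ t ≠ x) → 1 ≤ S.T) ∧
      (WithLp.toLp 2 (fun j => S.coord j (extend γ S.T)), h) ∈ S.O ∧
      (∀ t ≥ S.T, S.ψ (extend γ t) ≤ 1 / 2) ∧
      ∀ t : ℝ≥0, γ t = S.Γ (WithLp.toLp 2 (fun j => S.coord j (extend γ S.T)), h) t := by
  obtain ⟨N, hN, H⟩ := MorseUniv.exists_stableData ho hf hx hk hh
  have hfl := hγ.isFlow hf.1 hh
  obtain ⟨T, hT, h1, h2, hTN⟩ : ∃ T : ℝ, 0 ≤ T ∧ ((∀ t, γ t = x) → T = 0) ∧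
      ((∃ t, γ t ≠ x) → 1 ≤ T) ∧ ∀ t ≥ T, extend γ t ∈ N := by
    by_cases hc : ∀ t, γ t = x
    · exact ⟨0, le_rfl, fun _ => rfl, fun ⟨t, ht⟩ => absurd (hc t) ht, fun t _ => by
        simpa [extend, hc] using mem_of_mem_nhds hN⟩
    · obtain ⟨T, hT⟩ := eventually_atTop.1 (hγ.2.2.eventually hN)
      -- One unit is added so that a nonconstant curve has room before $T$ in which the metric can
      -- be varied.
      refine ⟨T + 1, by positivity, fun h => absurd h hc, fun _ => by simp, fun t ht => ?_⟩
      refine hT _ ?_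
      exact NNReal.le_toNNReal_of_coe_le (by linarith)
  obtain ⟨S, rfl, hq, hψ⟩ := H T hT _ hfl hTN
  refine ⟨S, h1, h2, hq, hψ, fun t => ?_⟩
  rw [← extend_coe γ t]
  exact S.unique h hh _ 0 le_rfl S.T_nonneg hfl (fun t ht => (hψ t ht).trans_lt (by norm_num)) hq
    (mem_Ici.2 t.2)

/-- The element of $H^{1,2}$ attached to a curve is an almost-everywhere class. It has the right
values because it coincides with the explicit element given by a family through the curve. -/
theorem WUniv.evalH1_pull [T2Space M] [CompleteSpace (CEps g₀ ε)]
    (ho : IsOpen (metricSet g₀ ε)) (hf : IsMorse (n := n) f) (hx : IsCrit (n := n) f x)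
    (w : WUniv g₀ ε f x) (φ : C^∞⟮𝓡 n, M; 𝓘(ℝ, ℝ), ℝ⟯) {t : ℝ} (ht : 0 ≤ t) :
    evalH1 t (w.pull φ) = φ (extend w.curve t) - φ x := by
  obtain ⟨S, -, -, hq, -, hS⟩ := WUniv.exists_stableData ho hf hx rfl w.form_mem w.isStableCurve
  obtain ⟨F, -, hF⟩ := S.exists_pull hf.1 φ
  rw [S.pull_eq hS (hF _ hq).1, (hF _ hq).2 t ht, extend_eq hS ht]

/-- `proj` is continuous because it consists of bounded functionals of the pulls. Its inverse is
continuous because the topology of $H^{1,2}_x$ is induced by the pulls, each of which is smooth in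
the parameter. -/
theorem StableData.exists_chart [T2Space M] [CompleteSpace (CEps g₀ ε)]
    (ho : IsOpen (metricSet g₀ ε)) (hf : IsMorse (n := n) f) (hx : IsCrit (n := n) f x)
    (S : StableData g₀ ε f x k) {w₀ : WUniv g₀ ε f x}
    (hw₀ : (WithLp.toLp 2 (fun j => S.coord j (extend w₀.curve S.T)), w₀.form) ∈ S.O)
    (hψ : ∀ t ≥ S.T, S.ψ (extend w₀.curve t) ≤ 1 / 2) :
    ∃ e : OpenPartialHomeomorph (WUniv g₀ ε f x) (Eu k × CEps g₀ ε), w₀ ∈ e.source ∧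
      (∀ w, e w = S.proj w) ∧ e.target ⊆ S.O ∧ ∀ q ∈ e.target, (e.symm q).form = q.2 ∧
      ∀ t : ℝ≥0, (e.symm q).curve t = S.Γ q t := by
  classical
  have hproj : ∀ w : WUniv g₀ ε f x, S.proj w =
      (WithLp.toLp 2 (fun j => S.coord j (extend w.curve S.T)), w.form) := by
    intro w
    refine Prod.ext ?_ rfl
    ext j
    change evalH1 S.T (w.pull (S.coord j)) = _
    rw [WUniv.evalH1_pull ho hf hx w _ S.T_nonneg, S.coord_zero, sub_zero]
  have hprojc : Continuous S.proj := by
    refine Continuous.prodMk ((PiLp.continuous_toLp 2 _).comp (continuous_pi fun j => ?_))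
      WUniv.continuous_form
    exact (evalH1 S.T).continuous.comp (WUniv.continuous_pull _)
  -- A bound $r<1$ uniform in time makes the condition open: a small change of $\psi\circ\gamma$ in
  -- $H^{1,2}$ changes all its values by at most twice as much, which allows $r$ to grow to
  -- $(1+r)/2$.
  let V : Set (WUniv g₀ ε f x) := {w | ∃ r < 1, ∀ t ≥ S.T, S.ψ (extend w.curve t) ≤ r}
  have hV : IsOpen V := by
    rw [isOpen_iff_mem_nhds]
    rintro w ⟨r, hr, hwr⟩
    have hc : Continuous fun w' : WUniv g₀ ε f x => ‖w'.pull S.ψ - w.pull S.ψ‖ :=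
      ((WUniv.continuous_pull S.ψ).sub continuous_const).norm
    have h1 : ∀ᶠ w' in 𝓝 w, ‖w'.pull S.ψ - w.pull S.ψ‖ < (1 - r) / 4 :=
      hc.continuousAt.eventually (gt_mem_nhds (by simpa using by linarith))
    filter_upwards [h1] with w' hw'
    refine ⟨(1 + r) / 2, by linarith, fun t ht => ?_⟩
    have ht0 := S.T_nonneg.trans ht
    have h2 := norm_evalH1_le t (w'.pull S.ψ - w.pull S.ψ)
    rw [map_sub, WUniv.evalH1_pull ho hf hx w' _ ht0, WUniv.evalH1_pull ho hf hx w _ ht0,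
      sub_sub_sub_cancel_right] at h2
    have h3 := (le_abs_self _).trans h2
    linarith [hwr t ht]
  let τ : Eu k × CEps g₀ ε → WUniv g₀ ε f x := fun q =>
    if hq : q ∈ S.O then (S.exists_point hf.1 hq).choose else w₀
  have hτ : ∀ q ∈ S.O, (τ q).form = q.2 ∧ ∀ t : ℝ≥0, (τ q).curve t = S.Γ q t := fun q hq => by
    simp only [τ, dif_pos hq]
    exact (S.exists_point hf.1 hq).choose_spec
  have hτc : ContinuousOn τ S.O := by
    refine Topology.IsInducing.subtypeVal.continuousOn_iff.2 ?_
    refine ContinuousOn.prodMk (f := fun q => (τ q).1.1) (g := fun q => (τ q).form) ?_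
      (continuous_snd.continuousOn.congr fun q hq => (hτ q hq).1)
    refine H12.continuousOn_of_pull fun φ => ?_
    obtain ⟨F, hF, hF'⟩ := S.exists_pull hf.1 φ
    exact hF.continuousOn.congr fun q hq => S.pull_eq (hτ q hq).2 (hF' q hq).1
  have hright : ∀ q ∈ S.O, S.proj (τ q) = q := by
    intro q hq
    rw [hproj, (hτ q hq).1]
    refine Prod.ext ?_ rfl
    ext j
    change S.coord j (extend (τ q).curve S.T) = _
    rw [extend_eq (hτ q hq).2 S.T_nonneg]
    exact S.coord_Γ q hq j
  have hleft : ∀ w ∈ V, S.proj w ∈ S.O → τ (S.proj w) = w := by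
    rintro w ⟨r, hr, hwr⟩ hw
    refine WUniv.ext (fun t => ?_) (hτ _ hw).1
    rw [(hτ _ hw).2, ← extend_coe w.curve t]
    rw [hproj] at hw ⊢
    exact (S.unique _ w.form_mem _ 0 le_rfl S.T_nonneg (w.isFlow hf.1)
      (fun t ht => (hwr t ht).trans_lt hr) hw (mem_Ici.2 t.2)).symm
  let e : OpenPartialHomeomorph (WUniv g₀ ε f x) (Eu k × CEps g₀ ε) :=
    { toFun := S.proj
      invFun := τ
      source := V ∩ S.proj ⁻¹' S.O
      target := S.O ∩ τ ⁻¹' V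
      map_source' := fun w hw => ⟨hw.2, by rw [mem_preimage, hleft w hw.1 hw.2]; exact hw.1⟩
      map_target' := fun q hq => ⟨hq.2, by rw [mem_preimage, hright q hq.1]; exact hq.1⟩
      left_inv' := fun w hw => hleft w hw.1 hw.2
      right_inv' := fun q hq => hright q hq.1
      open_source := hV.inter (S.family.isOpen.preimage hprojc)
      open_target := hτc.isOpen_inter_preimage S.family.isOpen hV
      continuousOn_toFun := hprojc.continuousOn
      continuousOn_invFun := hτc.mono inter_subset_left }
  refine ⟨e, ⟨⟨1 / 2, by norm_num, hψ⟩, ?_⟩, fun w => rfl, fun q hq => hq.1, fun q hq => hτ q hq.1⟩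
  rw [mem_preimage, hproj]
  exact hw₀

end Charts

/-! ### Criteria for immersions and submersions in a chart -/

section Criteria

open Manifold

variable {E : Type*} [NormedAddCommGroup E] [NormedSpace ℝ E] {W : Type*} [TopologicalSpace W]
  [ChartedSpace E W] [IsManifold 𝓘(ℝ, E) ∞ W]

theorem contMDiffAt_of_comp_symm {F : Type*} [NormedAddCommGroup F] [NormedSpace ℝ F] {N : Type*}
    [TopologicalSpace N] [ChartedSpace F N] {G : W → N} {e : OpenPartialHomeomorph W E}
    (he : e ∈ IsManifold.maximalAtlas 𝓘(ℝ, E) ∞ W)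
    (hG : ContMDiffOn 𝓘(ℝ, E) 𝓘(ℝ, F) ∞ (G ∘ e.symm) e.target) {w : W} (hw : w ∈ e.source) :
    ContMDiffAt 𝓘(ℝ, E) 𝓘(ℝ, F) ∞ G w := by
  have h1 : ContMDiffOn 𝓘(ℝ, E) 𝓘(ℝ, F) ∞ ((G ∘ e.symm) ∘ e) e.source :=
    hG.comp (contMDiffOn_of_mem_maximalAtlas he) fun r hr => e.map_source hr
  refine (h1.congr fun r hr => ?_).contMDiffAt (e.open_source.mem_nhds hw)
  simp [e.left_inv hr]

/-- With $\Phi=G\circ e^{-1}$, $R\Phi=\mathrm{id}$ and $L=D\Phi$ at the point, the linear projection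
$R$ splits the target as $E\times\ker R$. A vertical shift of the target turns the graph-like image
of $\Phi$ into the linear image of $L$. -/
theorem isImmersionAt_of_leftInverse {F : Type*} [NormedAddCommGroup F] [NormedSpace ℝ F]
    {G : W → F} {e : OpenPartialHomeomorph W E} (he : e ∈ IsManifold.maximalAtlas 𝓘(ℝ, E) ∞ W)
    (hG : ContDiffOn ℝ ∞ (G ∘ e.symm) e.target) {w : W} (hw : w ∈ e.source) (R : F →L[ℝ] E)
    (hR : ∀ q ∈ e.target, R (G (e.symm q)) = q) :
    Manifold.IsImmersionAt 𝓘(ℝ, E) 𝓘(ℝ, F) ∞ G w := by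
  set Φ : E → F := G ∘ e.symm with hΦ
  have hwt := e.map_source hw
  let L : E →L[ℝ] F := fderiv ℝ Φ (e w)
  have hL : Function.RightInverse L R := by
    have h1 : HasFDerivAt Φ L (e w) := ((hG.contDiffAt (e.open_target.mem_nhds hwt)).differentiableAt
      (by simp)).hasFDerivAt
    have h2 : HasFDerivAt (fun q => q) (R.comp L) (e w) :=
      (R.hasFDerivAt.comp (e w) h1).congr_of_eventuallyEq (by
        filter_upwards [e.open_target.mem_nhds hwt] with q hq
        exact (hR q hq).symm)
    exact fun v => DFunLike.congr_fun (h2.unique (hasFDerivAt_id (e w))) v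
  let T : Set F := R ⁻¹' e.target
  have hT : IsOpen T := e.open_target.preimage R.continuous
  have hΦR : ContDiffOn ℝ ∞ (fun y => Φ (R y)) T := hG.comp R.contDiff.contDiffOn fun y hy => hy
  have hLR : ContDiff ℝ ∞ fun y => L (R y) := L.contDiff.comp R.contDiff
  have hf : ContDiffOn ℝ ∞ (fun y => L (R y) + (y - Φ (R y))) T :=
    hLR.contDiffOn.add (contDiff_id.contDiffOn.sub hΦR)
  have hg : ContDiffOn ℝ ∞ (fun y => y - L (R y) + Φ (R y)) T :=
    (contDiff_id.sub hLR).contDiffOn.add hΦR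
  have hRf : ∀ y ∈ T, R (L (R y) + (y - Φ (R y))) = R y := fun y hy => by
    rw [map_add, hL, map_sub, hΦ, Function.comp_apply, hR _ hy]; abel
  have hRg : ∀ y ∈ T, R (y - L (R y) + Φ (R y)) = R y := fun y hy => by
    rw [map_add, map_sub, hL, hΦ, Function.comp_apply, hR _ hy]; abel
  -- The maps $y\mapsto y\pm(LRy-\Phi Ry)$ leave $Ry$ unchanged, hence are inverse to each other,
  -- and the one with the plus sign sends $\Phi(q)$ to $Lq$.
  let c : OpenPartialHomeomorph F F :=
    { toFun := fun y => L (R y) + (y - Φ (R y))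
      invFun := fun y => y - L (R y) + Φ (R y)
      source := T
      target := T
      map_source' := fun y hy => by rw [mem_preimage, hRf y hy]; exact hy
      map_target' := fun y hy => by rw [mem_preimage, hRg y hy]; exact hy
      left_inv' := fun y hy => by
        rw [hRf y hy]; abel
      right_inv' := fun y hy => by
        rw [hRg y hy]; abel
      open_source := hT
      open_target := hT
      continuousOn_toFun := hf.continuousOn
      continuousOn_invFun := hg.continuousOn }
  have hc : c ∈ IsManifold.maximalAtlas 𝓘(ℝ, F) ∞ F :=
    c.mem_maximalAtlas_of_contMDiffOn (contMDiffOn_iff_contDiffOn.2 hf)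
      (contMDiffOn_iff_contDiffOn.2 hg)
  have hcont : ContinuousAt G w := (contMDiffAt_of_comp_symm he
    (contMDiffOn_iff_contDiffOn.2 hG) hw).continuousAt
  refine Manifold.IsImmersionAt.mk_of_continuousAt (F := R.ker) hcont
    (ContinuousLinearEquiv.equivOfRightInverse R L hL).symm e c hw ?_ he hc fun q hq => ?_
  · change R (G w) ∈ e.target
    have := hR _ hwt
    rw [e.left_inv hw] at this
    rwa [this]
  · have hq' : q ∈ e.target := by simpa using hq
    change L (R (Φ q)) + (Φ q - Φ (R (Φ q))) = L q + ((0 : R.ker) : F)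
    have h1 : R (Φ q) = q := hR q hq'
    rw [h1]
    simp

/-- A surjection onto a finite-dimensional space has a bounded right inverse, so its kernel is
complemented. The map itself together with the projection to the kernel is a new chart, by the
inverse function theorem. -/
theorem isSubmersionAt_of_surjective [CompleteSpace E] {F : Type*} [NormedAddCommGroup F]
    [NormedSpace ℝ F] [FiniteDimensional ℝ F] {N : Type*} [TopologicalSpace N] [ChartedSpace F N]
    [IsManifold 𝓘(ℝ, F) ∞ N] {G : W → N} (hG : ContMDiff 𝓘(ℝ, E) 𝓘(ℝ, F) ∞ G)
    {e : OpenPartialHomeomorph W E} (he : e ∈ IsManifold.maximalAtlas 𝓘(ℝ, E) ∞ W) {w : W}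
    (hw : w ∈ e.source) {A : E →L[ℝ] F}
    (hA : HasFDerivAt (fun q => chartAt F (G w) (G (e.symm q))) A (e w))
    (hs : Function.Surjective A) : Manifold.IsSubmersionAt 𝓘(ℝ, E) 𝓘(ℝ, F) ∞ G w := by
  set c := chartAt F (G w) with hcdef
  have hc : c ∈ IsManifold.maximalAtlas 𝓘(ℝ, F) ∞ N := IsManifold.chart_mem_maximalAtlas _
  set Φ : E → F := fun q => c (G (e.symm q)) with hΦ
  have hwt := e.map_source hw
  set D : Set E := e.target ∩ (G ∘ e.symm) ⁻¹' c.source with hD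
  have hGe : ContMDiffOn 𝓘(ℝ, E) 𝓘(ℝ, F) ∞ (G ∘ e.symm) e.target :=
    hG.comp_contMDiffOn (contMDiffOn_symm_of_mem_maximalAtlas he)
  have hDo : IsOpen D := hGe.continuousOn.isOpen_inter_preimage e.open_target c.open_source
  have hΦs : ContDiffOn ℝ ∞ Φ D := by
    rw [← contMDiffOn_iff_contDiffOn]
    exact (contMDiffOn_of_mem_maximalAtlas hc).comp (hGe.mono inter_subset_left) fun q hq => hq.2
  have hwD : e w ∈ D := ⟨hwt, by
    rw [mem_preimage, Function.comp_apply, e.left_inv hw]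
    exact mem_chart_source F (G w)⟩
  obtain ⟨L, hL⟩ := A.exists_rightInverse_of_surjective (LinearMap.range_eq_top.2 hs)
  have hL' : Function.RightInverse L A := fun v => DFunLike.congr_fun hL v
  let κ := ContinuousLinearEquiv.equivOfRightInverse A L hL'
  let pr : E →L[ℝ] A.ker := (ContinuousLinearMap.snd ℝ F A.ker).comp (κ : E →L[ℝ] F × A.ker)
  obtain ⟨e₁, he₁, hwe₁, he₁D, hsymm⟩ := exists_smooth_inverse hDo (Φ := fun q => (Φ q, pr q))
    (hΦs.prodMk pr.contDiff.contDiffOn) hwD (A := κ) (hA.prodMk pr.hasFDerivAt)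
  let d : OpenPartialHomeomorph W E :=
    e.trans (e₁.trans κ.symm.toHomeomorph.toOpenPartialHomeomorph)
  have hds : ∀ v, v ∈ d.source ↔ v ∈ e.source ∧ e v ∈ e₁.source := by
    intro v; simp [d]
  have hdt : ∀ y ∈ d.target, κ y ∈ e₁.target ∧ e₁.symm (κ y) ∈ e.target := by
    intro y hy
    simpa [d] using hy
  have hsymm' : ∀ y, d.symm y = e.symm (e₁.symm (κ y)) := fun y => rfl
  have hd : d ∈ IsManifold.maximalAtlas 𝓘(ℝ, E) ∞ W := by
    refine d.mem_maximalAtlas_of_contMDiffOn ?_ ?_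
    · have h1 : ContDiffOn ℝ ∞ (fun q => κ.symm (Φ q, pr q)) D :=
        κ.symm.contDiff.comp_contDiffOn (hΦs.prodMk pr.contDiff.contDiffOn)
      have h2 : ContMDiffOn 𝓘(ℝ, E) 𝓘(ℝ, E) ∞ ((fun q => κ.symm (Φ q, pr q)) ∘ e) d.source :=
        (contMDiffOn_iff_contDiffOn.2 h1).comp
          ((contMDiffOn_of_mem_maximalAtlas he).mono fun v hv => ((hds v).1 hv).1)
          fun v hv => he₁D ((hds v).1 hv).2
      refine h2.congr fun v hv => ?_
      change κ.symm (e₁ (e v)) = _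
      rw [he₁]
      rfl
    · have h1 : ContDiffOn ℝ ∞ (fun y => e₁.symm (κ y)) d.target :=
        hsymm.comp κ.contDiff.contDiffOn fun y hy => (hdt y hy).1
      exact (contMDiffOn_symm_of_mem_maximalAtlas he).comp (contMDiffOn_iff_contDiffOn.2 h1)
        fun y hy => (hdt y hy).2
  refine Manifold.IsSubmersionAt.mk_of_continuousAt (F := A.ker) hG.continuous.continuousAt κ d c
    ((hds w).2 ⟨hw, hwe₁⟩) (mem_chart_source F (G w)) hd hc fun y hy => ?_
  have hy' : y ∈ d.target := by simpa using hy
  change c (G (d.symm y)) = (κ y).1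
  rw [hsymm']
  have h1 := e₁.right_inv (hdt y hy').1
  rw [he₁] at h1
  exact congrArg Prod.fst h1

end Criteria

/-! ### The smooth structure of the universal stable manifold -/

section Atlas

variable {n : ℕ} {M : Type*} [TopologicalSpace M] [ChartedSpace (Eu n) M]
  [IsManifold (𝓡 n) ∞ M] {g₀ : Metric n M} {ε : ℕ → Ioi (0 : ℝ)} {f : M → ℝ} {x : M}

/-- `e` is a chart whose inverse is the family `S`. -/
structure IsStableChart (S : StableData g₀ ε f x (n - morseIndex (n := n) f x))
    (e : OpenPartialHomeomorph (WUniv g₀ ε f x) (WModel g₀ ε f x)) : Prop where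
  apply : ∀ w, e w = S.proj w
  target_subset : e.target ⊆ S.O
  form_symm : ∀ q ∈ e.target, (e.symm q).form = q.2
  curve_symm : ∀ q ∈ e.target, ∀ t : ℝ≥0, (e.symm q).curve t = S.Γ q t

namespace IsStableChart

variable {S S' : StableData g₀ ε f x (n - morseIndex (n := n) f x)}
  {e e' : OpenPartialHomeomorph (WUniv g₀ ε f x) (WModel g₀ ε f x)}

theorem contDiffOn_pull (hf : ContMDiff (𝓡 n) 𝓘(ℝ, ℝ) ∞ f) (h : IsStableChart S e)
    (φ : C^∞⟮𝓡 n, M; 𝓘(ℝ, ℝ), ℝ⟯) :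
    ContDiffOn ℝ ∞ (fun q => (e.symm q).pull φ) e.target := by
  obtain ⟨F, hF, hF'⟩ := S.exists_pull hf φ
  exact (hF.mono h.target_subset).congr fun q hq =>
    S.pull_eq (h.curve_symm q hq) (hF' q (h.target_subset hq)).1

/-- This covers the transition maps: the inverse of one chart is smooth after every pull, and the
coordinates of another chart are bounded functionals of pulls. -/
theorem contDiffOn_proj_symm (hf : ContMDiff (𝓡 n) 𝓘(ℝ, ℝ) ∞ f) (h : IsStableChart S e)
    (S' : StableData g₀ ε f x (n - morseIndex (n := n) f x)) :
    ContDiffOn ℝ ∞ (fun q => S'.proj (e.symm q)) e.target := by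
  have h1 : ContDiffOn ℝ ∞ (fun q : WModel g₀ ε f x => (e.symm q).form) e.target :=
    contDiff_snd.contDiffOn.congr h.form_symm
  refine ContDiffOn.prodMk ?_ h1
  rw [contDiffOn_euclidean]
  exact fun j => (evalH1 S'.T).contDiff.comp_contDiffOn (h.contDiffOn_pull hf (S'.coord j))

theorem contDiffOn_inclusionMap (hf : ContMDiff (𝓡 n) 𝓘(ℝ, ℝ) ∞ f) (h : IsStableChart S e)
    {N : ℕ} (φ : Fin N → C^∞⟮𝓡 n, M; 𝓘(ℝ, ℝ), ℝ⟯) :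
    ContDiffOn ℝ ∞ (inclusionMap φ ∘ e.symm) e.target := by
  have h1 : ContDiffOn ℝ ∞ (fun q : WModel g₀ ε f x => (e.symm q).form) e.target :=
    contDiff_snd.contDiffOn.congr h.form_symm
  exact ContDiffOn.prodMk (contDiffOn_pi.2 fun i => h.contDiffOn_pull hf (φ i)) h1

theorem contMDiffOn_evalZero (h : IsStableChart S e) :
    ContMDiffOn 𝓘(ℝ, WModel g₀ ε f x) (𝓡 n) ∞ (evalZero ∘ e.symm) e.target :=
  (S.family.smooth.mono h.target_subset).congr fun q hq => h.curve_symm q hq 0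

end IsStableChart

variable [T2Space M] [CompleteSpace (CEps g₀ ε)]

theorem WUniv.exists_chart (ho : IsOpen (metricSet g₀ ε)) (hf : IsMorse (n := n) f)
    (hx : IsCrit (n := n) f x) (w : WUniv g₀ ε f x) :
    ∃ (S : StableData g₀ ε f x (n - morseIndex (n := n) f x))
      (e : OpenPartialHomeomorph (WUniv g₀ ε f x) (WModel g₀ ε f x)), w ∈ e.source ∧
      IsStableChart S e ∧ ((∀ t, w.curve t = x) → S.T = 0) ∧ ((∃ t, w.curve t ≠ x) → 1 ≤ S.T) ∧
      ∀ t ≥ S.T, S.ψ (extend w.curve t) ≤ 1 / 2 := by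
  obtain ⟨S, h1, h2, hq, hψ, -⟩ := WUniv.exists_stableData ho hf hx rfl w.form_mem w.isStableCurve
  obtain ⟨e, hw, ha, ht, hs⟩ := S.exists_chart ho hf hx hq hψ
  exact ⟨S, e, hw, ⟨ha, ht, fun q hq => (hs q hq).1, fun q hq => (hs q hq).2⟩, h1, h2, hψ⟩

/-- The last clause keeps, for every point, a chart given by a family with control on $T$; the
submersion statements are proved in these charts. -/
theorem exists_atlas (ho : IsOpen (metricSet g₀ ε)) (hf : IsMorse (n := n) f)
    (hx : IsCrit (n := n) f x) :
    ∃ _ : ChartedSpace (WModel g₀ ε f x) (WUniv g₀ ε f x), IsSubmanifoldAtlas g₀ ε f x ∧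
      ContMDiff 𝓘(ℝ, WModel g₀ ε f x) (𝓡 n) ∞ (evalZero : WUniv g₀ ε f x → M) ∧
      ∀ w : WUniv g₀ ε f x, ∃ (S : StableData g₀ ε f x (n - morseIndex (n := n) f x))
        (e : OpenPartialHomeomorph (WUniv g₀ ε f x) (WModel g₀ ε f x)),
        e ∈ IsManifold.maximalAtlas 𝓘(ℝ, WModel g₀ ε f x) ∞ (WUniv g₀ ε f x) ∧ w ∈ e.source ∧
        IsStableChart S e ∧ ((∀ t, w.curve t = x) → S.T = 0) ∧
        ((∃ t, w.curve t ≠ x) → 1 ≤ S.T) ∧ ∀ t ≥ S.T, S.ψ (extend w.curve t) ≤ 1 / 2 := by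
  choose S e hw hS h0 h1 hψ using fun w : WUniv g₀ ε f x => w.exists_chart ho hf hx
  let C : ChartedSpace (WModel g₀ ε f x) (WUniv g₀ ε f x) :=
    { atlas := range e
      chartAt := e
      mem_chart_source := hw
      chart_mem_atlas := fun w => mem_range_self w }
  have hman : IsManifold 𝓘(ℝ, WModel g₀ ε f x) ∞ (WUniv g₀ ε f x) := by
    refine isManifold_of_contDiffOn _ _ _ ?_
    rintro _ _ ⟨v, rfl⟩ ⟨v', rfl⟩
    have h2 := (hS v).contDiffOn_proj_symm hf.1 (S v')
    refine (h2.mono fun q hq => ?_).congr fun q hq => (hS v').apply _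
    exact hq.1.1
  have hmax : ∀ w, e w ∈ IsManifold.maximalAtlas 𝓘(ℝ, WModel g₀ ε f x) ∞ (WUniv g₀ ε f x) :=
    fun w => IsManifold.chart_mem_maximalAtlas w
  refine ⟨C, ⟨hman, fun N φ w => ?_, fun w => ?_⟩, fun w => ?_, fun w =>
    ⟨S w, e w, hmax w, hw w, hS w, h0 w, h1 w, hψ w⟩⟩
  · exact contMDiffAt_of_comp_symm (hmax w)
      (contMDiffOn_iff_contDiffOn.2 ((hS w).contDiffOn_inclusionMap hf.1 φ)) (hw w)
  · refine ⟨_, (S w).coord, ?_⟩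
    -- Evaluation of the coordinate functions at time $T$ recovers the chart parameter, and it is
    -- linear and bounded on $H^{1,2}$: a left inverse of the inclusion.
    let R : (Fin (n - morseIndex (n := n) f x) → H1) × CEps g₀ ε →L[ℝ] WModel g₀ ε f x :=
      ((PiLp.continuousLinearEquiv 2 ℝ fun _ => ℝ).symm.toContinuousLinearMap.comp
        (ContinuousLinearMap.pi fun j => (evalH1 (S w).T).comp
          (ContinuousLinearMap.proj j))).prodMap (ContinuousLinearMap.id ℝ _)
    refine isImmersionAt_of_leftInverse (hmax w) ((hS w).contDiffOn_inclusionMap hf.1 _) (hw w) R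
      fun q hq => ?_
    have h2 := (e w).right_inv hq
    rw [(hS w).apply] at h2
    exact h2
  · exact contMDiffAt_of_comp_symm (hmax w) (hS w).contMDiffOn_evalZero (hw w)

end Atlas

/-! ### The linearized flow -/

section Linearized

open scoped BoundedContinuousFunction

variable {E : Type} [NormedAddCommGroup E] [NormedSpace ℝ E]

/-- Integration over `[0, t]`, as a bounded operator. -/
def bcfIntegral (E : Type*) [NormedAddCommGroup E] [NormedSpace ℝ E] (t : ℝ) : (ℝ →ᵇ E) →L[ℝ] E :=
  LinearMap.mkContinuous
    { toFun := fun v => ∫ s in (0 : ℝ)..t, v s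
      map_add' := fun v w => intervalIntegral.integral_add (v.continuous.intervalIntegrable _ _)
        (w.continuous.intervalIntegrable _ _)
      map_smul' := fun c v => intervalIntegral.integral_smul c v } |t| fun v => by
    have := intervalIntegral.norm_integral_le_of_norm_le_const (a := (0 : ℝ)) (b := t)
      (fun r _ => v.norm_coe_le_norm r)
    rw [sub_zero] at this
    rw [mul_comm]
    exact this

@[simp] theorem bcfIntegral_apply (t : ℝ) (v : ℝ →ᵇ E) :
    bcfIntegral E t v = ∫ s in (0 : ℝ)..t, v s := rfl

/-- The flow satisfies an integral equation in terms of the composition operator `nem`, which is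
differentiated in $q$; the result is the linearized equation in integral form. -/
theorem fderiv_flow_eq [ProperSpace E] {P : Type*} [NormedAddCommGroup P] [NormedSpace ℝ P]
    {D : Set (E × P)} (hD : IsOpen D) {X : E × P → E} (hX : ContDiffOn ℝ ∞ X D) {δ : ℝ}
    {O : Set (E × P)} (hO : IsOpen O) {u : E × P → (ℝ →ᵇ E)} (hu : ContDiffOn ℝ ∞ u O)
    (hu' : ∀ q ∈ O, u q 0 = q.1 ∧ (u q, q.2) ∈ nemDom ℝ D ∧ ∀ t ∈ Icc (-δ) δ,
      HasDerivWithinAt (u q) (X (u q t, q.2)) (Icc (-δ) δ) t)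
    {q : E × P} (hq : q ∈ O) (k : E × P) {t : ℝ} (ht : t ∈ Icc (-δ) δ) :
    fderiv ℝ u q k t = k.1 + ∫ s in (0 : ℝ)..t, fderiv ℝ X (u q s, q.2) (fderiv ℝ u q k s, k.2) := by
  have hδ : 0 ∈ Icc (-δ) δ := by
    have : -δ ≤ δ := ht.1.trans ht.2
    constructor <;> linarith
  have h1 : ∀ q ∈ O, u q t = q.1 + bcfIntegral E t (nem ℝ X (u q, q.2)) := by
    intro q hq
    obtain ⟨h2, h3, h4⟩ := hu' q hq
    have hn := nem_apply hX.continuousOn h3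
    rw [bcfIntegral_apply, intervalIntegral.integral_eq_sub_of_hasDeriv_right (f := u q)
      (u q).continuous.continuousOn (fun s hs => ?_)
      ((nem ℝ X (u q, q.2)).continuous.intervalIntegrable _ _), h2]
    · abel
    · have hs' : s ∈ Icc (-δ) δ := by
        have := (convex_Icc (-δ) δ).ordConnected.uIcc_subset hδ ht
        exact this (by rw [uIcc]; exact Ioo_subset_Icc_self hs)
      have hlt : s < δ := hs.2.trans_le (max_le hδ.2 ht.2)
      rw [hn]
      refine (h4 s hs').mono_of_mem_nhdsWithin ?_
      filter_upwards [Ioo_mem_nhdsGT hlt] with r hr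
      exact ⟨hs'.1.trans hr.1.le, hr.2.le⟩
  have hud : HasFDerivAt u (fderiv ℝ u q) q :=
    ((hu.contDiffAt (hO.mem_nhds hq)).differentiableAt (by simp)).hasFDerivAt
  have h2 : HasFDerivAt (fun q => u q t)
      ((BoundedContinuousFunction.evalCLM ℝ t : (ℝ →ᵇ E) →L[ℝ] E).comp (fderiv ℝ u q)) q :=
    (BoundedContinuousFunction.evalCLM ℝ t : (ℝ →ᵇ E) →L[ℝ] E).hasFDerivAt.comp q hud
  have h3 := (nem_hasFDerivAt hD (hX.of_le (by simp)) (hu' q hq).2.1).comp q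
    (hud.prodMk hasFDerivAt_snd)
  have h4 := (hasFDerivAt_fst (p := q)).add ((bcfIntegral E t).hasFDerivAt.comp q h3)
  have h5 := h2.unique (h4.congr_of_eventuallyEq (by
    filter_upwards [hO.mem_nhds hq] with r hr using h1 r hr))
  refine (DFunLike.congr_fun h5 k).trans ?_
  change k.1 + bcfIntegral E t _ = _
  rw [bcfIntegral_apply]
  congr 1
  refine intervalIntegral.integral_congr fun s _ => ?_
  have h6 := nem_apply (T := ℝ) (hX.continuousOn_fderiv_of_isOpen hD (by simp)) (hu' q hq).2.1 s
  change nem ℝ (fderiv ℝ X) (u q, q.2) s (bcfPair ℝ E P (fderiv ℝ u q k, k.2) s) = _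
  rw [h6, bcfPair_apply]

/-- A linear differential equation on a short interval, with an inhomogeneity that is almost a
nonnegative multiple of `ζ`. -/
theorem inner_ne_zero_of_linear_ode {E : Type*} [NormedAddCommGroup E] [InnerProductSpace ℝ E]
    [CompleteSpace E] {b C c δ : ℝ} (hb : 0 < b) (hC : 8 * (b * C) ≤ 1) (hC0 : 0 ≤ C) {v g : ℝ → E} {A : ℝ → E →L[ℝ] E}
    {κ : ℝ → ℝ} {ζ : E} (hζ : ζ ≠ 0) (hv : ContinuousOn v (Icc (-b) 0))
    (hA : ContinuousOn (fun s => A s (v s)) (Icc (-b) 0)) (hg : ContinuousOn g (Icc (-b) 0))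
    (hκ : ContinuousOn κ (Icc (-b) 0)) (hAC : ∀ s ∈ Icc (-b) 0, ‖A s‖ ≤ C)
    (hint : ∀ t ∈ Icc (-b) 0, v t = ∫ s in (0 : ℝ)..t, (A s (v s) + g s))
    (hκ0 : ∀ s ∈ Icc (-b) 0, 0 ≤ κ s) (hc : c = ∫ s in (-b)..0, κ s) (hc0 : 0 < c)
    (hgκ : ∀ s ∈ Icc (-b) 0, ‖g s - κ s • ζ‖ ≤ ‖ζ‖ / 8 * κ s + δ) (hδ : δ * b ≤ c * ‖ζ‖ / 8) :
    inner ℝ ζ (v (-b)) ≠ 0 := by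
  have hb0 : (-b : ℝ) ≤ 0 := by linarith
  have hζ' : 0 < ‖ζ‖ := norm_pos_iff.2 hζ
  have hsub : ∀ {a : ℝ}, a ∈ Icc (-b) 0 → uIcc a 0 ⊆ Icc (-b) 0 := fun {a} ha => by
    rw [uIcc_of_le ha.2]; exact Icc_subset_Icc_left ha.1
  obtain ⟨s₀, hs₀, hmax⟩ := isCompact_Icc.exists_isMaxOn (nonempty_Icc.2 hb0) hv.norm
  set m := ‖v s₀‖
  have hm : ∀ s ∈ Icc (-b) 0, ‖v s‖ ≤ m := fun s hs => hmax hs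
  have hm0 : 0 ≤ m := norm_nonneg _
  have hAv : ∀ s ∈ Icc (-b) 0, ‖A s (v s)‖ ≤ C * m := fun s hs =>
    ((A s).le_opNorm _).trans (mul_le_mul (hAC s hs) (hm s hs) (norm_nonneg _) hC0)
  have hκi : IntervalIntegrable κ volume (-b) 0 :=
    ContinuousOn.intervalIntegrable (by rwa [uIcc_of_le hb0])
  have hbound : ∀ (a d : ℝ), IntervalIntegrable (fun s => a + d * κ s) volume (-b) 0 ∧
      ∫ s in (-b)..0, (a + d * κ s) = a * b + d * c := fun a d => by
    refine ⟨(intervalIntegrable_const).add (hκi.const_mul d), ?_⟩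
    rw [intervalIntegral.integral_add intervalIntegrable_const (hκi.const_mul d),
      intervalIntegral.integral_const, intervalIntegral.integral_const_mul, ← hc, smul_eq_mul]
    ring
  have hg' : ∀ s ∈ Icc (-b) 0, ‖g s‖ ≤ ‖ζ‖ * κ s + ‖ζ‖ / 8 * κ s + δ := fun s hs => by
    have h1 : ‖g s‖ ≤ ‖g s - κ s • ζ‖ + ‖κ s • ζ‖ := norm_le_norm_sub_add _ _
    rw [norm_smul, Real.norm_of_nonneg (hκ0 s hs)] at h1
    linarith [hgκ s hs]
  have hδ0 : 0 ≤ δ + ‖ζ‖ / 8 * κ s₀ := by linarith [hgκ s₀ hs₀, norm_nonneg (g s₀ - κ s₀ • ζ)]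
  have hv0 : m ≤ C * m * b + (9 / 8 * (c * ‖ζ‖) + δ * b) := by
    have h1 : m ≤ ∫ s in s₀..0, (C * m + δ + 9 / 8 * ‖ζ‖ * κ s) := by
      change ‖v s₀‖ ≤ _
      rw [hint s₀ hs₀, intervalIntegral.integral_symm, norm_neg]
      refine intervalIntegral.norm_integral_le_of_norm_le hs₀.2 (ae_of_all _ fun s hs => ?_)
        ((hbound _ _).1.mono_set (by rw [uIcc_of_le hb0]; exact hsub hs₀))
      have hs' : s ∈ Icc (-b) 0 := ⟨hs₀.1.trans hs.1.le, hs.2⟩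
      linarith [norm_add_le (A s (v s)) (g s), hAv s hs', hg' s hs']
    have h2 : ∫ s in s₀..0, (C * m + δ + 9 / 8 * ‖ζ‖ * κ s) ≤
        ∫ s in (-b)..0, (C * m + δ + 9 / 8 * ‖ζ‖ * κ s) := by
      refine intervalIntegral.integral_mono_interval hs₀.1 hs₀.2 le_rfl ?_ (hbound _ _).1
      refine (ae_restrict_iff' measurableSet_Ioc).2 (ae_of_all _ fun s hs => ?_)
      have hs' : s ∈ Icc (-b) 0 := Ioc_subset_Icc_self hs
      have h3 := hgκ s hs'
      have h4 := norm_nonneg (g s - κ s • ζ)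
      have h5 := mul_nonneg hζ'.le (hκ0 s hs')
      have h6 : 0 ≤ C * m := mul_nonneg hC0 hm0
      simp only [Pi.zero_apply]
      nlinarith
    rw [(hbound _ _).2] at h2
    linarith
  -- From $bC\le\frac18$ and $\delta b\le\frac18c\|\zeta\|$:
  -- $m\le\frac18m+\frac98c\|\zeta\|+\frac18c\|\zeta\|$.
  have hm1 : m ≤ 10 / 7 * (c * ‖ζ‖) := by nlinarith [mul_le_mul_of_nonneg_right hC hm0]
  -- To leading order $v(-b)=-c\,\zeta$. The error is at most
  -- $\frac18m+\frac18c\|\zeta\|+\frac18c\|\zeta\|$, which is less than $c\|\zeta\|$.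
  have hend : ‖v (-b) + c • ζ‖ < c * ‖ζ‖ := by
    have hmem : -b ∈ Icc (-b) 0 := ⟨le_rfl, hb0⟩
    have e : v (-b) + c • ζ = -∫ s in (-b)..0, ((A s (v s) + g s) - κ s • ζ) := by
      rw [intervalIntegral.integral_sub, hint _ hmem, intervalIntegral.integral_symm (-b) 0,
        intervalIntegral.integral_smul_const, ← hc]
      · abel
      · exact ContinuousOn.intervalIntegrable (by rw [uIcc_of_le hb0]; exact hA.add hg)
      · exact ContinuousOn.intervalIntegrable (by
          rw [uIcc_of_le hb0]; exact hκ.smul continuousOn_const)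
    rw [e, norm_neg]
    have h1 : ‖∫ s in (-b)..0, ((A s (v s) + g s) - κ s • ζ)‖ ≤
        ∫ s in (-b)..0, (C * m + δ + ‖ζ‖ / 8 * κ s) := by
      refine intervalIntegral.norm_integral_le_of_norm_le hb0 (ae_of_all _ fun s hs => ?_)
        (hbound _ _).1
      have hs' : s ∈ Icc (-b) 0 := Ioc_subset_Icc_self hs
      have h2 := norm_add_le (A s (v s)) (g s - κ s • ζ)
      rw [← add_sub_assoc] at h2
      linarith [hAv s hs', hgκ s hs']
    rw [(hbound _ _).2] at h1
    have h2 : 0 < c * ‖ζ‖ := mul_pos hc0 hζ'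
    nlinarith [mul_le_mul_of_nonneg_right hC hm0]
  intro h0
  have h1 : inner ℝ ζ (v (-b) + c • ζ) = c * (‖ζ‖ * ‖ζ‖) := by
    rw [inner_add_right, h0, zero_add, real_inner_smul_right, real_inner_self_eq_norm_mul_norm]
  have h2 := real_inner_le_norm ζ (v (-b) + c • ζ)
  nlinarith [mul_lt_mul_of_pos_left hend hζ']

end Linearized

/-! ### Bilinear forms with prescribed values and the variation of the gradient -/

section Variation

variable {n : ℕ} {M : Type*} [TopologicalSpace M] [ChartedSpace (Eu n) M] [IsManifold (𝓡 n) ∞ M]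
  {g₀ : Metric n M} {ε : ℕ → Ioi (0 : ℝ)} {f : M → ℝ}

/-- Polarization with the parallelogram law: the diagonal of a symmetric form controls its norm
without loss. -/
theorem norm_le_of_symm {B : Eu n →L[ℝ] Eu n →L[ℝ] ℝ} (hB : ∀ u v, B u v = B v u) {C : ℝ}
    (hC : 0 ≤ C) (h : ∀ v, |B v v| ≤ C * ‖v‖ ^ 2) : ‖B‖ ≤ C := by
  refine ContinuousLinearMap.opNorm_le_of_unit_norm hC fun u hu =>
    ContinuousLinearMap.opNorm_le_of_unit_norm hC fun v hv => ?_
  have h1 := abs_le.1 (h (u + v))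
  have h2 := abs_le.1 (h (u - v))
  have h3 := parallelogram_law_with_norm ℝ u v
  have h4 := hB u v
  simp only [map_add, map_sub, add_apply, sub_apply] at h1 h2
  rw [hu, hv] at h3
  have h5 : C * (‖u + v‖ ^ 2 + ‖u - v‖ ^ 2) = C * (2 * (1 ^ 2 + 1 ^ 2)) := by rw [h3]
  rw [Real.norm_eq_abs, abs_le]
  constructor <;> nlinarith

theorem norm_coordForm_sub_le {h S : BilinForm n M} (hh : ∀ m u v, h m u v = h m v u)
    (hS : ∀ m u v, S m u v = S m v u) {δ : ℝ} (hδ : 0 ≤ δ)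
    (hd : ∀ m v, |h m v v - S m v v| ≤ δ * g₀.inner m v v) {p : M} {y : Eu n}
    (hy : y ∈ (chartAt (Eu n) p).target) :
    ‖coordForm h p y - coordForm S p y‖ ≤ δ * ‖coordForm g₀.toBilin p y‖ := by
  refine norm_le_of_symm (fun u v => ?_) (by positivity) fun v => ?_
  · simp only [sub_apply, coordForm_apply _ _ hy]
    rw [hh, hS]
  · have h1 := hd ((chartAt (Eu n) p).symm y)
      ((trivializationAt (Eu n) (TangentSpace (𝓡 n)) p).symm ((chartAt (Eu n) p).symm y) v)
    have h2 := coordForm_apply g₀.toBilin p hy v v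
    have h3 := (le_abs_self _).trans (ContinuousLinearMap.le_opNorm₂ (coordForm g₀.toBilin p y) v v)
    rw [h2] at h3
    simp only [sub_apply, coordForm_apply _ _ hy]
    refine h1.trans ?_
    rw [mul_assoc, pow_two, ← mul_assoc ‖_‖]
    exact mul_le_mul_of_nonneg_left h3 hδ

/-- With $\alpha(X)=1$ and $\beta=-G\zeta$, the symmetric form
$\alpha\otimes\beta+\beta\otimes\alpha-\beta(X)\,\alpha\otimes\alpha$ sends $X$ to $\beta$. So a
nonzero gradient can be moved in any direction by varying the metric. -/
theorem exists_symm_inverse_apply {G : Eu n →L[ℝ] Eu n →L[ℝ] ℝ} (hG : G.IsInvertible) {X : Eu n}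
    (hX : X ≠ 0) (ζ : Eu n) :
    ∃ B : Eu n →L[ℝ] Eu n →L[ℝ] ℝ, (∀ u v, B u v = B v u) ∧ -(G.inverse (B X)) = ζ := by
  let α : Eu n →L[ℝ] ℝ := (‖X‖ ^ 2)⁻¹ • innerSL ℝ X
  have hα : α X = 1 := by
    change (‖X‖ ^ 2)⁻¹ * inner ℝ X X = 1
    rw [real_inner_self_eq_norm_sq]
    exact inv_mul_cancel₀ (by positivity)
  let β : Eu n →L[ℝ] ℝ := -G ζ
  let B : Eu n →L[ℝ] Eu n →L[ℝ] ℝ := α.smulRight β + β.smulRight α - β X • α.smulRight α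
  have hBX : B X = β := by
    ext v
    change α X * β v + β X * α v - β X * (α X * α v) = β v
    rw [hα]
    ring
  refine ⟨B, fun u v => ?_, ?_⟩
  · change α u * β v + β u * α v - β X * (α u * α v) = α v * β u + β v * α u - β X * (α v * α u)
    ring
  · rw [hBX, map_neg, neg_neg, hG.inverse_apply_self]

/-- $B$ is pulled back by the cut-off chart $Z:M\to\mathbb R^n$, whose differential at $p$ is the
identity in coordinates. No cut-off of the form itself is needed. -/
theorem exists_bilinForm_at [T2Space M] (p : M) {B : Eu n →L[ℝ] Eu n →L[ℝ] ℝ}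
    (hB : ∀ u v, B u v = B v u) :
    ∃ S : BilinForm n M, (∀ m u v, S m u v = S m v u) ∧
      coordForm S p (chartAt (Eu n) p p) = B := by
  obtain ⟨χ, -, -⟩ := (SmoothBumpFunction.nhds_basis_support (I := 𝓡 n) (c := p)
    (univ_mem : univ ∈ 𝓝 p)).mem_iff.1 univ_mem
  let Z : M → Eu n := fun m => χ m • chartAt (Eu n) p m
  have hZ : ContMDiff (𝓡 n) 𝓘(ℝ, Eu n) ∞ Z :=
    χ.contMDiff_smul (contMDiffOn_chart (I := 𝓡 n) (n := ∞) (x := p))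
  let D : M → Eu n → Eu n →L[ℝ] Eu n := fun q y => fderiv ℝ (Z ∘ (chartAt (Eu n) q).symm) y
  let L : M → Eu n → Eu n →L[ℝ] Eu n →L[ℝ] ℝ := fun q y =>
    ((ContinuousLinearMap.compL ℝ (Eu n) (Eu n) ℝ).flip (D q y)).comp (B.comp (D q y))
  have hL : ∀ q y u v, L q y u v = B (D q y u) (D q y v) := fun q y u v => rfl
  obtain ⟨S, hS⟩ := exists_bilinForm (fun m => L m (chartAt (Eu n) m m)) L (fun q => by
      have h1 : ContDiffOn ℝ ∞ (D q) (chartAt (Eu n) q).target :=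
        (contDiffOn_comp_chart_symm hZ q).fderiv_of_isOpen (m := ∞) (chartAt (Eu n) q).open_target
          (by simp)
      exact ((ContinuousLinearMap.compL ℝ (Eu n) (Eu n) ℝ).flip.contDiff.comp_contDiffOn h1).clm_comp
        (contDiffOn_const.clm_comp h1)) (fun q m hm u v => by
      have hs := mem_chart_source (Eu n) m
      have h1 : ∀ u, D q (chartAt (Eu n) q m) u =
          D m (chartAt (Eu n) m m) (toCoord m m (ofCoord q m u)) := fun u => by
        have h2 := fderiv_comp_transition hZ (chart_mem_transition_source hm hs) u
        rw [transition_apply, (chartAt (Eu n) q).left_inv hm] at h2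
        rw [toCoord_ofCoord_of_mem hm hs]
        exact h2
      rw [hL, hL, h1, h1])
  refine ⟨S, fun m u v => ?_, ?_⟩
  · rw [apply_eq_coordForm S (mem_chart_source (Eu n) m),
      apply_eq_coordForm S (mem_chart_source (Eu n) m), hS m _ (mem_chart_target _ m), hL, hL, hB]
  · rw [hS p _ (mem_chart_target _ p)]
    have h1 : D p (chartAt (Eu n) p p) = ContinuousLinearMap.id ℝ _ := by
      have h2 : Z ∘ (chartAt (Eu n) p).symm =ᶠ[𝓝 (chartAt (Eu n) p p)] id := by
        have hc : Tendsto (chartAt (Eu n) p).symm (𝓝 (chartAt (Eu n) p p)) (𝓝 p) := by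
          have := (chartAt (Eu n) p).continuousAt_symm (mem_chart_target _ p)
          rwa [ContinuousAt, (chartAt (Eu n) p).left_inv (mem_chart_source _ p)] at this
        filter_upwards [hc.eventually χ.eventuallyEq_one,
          (chartAt (Eu n) p).open_target.mem_nhds (mem_chart_target _ p)] with y h3 h4
        change χ _ • chartAt (Eu n) p _ = y
        rw [h3, (chartAt (Eu n) p).right_inv h4]
        exact one_smul _ _
      exact h2.fderiv_eq.trans fderiv_id
    ext u v
    rw [hL, h1]
    rfl

/-- Differentiation of $(g_0+h)(X_h,\cdot)=-df$ in $h$ with the point held fixed. -/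
theorem fderiv_field (hf : ContMDiff (𝓡 n) 𝓘(ℝ, ℝ) ∞ f) (ho : IsOpen (metricSet g₀ ε)) {p : M}
    {z : Eu n × CEps g₀ ε} (hy : z.1 ∈ (chartAt (Eu n) p).target) (hh : z.2 ∈ metricSet g₀ ε)
    (k : CEps g₀ ε) :
    fderiv ℝ (field g₀ f p) z (0, k) =
      -((metricCoord g₀ p z).inverse (coordForm k.1 p z.1 (field g₀ f p z))) := by
  obtain ⟨y, h⟩ := z
  have hD : IsOpen ((chartAt (Eu n) p).target ×ˢ metricSet g₀ ε) :=
    (chartAt (Eu n) p).open_target.prod ho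
  have h1 : HasFDerivAt (field g₀ f p) (fderiv ℝ (field g₀ f p) (y, h)) (y, h) :=
    (((contDiffOn_field hf p).contDiffAt (hD.mem_nhds ⟨hy, hh⟩)).differentiableAt
      (by simp)).hasFDerivAt
  have h2 : HasFDerivAt (fun h' => field g₀ f p (y, h')) ((fderiv ℝ (field g₀ f p) (y, h)).comp
      (ContinuousLinearMap.inr ℝ (Eu n) (CEps g₀ ε))) h := h1.comp h (hasFDerivAt_prodMk_right y h)
  have h3 : HasFDerivAt (fun h' => metricCoord g₀ p (y, h')) (coordL g₀ ε p hy) h :=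
    (coordL g₀ ε p hy).hasFDerivAt.const_add (coordForm g₀.toBilin p y)
  have h4 := h3.clm_apply h2
  have h5 : HasFDerivAt (fun h' => metricCoord g₀ p (y, h') (field g₀ f p (y, h')))
      (0 : CEps g₀ ε →L[ℝ] Eu n →L[ℝ] ℝ) h := by
    refine (hasFDerivAt_const (-fderiv ℝ (f ∘ (chartAt (Eu n) p).symm) y) h).congr_of_eventuallyEq ?_
    filter_upwards [ho.mem_nhds hh] with h' hh'
    ext u
    exact metricCoord_field (z := (y, h')) hy hh' u
  have h6 := DFunLike.congr_fun (h4.unique h5) k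
  change metricCoord g₀ p (y, h) (fderiv ℝ (field g₀ f p) (y, h) (0, k)) +
    coordForm k.1 p y (field g₀ f p (y, h)) = 0 at h6
  rw [← map_neg, ← eq_neg_of_add_eq_zero_left h6,
    (metricCoord_isInvertible (z := (y, h)) hy hh).inverse_apply_self]

theorem field_add_smul {p m : M} (hm : m ∈ (chartAt (Eu n) p).source) (h : CEps g₀ ε)
    {k : CEps g₀ ε} (hk : k.1 m = 0) (c : ℝ) :
    field g₀ f p (chartAt (Eu n) p m, h + c • k) = field g₀ f p (chartAt (Eu n) p m, h) := by
  have h1 : coordForm k.1 p (chartAt (Eu n) p m) = 0 := by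
    ext u v
    rw [coordForm_chart k.1 hm, hk]
    rfl
  have h2 : coordForm (h + c • k).1 p (chartAt (Eu n) p m) =
      coordForm h.1 p (chartAt (Eu n) p m) := by
    change coordForm (h.1 + c • k.1) p (chartAt (Eu n) p m) = _
    simp only [coordForm_add, coordForm_smul, h1, smul_zero, add_zero]
  unfold field metricCoord
  simp only [h2]

theorem slope_self_neg (hf : ContMDiff (𝓡 n) 𝓘(ℝ, ℝ) ∞ f) {h : CEps g₀ ε}
    (hh : h ∈ metricSet g₀ ε) {m : M} (hm : ¬ IsCrit (n := n) f m) : slope f f h m < 0 := by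
  have hs := mem_chart_source (Eu n) m
  have ht := mem_chart_target (Eu n) m
  rw [slope_eq hf hf hh hs, ← neg_neg (fderiv ℝ _ _ _),
    ← metricCoord_field (z := (chartAt (Eu n) m m, h)) ht hh, neg_lt_zero]
  exact metricCoord_pos (z := (chartAt (Eu n) m m, h)) ht hh fun h0 =>
    hm (isCrit_of_field_eq_zero hf hh hs h0)

/-- A flow line that meets a critical point is constant by uniqueness, so a nonconstant one has
negative slope of $f$ at all times. -/
theorem IsFlow.strictAntiOn [T2Space M] (hf : ContMDiff (𝓡 n) 𝓘(ℝ, ℝ) ∞ f) {h : CEps g₀ ε}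
    (hh : h ∈ metricSet g₀ ε) {γ : ℝ → M} (hγ : IsFlow f h γ (Ici 0)) {t₁ t₂ : ℝ} (h₁ : 0 ≤ t₁)
    (h₂ : 0 ≤ t₂) (hne : γ t₁ ≠ γ t₂) :
    (∀ t ≥ 0, ¬ IsCrit (n := n) f (γ t)) ∧ StrictAntiOn (f ∘ γ) (Ici 0) := by
  have hcrit : ∀ t ≥ 0, ¬ IsCrit (n := n) f (γ t) := fun t ht hc => by
    have h1 := isFlow_const (field_eq_zero_of_isCrit hf hc h (mem_chart_source _ _)) hf hh (Ici 0)
    have h2 := hγ.eqOn hf hh h1 ht rfl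
    exact hne ((h2 h₁).trans (h2 h₂).symm)
  refine ⟨hcrit, strictAntiOn_of_deriv_neg (convex_Ici 0)
    (hf.continuous.comp_continuousOn hγ.1) fun t ht => ?_⟩
  rw [interior_Ici] at ht
  have h1 := (hγ.hasDerivWithinAt_comp hf hf hh (mem_Ici.2 (le_of_lt ht))).hasDerivAt
    (Ici_mem_nhds ht)
  rw [h1.deriv]
  exact slope_self_neg hf hh (hcrit t (le_of_lt ht))

end Variation

/-! ### The evaluation map is a submersion -/

section Submersion

open scoped BoundedContinuousFunction

variable {n k : ℕ} {M : Type*} [TopologicalSpace M] [ChartedSpace (Eu n) M] [IsManifold (𝓡 n) ∞ M]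
  {g₀ : Metric n M} {ε : ℕ → Ioi (0 : ℝ)} {f : M → ℝ} {x : M} [T2Space M]

theorem IsFlow.chart_symm_eq (hf : ContMDiff (𝓡 n) 𝓘(ℝ, ℝ) ∞ f) {h : CEps g₀ ε}
    (hh : h ∈ metricSet g₀ ε) {b δ : ℝ} (hb : 0 ≤ b) (hδ : b ≤ δ) {γ : ℝ → M}
    (hγ : IsFlow f h γ (Ici 0)) {p : M} (hp : γ b ∈ (chartAt (Eu n) p).source) {y : ℝ → Eu n}
    (hy0 : y 0 = chartAt (Eu n) p (γ b)) (hyt : ∀ s, y s ∈ (chartAt (Eu n) p).target)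
    (hy : ∀ s ∈ Icc (-δ) δ, HasDerivWithinAt y (field g₀ f p (y s, h)) (Icc (-δ) δ) s) :
    ∀ s ∈ Icc (-b) 0, (chartAt (Eu n) p).symm (y s) = γ (s + b) := by
  obtain ⟨h1, h2⟩ := (hγ.mono (Ici_subset_Ici.2 hb)).glue hf hh hb (by linarith) hp hy0 hyt hy
  have h3 := h1.eqOn hf hh hγ hb (h2 self_mem_Ici)
  intro s hs
  have h4 := h3 (show s + b ∈ Ici 0 by simp only [mem_Ici]; linarith [hs.1])
  simp only [add_sub_cancel_right] at h4
  rwa [if_pos (by linarith [hs.2])] at h4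

theorem IsFlow.add_smul {h k : CEps g₀ ε} {γ : ℝ → M} {s : Set ℝ} (hγ : IsFlow f h γ s)
    (hk : ∀ t ∈ s, k.1 (γ t) = 0) (c : ℝ) : IsFlow f (h + c • k) γ s :=
  ⟨hγ.1, fun t ht p hp => by
    rw [field_add_smul hp h (hk t ht)]
    exact hγ.2 t ht p hp⟩

/-- If $k'$ vanishes along the curve after $b$, the curve still solves the perturbed equation on
$[b,\infty)$ and has the same coordinates at $T\ge b$. By uniqueness it is there the member of the
family for the perturbed metric. -/
theorem StableData.eventually_eqOn (S : StableData g₀ ε f x k)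
    {q : Eu k × CEps g₀ ε} (hq : q ∈ S.O) (hψ : ∀ t ≥ S.T, S.ψ (S.Γ q t) < 1) {b : ℝ} (hb : 0 ≤ b)
    (hbT : b ≤ S.T) {k' : CEps g₀ ε} (hk : ∀ t ≥ b, k'.1 (S.Γ q t) = 0) :
    ∀ᶠ c : ℝ in 𝓝 0, (q.1, q.2 + c • k') ∈ S.O ∧ EqOn (S.Γ q) (S.Γ (q.1, q.2 + c • k')) (Ici b) := by
  have hc : ContinuousAt (fun c : ℝ => (q.1, q.2 + c • k')) 0 := by fun_prop
  have h1 : (q.1, q.2 + (0 : ℝ) • k') ∈ S.O := by simpa using hq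
  filter_upwards [hc.eventually (S.family.isOpen.mem_nhds h1)] with c hcO
  have h2 : WithLp.toLp 2 (fun j => S.coord j (S.Γ q S.T)) = q.1 := by
    ext j
    exact S.coord_Γ q hq j
  have h3 := S.unique _ (S.family.mem _ hcO) (S.Γ q) b hb hbT
    (((S.family.isFlow q hq).mono (Ici_subset_Ici.2 hb)).add_smul hk c) hψ (by rwa [h2])
  rw [h2] at h3
  exact ⟨hcO, h3⟩

-- The metric is varied near $\gamma(0)$ only, so $\gamma(b)$ stays fixed and $\gamma(0)$ is the
-- image of $\gamma(b)$ under the backward flow. Its variation solves the linearized equation with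
-- inhomogeneity close to $\kappa\zeta$, where $\kappa\ge0$ is a bump along the curve. Over the
-- short time $b$ the homogeneous part is negligible, so the endpoint has a nonzero component along
-- $\zeta$.
set_option maxHeartbeats 1000000 in
theorem StableData.exists_inner_ne_zero [CompleteSpace (CEps g₀ ε)] (hd : LocallyDense g₀ ε)
    (ho : IsOpen (metricSet g₀ ε)) (hf : ContMDiff (𝓡 n) 𝓘(ℝ, ℝ) ∞ f) (S : StableData g₀ ε f x k)
    (hT : 0 < S.T) {q : Eu k × CEps g₀ ε} (hq : q ∈ S.O) (hψ : ∀ t ≥ S.T, S.ψ (S.Γ q t) < 1)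
    {t₁ t₂ : ℝ} (ht₁ : 0 ≤ t₁) (ht₂ : 0 ≤ t₂) (hne : S.Γ q t₁ ≠ S.Γ q t₂)
    {A : Eu k × CEps g₀ ε →L[ℝ] Eu n}
    (hA : HasFDerivAt (fun r => chartAt (Eu n) (S.Γ q 0) (S.Γ r 0)) A q) {ζ : Eu n} (hζ : ζ ≠ 0) :
    ∃ k' : CEps g₀ ε, inner ℝ ζ (A (0, k')) ≠ 0 := by
  obtain ⟨ξ, h⟩ := q
  set γ := S.Γ (ξ, h) with hγdef
  have hh : h ∈ metricSet g₀ ε := S.family.mem _ hq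
  have hγ : IsFlow f h γ (Ici 0) := S.family.isFlow _ hq
  obtain ⟨hcrit, hanti⟩ := hγ.strictAntiOn hf hh ht₁ ht₂ hne
  set p := γ 0 with hpdef
  have hp := mem_chart_source (Eu n) p
  set c := chartAt (Eu n) p with hcdef
  have hyt : c p ∈ c.target := c.map_source hp
  set D : Set (Eu n × CEps g₀ ε) := c.target ×ˢ metricSet g₀ ε with hDdef
  have hD : IsOpen D := c.open_target.prod ho
  set X : Eu n × CEps g₀ ε → Eu n := field g₀ f p with hXdef
  have hX : ContDiffOn ℝ ∞ X D := contDiffOn_field hf p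
  have hX0 : X (c p, h) ≠ 0 := fun h0 => hcrit 0 le_rfl (isCrit_of_field_eq_zero hf hh hp h0)
  -- The ideal variation at $p=\gamma(0)$: it moves the gradient field exactly by $\zeta$. It need
  -- not belong to $C^\infty_\varepsilon$ once extended to $M$, and is approximated below.
  obtain ⟨B, hB, hBζ⟩ := exists_symm_inverse_apply
    (metricCoord_isInvertible (g₀ := g₀) (z := (c p, h)) hyt hh) hX0 ζ
  obtain ⟨S₀, hS₀, hS₀B⟩ := exists_bilinForm_at p hB
  obtain ⟨δ, hδ, O₁, hO₁, hmem, u, hu, hu'⟩ := exists_flow_box hD hX (q₀ := (c p, h)) ⟨hyt, hh⟩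
  -- the quantities that are controlled near `p`
  have hcX' : ContinuousOn (fun y => (fderiv ℝ X (y, h)).comp (ContinuousLinearMap.inl ℝ _ _))
      c.target := by
    have := hX.continuousOn_fderiv_of_isOpen hD (by simp)
    exact ((this.comp (Continuous.prodMk_left h).continuousOn fun y hy => ⟨hy, hh⟩)).clm_comp
      continuousOn_const
  have hcX : ContinuousOn (fun y => X (y, h)) c.target :=
    hX.continuousOn.comp (Continuous.prodMk_left h).continuousOn fun y hy => ⟨hy, hh⟩
  have hcG : ContinuousOn (fun y => (metricCoord g₀ p (y, h)).inverse) c.target := fun y hy =>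
    ((metricCoord_isInvertible (z := (y, h)) hy hh).contDiffAt_map_inverse
      (n := 0)).continuousAt.comp_continuousWithinAt (f := fun y => metricCoord g₀ p (y, h))
      (((contDiffOn_metricCoord p).continuousOn.comp (Continuous.prodMk_left h).continuousOn
        fun y hy => ⟨hy, mem_univ _⟩) y hy)
  have hcS : ContinuousOn (coordForm S₀ p) c.target := (contDiffOn_coordForm S₀ p).continuousOn
  have hcg : ContinuousOn (coordForm g₀.toBilin p) c.target :=
    (contDiffOn_coordForm g₀.toBilin p).continuousOn
  set Y : Eu n → Eu n := fun y =>
    -((metricCoord g₀ p (y, h)).inverse (coordForm S₀ p y (X (y, h)))) with hYdef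
  have hcY : ContinuousOn Y c.target := (hcG.clm_apply (hcS.clm_apply hcX)).neg
  set κ₀ : Eu n → ℝ := fun y => ‖(metricCoord g₀ p (y, h)).inverse‖ *
    ‖coordForm g₀.toBilin p y‖ * ‖X (y, h)‖ with hκ₀def
  have hcκ₀ : ContinuousOn κ₀ c.target := (hcG.norm.mul hcg.norm).mul hcX.norm
  set C := ‖(fderiv ℝ X (c p, h)).comp (ContinuousLinearMap.inl ℝ _ _)‖ + 1 with hCdef
  have hC : 0 < C := by positivity
  have hζ' : 0 < ‖ζ‖ := norm_pos_iff.2 hζ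
  have hnear : ∀ᶠ y in 𝓝 (c p), ‖(fderiv ℝ X (y, h)).comp (ContinuousLinearMap.inl ℝ _ _)‖ < C ∧
      ‖Y y - ζ‖ < ‖ζ‖ / 8 ∧ κ₀ y < κ₀ (c p) + 1 ∧ (y, h) ∈ O₁ := by
    have ht := c.open_target.mem_nhds hyt
    refine ((hcX'.continuousAt ht).norm.eventually (gt_mem_nhds (lt_add_one _))).and
      (Filter.Eventually.and ?_ (((hcκ₀.continuousAt ht).eventually (gt_mem_nhds (lt_add_one _))).and ?_))
    · have h1 : ContinuousAt (fun y => ‖Y y - ζ‖) (c p) := ((hcY.continuousAt ht).sub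
        continuousAt_const).norm
      refine h1.eventually (gt_mem_nhds ?_)
      have h2 : Y (c p) = ζ := by simp only [hYdef, hcdef, hS₀B]; exact hBζ
      simp only [h2, sub_self, norm_zero]
      positivity
    · exact (Continuous.prodMk_left h).continuousAt.eventually (hO₁.mem_nhds hmem)
  obtain ⟨N, hN, hNo, hpN⟩ := eventually_nhds_iff.1
    (((c.continuousAt hp).eventually hnear).and (c.open_source.mem_nhds hp))
  -- the initial piece of the flow line
  obtain ⟨r, hr, hrN⟩ : ∃ r > 0, ∀ t ∈ Ico 0 r, γ t ∈ N := by
    have h1 := (hγ.1 0 self_mem_Ici).eventually (hNo.mem_nhds hpN)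
    obtain ⟨r, hr, h2⟩ := mem_nhdsGE_iff_exists_Ico_subset.1 h1
    exact ⟨r, hr, fun t ht => h2 ht⟩
  -- The four bounds on $b$ keep the curve in $N$, keep it in the time span of the flow box, place
  -- $b$ before $T$, and make $bC\le\frac18$.
  obtain ⟨b, hb, hbr⟩ := exists_between (lt_min hr (lt_min hδ (lt_min hT
    (show 0 < (8 * C)⁻¹ by positivity))))
  have hbr' := lt_min_iff.1 hbr
  have hbδ := (lt_min_iff.1 hbr'.2).1
  have hbT := (lt_min_iff.1 (lt_min_iff.1 hbr'.2).2).1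
  have hbC : 8 * (b * C) ≤ 1 := by
    have := (lt_min_iff.1 (lt_min_iff.1 hbr'.2).2).2
    rw [lt_inv_comm₀ hb (by positivity), ← one_div, lt_div_iff₀ hb] at this
    nlinarith
  have hγN : ∀ s ∈ Icc (-b) 0, γ (s + b) ∈ N := fun s hs =>
    hrN _ ⟨by linarith [hs.1], by linarith [hs.2, hbr'.1]⟩
  have hγbN : γ b ∈ N := hrN _ ⟨hb.le, hbr'.1⟩
  have hO : (c (γ b), h) ∈ O₁ := (hN _ hγbN).1.2.2.2
  obtain ⟨hu0, hun, hud⟩ := hu' _ hO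
  have hut : ∀ s, u (c (γ b), h) s ∈ c.target := by
    obtain ⟨K, -, h1, h2⟩ := hun
    exact fun s => (h2 _ (h1 s)).1
  have huγ : ∀ s ∈ Icc (-b) 0, u (c (γ b), h) s = c (γ (s + b)) := by
    intro s hs
    rw [← hγ.chart_symm_eq hf hh hb.le hbδ.le (hN _ hγbN).2 hu0 hut hud s hs, c.right_inv (hut s)]
  -- the variation of the metric
  obtain ⟨V, hV, hpV, hVW, -, hVd⟩ := hd (N ∩ {m | f (γ b) < f m})
    (hNo.inter (isOpen_lt continuous_const hf.continuous)) p
    ⟨hpN, hanti self_mem_Ici hb.le hb⟩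
  obtain ⟨χ, -, hχV⟩ := (SmoothBumpFunction.nhds_basis_tsupport (I := 𝓡 n) p).mem_iff.1
    (hV.mem_nhds hpV)
  obtain ⟨S₁, hS₁⟩ := exists_bilinForm_smul χ χ.contMDiff S₀
  have hS₁V : S₁ ∈ formsIn V := by
    refine ⟨fun m u v => by rw [hS₁, hS₁, hS₀], fun m hm => ?_⟩
    ext u v
    rw [hS₁, image_eq_zero_of_notMem_tsupport fun h0 => hm (hχV h0), zero_mul]
    rfl
  have hS₁s : ∀ y ∈ c.target, coordForm S₁ p y = χ (c.symm y) • coordForm S₀ p y := by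
    intro y hy
    ext u v
    rw [coordForm_apply _ _ hy, hS₁, smul_apply, smul_apply, coordForm_apply _ _ hy]
    rfl
  set κ : ℝ → ℝ := fun s => χ (γ (s + b)) with hκdef
  have hγc : ContinuousOn (fun s => γ (s + b)) (Icc (-b) 0) :=
    hγ.1.comp (by fun_prop) fun s hs => by simp only [mem_Ici]; linarith [hs.1]
  have hκc : ContinuousOn κ (Icc (-b) 0) := χ.continuous.comp_continuousOn hγc
  have hκ0 : 0 < ∫ s in (-b)..0, κ s := by
    refine intervalIntegral.integral_pos (by linarith) hκc (fun s _ => χ.nonneg) ⟨-b, ?_, ?_⟩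
    · exact ⟨le_rfl, by linarith⟩
    · simp only [hκdef, neg_add_cancel, ← hpdef, χ.eq_one, zero_lt_one]
  set I := ∫ s in (-b)..0, κ s with hIdef
  have hκp : 0 ≤ κ₀ (c p) := by positivity
  -- The tolerance is such that the error in the inhomogeneity, integrated over time $b$, is
  -- $I\|\zeta\|/8$; the factor $\kappa_0(c(p))+1$ bounds the effect of an error in the form on the
  -- field.
  obtain ⟨k', hk'V, hk'⟩ := hVd S₁ hS₁V (I * ‖ζ‖ / 8 / b / (κ₀ (c p) + 1)) (by positivity)
  refine ⟨k', ?_⟩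
  -- The support lies where $f>f(\gamma(b))$, and $f$ decreases along the curve.
  have hk'γ : ∀ t ≥ b, k'.1 (γ t) = 0 := fun t ht => hk'V.2 _ fun hmV => by
    have h1 : f (γ b) < f (γ t) := (hVW (subset_closure hmV)).2
    exact absurd (hanti.antitoneOn hb.le (hb.le.trans ht) ht) (not_le.2 h1)
  set v := fderiv ℝ u (c (γ b), h) (0, k') with hvdef
  -- For small $\sigma$, $\Gamma_{(\xi,h+\sigma k')}(0)$ is reached from the fixed point $\gamma(b)$
  -- by the backward flow of the perturbed metric, so both derivatives in $\sigma$ agree.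
  have hAv : A (0, k') = v (-b) := by
    have hl : ∀ {F : Type} [NormedAddCommGroup F] [NormedSpace ℝ F] (a : F),
        HasDerivAt (fun σ : ℝ => (a, h + σ • k')) (0, k') 0 := fun a => by
      have h1 := (hasDerivAt_const (0 : ℝ) a).prodMk
        (((hasDerivAt_id (0 : ℝ)).smul_const k').const_add h)
      simpa using h1
    have h1 : HasDerivAt (fun σ : ℝ => c (S.Γ (ξ, h + σ • k') 0)) (A (0, k')) 0 :=
      hA.comp_hasDerivAt_of_eq 0 (hl ξ) (by simp)
    have h2 : HasFDerivAt u (fderiv ℝ u (c (γ b), h)) (c (γ b), h) :=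
      ((hu.contDiffAt (hO₁.mem_nhds hO)).differentiableAt (by simp)).hasFDerivAt
    have h3 : HasDerivAt (fun σ : ℝ => u (c (γ b), h + σ • k') (-b)) (v (-b)) 0 :=
      ((BoundedContinuousFunction.evalCLM ℝ (-b) : (ℝ →ᵇ Eu n) →L[ℝ] Eu n).hasFDerivAt.comp _
        h2).comp_hasDerivAt_of_eq 0 (hl (c (γ b))) (by simp)
    refine h1.unique (h3.congr_of_eventuallyEq ?_)
    filter_upwards [S.eventually_eqOn hq hψ hb.le hbT.le hk'γ,
      (hl (c (γ b))).continuousAt.eventually (hO₁.mem_nhds (by simpa using hO))] with σ hσ hσO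
    obtain ⟨h4, h5, h6⟩ := hu' _ hσO
    have h7 : S.Γ (ξ, h + σ • k') b = γ b := (hσ.2 self_mem_Ici).symm
    have h8 : ∀ s, u (c (γ b), h + σ • k') s ∈ c.target := by
      obtain ⟨K, -, h8, h9⟩ := h5
      exact fun s => (h9 _ (h8 s)).1
    have h9 := (S.family.isFlow _ hσ.1).chart_symm_eq hf (S.family.mem _ hσ.1) hb.le hbδ.le
      (p := p) (by rw [h7]; exact (hN _ hγbN).2) (by rw [h7]; exact h4) h8 h6 (-b)
      ⟨le_rfl, by linarith⟩
    rw [neg_add_cancel] at h9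
    rw [← h9, c.right_inv (h8 _)]
  have hX' : ContinuousOn (fun s => fderiv ℝ X (u (c (γ b), h) s, h)) (Icc (-b) 0) :=
    (hX.continuousOn_fderiv_of_isOpen hD (by simp)).comp
      ((u (c (γ b), h)).continuous.prodMk continuous_const).continuousOn fun s _ => ⟨hut s, hh⟩
  rw [hAv]
  refine inner_ne_zero_of_linear_ode (b := b) (C := C) (c := I)
    (δ := I * ‖ζ‖ / 8 / b / (κ₀ (c p) + 1) * (κ₀ (c p) + 1)) (v := v)
    (A := fun s => (fderiv ℝ X (u (c (γ b), h) s, h)).comp (ContinuousLinearMap.inl ℝ _ _))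
    (g := fun s => fderiv ℝ X (u (c (γ b), h) s, h) (0, k')) (κ := κ) hb hbC hC.le hζ
    v.continuous.continuousOn ?_ ?_ hκc ?_ ?_ (fun s _ => χ.nonneg) rfl hκ0 ?_ ?_
  · exact (hX'.clm_comp continuousOn_const).clm_apply v.continuous.continuousOn
  · exact hX'.clm_apply continuousOn_const
  · intro s hs
    rw [huγ s hs]
    exact (hN _ (hγN s hs)).1.1.le
  · intro t ht
    have h1 := fderiv_flow_eq hD hX hO₁ hu hu' hO (0, k') (t := t)
      ⟨by linarith [ht.1], by linarith [ht.2]⟩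
    rw [zero_add] at h1
    refine h1.trans (intervalIntegral.integral_congr fun s _ => ?_)
    change fderiv ℝ X _ (v s, k') = fderiv ℝ X _ (v s, 0) + fderiv ℝ X _ (0, k')
    rw [← map_add, Prod.mk_add_mk, add_zero, zero_add]
  · intro s hs
    have hm := hN _ (hγN s hs)
    have hy : c (γ (s + b)) ∈ c.target := c.map_source hm.2
    simp only [huγ s hs]
    set y := c (γ (s + b)) with hydef
    have h1 : fderiv ℝ X (y, h) (0, k') - κ s • ζ =
        -((metricCoord g₀ p (y, h)).inverse
          ((coordForm k'.1 p y - coordForm S₁ p y) (X (y, h)))) + κ s • (Y y - ζ) := by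
      rw [hXdef, fderiv_field hf ho (z := (y, h)) hy hh, hS₁s y hy, hydef, c.left_inv hm.2]
      simp only [hYdef, hκdef, sub_apply, smul_apply, map_sub, map_smul, smul_sub, smul_neg]
      abel
    rw [h1]
    refine (norm_add_le _ _).trans ?_
    rw [norm_neg, norm_smul, Real.norm_of_nonneg χ.nonneg, add_comm]
    refine add_le_add ?_ ?_
    · rw [mul_comm]
      exact mul_le_mul_of_nonneg_right hm.1.2.1.le χ.nonneg
    · have h2 := norm_coordForm_sub_le hk'V.1 hS₁V.1 (by positivity) hk' hy
      refine ((ContinuousLinearMap.le_opNorm _ _).trans (mul_le_mul_of_nonneg_left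
        (ContinuousLinearMap.le_of_opNorm_le _ h2 _) (norm_nonneg _))).trans ?_
      refine le_trans (le_of_eq ?_) (mul_le_mul_of_nonneg_left hm.1.2.2.1.le (by positivity))
      simp only [hκ₀def]
      ring
  · apply le_of_eq
    field_simp

end Submersion

/-! ### The submersion property at nonconstant and at constant curves. -/

section Evaluation

variable {n : ℕ} {M : Type*} [TopologicalSpace M] [ChartedSpace (Eu n) M] [IsManifold (𝓡 n) ∞ M]
  {g₀ : Metric n M} {ε : ℕ → Ioi (0 : ℝ)} {f : M → ℝ} {x : M}
  {S : StableData g₀ ε f x (n - morseIndex (n := n) f x)}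
  {e : OpenPartialHomeomorph (WUniv g₀ ε f x) (WModel g₀ ε f x)} {w : WUniv g₀ ε f x}

theorem IsStableChart.curve_eq (hS : IsStableChart S e) (hw : w ∈ e.source) (t : ℝ≥0) :
    w.curve t = S.Γ (e w) t := by
  have := hS.curve_symm (e w) (e.map_source hw) t
  rwa [e.left_inv hw] at this

theorem IsStableChart.exists_hasFDerivAt (hS : IsStableChart S e) (hw : w ∈ e.source) :
    ∃ A : WModel g₀ ε f x →L[ℝ] Eu n,
      HasFDerivAt (fun q => chartAt (Eu n) (evalZero w) (evalZero (e.symm q))) A (e w) ∧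
      HasFDerivAt (fun q => chartAt (Eu n) (evalZero w) (S.Γ q 0)) A (e w) := by
  have hwt := e.map_source hw
  have h0 : ∀ q ∈ e.target, evalZero (e.symm q) = S.Γ q 0 := fun q hq => hS.curve_symm q hq 0
  have h1 : S.Γ (e w) 0 = evalZero w := (hS.curve_eq hw 0).symm
  have h2 : ContMDiffAt 𝓘(ℝ, WModel g₀ ε f x) 𝓘(ℝ, Eu n) ∞
      (fun q => chartAt (Eu n) (evalZero w) (S.Γ q 0)) (e w) := by
    refine ContMDiffAt.comp (I' := 𝓡 n) (e w) ?_
      (S.family.smooth.contMDiffAt (S.family.isOpen.mem_nhds (hS.target_subset hwt)))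
    rw [h1]
    exact (contMDiffOn_chart (I := 𝓡 n) (n := ∞) (x := evalZero w)).contMDiffAt
      ((chartAt (Eu n) (evalZero w)).open_source.mem_nhds (mem_chart_source _ _))
  have h3 := ((contMDiffAt_iff_contDiffAt.1 h2).differentiableAt (by simp)).hasFDerivAt
  refine ⟨_, h3.congr_of_eventuallyEq ?_, h3⟩
  filter_upwards [e.open_target.mem_nhds hwt] with q hq
  rw [h0 q hq]

theorem exists_curve_of_isStableCurve [T2Space M] [CompleteSpace (CEps g₀ ε)]
    (ho : IsOpen (metricSet g₀ ε)) (hf : IsMorse (n := n) f)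
    (hx : IsCrit (n := n) f x) {h : CEps g₀ ε} (hh : h ∈ metricSet g₀ ε) {γ : C(ℝ≥0, M)}
    (hγ : IsStableCurve g₀ f x h γ) : ∃ w : WUniv g₀ ε f x, w.1.1.1 = γ ∧ w.1.2 = h := by
  obtain ⟨S, -, -, hq, -, hS⟩ := WUniv.exists_stableData ho hf hx rfl hh hγ
  obtain ⟨w, h1, h2⟩ := S.exists_point hf.1 hq
  exact ⟨w, ContinuousMap.ext fun t => (h2 t).trans (hS t).symm, h1⟩

variable [T2Space M] [CompleteSpace (CEps g₀ ε)]
  [ChartedSpace (WModel g₀ ε f x) (WUniv g₀ ε f x)]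
  [IsManifold 𝓘(ℝ, WModel g₀ ε f x) ∞ (WUniv g₀ ε f x)]

/-- In finite dimensions surjectivity means that no $\zeta\ne0$ is orthogonal to the range of the
differential, and variations of the metric alone already exclude this. -/
theorem IsStableChart.isSubmersionAt_of_ne (hd : LocallyDense g₀ ε) (ho : IsOpen (metricSet g₀ ε))
    (hf : ContMDiff (𝓡 n) 𝓘(ℝ, ℝ) ∞ f)
    (hE : ContMDiff 𝓘(ℝ, WModel g₀ ε f x) (𝓡 n) ∞ (evalZero : WUniv g₀ ε f x → M))
    (he : e ∈ IsManifold.maximalAtlas 𝓘(ℝ, WModel g₀ ε f x) ∞ (WUniv g₀ ε f x))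
    (hw : w ∈ e.source) (hS : IsStableChart S e) (hT : 1 ≤ S.T)
    (hψ : ∀ t ≥ S.T, S.ψ (extend w.curve t) ≤ 1 / 2) (hne : ∃ t, w.curve t ≠ x) :
    Manifold.IsSubmersionAt 𝓘(ℝ, WModel g₀ ε f x) (𝓡 n) ∞
      (evalZero : WUniv g₀ ε f x → M) w := by
  obtain ⟨A, hA, hA'⟩ := hS.exists_hasFDerivAt hw
  refine isSubmersionAt_of_surjective hE he hw hA ?_
  have hq := hS.target_subset (e.map_source hw)
  have hc := hS.curve_eq hw
  rw [show evalZero w = S.Γ (e w) 0 from hc 0] at hA'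
  obtain ⟨t₁, t₂, hne'⟩ : ∃ t₁ t₂, w.curve t₁ ≠ w.curve t₂ := by
    by_contra! h
    obtain ⟨t, ht⟩ := hne
    have h1 : Tendsto w.curve atTop (𝓝 (w.curve t)) :=
      tendsto_const_nhds.congr fun s => h t s
    exact ht (tendsto_nhds_unique h1 w.isStableCurve.2.2)
  rw [hc, hc] at hne'
  have hψ' : ∀ t ≥ S.T, S.ψ (S.Γ (e w) t) < 1 := fun t ht => by
    have := hψ t ht
    rw [extend_eq hc (by linarith)] at this
    linarith
  change Function.Surjective A.toLinearMap
  rw [← LinearMap.range_eq_top, ← Submodule.orthogonal_eq_bot_iff, Submodule.eq_bot_iff]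
  intro ζ hζ
  by_contra h0
  obtain ⟨k', hk'⟩ := S.exists_inner_ne_zero hd ho hf (by linarith) hq hψ' t₁.2 t₂.2 hne' hA' h0
  refine hk' ?_
  rw [real_inner_comm]
  exact (Submodule.mem_orthogonal _ _).1 hζ _ ⟨(0, k'), rfl⟩

/-- With $T=0$ the stable coordinates are functions $z$ of $\gamma(0)$, so $Dz\circ A$ is the
projection to the first factor and $Dz$ is onto. For $\mu(x)=0$ the dimensions agree, $Dz$ is
bijective, and $A$ is onto. -/
theorem IsStableChart.isSubmersionAt_of_eq
    (hE : ContMDiff 𝓘(ℝ, WModel g₀ ε f x) (𝓡 n) ∞ (evalZero : WUniv g₀ ε f x → M))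
    (he : e ∈ IsManifold.maximalAtlas 𝓘(ℝ, WModel g₀ ε f x) ∞ (WUniv g₀ ε f x))
    (hw : w ∈ e.source) (hS : IsStableChart S e) (hT : S.T = 0)
    (hμ : morseIndex (n := n) f x = 0) :
    Manifold.IsSubmersionAt 𝓘(ℝ, WModel g₀ ε f x) (𝓡 n) ∞
      (evalZero : WUniv g₀ ε f x → M) w := by
  obtain ⟨A, hA, hA'⟩ := hS.exists_hasFDerivAt hw
  refine isSubmersionAt_of_surjective hE he hw hA ?_
  set p := evalZero w
  have hq := hS.target_subset (e.map_source hw)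
  have hp : S.Γ (e w) 0 = p := (hS.curve_eq hw 0).symm
  have hps := mem_chart_source (Eu n) p
  let z : Eu n → Eu (n - morseIndex (n := n) f x) := fun y =>
    WithLp.toLp 2 fun j => S.coord j ((chartAt (Eu n) p).symm y)
  have hz : DifferentiableAt ℝ z (chartAt (Eu n) p p) := by
    refine differentiableAt_euclidean.2 fun j => ?_
    exact ((contDiffOn_comp_chart_symm (S.coord j).contMDiff p).contDiffAt
      ((chartAt (Eu n) p).open_target.mem_nhds (mem_chart_target _ p))).differentiableAt (by simp)
  have h1 : HasFDerivAt (fun q : WModel g₀ ε f x => q.1)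
      ((fderiv ℝ z (chartAt (Eu n) p p)).comp A) (e w) := by
    have h2 : HasFDerivAt z (fderiv ℝ z (chartAt (Eu n) p p))
        (chartAt (Eu n) p (S.Γ (e w) 0)) := by
      rw [hp]
      exact hz.hasFDerivAt
    refine (h2.comp (e w) hA').congr_of_eventuallyEq ?_
    have h3 : ContinuousAt (fun q => S.Γ q 0) (e w) :=
      S.family.smooth.continuousOn.continuousAt (S.family.isOpen.mem_nhds hq)
    filter_upwards [S.family.isOpen.mem_nhds hq, h3.eventually
      ((chartAt (Eu n) p).open_source.mem_nhds (by simpa only [hp] using hps))] with q h4 h5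
    ext j
    simp only [Function.comp_apply, z, (chartAt (Eu n) p).left_inv h5]
    have h6 := S.coord_Γ q h4 j
    rw [hT] at h6
    exact h6.symm
  have h2 := h1.unique hasFDerivAt_fst
  have hs : Function.Surjective (fderiv ℝ z (chartAt (Eu n) p p)) := fun v =>
    ⟨A (v, 0), DFunLike.congr_fun h2 (v, 0)⟩
  have hi : Function.Injective (fderiv ℝ z (chartAt (Eu n) p p)) :=
    (LinearMap.injective_iff_surjective_of_finrank_eq_finrank
      (f := (fderiv ℝ z (chartAt (Eu n) p p)).toLinearMap) (by simp [hμ])).2 hs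
  intro u
  exact ⟨(fderiv ℝ z (chartAt (Eu n) p p) u, 0), hi (DFunLike.congr_fun h2 _)⟩

end Evaluation

end MorseUniv

end

/-! ### Assembly of the theorem. -/

theorem mainTheorem12 {n : ℕ} {M : Type*} [TopologicalSpace M] [T2Space M]
    [SecondCountableTopology M] [ChartedSpace (EuclideanSpace ℝ (Fin n)) M]
    [IsManifold (𝓡 n) ∞ M] (g₀ : MorseUniv.Metric n M) :
    ∃ ε₀ : ℕ → Set.Ioi (0 : ℝ), ∀ ε ≤ ε₀,
      CompleteSpace (MorseUniv.CEps g₀ ε) ∧ IsOpen (MorseUniv.metricSet g₀ ε) ∧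
      MorseUniv.MetricsDense g₀ ε ∧
      ∀ f : M → ℝ, MorseUniv.IsMorse (n := n) f → ∀ x : M, MorseUniv.IsCrit (n := n) f x →
        (∀ h ∈ MorseUniv.metricSet g₀ ε, ∀ γ : C(ℝ≥0, M), MorseUniv.IsStableCurve g₀ f x h γ →
          ∃ w : MorseUniv.WUniv g₀ ε f x, w.1.1.1 = γ ∧ w.1.2 = h) ∧
        ∃ _ : ChartedSpace (MorseUniv.WModel g₀ ε f x) (MorseUniv.WUniv g₀ ε f x),
          MorseUniv.IsSubmanifoldAtlas g₀ ε f x ∧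
          ContMDiff 𝓘(ℝ, MorseUniv.WModel g₀ ε f x) (𝓡 n) ∞
            (MorseUniv.evalZero : MorseUniv.WUniv g₀ ε f x → M) ∧
          (∀ w : MorseUniv.WUniv g₀ ε f x, w.1.1.1 ≠ ContinuousMap.const ℝ≥0 x →
            Manifold.IsSubmersionAt 𝓘(ℝ, MorseUniv.WModel g₀ ε f x) (𝓡 n) ∞
              (MorseUniv.evalZero : MorseUniv.WUniv g₀ ε f x → M) w) ∧
          (MorseUniv.morseIndex (n := n) f x = 0 → ∀ w : MorseUniv.WUniv g₀ ε f x,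
            Manifold.IsSubmersionAt 𝓘(ℝ, MorseUniv.WModel g₀ ε f x) (𝓡 n) ∞
              (MorseUniv.evalZero : MorseUniv.WUniv g₀ ε f x → M) w) := by
  obtain ⟨ε₀, hε₀⟩ := MorseUniv.exists_locallyDense g₀
  refine ⟨ε₀, fun ε hε => ?_⟩
  have hd := hε₀ ε hε
  have ho : IsOpen (MorseUniv.metricSet g₀ ε) := MorseUniv.isOpen_metricSet
  have hcomplete : CompleteSpace (MorseUniv.CEps g₀ ε) := MorseUniv.completeSpace_CEps
  refine ⟨hcomplete, ho, hd.metricsDense, fun f hf x hx =>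
    ⟨fun h hh γ hγ => MorseUniv.exists_curve_of_isStableCurve ho hf hx hh hγ, ?_⟩⟩
  obtain ⟨C, hC, hE, hS⟩ := MorseUniv.exists_atlas ho hf hx
  have := hC.isManifold
  have hne : ∀ w : MorseUniv.WUniv g₀ ε f x, (∃ t, w.curve t ≠ x) →
      Manifold.IsSubmersionAt 𝓘(ℝ, MorseUniv.WModel g₀ ε f x) (𝓡 n) ∞
        (MorseUniv.evalZero : MorseUniv.WUniv g₀ ε f x → M) w := fun w hw => by
    obtain ⟨S, e, he, hwe, hSe, -, h1, hψ⟩ := hS w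
    exact hSe.isSubmersionAt_of_ne hd ho hf.1 hE he hwe (h1 hw) hψ hw
  refine ⟨C, hC, hE, fun w hw => hne w ?_, fun hμ w => ?_⟩
  · by_contra! h
    exact hw (ContinuousMap.ext h)
  -- For $\mu(x)=0$ the constant curve is the only case not covered by variations of the metric.
  · by_cases hw : ∃ t, w.curve t ≠ x
    · exact hne w hw
    · push Not at hw
      obtain ⟨S, e, he, hwe, hSe, h0, -, -⟩ := hS w
      exact hSe.isSubmersionAt_of_eq hE he hwe (h0 hw) hμ
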